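/- Let $n\ge 1$. Tempered distributions $v\in\mathcal S'(\mathbb R^n;\mathbb R^n)$ are real vector valued, $m(D)v=\mathcal F^{-1}[m(\xi)\mathcal Fv]$ (with the convention that $\nabla$ has symbol $i\xi$), and $\|v\|_{L^p}=\infty$ if $v$ is not a function. Fix radial functions $\chi,\varphi\in C_c^\infty(\mathbb R^n;[0,1])$ with $\operatorname{supp}\chi\subset\{|\xi|<4/3\}$, $\operatorname{supp}\varphi\subset\{3/4<|\xi|<8/3\}$, $\chi(\xi)+\sum_{j\ge0}\varphi(2^{-j}\xi)=1$ for all $\xi$ and $\sum_{j\in\mathbb Z}\varphi(2^{-j}\xi)=1$ for $\xi\ne0$; put $\dot S_j=\chi(2^{-j}D)$ and $\dot\Delta_j=\varphi(2^{-j}D)$. Let $\mathcal S_h'$ be the set of $v\in\mathcal S'$ with $\|\dot S_jv\|_{L^\infty}\to0$ as $j\to-\infty$, let $\|v\|_{\dot B^s_{p,q}}=\big\|j\mapsto 2^{js}\|\dot\Delta_jv\|_{L^p}\big\|_{\ell^q(\mathbb Z)}$, and let $\dot B^s_{p,q}=\{v\in\mathcal S'_h:\|v\|_{\dot B^s_{p,q}}<\infty\}$.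 For $T\in(0,\infty)$ let $Z^s_{p,q}(T)$ be the set of weakly* measurable $u:(0,T)\to\mathcal S_h'$ with $$\Big\|j\mapsto 2^{j(s+2)}\int_0^T\|\dot\Delta_ju(t)\|_{L^p}\,dt\Big\|_{\ell^q(\mathbb Z)}<\infty,\qquad \Big\|j\mapsto2^{js}\sup_{0<t<T}\|\dot\Delta_ju(t)\|_{L^p}\Big\|_{\ell^q(\mathbb Z)}<\infty .$$ Let $S[f](t)=e^{t\Delta}f$ and, for Schwartz functions $\phi$ (summing over repeated indices), $$\langle B[u,v]_i(t),\phi\rangle=-\int_0^t\int_{\mathbb R^n}u_j(s,x)\,v_k(s,x)\,\big[\mathbb P_{ij}\nabla_k e^{(t-s)\Delta}\phi\big](x)\,dx\,ds,$$ where $\mathbb P_{ij}\nabla_k$ is the Fourier multiplier with symbol $\big(\delta_{ij}-\xi_i\xi_j/|\xi|^2\big)\,i\xi_k$. A mild solution on $(0,T)$ with data $f$ is a $u$ for which these expressions are well defined (the pairings being absolutely convergent integrals) and $u(t)=S[f](t)-B[u,u](t)$ in $\mathcal S'$ for all $t\in(0,T)$. Then there exist a constant $C_\varphi>0$, and a constant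 $\widetilde C_{\varphi,\epsilon}>0$ for each $\epsilon\in(0,1)$, such that, with $$\rho_{\varphi,\epsilon}(T,f)=\min\Big\{\frac{C_\varphi}{\epsilon(1-\epsilon)}T^{\epsilon/2}\|f\|_{\dot B^{-1+\epsilon}_{\infty,\infty}},\ \widetilde C_{\varphi,\epsilon}T^{1/2}\|f\|_{L^\infty}\Big\},$$ the following hold for all $\epsilon\in(0,1)$, $s\in(-1,\infty)$, $p,q\in[1,\infty]$ and $f\in\dot B^s_{p,q}\cap\dot B^{-1+\epsilon}_{\infty,\infty}$. (i) If $T\in(0,\infty)$ and $\rho_{\varphi,\epsilon}(T,f)<1$, then there is a mild solution $u\in Z^s_{p,q}(T)\cap Z^{-1+\epsilon}_{\infty,\infty}(T)$ on $(0,T)$ with data $f$. (ii) Let $T_f^*$ be the supremum of all $T$ for which there is a mild solution $u\in\bigcap_{T'\in(0,T)}\big(Z^s_{p,q}(T')\cap Z^{-1+\epsilon}_{\infty,\infty}(T')\big)$ on $(0,T)$ with data $f$. Then $T_f^*\in(0,\infty]$, and the supremum is attained. If $T_f^*<\infty$, then for every such solution $u$ on $(0,T_f^*)$ and every $t\in(0,T_f^*)$,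 $$\rho_{\varphi,\epsilon}(T_f^*-t,u(t))\ge1;$$ hence $\|u(t)\|_{\dot B^{-1+\epsilon}_{\infty,\infty}}\ge C_\varphi^{-1}\epsilon(1-\epsilon)(T_f^*-t)^{-\epsilon/2}$ and $\|u(t)\|_{L^\infty}\ge\widetilde C_{\varphi,\epsilon}^{-1}(T_f^*-t)^{-1/2}$. Moreover $T_f^*$ does not depend on $\epsilon,s,p,q$: if $f\in\dot B^s_{p,q}\cap\dot B^{-1+\epsilon}_{\infty,\infty}$ and $f\in\dot B^{s'}_{p',q'}\cap\dot B^{-1+\epsilon'}_{\infty,\infty}$ for two admissible choices of the parameters, then the two maximal times coincide. -/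

import Mathlib

open MeasureTheory Filter Topology Set
open scoped ENNReal SchwartzMap FourierTransform ContDiff

noncomputable section

namespace BesovNS

/-- The space `ℝⁿ` with its Euclidean norm. -/
abbrev RR (n : ℕ) : Type := EuclideanSpace ℝ (Fin n)

/-- The space `ℂⁿ` with its Hermitian norm. Vector fields with values in `ℝⁿ` are regarded as
`ℂⁿ`-valued ones whose components are real, see `IsReal`. -/
abbrev CC (n : ℕ) : Type := EuclideanSpace ℂ (Fin n)

/-- Tempered distributions on `ℝⁿ` with values in `ℂⁿ`. -/
abbrev TDist (n : ℕ) : Type := 𝓢'(RR n, CC n)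

variable {n : ℕ}

/-- `v` belongs to `𝓢'(ℝⁿ; ℝⁿ)`: all components are real on real-valued test functions. -/
def IsReal (v : TDist n) : Prop :=
  ∀ φ : 𝓢(RR n, ℂ), (∀ x, (φ x).im = 0) → ∀ i, (v φ i).im = 0

/-- The distribution `v` is given by the locally integrable function `g`. -/
def IsRep (v : TDist n) (g : RR n → CC n) : Prop :=
  LocallyIntegrable g volume ∧
    ∀ φ : 𝓢(RR n, ℂ), HasCompactSupport (φ : RR n → ℂ) → v φ = ∫ x, φ x • g x

open Classical in
/-- A locally integrable function that represents `v` (it is unique almost everywhere), and `0`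
when there is none. -/
def toFn (v : TDist n) : RR n → CC n :=
  if h : ∃ g, IsRep v g then h.choose else 0

/-- The `L^p(ℝⁿ)` norm of a tempered distribution; it is `∞` when the distribution is not a
locally integrable function. -/
def distLpNorm (p : ℝ≥0∞) (v : TDist n) : ℝ≥0∞ :=
  ⨅ (g : RR n → CC n) (_ : IsRep v g), eLpNorm g p volume

/-! ### Fourier multipliers

Symbols `m(ξ)` refer to the convention in which `∇` has the symbol `i ξ`. Since Mathlib's Fourier
transform has the kernel `exp (-2 π i x·η)`, the operator `m(D)` is multiplication by `m (2 π η)`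
on the Fourier side. -/

/-- The Fourier multiplier `m(D)` on tempered distributions. -/
def mult (m : RR n → ℂ) (v : TDist n) : TDist n :=
  TemperedDistribution.fourierMultiplierCLM (CC n) (fun η => m ((2 * Real.pi) • η)) v

/-- The Fourier multiplier `m(D)` on Schwartz functions. -/
def multS (m : RR n → ℂ) (φ : 𝓢(RR n, ℂ)) : 𝓢(RR n, ℂ) :=
  SchwartzMap.fourierMultiplierCLM ℂ (fun η => m ((2 * Real.pi) • η)) φ

/-- The symbol `exp (-t |ξ|²)` of the heat operator `e^{tΔ}`. -/
def heatSymbol (t : ℝ) (ξ : RR n) : ℂ := ((Real.exp (-t * ‖ξ‖ ^ 2) : ℝ) : ℂ)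

/-- `S[f](t) = e^{tΔ} f`. -/
def heat (t : ℝ) (f : TDist n) : TDist n := mult (heatSymbol t) f

/-- The symbol `(δ_{ij} - ξ_i ξ_j / |ξ|²) i ξ_k` of `ℙ_{ij} ∇_k`. -/
def lerayGradSymbol (i j k : Fin n) (ξ : RR n) : ℂ :=
  (((if i = j then (1 : ℝ) else 0) - ξ i * ξ j / ‖ξ‖ ^ 2 : ℝ) : ℂ) * (Complex.I * (ξ k : ℂ))

/-- The function `ℙ_{ij} ∇_k φ` for a Schwartz function `φ` (it need not be a Schwartz function,
the symbol being singular at the origin). -/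
def lerayGrad (i j k : Fin n) (φ : 𝓢(RR n, ℂ)) : RR n → ℂ :=
  𝓕⁻ (fun η : RR n => lerayGradSymbol i j k ((2 * Real.pi) • η) * 𝓕 (φ : RR n → ℂ) η)

/-! ### The mild formulation -/

/-- The products `v_j w_k` are functions that may be paired with all `ℙ_{ij} ∇_k φ`. -/
def ProductAdmissible (v w : TDist n) : Prop :=
  (∃ g, IsRep v g) ∧ (∃ g, IsRep w g) ∧
    ∀ (i j k : Fin n) (φ : 𝓢(RR n, ℂ)),
      Integrable (fun x => toFn v x j * toFn w x k * lerayGrad i j k φ x) volume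

/-- `⟨(ℙ∇·(v ⊗ w))_i, φ⟩ = - ∑_{j,k} ⟨v_j w_k, ℙ_{ij} ∇_k φ⟩`. -/
def lerayDivProd (v w : TDist n) (i : Fin n) (φ : 𝓢(RR n, ℂ)) : ℂ :=
  -∑ j, ∑ k, ∫ x, toFn v x j * toFn w x k * lerayGrad i j k φ x

/-- The integrand `⟨e^{(t-s)Δ} (ℙ∇·(u ⊗ v))_i(s), φ⟩` in the definition of `B[u,v](t)`. -/
def bilinIntegrand (u v : ℝ → TDist n) (t : ℝ) (i : Fin n) (φ : 𝓢(RR n, ℂ)) (s : ℝ) : ℂ :=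
  lerayDivProd (u s) (v s) i (multS (heatSymbol (t - s)) φ)

/-- `⟨(B[u,v](t))_i, φ⟩`. -/
def bilin (u v : ℝ → TDist n) (t : ℝ) (i : Fin n) (φ : 𝓢(RR n, ℂ)) : ℂ :=
  ∫ s in (0 : ℝ)..t, bilinIntegrand u v t i φ s

/-- `u(t) = S[f](t) - B[u,u](t)` in `𝓢'` for all `t ∈ (0,T)`, where `T ∈ [0,∞]`; it is part of the
definition that all the expressions that enter `B[u,u]` make sense. Only the values of `u` on
`(0,T)` matter. -/
def IsMildSolution (T : ℝ≥0∞) (f : TDist n) (u : ℝ → TDist n) : Prop :=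
  (∀ᵐ s ∂(volume : Measure ℝ), 0 < s → ENNReal.ofReal s < T → ProductAdmissible (u s) (u s)) ∧
    ∀ t : ℝ, 0 < t → ENNReal.ofReal t < T → ∀ (i : Fin n) (φ : 𝓢(RR n, ℂ)),
      IntervalIntegrable (bilinIntegrand u u t i φ) volume 0 t ∧
        u t φ i = heat t f φ i - bilin u u t i φ

/-! ### Littlewood-Paley theory, Besov and Chemin-Lerner spaces -/

/-- A pair of Littlewood-Paley cutoff functions: `χ` is supported in the ball of radius `4/3`, `φ`
in the annulus `3/4 < |ξ| < 8/3`, and they generate dyadic partitions of unity. (The usual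
almost orthogonality properties follow from these.) -/
structure IsLittlewoodPaley (χ φ : RR n → ℝ) : Prop where
  smooth_χ : ContDiff ℝ ∞ χ
  smooth_φ : ContDiff ℝ ∞ φ
  supp_χ : tsupport χ ⊆ {ξ | ‖ξ‖ < 4 / 3}
  supp_φ : tsupport φ ⊆ {ξ | 3 / 4 < ‖ξ‖ ∧ ‖ξ‖ < 8 / 3}
  radial_χ : ∀ ξ η : RR n, ‖ξ‖ = ‖η‖ → χ ξ = χ η
  radial_φ : ∀ ξ η : RR n, ‖ξ‖ = ‖η‖ → φ ξ = φ η
  range_χ : ∀ ξ, χ ξ ∈ Icc (0 : ℝ) 1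
  range_φ : ∀ ξ, φ ξ ∈ Icc (0 : ℝ) 1
  sum_nat : ∀ ξ, χ ξ + ∑' j : ℕ, φ ((2 : ℝ) ^ (-(j : ℤ)) • ξ) = 1
  sum_int : ∀ ξ, ξ ≠ 0 → ∑' j : ℤ, φ ((2 : ℝ) ^ (-j) • ξ) = 1

/-- The dyadic operator `m(2^{-j} D)`: this is `Δ̇_j` for `m = φ` and `Ṡ_j` for `m = χ`. -/
def dyadic (m : RR n → ℝ) (j : ℤ) (v : TDist n) : TDist n :=
  mult (fun ξ => ((m ((2 : ℝ) ^ (-j) • ξ) : ℝ) : ℂ)) v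

/-- Membership in `𝓢'_h`: `‖Ṡ_j v‖_{L^∞} → 0` as `j → -∞`. -/
def InSh (χ : RR n → ℝ) (v : TDist n) : Prop :=
  Tendsto (fun j : ℤ => distLpNorm ⊤ (dyadic χ j v)) atBot (𝓝 0)

/-- The norm `‖(2^{js} a_j)_j‖_{ℓ^q(ℤ)}`. -/
def weightedSeqNorm (s : ℝ) (q : ℝ≥0∞) (a : ℤ → ℝ≥0∞) : ℝ≥0∞ :=
  eLpNorm (fun j : ℤ => ENNReal.ofReal ((2 : ℝ) ^ ((j : ℝ) * s)) * a j) q Measure.count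

/-- The homogeneous Besov seminorm of `Ḃ^s_{p,q}(ℝⁿ)`. -/
def besovNorm (φ : RR n → ℝ) (s : ℝ) (p q : ℝ≥0∞) (v : TDist n) : ℝ≥0∞ :=
  weightedSeqNorm s q fun j => distLpNorm p (dyadic φ j v)

/-- Membership in `Ḃ^s_{p,q}(ℝⁿ; ℝⁿ)`. -/
def MemBesov (χ φ : RR n → ℝ) (s : ℝ) (p q : ℝ≥0∞) (v : TDist n) : Prop :=
  IsReal v ∧ InSh χ v ∧ besovNorm φ s p q v < ⊤

/-- The Chemin-Lerner seminorm of `L̃^α(0,T; Ḃ^s_{p,q})`. -/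
def cheminLernerNorm (φ : RR n → ℝ) (T : ℝ) (α : ℝ≥0∞) (s : ℝ) (p q : ℝ≥0∞)
    (u : ℝ → TDist n) : ℝ≥0∞ :=
  weightedSeqNorm s q fun j =>
    eLpNorm (fun t => distLpNorm p (dyadic φ j (u t))) α (volume.restrict (Ioo 0 T))

/-- The variant of the seminorm of `L̃^∞(0,T; Ḃ^s_{p,q})` with a true supremum over `(0,T)`. -/
def cheminLernerSupNorm (φ : RR n → ℝ) (T : ℝ) (s : ℝ) (p q : ℝ≥0∞) (u : ℝ → TDist n) : ℝ≥0∞ :=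
  weightedSeqNorm s q fun j => ⨆ t ∈ Ioo 0 T, distLpNorm p (dyadic φ j (u t))

/-- Membership of (the restriction to `(0,T)` of) `u` in `Z^s_{p,q}(T)`: `u` is a weakly* measurable
function on `(0,T)` with values in `𝓢'_h(ℝⁿ; ℝⁿ)`, with finite `L̃^1(0,T; Ḃ^{s+2}_{p,q})` seminorm
and finite `L̃^∞(0,T; Ḃ^s_{p,q})` seminorm (the latter with a true supremum in time). -/
def MemZ (χ φ : RR n → ℝ) (s : ℝ) (p q : ℝ≥0∞) (T : ℝ) (u : ℝ → TDist n) : Prop :=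
  (∀ t ∈ Ioo 0 T, IsReal (u t) ∧ InSh χ (u t)) ∧
    (∀ ψ : 𝓢(RR n, ℂ), Measurable fun t : Ioo (0 : ℝ) T => u t ψ) ∧
    cheminLernerNorm φ T 1 (s + 2) p q u < ⊤ ∧
    cheminLernerSupNorm φ T s p q u < ⊤

/-- `u ∈ ⋂_{T' ∈ (0,T)} (Z^s_{p,q}(T') ∩ Z^{-1+ε}_{∞,∞}(T'))` solves `u = S[f] - B[u,u]` on
`(0,T)`, where `T ∈ [0,∞]`. -/
def IsSolutionBefore (χ φ : RR n → ℝ) (ε s : ℝ) (p q : ℝ≥0∞) (f : TDist n) (T : ℝ≥0∞)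
    (u : ℝ → TDist n) : Prop :=
  (∀ T' : ℝ, 0 < T' → ENNReal.ofReal T' < T →
      MemZ χ φ s p q T' u ∧ MemZ χ φ (-1 + ε) ⊤ ⊤ T' u) ∧
    IsMildSolution T f u

/-- The maximal existence time `T_f^* ∈ [0,∞]` of a solution in the above class. -/
def maximalTime (χ φ : RR n → ℝ) (ε s : ℝ) (p q : ℝ≥0∞) (f : TDist n) : ℝ≥0∞ :=
  sSup {T : ℝ≥0∞ | ∃ u, IsSolutionBefore χ φ ε s p q f T u}

/-- The quantity
`(C / (ε (1 - ε))) T^{ε/2} ‖v‖_{Ḃ^{-1+ε}_{∞,∞}} ∧ C' T^{1/2} ‖v‖_{L^∞}`, where `∧` is the minimum. -/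
def rho (φ : RR n → ℝ) (C C' ε T : ℝ) (v : TDist n) : ℝ≥0∞ :=
  min (ENNReal.ofReal (C / (ε * (1 - ε)) * T ^ (ε / 2)) * besovNorm φ (-1 + ε) ⊤ ⊤ v)
    (ENNReal.ofReal (C' * T ^ (1 / 2 : ℝ)) * distLpNorm ⊤ v)

/-- The standing restrictions on the parameters: `ε ∈ (0,1)`, `s > -1`, `p, q ∈ [1,∞]`. -/
def AdmissibleParams (ε s : ℝ) (p q : ℝ≥0∞) : Prop :=
  ε ∈ Ioo (0 : ℝ) 1 ∧ -1 < s ∧ 1 ≤ p ∧ 1 ≤ q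

end BesovNS

end

open MeasureTheory Filter Topology Set
open scoped ENNReal SchwartzMap FourierTransform ContDiff

noncomputable section

namespace BesovNS

variable {n : ℕ}

section

/-! ### Schwartz symbols and their kernels -/

/-! The proof rests on one kernel bound. The operator `ℙ∇e^{τΔ}` is convolution with a kernel of
`L¹` norm at most a constant times `τ^{-1/2}` (`exists_dnorm_one_le`), and on frequencies of size
`2^l` the bound improves to a multiple of `2^l (1 + (4^l τ)²)⁻¹` (`exists_dnorm_phi_le`). Solutions
are treated as genuine functions `U(t,x)` bounded by some `g(t)` uniformly in `x` (`Flow`);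
`Flow.block` turns the weak mild formulation into Duhamel's formula for these functions, at every
time and for every frequency block.

Existence. If `|e^{tΔ}f| ≤ a t^{-κ}` with `0 ≤ κ < 1/2`, Picard iteration among functions bounded by
a multiple of `t^{-κ}` converges once a constant times `a T^{1/2-κ}` is below one
(`exists_fixed_point`, with the beta integral `lintegral_beta_le`). Summing the dyadic pieces of the
heat flow gives `κ = (1-ε)/2` and a factor `1/(1-ε)` in `a` (`tsum_dyadic_decay_le`), while the beta
integral contributes `1/ε`; bounded data give `κ = 0`. These are the two terms of the minimum in `ρ`
(`exists_memZ`).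

Regularity. The construction controls only sup norms; `Flow.persist` upgrades to every `Z^s_{p,q}`
that the data allow. A product of two fields with frequencies below about `2^{l-2}` has no
frequencies of size `2^l` (`spectral`), so in the `l`-th block one factor of `u ⊗ u` may be replaced
by `∑_{k ≥ l-2} Δ̇_k u`, the other one being estimated by `g`. The blocks thus satisfy a linear
inequality: they are at most their free evolution plus `flop` applied to themselves. In `L²` in
time, `flop` has a kernel of scale invariant size; an exponential weight `e^{-λt}` makes its norm at
most `1/2` without any smallness, provided that `∫ (t-s)^{-α} g(s)² ds` is bounded for some `α > 0`
(`TimeGood`). The blocks are then at most the Neumann series of the free evolution, pointwise in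
`x`, so that any `L^p` norm can be taken afterwards. In `L²` in time the free block has size
`2^{-l}‖Δ̇_l f‖`, and the geometric sums over high frequencies converge because `s + 1 > 0`.

Conversely every element of `Z^{-1+ε}_{∞,∞}` is a flow with `α = ε/2` (`MemZ.exists_flow`). Hence
the persistence result applies to all solutions and the solution classes for different parameters
coincide (`GoodSolution.change_params`), which makes the maximal time independent of them.

Continuation. The same weighted `L²` contraction gives uniqueness (`Flow.unique`), so solutions on
shorter intervals fit together and the supremum is attained. If `ρ(T* - t, u(t)) < 1`, the condition
persists for a slightly larger time span by continuity; restarting at `t` and concatenating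
(`IsMildSolution.concat`) gives a solution beyond `T*`, a contradiction. -/

/-- `m` is a Schwartz function. -/
def IsSch (m : RR n → ℂ) : Prop := ∃ g : 𝓢(RR n, ℂ), ∀ x, g x = m x

theorem IsSch.eq {m : RR n → ℂ} (h : IsSch m) : ∃ g : 𝓢(RR n, ℂ), ⇑g = m :=
  h.imp fun _ hg => funext hg

theorem IsSch.continuous {m : RR n → ℂ} (h : IsSch m) : Continuous m := by
  obtain ⟨g, rfl⟩ := h.eq; exact g.continuous

theorem IsSch.integrable {m : RR n → ℂ} (h : IsSch m) : Integrable m volume := by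
  obtain ⟨g, rfl⟩ := h.eq; exact g.integrable

theorem IsSch.hasTemperateGrowth {m : RR n → ℂ} (h : IsSch m) : m.HasTemperateGrowth := by
  obtain ⟨g, rfl⟩ := h.eq; exact g.hasTemperateGrowth

theorem IsSch.mul_left {a m : RR n → ℂ} (ha : a.HasTemperateGrowth) (h : IsSch m) :
    IsSch fun ξ => a ξ * m ξ := by
  obtain ⟨g, rfl⟩ := h.eq
  exact ⟨SchwartzMap.smulLeftCLM ℂ a g, fun x => by
    rw [SchwartzMap.smulLeftCLM_apply_apply ha, smul_eq_mul]⟩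

theorem IsSch.comp_smul {m : RR n → ℂ} (h : IsSch m) {c : ℝ} (hc : c ≠ 0) :
    IsSch fun ξ => m (c • ξ) := by
  obtain ⟨g, rfl⟩ := h.eq
  exact ⟨SchwartzMap.compCLMOfContinuousLinearEquiv ℂ
    (ContinuousLinearEquiv.smulLeft (Units.mk0 c hc) : RR n ≃L[ℝ] RR n) g, fun x => rfl⟩

theorem IsSch.of_hasCompactSupport {m : RR n → ℂ} (h : HasCompactSupport m)
    (h' : ContDiff ℝ ∞ m) : IsSch m :=
  ⟨h.toSchwartzMap h', fun _ => rfl⟩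

/-- The Taylor bound `y^K / K! ≤ e^y` at `y = τ (1 + r²)`, combined with `1 + r ≤ 2 (1 + r²)`. -/
theorem one_add_pow_mul_exp_neg_le (K : ℕ) {τ r : ℝ} (hτ : 0 < τ) (hr : 0 ≤ r) :
    (1 + r) ^ K * Real.exp (-τ * r ^ 2) ≤
      2 ^ K * (τ⁻¹ ^ K * (K.factorial * Real.exp τ)) := by
  have h1 : (1 + r) ^ K ≤ 2 ^ K * (1 + r ^ 2) ^ K := by
    rw [← mul_pow]
    gcongr
    nlinarith [sq_nonneg (r - 1)]
  have h2 := Real.pow_div_factorial_le_exp (τ * (1 + r ^ 2)) (by positivity) K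
  have h3 : (1 + r ^ 2) ^ K ≤ τ⁻¹ ^ K * (K.factorial * Real.exp (τ * (1 + r ^ 2))) := by
    rw [div_le_iff₀ (by positivity), mul_pow] at h2
    rw [inv_pow, ← div_eq_inv_mul, le_div_iff₀ (by positivity)]
    linarith
  calc (1 + r) ^ K * Real.exp (-τ * r ^ 2)
      ≤ (2 ^ K * (τ⁻¹ ^ K * (K.factorial * Real.exp (τ * (1 + r ^ 2))))) *
          Real.exp (-τ * r ^ 2) := by
        gcongr
        exact h1.trans (by gcongr)
    _ = _ := by
        have : Real.exp τ = Real.exp (τ * (1 + r ^ 2)) * Real.exp (-τ * r ^ 2) := by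
          rw [← Real.exp_add]; ring_nf
        rw [this]; ring

/-- The Gaussian as a real-valued Schwartz function. -/
def gaussSchwartz (n : ℕ) (τ : ℝ) (hτ : 0 < τ) : 𝓢(RR n, ℝ) where
  toFun ξ := Real.exp (-τ * ‖ξ‖ ^ 2)
  smooth' := by
    apply Real.contDiff_exp.comp
    exact contDiff_const.mul (contDiff_norm_sq ℝ)
  decay' k N := by
    have hf := Function.hasTemperateGrowth_norm_sq (RR n)
    obtain ⟨k₁, C₁, hC₁, h₁⟩ := hf.norm_iteratedFDeriv_le_uniform N
    refine ⟨N.factorial * (1 + τ) ^ N * (1 + C₁) ^ N *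
      (2 ^ (k + k₁ * N) * (τ⁻¹ ^ (k + k₁ * N) * ((k + k₁ * N).factorial * Real.exp τ))),
      fun x => ?_⟩
    -- Faà di Bruno bound. The outer derivatives of all orders `i ≤ N` need one common bound, hence
    -- `(1 + τ) ^ N`; the inner ones must be bounded by an `i`-th power, hence a base that is at
    -- least one.
    have key : ‖iteratedFDeriv ℝ N ((fun y : ℝ => Real.exp (-τ * y)) ∘ fun ξ : RR n => ‖ξ‖ ^ 2) x‖
        ≤ N.factorial * ((1 + τ) ^ N * Real.exp (-τ * ‖x‖ ^ 2)) *
          ((1 + C₁) * (1 + ‖x‖) ^ k₁) ^ N := by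
      refine norm_iteratedFDeriv_comp_le (N := ∞) (by fun_prop) hf.1 (mod_cast le_top) x
        (fun i hi => ?_) (fun i hi hi' => ?_)
      · rw [norm_iteratedFDeriv_eq_norm_iteratedDeriv, iteratedDeriv_exp_const_mul]
        simp only [norm_mul, norm_pow, norm_neg, Real.norm_eq_abs, Real.abs_exp, abs_of_pos hτ]
        gcongr
        calc τ ^ i ≤ (1 + τ) ^ i := by gcongr; linarith
          _ ≤ (1 + τ) ^ N := pow_le_pow_right₀ (by linarith) hi
      · calc _ ≤ C₁ * (1 + ‖x‖) ^ k₁ := h₁ i hi' x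
          _ ≤ (1 + C₁) * (1 + ‖x‖) ^ k₁ := by gcongr; simp
          _ ≤ _ := le_self_pow₀ (one_le_mul_of_one_le_of_one_le (by linarith)
                (one_le_pow₀ (by simp))) (by omega)
    calc ‖x‖ ^ k * ‖iteratedFDeriv ℝ N (fun ξ : RR n => Real.exp (-τ * ‖ξ‖ ^ 2)) x‖
        ≤ (1 + ‖x‖) ^ k * (N.factorial * ((1 + τ) ^ N * Real.exp (-τ * ‖x‖ ^ 2)) *
          ((1 + C₁) * (1 + ‖x‖) ^ k₁) ^ N) := by
          gcongr
          · linarith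
          · exact key
      _ = N.factorial * (1 + τ) ^ N * (1 + C₁) ^ N *
          ((1 + ‖x‖) ^ (k + k₁ * N) * Real.exp (-τ * ‖x‖ ^ 2)) := by
          rw [mul_pow, ← pow_mul, pow_add]; ring
      _ ≤ _ := by
          exact mul_le_mul_of_nonneg_left (one_add_pow_mul_exp_neg_le _ hτ (norm_nonneg x))
            (by positivity)

theorem isSch_heatSymbol {τ : ℝ} (hτ : 0 < τ) : IsSch (heatSymbol (n := n) τ) :=
  ⟨(gaussSchwartz n τ hτ).postcompCLM Complex.ofRealCLM, fun _ => rfl⟩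

theorem hasTemperateGrowth_heatSymbol {τ : ℝ} (hτ : 0 ≤ τ) :
    (heatSymbol (n := n) τ).HasTemperateGrowth := by
  rcases hτ.eq_or_lt with rfl | h
  · have : heatSymbol (n := n) 0 = fun _ => 1 := by ext; simp [heatSymbol]
    rw [this]; exact .const 1
  · exact (isSch_heatSymbol h).hasTemperateGrowth

theorem two_pi_ne_zero : (2 * Real.pi : ℝ) ≠ 0 := by positivity

theorem Function.HasTemperateGrowth.comp_const_smul {m : RR n → ℂ} (h : m.HasTemperateGrowth)
    (c : ℝ) : Function.HasTemperateGrowth fun ξ => m (c • ξ) :=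
  h.comp (f := fun ξ : RR n => c • ξ)
    (c • ContinuousLinearMap.id ℝ (RR n)).hasTemperateGrowth

/-- The convolution kernel of the operator `m(D)`. -/
def ker (m : RR n → ℂ) : RR n → ℂ := 𝓕⁻ fun η : RR n => m ((2 * Real.pi) • η)

/-- The `L¹` norm of the convolution kernel of the operator `m(D)`. -/
def kerNorm (m : RR n → ℂ) : ℝ≥0∞ := ∫⁻ x, ‖ker m x‖ₑ

theorem IsSch.ker {m : RR n → ℂ} (h : IsSch m) : IsSch (ker m) := by
  obtain ⟨g, hg⟩ := (h.comp_smul two_pi_ne_zero).eq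
  exact ⟨𝓕⁻ g, fun x => by rw [SchwartzMap.fourierInv_coe, hg]; rfl⟩

theorem IsSch.kerNorm_lt_top {m : RR n → ℂ} (h : IsSch m) : kerNorm m < ⊤ :=
  h.ker.integrable.2

/-- As a function of `y`, `𝓕⁻ M (x - y)` is the Fourier transform of a modulation of `M`; the
self-adjointness of the Fourier integral does the rest. Only integrability of `M` enters, so symbols
that are singular at the origin are admissible. -/
theorem fourierInv_mul_fourier {M ψ : RR n → ℂ} (hM : Integrable M volume)
    (hψ : Integrable ψ volume) (x : RR n) :
    𝓕⁻ (fun η => M η * 𝓕 ψ η) x = ∫ y, 𝓕⁻ M (x - y) * ψ y := by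
  have hMx : Integrable (fun η : RR n => Real.fourierChar (inner ℝ η x) • M η) volume := by
    have := (Real.fourierIntegral_convergent_iff (μ := (volume : Measure (RR n))) (f := M) (-x)).2 hM
    simpa using this
  have h1 : ∀ y, 𝓕⁻ M (x - y) = 𝓕 (fun η : RR n => Real.fourierChar (inner ℝ η x) • M η) y := by
    intro y
    rw [Real.fourierInv_eq, Real.fourier_eq]
    congr 1
    ext η
    rw [smul_smul, ← AddChar.map_add_eq_mul, inner_sub_right]
    congr 2
    ring
  simp_rw [h1]
  have h2 := VectorFourier.integral_fourierIntegral_smul_eq_flip (μ := (volume : Measure (RR n)))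
    (ν := (volume : Measure (RR n))) (L := innerₗ (RR n)) Real.continuous_fourierChar
    (by simpa using continuous_inner) hMx hψ
  rw [flip_innerₗ] at h2
  rw [Real.fourierInv_eq]
  refine Eq.trans ?_ h2.symm
  congr 1
  ext η
  rw [smul_eq_mul, smul_mul_assoc]
  rfl

theorem integrable_comp_two_pi {m : RR n → ℂ} (h : Integrable m volume) :
    Integrable (fun η : RR n => m ((2 * Real.pi) • η)) volume :=
  h.comp_smul two_pi_ne_zero

theorem continuous_ker {m : RR n → ℂ} (h : Integrable m volume) : Continuous (ker m) := by
  have h1 := VectorFourier.fourierIntegral_continuous (μ := (volume : Measure (RR n)))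
    Real.continuous_fourierChar (L := innerₗ (RR n))
    (by simpa using continuous_inner) (integrable_comp_two_pi h)
  have : ker m = fun x => 𝓕 (fun η : RR n => m ((2 * Real.pi) • η)) (-x) := by
    ext x; rw [ker, Real.fourierInv_eq_fourier_neg]
  rw [this]
  exact h1.comp continuous_neg

/-- Fourier inversion is applied to the second factor alone. The first one may therefore contain the
Leray symbol. -/
theorem ker_mul {m₁ m₂ : RR n → ℂ} (h₁ : Integrable m₁ volume) (h₂ : IsSch m₂) (x : RR n) :
    ker (fun ξ => m₁ ξ * m₂ ξ) x = ∫ y, ker m₁ (x - y) * ker m₂ y := by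
  obtain ⟨g, hg⟩ := (h₂.comp_smul two_pi_ne_zero).eq
  have hk : ker m₂ = ⇑(𝓕⁻ g : 𝓢(RR n, ℂ)) := by rw [SchwartzMap.fourierInv_coe, hg]; rfl
  have h3 := fourierInv_mul_fourier (integrable_comp_two_pi h₁) (𝓕⁻ g : 𝓢(RR n, ℂ)).integrable x
  rw [← SchwartzMap.fourier_coe, FourierTransform.fourier_fourierInv_eq, hg] at h3
  rw [hk]
  exact h3

theorem lintegral_conv_le {k₁ k₂ : RR n → ℝ≥0∞} (h₁ : Measurable k₁) (h₂ : Measurable k₂) :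
    ∫⁻ x, ∫⁻ y, k₁ (x - y) * k₂ y = (∫⁻ x, k₁ x) * ∫⁻ y, k₂ y := by
  rw [lintegral_lintegral_swap]
  · rw [← lintegral_const_mul _ h₂]
    congr 1
    ext y
    rw [lintegral_mul_const _ (by fun_prop), lintegral_sub_right_eq_self]
  · fun_prop

theorem kerNorm_mul_le {m₁ m₂ : RR n → ℂ} (h₁ : Integrable m₁ volume) (h₂ : IsSch m₂) :
    kerNorm (fun ξ => m₁ ξ * m₂ ξ) ≤ kerNorm m₁ * kerNorm m₂ := by
  rw [kerNorm, kerNorm, kerNorm, ← lintegral_conv_le]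
  · refine lintegral_mono fun x => ?_
    rw [ker_mul h₁ h₂]
    refine (enorm_integral_le_lintegral_enorm _).trans (lintegral_mono fun y => ?_)
    rw [enorm_mul]
  · exact (continuous_ker h₁).measurable.enorm
  · exact (continuous_ker h₂.integrable).measurable.enorm

/-! ### Dilations, multiples and conjugates of symbols. -/

theorem ker_comp_smul (m : RR n → ℂ) {c : ℝ} (hc : 0 < c) (x : RR n) :
    ker (fun ξ => m (c • ξ)) x = ((c ^ n)⁻¹ : ℝ) • ker m (c⁻¹ • x) := by
  rw [ker, ker, Real.fourierInv_eq, Real.fourierInv_eq]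
  have := Measure.integral_comp_smul_of_nonneg (volume : Measure (RR n))
    (fun v => Real.fourierChar (inner ℝ v (c⁻¹ • x)) • m ((2 * Real.pi) • v)) c (hR := hc.le)
  rw [finrank_euclideanSpace_fin] at this
  rw [← this]
  congr 1
  ext η
  rw [inner_smul_left, inner_smul_right]
  simp only [conj_trivial]
  rw [mul_inv_cancel_left₀ hc.ne', smul_comm]

theorem lintegral_comp_smul' (f : RR n → ℝ≥0∞) {c : ℝ} (hc : 0 < c) :
    ∫⁻ x, f (c • x) = ENNReal.ofReal ((c ^ n)⁻¹) * ∫⁻ x, f x := by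
  have h := (Homeomorph.smulOfNeZero c hc.ne' : RR n ≃ₜ RR n).measurableEmbedding.lintegral_map
    (μ := volume) f
  have h2 : Measure.map (⇑(Homeomorph.smulOfNeZero c hc.ne' : RR n ≃ₜ RR n)) volume
    = Measure.map (c • ·) (volume : Measure (RR n)) := rfl
  rw [h2, Measure.map_addHaar_smul _ hc.ne', finrank_euclideanSpace_fin,
    abs_of_pos (by positivity), lintegral_smul_measure, smul_eq_mul] at h
  exact h.symm

/-- The Jacobian cancels: the `L¹` norm of a kernel is invariant under dilation of the symbol. All
uniformity in the frequency `2^j` and in the time of the heat flow comes from here. -/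
theorem kerNorm_comp_smul (m : RR n → ℂ) {c : ℝ} (hc : 0 < c) :
    kerNorm (fun ξ => m (c • ξ)) = kerNorm m := by
  rw [kerNorm, kerNorm]
  simp_rw [ker_comp_smul m hc, enorm_smul]
  rw [lintegral_const_mul' _ _ enorm_ne_top, lintegral_comp_smul' (fun x => ‖ker m x‖ₑ) (inv_pos.2 hc)]
  rw [← mul_assoc, Real.enorm_eq_ofReal (by positivity), ← ENNReal.ofReal_mul (by positivity)]
  have : (c ^ n)⁻¹ * (c⁻¹ ^ n)⁻¹ = 1 := by
    rw [inv_pow, inv_inv, inv_mul_cancel₀ (by positivity)]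
  rw [this]; simp

theorem ker_const_mul (c : ℂ) (m : RR n → ℂ) (x : RR n) :
    ker (fun ξ => c * m ξ) x = c * ker m x := by
  rw [ker, ker, Real.fourierInv_eq, Real.fourierInv_eq, ← integral_const_mul]
  congr 1; ext η; rw [mul_smul_comm]

theorem kerNorm_const_mul (c : ℂ) (m : RR n → ℂ) :
    kerNorm (fun ξ => c * m ξ) = ‖c‖ₑ * kerNorm m := by
  simp_rw [kerNorm, ker_const_mul, enorm_mul]
  rw [lintegral_const_mul' _ _ enorm_ne_top]

/-- A symbol with `m(-ξ)` equal to the conjugate of `m(ξ)` therefore has a real kernel, which keeps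
the iteration and the heat flow real. -/
theorem conj_ker (m : RR n → ℂ) (x : RR n) :
    (starRingEnd ℂ) (ker m x) = ker (fun ξ => (starRingEnd ℂ) (m (-ξ))) x := by
  rw [ker, ker, Real.fourierInv_eq, Real.fourierInv_eq, ← integral_conj, ← integral_neg_eq_self]
  congr 1; ext η
  simp only [Circle.smul_def, smul_eq_mul, map_mul, inner_neg_left, smul_neg]
  rw [← Circle.coe_inv_eq_conj, AddChar.map_neg_eq_inv, inv_inv]

theorem measurable_ker_family {α : Type*} [MeasurableSpace α] {m : α → RR n → ℂ}
    (hm : Measurable (Function.uncurry m)) :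
    Measurable (Function.uncurry fun a => ker (m a)) := by
  have : StronglyMeasurable fun p : α × RR n =>
      ∫ η : RR n, Real.fourierChar (inner ℝ η p.2) • m p.1 ((2 * Real.pi) • η) := by
    refine StronglyMeasurable.integral_prod_right'
      (f := fun q : (α × RR n) × RR n => Real.fourierChar (inner ℝ q.2 q.1.2) •
        m q.1.1 ((2 * Real.pi) • q.2)) ?_
    refine Measurable.stronglyMeasurable ?_
    simp only [Circle.smul_def, smul_eq_mul]
    refine Measurable.mul ?_ ?_
    · exact (continuous_subtype_val.comp Real.continuous_fourierChar).measurable.comp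
        (f := fun q : (α × RR n) × RR n => inner ℝ q.2 q.1.2) (by fun_prop)
    · exact hm.comp (f := fun q : (α × RR n) × RR n => (q.1.1, (2 * Real.pi) • q.2))
        (by fun_prop)
  have h2 : (Function.uncurry fun a => ker (m a)) = fun p : α × RR n =>
      ∫ η : RR n, Real.fourierChar (inner ℝ η p.2) • m p.1 ((2 * Real.pi) • η) := by
    ext p; exact Real.fourierInv_eq _ _
  rw [h2]; exact this.measurable


/-! ### Smooth truncation of Schwartz functions. -/

theorem exists_bound_iteratedFDeriv_one_sub {θ : RR n → ℝ} (hθ : ContDiff ℝ ∞ θ)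
    (hs : HasCompactSupport θ) (N : ℕ) :
    ∃ C, 0 ≤ C ∧ ∀ i ≤ N, ∀ x, ‖iteratedFDeriv ℝ i (fun x => ((1 - θ x : ℝ) : ℂ)) x‖ ≤ C := by
  have h1 : ∀ i, ∃ C, 0 ≤ C ∧ ∀ x, ‖iteratedFDeriv ℝ i (fun x => ((1 - θ x : ℝ) : ℂ)) x‖ ≤ C := by
    intro i
    let g : 𝓢(RR n, ℂ) := (hs.toSchwartzMap hθ).postcompCLM Complex.ofRealCLM
    have hg : (fun x => ((1 - θ x : ℝ) : ℂ)) = (fun _ => 1) - ⇑g := by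
      ext x; simp [g]
    obtain ⟨C, hC, h⟩ := g.decay 0 i
    refine ⟨1 + C, by linarith, fun x => ?_⟩
    rw [hg, iteratedFDeriv_sub_apply contDiff_const.contDiffAt (g.smooth i).contDiffAt]
    refine (norm_sub_le _ _).trans (add_le_add ?_ (by simpa using h x))
    rcases Nat.eq_zero_or_pos i with rfl | hi
    · simp
    · rw [iteratedFDeriv_const_of_ne (by omega)]; simp
  choose C hC h using h1
  refine ⟨∑ i ∈ Finset.range (N + 1), C i, Finset.sum_nonneg fun i _ => hC i, fun i hi x =>
    (h i x).trans (Finset.single_le_sum (fun i _ => hC i) (Finset.mem_range.2 (by omega)))⟩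

theorem norm_iteratedFDeriv_comp_smul_le {f : RR n → ℂ} (hf : ContDiff ℝ ∞ f) {c : ℝ}
    (hc : |c| ≤ 1) (i : ℕ) (x : RR n) :
    ‖iteratedFDeriv ℝ i (fun y => f (c • y)) x‖ ≤ ‖iteratedFDeriv ℝ i f (c • x)‖ := by
  rw [iteratedFDeriv_comp_const_smul c (hf.of_le (mod_cast le_top)), norm_smul, norm_pow,
    Real.norm_eq_abs]
  exact mul_le_of_le_one_left (norm_nonneg _) (pow_le_one₀ (abs_nonneg c) hc)

/-- Smooth truncations of a Schwartz function converge to it in the Schwartz space. -/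
theorem tendsto_smulLeftCLM_truncation {θ : RR n → ℝ} (hθ : ContDiff ℝ ∞ θ)
    (hs : HasCompactSupport θ) {r : ℝ} (hr : 0 < r) (h1 : ∀ x, ‖x‖ < r → θ x = 1)
    (ψ : 𝓢(RR n, ℂ)) :
    Tendsto (fun c : ℝ => SchwartzMap.smulLeftCLM ℂ (fun x => ((θ (c • x) : ℝ) : ℂ)) ψ)
      (𝓝[>] 0) (𝓝 ψ) := by
  rw [(schwartz_withSeminorms ℂ (RR n) ℂ).tendsto_nhds _ ψ]
  rintro ⟨k, N⟩ ε hε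
  simp only [schwartzSeminormFamily]
  obtain ⟨C, hC, hCb⟩ := exists_bound_iteratedFDeriv_one_sub hθ hs N
  let S : ℝ := ∑ i ∈ Finset.range (N + 1), (N.choose i : ℝ) * C *
    SchwartzMap.seminorm ℂ (k + 1) (N - i) ψ
  have hS : 0 ≤ S := Finset.sum_nonneg fun i _ => by positivity
  have hsm : ∀ c : ℝ, ContDiff ℝ ∞ fun x : RR n => ((1 - θ (c • x) : ℝ) : ℂ) := fun c =>
    Complex.ofRealCLM.contDiff.comp
      (contDiff_const.sub (hθ.comp (contDiff_const_smul c)))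
  have main : ∀ c : ℝ, 0 < c → c ≤ 1 →
      SchwartzMap.seminorm ℂ k N
        (SchwartzMap.smulLeftCLM ℂ (fun x => ((θ (c • x) : ℝ) : ℂ)) ψ - ψ) ≤ c * (r⁻¹ * S) := by
    intro c hc hc1
    refine SchwartzMap.seminorm_le_bound _ _ _ _ (by positivity) fun x => ?_
    have hT : Function.HasTemperateGrowth fun x : RR n => ((θ (c • x) : ℝ) : ℂ) := by
      have : IsSch fun x : RR n => ((θ x : ℝ) : ℂ) :=
        ⟨(hs.toSchwartzMap hθ).postcompCLM Complex.ofRealCLM, fun x => rfl⟩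
      exact (this.comp_smul hc.ne').hasTemperateGrowth
    have hfun : ⇑(SchwartzMap.smulLeftCLM ℂ (fun x => ((θ (c • x) : ℝ) : ℂ)) ψ - ψ) =
        -fun x => ((1 - θ (c • x) : ℝ) : ℂ) * ψ x := by
      ext y
      simp only [sub_apply, SchwartzMap.smulLeftCLM_apply_apply hT, Pi.neg_apply]
      push_cast; rw [smul_eq_mul]; ring
    rw [hfun, iteratedFDeriv_neg, Pi.neg_apply, norm_neg]
    -- Near such `x` the factor `1 - θ (c • ·)` vanishes identically. Elsewhere `c * r⁻¹ * ‖x‖ ≥ 1`,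
    -- so a factor `c` is gained for one more power of `‖x‖` in the seminorm.
    by_cases hx : ‖x‖ < c⁻¹ * r
    · have : (fun x => ((1 - θ (c • x) : ℝ) : ℂ) * ψ x) =ᶠ[𝓝 x] fun _ => 0 := by
        have : ∀ᶠ y : RR n in 𝓝 x, ‖y‖ < c⁻¹ * r := continuous_norm.tendsto x |>.eventually_lt_const hx
        filter_upwards [this] with y hy
        rw [h1 (c • y)]
        · simp
        · rw [norm_smul, Real.norm_of_nonneg hc.le]
          rwa [inv_mul_eq_div, lt_div_iff₀ hc, mul_comm] at hy
      rw [(this.iteratedFDeriv ℝ N).eq_of_nhds, iteratedFDeriv_fun_zero]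
      simp
      positivity
    · push Not at hx
      have hx' : 1 ≤ c * r⁻¹ * ‖x‖ := by
        rw [inv_mul_eq_div, div_le_iff₀ hc] at hx
        rw [mul_right_comm, ← div_eq_mul_inv, le_div_iff₀ hr]; linarith
      calc ‖x‖ ^ k * ‖iteratedFDeriv ℝ N (fun x => ((1 - θ (c • x) : ℝ) : ℂ) * ψ x) x‖
          ≤ (c * r⁻¹ * ‖x‖) * (‖x‖ ^ k * ‖iteratedFDeriv ℝ N (fun x => ((1 - θ (c • x) : ℝ) : ℂ) * ψ x) x‖) :=
            le_mul_of_one_le_left (by positivity) hx'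
        _ ≤ (c * r⁻¹ * ‖x‖) * (‖x‖ ^ k * ∑ i ∈ Finset.range (N + 1), (N.choose i : ℝ) *
            ‖iteratedFDeriv ℝ i (fun x => ((1 - θ (c • x) : ℝ) : ℂ)) x‖ *
              ‖iteratedFDeriv ℝ (N - i) ψ x‖) := by
            gcongr
            exact norm_iteratedFDeriv_mul_le (hsm c) (ψ.smooth ⊤) x (mod_cast le_top)
        _ = c * (r⁻¹ * ∑ i ∈ Finset.range (N + 1), (N.choose i : ℝ) *
            ‖iteratedFDeriv ℝ i (fun x => ((1 - θ (c • x) : ℝ) : ℂ)) x‖ *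
              (‖x‖ ^ (k + 1) * ‖iteratedFDeriv ℝ (N - i) ψ x‖)) := by
            rw [Finset.mul_sum, Finset.mul_sum, Finset.mul_sum, Finset.mul_sum]
            refine Finset.sum_congr rfl fun i _ => ?_
            ring
        _ ≤ c * (r⁻¹ * S) := by
            gcongr c * (r⁻¹ * ?_)
            refine Finset.sum_le_sum fun i hi => ?_
            have hi : i ≤ N := by have := Finset.mem_range.1 hi; omega
            gcongr
            · have := norm_iteratedFDeriv_comp_smul_le
                (f := fun x : RR n => ((1 - θ x : ℝ) : ℂ)) (by simpa using hsm 1) (c := c)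
                (by rw [abs_of_pos hc]; exact hc1) i x
              exact this.trans (hCb i hi _)
            · exact SchwartzMap.le_seminorm ℂ _ _ ψ x
  have hlim : Tendsto (fun c : ℝ => c * (r⁻¹ * S)) (𝓝[>] 0) (𝓝 0) := by
    have : Tendsto (fun c : ℝ => c * (r⁻¹ * S)) (𝓝 0) (𝓝 (0 * (r⁻¹ * S))) :=
      (continuous_id.mul continuous_const).tendsto 0
    rw [zero_mul] at this
    exact this.mono_left nhdsWithin_le_nhds
  filter_upwards [hlim.eventually_lt_const hε, self_mem_nhdsWithin,
    (eventually_le_nhds (zero_lt_one' ℝ)).filter_mono nhdsWithin_le_nhds] with c h1 h2 h3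
  exact (main c h2 h3).trans_lt h1

end

section

/-! ### Minkowski's integral inequality -/

/-- No duality: Hölder's inequality for `F = (F N^{-1/q}) N^{1/q}` gives `(∫ F)^p ≤ (∫ F^p N^{1-p})
(∫ N)^{p-1}` for each `x`, and Tonelli lets `∫ F^p dν ≤ N^p` be inserted. The negative power is the
reason for requiring `N ≠ 0`. -/
theorem eLpNorm_lintegral_le_aux {Ω X : Type*} [MeasurableSpace Ω] [MeasurableSpace X]
    {μ : Measure Ω} {ν : Measure X} [SigmaFinite μ] [SigmaFinite ν] {p : ℝ} (hp : 1 < p)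
    {F : Ω → X → ℝ≥0∞} (hF : Measurable (Function.uncurry F)) {N : Ω → ℝ≥0∞} (hN : Measurable N)
    (hpos : ∀ o, N o ≠ 0) (h : ∀ᵐ o ∂μ, ∫⁻ x, F o x ^ p ∂ν ≤ N o ^ p) :
    ∫⁻ x, (∫⁻ o, F o x ∂μ) ^ p ∂ν ≤ (∫⁻ o, N o ∂μ) ^ p := by
  have hp0 : 0 < p := by linarith
  set M := ∫⁻ o, N o ∂μ with hM
  rcases eq_or_ne M ⊤ with hMt | hMt
  · rw [hMt, ENNReal.top_rpow_of_pos hp0]; exact le_top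
  have hfin : ∀ᵐ o ∂μ, N o < ⊤ := ae_lt_top hN hMt
  have hpq : p.HolderConjugate (Real.conjExponent p) := Real.HolderConjugate.conjExponent hp
  set q := Real.conjExponent p
  have hq := hpq.symm.pos
  have hFx : ∀ x, Measurable fun o => F o x := fun x => hF.of_uncurry_right
  have key : ∀ x, (∫⁻ o, F o x ∂μ) ^ p ≤ (∫⁻ o, F o x ^ p * N o ^ (1 - p) ∂μ) * M ^ (p - 1) := by
    intro x
    have e1 : ∫⁻ o, F o x ∂μ =
        ∫⁻ o, ((fun o => F o x * N o ^ (-(1 / q))) * fun o => N o ^ (1 / q)) o ∂μ := by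
      refine lintegral_congr_ae ?_
      filter_upwards [hfin] with o ho
      rw [Pi.mul_apply, mul_assoc, ← ENNReal.rpow_add _ _ (hpos o) ho.ne]
      simp
    have e2 := ENNReal.lintegral_mul_le_Lp_mul_Lq μ hpq
      (f := fun o => F o x * N o ^ (-(1 / q))) (g := fun o => N o ^ (1 / q))
      ((hFx x).mul (hN.pow_const (-(1 / q)))).aemeasurable (hN.pow_const (1 / q)).aemeasurable
    rw [← e1] at e2
    have e3 : ∫⁻ o, (N o ^ (1 / q)) ^ q ∂μ = M := by
      refine lintegral_congr fun o => ?_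
      rw [← ENNReal.rpow_mul, one_div, inv_mul_cancel₀ hq.ne', ENNReal.rpow_one]
    have e4 : ∫⁻ o, (F o x * N o ^ (-(1 / q))) ^ p ∂μ = ∫⁻ o, F o x ^ p * N o ^ (1 - p) ∂μ := by
      refine lintegral_congr fun o => ?_
      rw [ENNReal.mul_rpow_of_nonneg _ _ hp0.le, ← ENNReal.rpow_mul]
      congr 2
      have := hpq.one_sub_inv
      rw [one_div, ← this]
      field_simp
      ring
    have e5 := ENNReal.rpow_le_rpow e2 hp0.le
    rw [ENNReal.mul_rpow_of_nonneg _ _ hp0.le, ← ENNReal.rpow_mul, ← ENNReal.rpow_mul,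
      one_div_mul_cancel hp0.ne', ENNReal.rpow_one, e3] at e5
    rw [e4] at e5
    refine e5.trans_eq ?_
    congr 2
    have := hpq.one_sub_inv
    rw [one_div, ← this]
    field_simp
  calc ∫⁻ x, (∫⁻ o, F o x ∂μ) ^ p ∂ν
      ≤ ∫⁻ x, (∫⁻ o, F o x ^ p * N o ^ (1 - p) ∂μ) * M ^ (p - 1) ∂ν := lintegral_mono key
    _ = (∫⁻ x, ∫⁻ o, F o x ^ p * N o ^ (1 - p) ∂μ ∂ν) * M ^ (p - 1) := by
        refine lintegral_mul_const' _ _ ?_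
        exact ENNReal.rpow_ne_top_of_nonneg (by linarith) hMt
    _ = (∫⁻ o, ∫⁻ x, F o x ^ p * N o ^ (1 - p) ∂ν ∂μ) * M ^ (p - 1) := by
        rw [lintegral_lintegral_swap]
        have : Measurable fun z : X × Ω => F z.2 z.1 := hF.comp measurable_swap
        exact ((this.pow_const p).mul ((hN.comp measurable_snd).pow_const (1 - p))).aemeasurable
    _ ≤ (∫⁻ o, N o ∂μ) * M ^ (p - 1) := by
        gcongr ?_ * _
        refine lintegral_mono_ae ?_
        filter_upwards [hfin, h] with o ho h
        rw [lintegral_mul_const' _ _ (ENNReal.rpow_ne_top_of_ne_zero (hpos o) ho.ne)]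
        calc _ ≤ N o ^ p * N o ^ (1 - p) := by gcongr
          _ = N o := by rw [← ENNReal.rpow_add _ _ (hpos o) ho.ne]; simp
    _ = M ^ p := by
        rw [← hM]
        nth_rw 1 [← ENNReal.rpow_one M]
        rw [← ENNReal.rpow_add_of_nonneg _ _ (by linarith) (by linarith)]
        congr 1; ring

/-- Minkowski's integral inequality. -/
theorem eLpNorm_lintegral_le {Ω X : Type*} [MeasurableSpace Ω] [MeasurableSpace X]
    {μ : Measure Ω} {ν : Measure X} [SigmaFinite μ] [SigmaFinite ν] {p : ℝ≥0∞} (hp : 1 ≤ p)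
    {F : Ω → X → ℝ≥0∞} (hF : Measurable (Function.uncurry F)) {N : Ω → ℝ≥0∞} (hN : Measurable N)
    (h : ∀ᵐ o ∂μ, eLpNorm (F o) p ν ≤ N o) :
    eLpNorm (fun x => ∫⁻ o, F o x ∂μ) p ν ≤ ∫⁻ o, N o ∂μ := by
  rcases eq_or_ne p ⊤ with rfl | hpt
  · simp only [eLpNorm_exponent_top] at h ⊢
    refine eLpNormEssSup_le_of_ae_enorm_bound ?_
    have h1 : ∀ᵐ o ∂μ, ∀ᵐ x ∂ν, F o x ≤ N o := by
      filter_upwards [h] with o ho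
      filter_upwards [ae_le_eLpNormEssSup (f := F o)] with x hx
      exact hx.trans ho
    have h2 : ∀ᵐ x ∂ν, ∀ᵐ o ∂μ, F o x ≤ N o := by
      have hs : MeasurableSet {z : Ω × X | F z.1 z.2 ≤ N z.1} :=
        measurableSet_le hF (hN.comp measurable_fst)
      have h3 : ∀ᵐ z ∂μ.prod ν, F z.1 z.2 ≤ N z.1 := (Measure.ae_prod_mem_iff_ae_ae_mem hs).2 h1
      have h4 := (Measure.ae_ae_comm (p := fun o x => F o x ≤ N o) hs).1 h1
      exact h4
    filter_upwards [h2] with x hx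
    exact lintegral_mono_ae hx
  · rcases hp.eq_or_lt with rfl | hp1
    · simp only [eLpNorm_one_eq_lintegral_enorm, enorm_eq_self] at h ⊢
      rw [lintegral_lintegral_swap (f := fun x o => F o x)
        (hF.comp measurable_swap).aemeasurable]
      exact lintegral_mono_ae h
    · have hp0 : p ≠ 0 := (zero_lt_one.trans hp1).ne'
      have hp1' : 1 < p.toReal := by
        rw [← ENNReal.toReal_one]; exact (ENNReal.toReal_lt_toReal (by simp) hpt).2 hp1
      have hpp : 0 < p.toReal := by linarith
      refine ENNReal.le_of_forall_pos_le_add fun ε hε hfin => ?_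
      -- A strictly positive function of small integral is added to `N`, which may vanish.
      obtain ⟨w, hw0, hwm, hw⟩ := exists_pos_lintegral_lt_of_sigmaFinite μ
        (ENNReal.coe_pos.2 hε).ne'
      have key := eLpNorm_lintegral_le_aux (μ := μ) (ν := ν) hp1' hF
        (N := fun o => N o + w o) (by fun_prop) (fun o => by simp [(hw0 o).ne']) (by
          filter_upwards [h] with o ho
          rw [eLpNorm_eq_lintegral_rpow_enorm_toReal hp0 hpt] at ho
          simp only [enorm_eq_self] at ho
          rw [one_div, ENNReal.rpow_inv_le_iff hpp] at ho
          refine ho.trans ?_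
          gcongr
          exact le_self_add)
      rw [eLpNorm_eq_lintegral_rpow_enorm_toReal hp0 hpt, one_div, ENNReal.rpow_inv_le_iff hpp]
      simp only [enorm_eq_self]
      refine key.trans ?_
      gcongr
      rw [lintegral_add_left hN]
      gcongr

theorem eLpNorm_const_mul {X : Type*} [MeasurableSpace X] {ν : Measure X} {p : ℝ≥0∞} (hp : p ≠ 0)
    (c : ℝ≥0∞) {a : X → ℝ≥0∞} (ha : Measurable a) :
    eLpNorm (fun x => c * a x) p ν = c * eLpNorm a p ν := by
  rcases eq_or_ne p ⊤ with rfl | hpt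
  · simp only [eLpNorm_exponent_top, eLpNormEssSup, enorm_eq_self]
    exact ENNReal.essSup_const_mul
  · have hpp : 0 < p.toReal := ENNReal.toReal_pos hp hpt
    simp only [eLpNorm_eq_lintegral_rpow_enorm_toReal hp hpt, enorm_eq_self,
      ENNReal.mul_rpow_of_nonneg _ _ hpp.le]
    rw [lintegral_const_mul _ (ha.pow_const _), ENNReal.mul_rpow_of_nonneg _ _ (by positivity),
      ← ENNReal.rpow_mul, mul_one_div_cancel hpp.ne', ENNReal.rpow_one]

/-- Convolution with an integrable kernel, in the nonnegative setting. -/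
theorem eLpNorm_lconv_le {p : ℝ≥0∞} (hp : 1 ≤ p) {k a : RR n → ℝ≥0∞} (hk : Measurable k)
    (ha : Measurable a) :
    eLpNorm (fun x => ∫⁻ y, k (x - y) * a y) p volume ≤ (∫⁻ y, k y) * eLpNorm a p volume := by
  have h1 : (fun x => ∫⁻ y, k (x - y) * a y) = fun x => ∫⁻ z, k z * a (x - z) := by
    ext x
    rw [← lintegral_sub_left_eq_self _ x]
    simp
  rw [h1, ← lintegral_mul_const _ hk]
  refine eLpNorm_lintegral_le hp (F := fun z x => k z * a (x - z))
    ((hk.comp measurable_fst).mul (ha.comp (measurable_snd.sub measurable_fst)))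
    (hk.mul_const _) (Eventually.of_forall fun z => ?_)
  have h2 : eLpNorm (fun x => a (x - z)) p volume = eLpNorm a p volume :=
    eLpNorm_comp_measurePreserving ha.aestronglyMeasurable (measurePreserving_sub_right volume z)
  rw [← h2]
  exact (eLpNorm_const_mul (zero_lt_one.trans_le hp).ne' (k z)
    (ha.comp (measurable_id.sub_const z))).le

/-! ### Distributions that are bounded functions -/

/-- The convolution of a scalar kernel and a vector field. -/
def cv (k : RR n → ℂ) (h : RR n → CC n) (x : RR n) : CC n := ∫ y, k (x - y) • h y

/-- The distribution `v` is given by the bounded function `h`. -/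
structure BRep (v : TDist n) (h : RR n → CC n) : Prop where
  meas : Measurable h
  bdd : ∃ M : ℝ, ∀ x, ‖h x‖ ≤ M
  rep : ∀ ψ : 𝓢(RR n, ℂ), v ψ = ∫ x, ψ x • h x

theorem locallyIntegrable_of_bdd {h : RR n → CC n} (hm : Measurable h)
    (hb : ∃ M : ℝ, ∀ x, ‖h x‖ ≤ M) : LocallyIntegrable h volume := by
  obtain ⟨M, hM⟩ := hb
  exact (locallyIntegrable_const M).mono hm.aestronglyMeasurable
    (Eventually.of_forall fun x => (hM x).trans (Real.le_norm_self M))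

theorem BRep.isRep {v : TDist n} {h : RR n → CC n} (H : BRep v h) : IsRep v h :=
  ⟨locallyIntegrable_of_bdd H.meas H.bdd, fun ψ _ => H.rep ψ⟩

theorem IsRep.ae_eq {v : TDist n} {g g' : RR n → CC n} (h : IsRep v g) (h' : IsRep v g') :
    g =ᵐ[volume] g' := by
  refine ae_eq_of_integral_contDiff_smul_eq h.1 h'.1 fun θ hθ hc => ?_
  have h1 : HasCompactSupport (Complex.ofRealCLM ∘ θ) := hc.comp_left rfl
  have h2 : ContDiff ℝ ∞ (Complex.ofRealCLM ∘ θ) := Complex.ofRealCLM.contDiff.comp hθ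
  have h3 := (h.2 (h1.toSchwartzMap h2) h1).symm.trans (h'.2 (h1.toSchwartzMap h2) h1)
  simpa using h3

theorem IsRep.distLpNorm_eq {v : TDist n} {g : RR n → CC n} (h : IsRep v g) (p : ℝ≥0∞) :
    distLpNorm p v = eLpNorm g p volume := by
  refine le_antisymm (iInf₂_le g h) (le_iInf₂ fun g' h' => ?_)
  rw [eLpNorm_congr_ae (h.ae_eq h')]

theorem IsRep.toFn_ae_eq {v : TDist n} {g : RR n → CC n} (h : IsRep v g) :
    toFn v =ᵐ[volume] g := by
  have h' : ∃ g, IsRep v g := ⟨g, h⟩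
  rw [toFn, dif_pos h']
  exact h'.choose_spec.ae_eq h

theorem BRep.distLpNorm_eq {v : TDist n} {h : RR n → CC n} (H : BRep v h) (p : ℝ≥0∞) :
    distLpNorm p v = eLpNorm h p volume := H.isRep.distLpNorm_eq p

theorem exists_bRep {h : RR n → CC n} (hm : Measurable h) (hb : ∃ M : ℝ, ∀ x, ‖h x‖ ≤ M) :
    ∃ v : TDist n, BRep v h := by
  obtain ⟨M, hM⟩ := hb
  have hL : MemLp h ⊤ volume := memLp_top_of_bound hm.aestronglyMeasurable M
    (Eventually.of_forall hM)
  have : Fact ((1 : ℝ≥0∞) ≤ ⊤) := ⟨le_top⟩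
  refine ⟨Lp.toTemperedDistribution (hL.toLp h), hm, ⟨M, hM⟩, fun ψ => ?_⟩
  rw [Lp.toTemperedDistribution_apply]
  refine integral_congr_ae ?_
  filter_upwards [hL.coeFn_toLp] with x hx
  rw [hx]

/-- `IsRep` tests with compactly supported functions only; by truncation these determine the
distribution. -/
theorem TDist.ext_of_compactSupport {v w : TDist n}
    (h : ∀ ψ : 𝓢(RR n, ℂ), HasCompactSupport (ψ : RR n → ℂ) → v ψ = w ψ) : v = w := by
  ext1 ψ
  let b : ContDiffBump (0 : RR n) := ⟨1, 2, one_pos, one_lt_two⟩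
  have ht := tendsto_smulLeftCLM_truncation b.contDiff b.hasCompactSupport one_pos
    (fun x hx => b.one_of_mem_closedBall (by simpa using hx.le)) ψ
  have h1 := (v.continuous.tendsto ψ).comp ht
  have h2 := (w.continuous.tendsto ψ).comp ht
  refine tendsto_nhds_unique h1 (h2.congr' ?_)
  filter_upwards [self_mem_nhdsWithin] with c hc
  refine (h _ ?_).symm
  have hc : c ≠ 0 := (mem_Ioi.1 hc).ne'
  have hs : HasCompactSupport fun x : RR n => ((b (c • x) : ℝ) : ℂ) :=
    (b.hasCompactSupport.comp_smul hc).comp_left (g := Complex.ofReal) rfl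
  have hsm : ContDiff ℝ ∞ fun x : RR n => ((b (c • x) : ℝ) : ℂ) :=
    Complex.ofRealCLM.contDiff.comp (b.contDiff.comp (contDiff_const_smul c))
  have hT := (IsSch.of_hasCompactSupport hs hsm).hasTemperateGrowth
  refine hs.mono fun x hx => ?_
  rw [Function.mem_support, SchwartzMap.smulLeftCLM_apply_apply hT] at hx
  exact left_ne_zero_of_smul hx

/-- The representative is changed on a null set so as to be Borel and bounded by the norm
everywhere. The pairing formula then extends from compactly supported test functions to all Schwartz
functions by `TDist.ext_of_compactSupport`. -/
theorem exists_bRep_of_distLpNorm_lt_top {v : TDist n} (h : distLpNorm ⊤ v < ⊤) :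
    ∃ g, BRep v g ∧ ∀ x, ‖g x‖ₑ ≤ distLpNorm ⊤ v := by
  obtain ⟨g, hg, hlt⟩ : ∃ g, ∃ _ : IsRep v g, eLpNorm g ⊤ volume < ⊤ := by
    simpa [distLpNorm, iInf_lt_iff] using h
  have hM := hg.distLpNorm_eq ⊤
  set M := distLpNorm ⊤ v
  have hgm : AEStronglyMeasurable g volume := hg.1.aestronglyMeasurable
  let g₀ := hgm.mk g
  have hg₀ : Measurable g₀ := hgm.stronglyMeasurable_mk.measurable
  let g₁ : RR n → CC n := {x | ‖g₀ x‖ₑ ≤ M}.indicator g₀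
  have hs : MeasurableSet {x | ‖g₀ x‖ₑ ≤ M} := measurableSet_le hg₀.enorm measurable_const
  have hb : ∀ x, ‖g₁ x‖ₑ ≤ M := fun x => by
    by_cases hx : x ∈ {x | ‖g₀ x‖ₑ ≤ M}
    · simp only [g₁, indicator_of_mem hx]; exact hx
    · simp [g₁, indicator_of_notMem hx]
  have hae : g =ᵐ[volume] g₁ := by
    filter_upwards [hgm.ae_eq_mk, ae_le_eLpNormEssSup (f := g)] with x hx hx2
    rw [← eLpNorm_exponent_top, ← hM, hx] at hx2
    rw [hx]
    exact (indicator_of_mem (s := {x | ‖g₀ x‖ₑ ≤ M}) hx2 g₀).symm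
  have hbdd : ∃ C : ℝ, ∀ x, ‖g₁ x‖ ≤ C := ⟨M.toReal, fun x => by
    rw [← toReal_enorm]; exact ENNReal.toReal_mono h.ne (hb x)⟩
  have hmeas : Measurable g₁ := hg₀.indicator hs
  obtain ⟨w, hw⟩ := exists_bRep hmeas hbdd
  have : v = w := TDist.ext_of_compactSupport fun ψ hψ => by
    rw [hg.2 ψ hψ, hw.rep]
    exact integral_congr_ae (by filter_upwards [hae] with x hx; rw [hx])
  exact ⟨g₁, this ▸ hw, hb⟩

theorem enorm_cv_le (k : RR n → ℂ) (h : RR n → CC n) (x : RR n) :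
    ‖cv k h x‖ₑ ≤ ∫⁻ y, ‖k (x - y)‖ₑ * ‖h y‖ₑ :=
  (enorm_integral_le_lintegral_enorm _).trans_eq (by simp_rw [enorm_smul])


theorem enorm_cv_le_of_bound {k : RR n → ℂ} {h : RR n → CC n} {M : ℝ≥0∞} (hk : Measurable k)
    (hM : ∀ᵐ y, ‖h y‖ₑ ≤ M) (x : RR n) : ‖cv k h x‖ₑ ≤ (∫⁻ y, ‖k y‖ₑ) * M := by
  refine (enorm_cv_le k h x).trans ?_
  calc ∫⁻ y, ‖k (x - y)‖ₑ * ‖h y‖ₑ ≤ ∫⁻ y, ‖k (x - y)‖ₑ * M := by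
        refine lintegral_mono_ae ?_
        filter_upwards [hM] with y hy; gcongr
    _ = (∫⁻ y, ‖k (x - y)‖ₑ) * M := lintegral_mul_const _ (by fun_prop)
    _ = _ := by rw [lintegral_sub_left_eq_self (fun y => ‖k y‖ₑ) x]

theorem measurable_cv {k : RR n → ℂ} {h : RR n → CC n} (hk : Measurable k) (hh : Measurable h) :
    Measurable (cv k h) := by
  have : StronglyMeasurable fun x => ∫ y, k (x - y) • h y :=
    StronglyMeasurable.integral_prod_right' (f := fun q : RR n × RR n => k (q.1 - q.2) • h q.2)
      (Measurable.stronglyMeasurable (by fun_prop))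
  exact this.measurable

theorem enorm_bdd_iff {h : RR n → CC n} {M : ℝ≥0∞} (hM : M ≠ ⊤) (hb : ∀ x, ‖h x‖ₑ ≤ M) :
    ∃ C : ℝ, ∀ x, ‖h x‖ ≤ C :=
  ⟨M.toReal, fun x => by rw [← toReal_enorm]; exact ENNReal.toReal_mono hM (hb x)⟩

theorem eLpNorm_cv_le {p : ℝ≥0∞} (hp : 1 ≤ p) {k : RR n → ℂ} {h : RR n → CC n}
    (hk : Measurable k) (hh : Measurable h) :
    eLpNorm (cv k h) p volume ≤ (∫⁻ y, ‖k y‖ₑ) * eLpNorm h p volume := by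
  have := eLpNorm_lconv_le hp (k := fun x => ‖k x‖ₑ) (a := fun y => ‖h y‖ₑ) (by fun_prop)
    (by fun_prop)
  rw [eLpNorm_enorm] at this
  exact (eLpNorm_mono_enorm fun x => by simpa using enorm_cv_le k h x).trans this

/-! ### Fourier multipliers on bounded functions -/

/-- The transpose of the operator `m(D)` on Schwartz functions. -/
def multT (m : RR n → ℂ) (ψ : 𝓢(RR n, ℂ)) : 𝓢(RR n, ℂ) :=
  𝓕 (SchwartzMap.smulLeftCLM ℂ (fun η : RR n => m ((2 * Real.pi) • η)) (𝓕⁻ ψ))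

theorem mult_apply (m : RR n → ℂ) (v : TDist n) (ψ : 𝓢(RR n, ℂ)) : mult m v ψ = v (multT m ψ) :=
  rfl

theorem multS_apply {m : RR n → ℂ} (hm : IsSch m) (ψ : 𝓢(RR n, ℂ)) (x : RR n) :
    multS m ψ x = ∫ y, ker m (x - y) * ψ y := by
  have ht := (hm.comp_smul two_pi_ne_zero).hasTemperateGrowth
  rw [multS, SchwartzMap.fourierMultiplierCLM_apply, SchwartzMap.fourierInv_coe]
  refine Eq.trans ?_
    (fourierInv_mul_fourier (integrable_comp_two_pi hm.integrable) ψ.integrable x)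
  refine congrFun (congrArg _ (funext fun η => ?_)) x
  rw [SchwartzMap.smulLeftCLM_apply_apply ht, SchwartzMap.fourier_coe, smul_eq_mul]

/-- Reflection of a Schwartz function. -/
def reflS (ψ : 𝓢(RR n, ℂ)) : 𝓢(RR n, ℂ) :=
  SchwartzMap.compCLMOfContinuousLinearEquiv ℂ (ContinuousLinearEquiv.neg ℝ (M := RR n)) ψ

theorem reflS_apply (ψ : 𝓢(RR n, ℂ)) (x : RR n) : reflS ψ x = ψ (-x) := rfl

theorem fourierInv_eq_fourier_reflS (ψ : 𝓢(RR n, ℂ)) : 𝓕⁻ ψ = 𝓕 (reflS ψ) := by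
  ext η
  rw [SchwartzMap.fourierInv_coe, SchwartzMap.fourier_coe, Real.fourierInv_eq_fourier_comp_neg]
  rfl

/-- Transposition reflects the kernel, so it amounts to conjugation with the reflection of space. -/
theorem multT_eq (m : RR n → ℂ) (ψ : 𝓢(RR n, ℂ)) (x : RR n) :
    multT m ψ x = multS m (reflS ψ) (-x) := by
  rw [multT, multS, SchwartzMap.fourierMultiplierCLM_apply, SchwartzMap.fourierInv_coe,
    Real.fourierInv_eq_fourier_neg, neg_neg, SchwartzMap.fourier_coe, fourierInv_eq_fourier_reflS]

theorem multT_apply {m : RR n → ℂ} (hm : IsSch m) (ψ : 𝓢(RR n, ℂ)) (y : RR n) :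
    multT m ψ y = ∫ z, ker m (z - y) * ψ z := by
  rw [multT_eq, multS_apply hm, ← integral_neg_eq_self]
  congr 1
  ext z
  rw [reflS_apply, neg_neg]
  congr 2
  abel

theorem BRep.mult {v : TDist n} {h : RR n → CC n} (H : BRep v h) {m : RR n → ℂ} (hm : IsSch m) :
    BRep (mult m v) (cv (ker m) h) := by
  have hk : Measurable (ker m) := hm.ker.continuous.measurable
  have hh := H.meas
  obtain ⟨M, hM⟩ := H.bdd
  have hMe : ∀ x, ‖h x‖ₑ ≤ ENNReal.ofReal M := fun x => by
    rw [← ofReal_norm]; exact ENNReal.ofReal_le_ofReal (hM x)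
  refine ⟨measurable_cv hk hh, ?_, fun ψ => ?_⟩
  · exact enorm_bdd_iff (ENNReal.mul_ne_top hm.kerNorm_lt_top.ne ENNReal.ofReal_ne_top)
      (enorm_cv_le_of_bound hk (Eventually.of_forall hMe))
  · rw [mult_apply, H.rep]
    simp_rw [multT_apply hm, cv]
    have h1 : ∀ x, (∫ z, ker m (z - x) * ψ z) • h x = ∫ z, (ker m (z - x) * ψ z) • h x :=
      fun x => (integral_smul_const _ _).symm
    have h2 : ∀ x, ψ x • ∫ y, ker m (x - y) • h y = ∫ y, (ker m (x - y) * ψ x) • h y := by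
      intro x
      rw [← integral_smul]
      congr 1; ext1 y
      rw [smul_smul, mul_comm]
    simp_rw [h1, h2]
    rw [integral_integral_swap]
    refine ⟨?_, ?_⟩
    · refine Measurable.aestronglyMeasurable ?_
      have := ψ.continuous.measurable
      simp only [Function.uncurry_def]
      fun_prop
    · rw [hasFiniteIntegral_def]
      have := ψ.continuous.measurable
      rw [lintegral_prod_symm _ (by simp only [Function.uncurry_def]; fun_prop)]
      calc ∫⁻ z, ∫⁻ x, ‖(ker m (z - x) * ψ z) • h x‖ₑ
          ≤ ∫⁻ z, ∫⁻ x, ‖ker m (z - x)‖ₑ * (‖ψ z‖ₑ * ENNReal.ofReal M) := by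
            refine lintegral_mono fun z => lintegral_mono fun x => ?_
            simp only []
            rw [enorm_smul, enorm_mul, mul_assoc]
            gcongr
            exact hMe x
        _ = ∫⁻ z, kerNorm m * (‖ψ z‖ₑ * ENNReal.ofReal M) := by
            refine lintegral_congr fun z => ?_
            rw [lintegral_mul_const _ (by fun_prop),
              lintegral_sub_left_eq_self (fun y => ‖ker m y‖ₑ) z]
            rfl
        _ = kerNorm m * ((∫⁻ z, ‖ψ z‖ₑ) * ENNReal.ofReal M) := by
            rw [lintegral_const_mul _ (by fun_prop), lintegral_mul_const _ (by fun_prop)]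
        _ < ⊤ := ENNReal.mul_lt_top hm.kerNorm_lt_top
            (ENNReal.mul_lt_top ψ.integrable.2 ENNReal.ofReal_lt_top)

theorem BRep.distLpNorm_mult_le {v : TDist n} {h : RR n → CC n} (H : BRep v h) {m : RR n → ℂ}
    (hm : IsSch m) {p : ℝ≥0∞} (hp : 1 ≤ p) :
    distLpNorm p (BesovNS.mult m v) ≤ kerNorm m * distLpNorm p v := by
  rw [(H.mult hm).distLpNorm_eq, H.distLpNorm_eq]
  exact eLpNorm_cv_le hp hm.ker.continuous.measurable H.meas

theorem mult_mult {a b : RR n → ℂ} (ha : a.HasTemperateGrowth) (hb : b.HasTemperateGrowth)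
    (v : TDist n) : mult b (mult a v) = mult (fun ξ => a ξ * b ξ) v :=
  TemperedDistribution.fourierMultiplierCLM_fourierMultiplierCLM_apply
    (Function.HasTemperateGrowth.comp_const_smul ha _)
    (Function.HasTemperateGrowth.comp_const_smul hb _) v

theorem multS_multS {a b : RR n → ℂ} (ha : a.HasTemperateGrowth) (hb : b.HasTemperateGrowth)
    (ψ : 𝓢(RR n, ℂ)) : multS b (multS a ψ) = multS (fun ξ => b ξ * a ξ) ψ :=
  SchwartzMap.fourierMultiplierCLM_fourierMultiplierCLM_apply
    (Function.HasTemperateGrowth.comp_const_smul hb _)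
    (Function.HasTemperateGrowth.comp_const_smul ha _) ψ

theorem multT_eq_multS {m : RR n → ℂ} (hm : ∀ ξ, m (-ξ) = m ξ) (ht : m.HasTemperateGrowth)
    (ψ : 𝓢(RR n, ℂ)) : multT m ψ = multS m ψ := by
  have htt := Function.HasTemperateGrowth.comp_const_smul ht (2 * Real.pi)
  ext x
  rw [multT, multS, SchwartzMap.fourierMultiplierCLM_apply, SchwartzMap.fourierInv_coe,
    SchwartzMap.fourier_coe, Real.fourierInv_eq_fourier_comp_neg]
  refine congrFun (congrArg _ (funext fun η => ?_)) x
  rw [SchwartzMap.smulLeftCLM_apply_apply htt, SchwartzMap.smulLeftCLM_apply_apply htt,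
    SchwartzMap.fourierInv_coe, Real.fourierInv_eq_fourier_neg, SchwartzMap.fourier_coe,
    smul_neg, hm]

end

section

/-! ### Homogeneous symbols localized to annuli -/

/-- Smooth functions with compact support away from the origin. -/
structure IsAnnular (θ : RR n → ℝ) : Prop where
  smooth : ContDiff ℝ ∞ θ
  compact : HasCompactSupport θ
  away : ∃ r > 0, ∀ ξ, ‖ξ‖ < r → θ ξ = 0

/-- The product is smooth at the origin because `θ` vanishes near it; the behaviour of `a` there is
irrelevant. -/
theorem IsAnnular.isSch_mul {θ : RR n → ℝ} (h : IsAnnular θ) {a : RR n → ℂ}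
    (ha : ContDiffOn ℝ ∞ a {0}ᶜ) : IsSch fun ξ => a ξ * (θ ξ : ℂ) := by
  have hθ : ContDiff ℝ ∞ fun ξ => (θ ξ : ℂ) := Complex.ofRealCLM.contDiff.comp h.smooth
  refine IsSch.of_hasCompactSupport ((h.compact.comp_left (g := Complex.ofReal) rfl).mul_left) ?_
  rw [contDiff_iff_contDiffAt]
  intro ξ
  by_cases hξ : ξ = 0
  · obtain ⟨r, hr, hz⟩ := h.away
    refine (contDiffAt_const (c := (0 : ℂ))).congr_of_eventuallyEq ?_
    filter_upwards [Metric.ball_mem_nhds ξ hr] with y hy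
    rw [hz y (by simpa [hξ] using hy)]; simp
  · exact (ha.contDiffAt (isOpen_compl_singleton.mem_nhds hξ)).mul hθ.contDiffAt

theorem heatSymbol_sq_mul (c τ : ℝ) (ξ : RR n) :
    heatSymbol (c ^ 2 * τ) ξ = heatSymbol τ (c • ξ) := by
  simp only [heatSymbol, norm_smul, mul_pow, Real.norm_eq_abs, sq_abs]
  congr 2; ring

theorem heatSymbol_eq_comp_sqrt {τ : ℝ} (hτ : 0 ≤ τ) :
    heatSymbol (n := n) τ = fun ξ => heatSymbol 1 (√τ • ξ) := by
  ext ξ; rw [← heatSymbol_sq_mul, Real.sq_sqrt hτ, mul_one]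

theorem heatSymbol_add (s t : ℝ) (ξ : RR n) :
    heatSymbol (s + t) ξ = heatSymbol s ξ * heatSymbol t ξ := by
  rw [heatSymbol, heatSymbol, heatSymbol, ← Complex.ofReal_mul, ← Real.exp_add]
  congr 2; ring

theorem kerNorm_heatSymbol {τ : ℝ} (hτ : 0 < τ) :
    kerNorm (heatSymbol (n := n) τ) = kerNorm (heatSymbol (n := n) 1) := by
  rw [heatSymbol_eq_comp_sqrt hτ.le]
  exact kerNorm_comp_smul _ (Real.sqrt_pos.2 hτ)

/-- A decaying profile that majorizes the heat flow on annuli. -/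
def decay (y : ℝ) : ℝ≥0∞ := ENNReal.ofReal ((1 + y ^ 2)⁻¹)

theorem measurable_decay : Measurable decay := by unfold decay; fun_prop

theorem decay_le_one (y : ℝ) : decay y ≤ 1 := by
  rw [decay, ENNReal.ofReal_le_one]
  exact inv_le_one_of_one_le₀ (by nlinarith [sq_nonneg y])

/-- Quadratic decay is all that is used in place of the true exponential decay on annuli. It is
integrable in time, and with `y = 4^l t` it beats the factors `2^{lβ}`, `β ≤ 1`, at high
frequencies. -/
theorem le_mul_decay {W C : ℝ≥0∞} {y : ℝ} (h₁ : W ≤ C)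
    (h₂ : ENNReal.ofReal (y ^ 2) * W ≤ C) : W ≤ 2 * C * decay y := by
  have h3 : ENNReal.ofReal (1 + y ^ 2) * W ≤ 2 * C := by
    rw [ENNReal.ofReal_add zero_le_one (sq_nonneg y), add_mul, ENNReal.ofReal_one, one_mul, two_mul]
    exact add_le_add h₁ h₂
  have hpos : 0 < 1 + y ^ 2 := by positivity
  calc W = (ENNReal.ofReal (1 + y ^ 2) * W) * decay y := by
        rw [decay, ENNReal.ofReal_inv_of_pos hpos, mul_right_comm,
          ENNReal.mul_inv_cancel (by simpa using hpos) ENNReal.ofReal_ne_top, one_mul]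
    _ ≤ _ := by gcongr

theorem hasTemperateGrowth_norm_pow_four :
    Function.HasTemperateGrowth fun ξ : RR n => ((‖ξ‖ ^ 4 : ℝ) : ℂ) := by
  have h := (Function.hasTemperateGrowth_norm_sq (RR n)).pow 2
  have h2 : (fun ξ : RR n => ((‖ξ‖ ^ 4 : ℝ) : ℂ)) = Complex.ofReal ∘ ((fun x : RR n => ‖x‖ ^ 2) ^ 2) := by
    ext ξ; simp [← pow_mul]
  rw [h2]
  exact Function.Complex.hasTemperateGrowth_ofReal.comp h

theorem contDiffOn_norm_pow_four_inv :
    ContDiffOn ℝ ∞ (fun ξ : RR n => (((‖ξ‖ ^ 4)⁻¹ : ℝ) : ℂ)) {0}ᶜ := by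
  have h : ContDiffOn ℝ ∞ (fun ξ : RR n => ((‖ξ‖ ^ 2) ^ 2)⁻¹) {0}ᶜ :=
    (((contDiff_norm_sq ℝ).pow 2).contDiffOn).inv fun ξ hξ => by
      have : ξ ≠ 0 := hξ
      positivity
  have h2 : (fun ξ : RR n => (((‖ξ‖ ^ 4)⁻¹ : ℝ) : ℂ)) =
      Complex.ofRealCLM ∘ fun ξ : RR n => ((‖ξ‖ ^ 2) ^ 2)⁻¹ := by
    ext ξ; simp [← pow_mul]
  rw [h2]
  exact Complex.ofRealCLM.contDiff.comp_contDiffOn h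

/-- The bound without decay is Young's inequality for the heat kernel. The bound with the factor
`τ²` comes from `τ² e^{-τ|ξ|²} = |ξ|^{-4} (|√τ ξ|⁴ e^{-|√τ ξ|²})`: the bracket is a dilation of a
fixed Schwartz function, and `|ξ|^{-4}` is harmless on the support of `θ`. -/
theorem kerNorm_annular_heat_le {θ : RR n → ℝ} (h : IsAnnular θ) {a : RR n → ℂ}
    (ha : ContDiffOn ℝ ∞ a {0}ᶜ) {τ : ℝ} (hτ : 0 ≤ τ) :
    kerNorm (fun ξ => a ξ * (θ ξ : ℂ) * heatSymbol τ ξ) ≤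
      2 * (kerNorm (fun ξ => a ξ * (θ ξ : ℂ)) * (1 + kerNorm (heatSymbol (n := n) 1)) +
        kerNorm (fun ξ => a ξ * (((‖ξ‖ ^ 4)⁻¹ : ℝ) : ℂ) * (θ ξ : ℂ)) *
          kerNorm (fun ξ : RR n => ((‖ξ‖ ^ 4 : ℝ) : ℂ) * heatSymbol 1 ξ)) * decay τ := by
  have hs := h.isSch_mul ha
  have hs' := h.isSch_mul (ha.mul contDiffOn_norm_pow_four_inv)
  rcases hτ.eq_or_lt with rfl | hτ
  -- At `τ = 0` the heat symbol is the constant one, which is not Schwartz; the summand `1` in the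
  -- constant covers this case.
  · refine le_mul_decay ?_ (by simp)
    have : (fun ξ => a ξ * (θ ξ : ℂ) * heatSymbol 0 ξ) = fun ξ => a ξ * (θ ξ : ℂ) := by
      ext ξ; simp [heatSymbol]
    rw [this, mul_add, mul_one, add_assoc]
    exact le_self_add
  · refine le_mul_decay ?_ ?_
    · refine (kerNorm_mul_le hs.integrable (isSch_heatSymbol hτ)).trans ?_
      rw [kerNorm_heatSymbol hτ]
      refine le_trans ?_ le_self_add
      gcongr
      exact le_add_self
    · have hg : IsSch fun ξ : RR n => ((‖ξ‖ ^ 4 : ℝ) : ℂ) * heatSymbol 1 ξ :=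
        (isSch_heatSymbol one_pos).mul_left hasTemperateGrowth_norm_pow_four
      have hsq := Real.sqrt_pos.2 hτ
      have e1 : (fun ξ => ((τ ^ 2 : ℝ) : ℂ) * (a ξ * (θ ξ : ℂ) * heatSymbol τ ξ)) =
          fun ξ => (a ξ * (((‖ξ‖ ^ 4)⁻¹ : ℝ) : ℂ) * (θ ξ : ℂ)) *
            (((‖√τ • ξ‖ ^ 4 : ℝ) : ℂ) * heatSymbol 1 (√τ • ξ)) := by
        ext ξ
        rw [heatSymbol_eq_comp_sqrt hτ.le]
        have : √τ ^ 4 = τ ^ 2 := by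
          rw [show (4 : ℕ) = 2 * 2 from rfl, pow_mul, Real.sq_sqrt hτ.le]
        rw [norm_smul, Real.norm_of_nonneg hsq.le, mul_pow, this]
        by_cases hξ : ξ = 0
        · obtain ⟨r, hr, hz⟩ := h.away
          rw [hz ξ (by simpa [hξ] using hr)]; simp
        · have : (‖ξ‖ : ℂ) ≠ 0 := by simpa using hξ
          push_cast
          field_simp
      have e2 := kerNorm_const_mul ((τ ^ 2 : ℝ) : ℂ) fun ξ => a ξ * (θ ξ : ℂ) * heatSymbol τ ξ
      have e3 : ‖((τ ^ 2 : ℝ) : ℂ)‖ₑ = ENNReal.ofReal (τ ^ 2) := by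
        rw [← ofReal_norm, Complex.norm_real, Real.norm_of_nonneg (by positivity)]
      rw [e3, e1] at e2
      rw [← e2]
      refine (kerNorm_mul_le hs'.integrable (hg.comp_smul hsq.ne')).trans ?_
      rw [kerNorm_comp_smul (fun ξ : RR n => ((‖ξ‖ ^ 4 : ℝ) : ℂ) * heatSymbol 1 ξ) hsq]
      exact le_add_self

/-- The dyadic symbol `m(2^{-j} ξ)`. -/
def dsym (m : RR n → ℝ) (j : ℤ) (ξ : RR n) : ℂ := ((m ((2 : ℝ) ^ (-j) • ξ) : ℝ) : ℂ)

theorem dyadic_eq (m : RR n → ℝ) (j : ℤ) (v : TDist n) : dyadic m j v = mult (dsym m j) v := rfl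

theorem dyadic_heat_symbol_eq {θ : RR n → ℝ} {a : RR n → ℂ} {d : ℕ}
    (hom : ∀ c : ℝ, 0 < c → ∀ ξ, a (c • ξ) = (c : ℂ) ^ d * a ξ) (j : ℤ) (τ : ℝ) (ξ : RR n) :
    a ξ * dsym θ j ξ * heatSymbol τ ξ = (((2 : ℝ) ^ j : ℝ) : ℂ) ^ d *
      (fun ξ => a ξ * (θ ξ : ℂ) * heatSymbol ((4 : ℝ) ^ j * τ) ξ) ((2 : ℝ) ^ (-j) • ξ) := by
  have h2 : (0 : ℝ) < 2 ^ (-j) := by positivity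
  have h3 : ((2 : ℝ) ^ (-j)) ^ 2 * (4 ^ j * τ) = τ := by
    rw [show (4 : ℝ) = 2 ^ (2 : ℤ) by norm_num, ← zpow_mul, ← zpow_natCast, ← zpow_mul, ← mul_assoc,
      ← zpow_add₀ two_ne_zero]
    norm_num [mul_comm]
  simp only []
  rw [← heatSymbol_sq_mul, h3, hom _ h2, dsym, ← mul_assoc, ← mul_assoc, ← mul_assoc, ← mul_pow,
    ← Complex.ofReal_mul, ← zpow_add₀ two_ne_zero]
  simp

/-- Dilation by `2^j` reduces to `j = 0`; homogeneity of degree `d` produces the power of `2^j`, and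
parabolic scaling turns `τ` into `4^j τ`. It is applied with `d = 0` to the heat flow and with `d =
1` to the Leray symbol. -/
theorem exists_kerNorm_dyadic_heat_le {θ : RR n → ℝ} (h : IsAnnular θ) {a : RR n → ℂ}
    (ha : ContDiffOn ℝ ∞ a {0}ᶜ) {d : ℕ}
    (hom : ∀ c : ℝ, 0 < c → ∀ ξ, a (c • ξ) = (c : ℂ) ^ d * a ξ) :
    ∃ C : ℝ≥0∞, C ≠ ⊤ ∧ ∀ (j : ℤ) (τ : ℝ), 0 ≤ τ →
      kerNorm (fun ξ => a ξ * dsym θ j ξ * heatSymbol τ ξ) ≤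
        C * ENNReal.ofReal (2 ^ j) ^ d * decay (4 ^ j * τ) := by
  have hs := h.isSch_mul ha
  have hs' := h.isSch_mul (ha.mul contDiffOn_norm_pow_four_inv)
  have hg : IsSch fun ξ : RR n => ((‖ξ‖ ^ 4 : ℝ) : ℂ) * heatSymbol 1 ξ :=
    (isSch_heatSymbol one_pos).mul_left hasTemperateGrowth_norm_pow_four
  refine ⟨2 * (kerNorm (fun ξ => a ξ * (θ ξ : ℂ)) * (1 + kerNorm (heatSymbol (n := n) 1)) +
        kerNorm (fun ξ => a ξ * (((‖ξ‖ ^ 4)⁻¹ : ℝ) : ℂ) * (θ ξ : ℂ)) *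
          kerNorm (fun ξ : RR n => ((‖ξ‖ ^ 4 : ℝ) : ℂ) * heatSymbol 1 ξ)), ?_, fun j τ hτ => ?_⟩
  · have h1 := hs.kerNorm_lt_top.ne
    have h2 := hs'.kerNorm_lt_top.ne
    have h3 := hg.kerNorm_lt_top.ne
    have h4 := (isSch_heatSymbol (n := n) one_pos).kerNorm_lt_top.ne
    finiteness
  · have e : (fun ξ => a ξ * dsym θ j ξ * heatSymbol τ ξ) = fun ξ => _ :=
      funext fun ξ => dyadic_heat_symbol_eq (θ := θ) hom j τ ξ
    rw [e, kerNorm_const_mul, kerNorm_comp_smul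
      (fun ξ => a ξ * (θ ξ : ℂ) * heatSymbol ((4 : ℝ) ^ j * τ) ξ) (c := (2 : ℝ) ^ (-j)) (by positivity)]
    have e2 : ‖(((2 : ℝ) ^ j : ℝ) : ℂ) ^ d‖ₑ = ENNReal.ofReal (2 ^ j) ^ d := by
      rw [enorm_pow, ← ofReal_norm, Complex.norm_real, Real.norm_of_nonneg (by positivity)]
    rw [e2, mul_right_comm, mul_comm (_ ^ d)]
    gcongr
    exact kerNorm_annular_heat_le h ha (by positivity)

/-! ### The Leray symbol -/

theorem measurable_lerayGradSymbol (i j k : Fin n) : Measurable (lerayGradSymbol i j k) := by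
  unfold lerayGradSymbol
  fun_prop

theorem contDiffOn_lerayGradSymbol (i j k : Fin n) :
    ContDiffOn ℝ ∞ (lerayGradSymbol i j k) {0}ᶜ := by
  have hc : ∀ l : Fin n, ContDiffOn ℝ ∞ (fun ξ : RR n => ξ l) {0}ᶜ := fun l =>
    (EuclideanSpace.proj (𝕜 := ℝ) l).contDiff.contDiffOn
  have h1 : ContDiffOn ℝ ∞ (fun ξ : RR n => (if i = j then (1 : ℝ) else 0) - ξ i * ξ j / ‖ξ‖ ^ 2) {0}ᶜ :=
    contDiffOn_const.sub (((hc i).mul (hc j)).div (contDiff_norm_sq ℝ).contDiffOn fun ξ hξ => by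
      have : ξ ≠ 0 := hξ
      positivity)
  exact (Complex.ofRealCLM.contDiff.comp_contDiffOn h1).mul
    (contDiffOn_const.mul (Complex.ofRealCLM.contDiff.comp_contDiffOn (hc k)))

theorem lerayGradSymbol_smul (i j k : Fin n) {c : ℝ} (hc : c ≠ 0) (ξ : RR n) :
    lerayGradSymbol i j k (c • ξ) = c * lerayGradSymbol i j k ξ := by
  have : (c * ξ i) * (c * ξ j) / ‖c • ξ‖ ^ 2 = ξ i * ξ j / ‖ξ‖ ^ 2 := by
    rw [norm_smul, mul_pow, Real.norm_eq_abs, sq_abs]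
    rw [show c * ξ i * (c * ξ j) = c ^ 2 * (ξ i * ξ j) by ring, mul_div_mul_left _ _ (by positivity)]
  simp only [lerayGradSymbol, PiLp.smul_apply, smul_eq_mul, this]
  push_cast; ring

theorem lerayGradSymbol_neg (i j k : Fin n) (ξ : RR n) :
    lerayGradSymbol i j k (-ξ) = -lerayGradSymbol i j k ξ := by
  have := lerayGradSymbol_smul i j k (c := -1) (by norm_num) ξ
  simpa using this

theorem conj_lerayGradSymbol (i j k : Fin n) (ξ : RR n) :
    (starRingEnd ℂ) (lerayGradSymbol i j k ξ) = lerayGradSymbol i j k (-ξ) := by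
  rw [lerayGradSymbol_neg, lerayGradSymbol]
  simp only [map_mul, Complex.conj_ofReal, Complex.conj_I]
  ring

theorem norm_lerayGradSymbol_le (i j k : Fin n) (ξ : RR n) :
    ‖lerayGradSymbol i j k ξ‖ ≤ 2 * ‖ξ‖ := by
  have hc : ∀ l, |ξ l| ≤ ‖ξ‖ := fun l => by
    rw [← Real.norm_eq_abs]; exact PiLp.norm_apply_le ξ l
  rw [lerayGradSymbol, norm_mul, norm_mul, Complex.norm_I, one_mul, Complex.norm_real,
    Complex.norm_real, Real.norm_eq_abs, Real.norm_eq_abs]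
  refine mul_le_mul ?_ (hc k) (abs_nonneg _) zero_le_two
  refine (abs_sub _ _).trans ?_
  have h1 : |(if i = j then (1 : ℝ) else 0)| ≤ 1 := by split_ifs <;> simp
  have h2 : |ξ i * ξ j / ‖ξ‖ ^ 2| ≤ 1 := by
    rw [abs_div, abs_mul, abs_of_nonneg (sq_nonneg ‖ξ‖)]
    refine div_le_one_of_le₀ ?_ (sq_nonneg _)
    rw [sq]
    exact mul_le_mul (hc i) (hc j) (abs_nonneg _) (norm_nonneg _)
  linarith

theorem IsSch.integrable_lerayGradSymbol_mul {m : RR n → ℂ} (hm : IsSch m) (i j k : Fin n) :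
    Integrable (fun ξ => lerayGradSymbol i j k ξ * m ξ) volume := by
  obtain ⟨g, rfl⟩ := hm.eq
  have := (g.integrable_pow_mul volume 1).const_mul 2
  refine this.mono ((measurable_lerayGradSymbol i j k).mul g.continuous.measurable).aestronglyMeasurable
    (Eventually.of_forall fun ξ => ?_)
  rw [norm_mul, Real.norm_of_nonneg (by positivity), pow_one, ← mul_assoc]
  gcongr
  exact norm_lerayGradSymbol_le i j k ξ

/-! ### Littlewood-Paley symbols -/

section LP

variable {χ φ : RR n → ℝ}

theorem IsLittlewoodPaley.chi_eq_zero (h : IsLittlewoodPaley χ φ) {ξ : RR n} (hξ : 4 / 3 ≤ ‖ξ‖) :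
    χ ξ = 0 := by
  by_contra h0
  have := h.supp_χ (subset_tsupport _ h0)
  exact absurd hξ (not_le.2 this)

theorem IsLittlewoodPaley.phi_eq_zero (h : IsLittlewoodPaley χ φ) {ξ : RR n}
    (hξ : ‖ξ‖ ≤ 3 / 4 ∨ 8 / 3 ≤ ‖ξ‖) : φ ξ = 0 := by
  by_contra h0
  have := h.supp_φ (subset_tsupport _ h0)
  rcases hξ with hξ | hξ
  · exact absurd hξ (not_le.2 this.1)
  · exact absurd hξ (not_le.2 this.2)

theorem norm_two_zpow_smul (j : ℤ) (ξ : RR n) : ‖(2 : ℝ) ^ j • ξ‖ = 2 ^ j * ‖ξ‖ := by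
  rw [norm_smul, Real.norm_of_nonneg (by positivity)]

theorem IsLittlewoodPaley.chi_eq_one (h : IsLittlewoodPaley χ φ) {ξ : RR n} (hξ : ‖ξ‖ ≤ 3 / 4) :
    χ ξ = 1 := by
  have := h.sum_nat ξ
  have h0 : ∀ j : ℕ, φ ((2 : ℝ) ^ (-(j : ℤ)) • ξ) = 0 := fun j => h.phi_eq_zero <| Or.inl <| by
    rw [norm_two_zpow_smul]
    have : (2 : ℝ) ^ (-(j : ℤ)) ≤ 1 := zpow_le_one_of_nonpos₀ one_le_two (by simp)
    nlinarith [norm_nonneg ξ]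
  rwa [tsum_congr h0, tsum_zero, add_zero] at this

theorem IsLittlewoodPaley.summable_nat (h : IsLittlewoodPaley χ φ) (ξ : RR n) :
    Summable fun j : ℕ => φ ((2 : ℝ) ^ (-(j : ℤ)) • ξ) := by
  have ht : Tendsto (fun j : ℕ => (2 : ℝ) ^ (-(j : ℤ)) * ‖ξ‖) atTop (𝓝 0) := by
    have := (tendsto_pow_atTop_nhds_zero_of_lt_one (r := (1 / 2 : ℝ)) (by norm_num)
      (by norm_num)).mul_const ‖ξ‖
    simpa using this
  obtain ⟨k, hk⟩ := (ht.eventually_le_const (show (0 : ℝ) < 3 / 4 by norm_num)).exists_forall_of_atTop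
  refine summable_of_ne_finset_zero (s := Finset.range k) fun j hj => h.phi_eq_zero <| Or.inl ?_
  rw [norm_two_zpow_smul]
  exact hk j (by simpa using hj)

/-- Subtract the inhomogeneous partitions of unity at `ξ` and at `ξ / 2`: all terms but one cancel.
This is the identity `Ṡ_{j+1} = Ṡ_j + Δ̇_j` on the level of symbols. -/
theorem IsLittlewoodPaley.chi_half (h : IsLittlewoodPaley χ φ) (ξ : RR n) :
    χ ((2 : ℝ) ^ (-1 : ℤ) • ξ) = χ ξ + φ ξ := by
  have h1 := h.sum_nat ξ
  have h2 := h.sum_nat ((2 : ℝ) ^ (-1 : ℤ) • ξ)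
  rw [(h.summable_nat ξ).tsum_eq_zero_add] at h1
  have h3 : ∀ j : ℕ, (2 : ℝ) ^ (-(j : ℤ)) • (2 : ℝ) ^ (-1 : ℤ) • ξ =
      (2 : ℝ) ^ (-((j + 1 : ℕ) : ℤ)) • ξ := fun j => by
    rw [smul_smul, ← zpow_add₀ two_ne_zero]
    congr 2; push_cast; ring
  simp_rw [h3] at h2
  simp only [CharP.cast_eq_zero, neg_zero, zpow_zero, one_smul] at h1
  linarith

theorem IsLittlewoodPaley.dsym_chi_succ (h : IsLittlewoodPaley χ φ) (j : ℤ) (ξ : RR n) :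
    dsym χ (j + 1) ξ = dsym χ j ξ + dsym φ j ξ := by
  have := h.chi_half ((2 : ℝ) ^ (-j) • ξ)
  rw [smul_smul, ← zpow_add₀ two_ne_zero, show (-1 : ℤ) + -j = -(j + 1) by ring] at this
  rw [dsym, dsym, dsym, this]
  push_cast; ring

theorem hasCompactSupport_of_norm {θ : RR n → ℝ} (R : ℝ) (h : ∀ ξ, R ≤ ‖ξ‖ → θ ξ = 0) :
    HasCompactSupport θ :=
  HasCompactSupport.intro (isCompact_closedBall (0 : RR n) R) fun ξ hξ =>
    h ξ (by simpa using (not_le.1 (by simpa using hξ)).le)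

theorem IsLittlewoodPaley.compact_chi (h : IsLittlewoodPaley χ φ) : HasCompactSupport χ :=
  hasCompactSupport_of_norm _ fun _ hξ => h.chi_eq_zero hξ

theorem IsLittlewoodPaley.annular_phi (h : IsLittlewoodPaley χ φ) : IsAnnular φ :=
  ⟨h.smooth_φ, hasCompactSupport_of_norm _ fun _ hξ => h.phi_eq_zero (Or.inr hξ),
    3 / 4, by norm_num, fun _ hξ => h.phi_eq_zero (Or.inl hξ.le)⟩

/-- A smooth function supported in an annulus that is equal to `1` on the support of `φ`. -/
def fatten (χ : RR n → ℝ) (ξ : RR n) : ℝ := χ ((1 / 4 : ℝ) • ξ) - χ ((2 : ℝ) • ξ)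

theorem IsLittlewoodPaley.annular_fatten (h : IsLittlewoodPaley χ φ) : IsAnnular (fatten χ) := by
  refine ⟨(h.smooth_χ.comp (contDiff_const_smul _)).sub (h.smooth_χ.comp (contDiff_const_smul _)),
    hasCompactSupport_of_norm (16 / 3) fun ξ hξ => ?_, 3 / 8, by norm_num, fun ξ hξ => ?_⟩
  · rw [fatten, h.chi_eq_zero, h.chi_eq_zero, sub_zero] <;>
    · rw [norm_smul, Real.norm_of_nonneg (by norm_num)]; linarith
  · rw [fatten, h.chi_eq_one, h.chi_eq_one, sub_self] <;>
    · rw [norm_smul, Real.norm_of_nonneg (by norm_num)]; linarith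

theorem IsLittlewoodPaley.fatten_mul (h : IsLittlewoodPaley χ φ) (ξ : RR n) :
    fatten χ ξ * φ ξ = φ ξ := by
  by_cases hξ : ‖ξ‖ ≤ 3 / 4 ∨ 8 / 3 ≤ ‖ξ‖
  · rw [h.phi_eq_zero hξ, mul_zero]
  · push Not at hξ
    rw [fatten, h.chi_eq_one, h.chi_eq_zero, sub_zero, one_mul] <;>
    · rw [norm_smul, Real.norm_of_nonneg (by norm_num)]; linarith

theorem IsLittlewoodPaley.dsym_fatten_mul (h : IsLittlewoodPaley χ φ) (j : ℤ) (ξ : RR n) :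
    dsym (fatten χ) j ξ * dsym φ j ξ = dsym φ j ξ := by
  rw [dsym, dsym, ← Complex.ofReal_mul, h.fatten_mul]

theorem isSch_dsym {θ : RR n → ℝ} (h1 : ContDiff ℝ ∞ θ) (h2 : HasCompactSupport θ) (j : ℤ) :
    IsSch (dsym θ j) :=
  (IsSch.of_hasCompactSupport (h2.comp_left (g := Complex.ofReal) rfl)
    (Complex.ofRealCLM.contDiff.comp h1)).comp_smul (c := (2 : ℝ) ^ (-j)) (by positivity)

theorem IsLittlewoodPaley.isSch_phi (h : IsLittlewoodPaley χ φ) (j : ℤ) : IsSch (dsym φ j) :=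
  isSch_dsym h.annular_phi.smooth h.annular_phi.compact j

theorem IsLittlewoodPaley.isSch_chi (h : IsLittlewoodPaley χ φ) (j : ℤ) : IsSch (dsym χ j) :=
  isSch_dsym h.smooth_χ h.compact_chi j

theorem dsym_neg {θ : RR n → ℝ} (h : ∀ ξ η : RR n, ‖ξ‖ = ‖η‖ → θ ξ = θ η) (j : ℤ) (ξ : RR n) :
    dsym θ j (-ξ) = dsym θ j ξ := by
  rw [dsym, dsym, h ((2 : ℝ) ^ (-j) • -ξ) ((2 : ℝ) ^ (-j) • ξ) (by rw [smul_neg, norm_neg])]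

theorem IsLittlewoodPaley.hasSum_phi (h : IsLittlewoodPaley χ φ) {ξ : RR n} (hξ : ξ ≠ 0) :
    HasSum (fun j : ℤ => φ ((2 : ℝ) ^ (-j) • ξ)) 1 := by
  have h1 := h.sum_int ξ hξ
  have : Summable fun j : ℤ => φ ((2 : ℝ) ^ (-j) • ξ) := by
    by_contra h2
    rw [tsum_eq_zero_of_not_summable h2] at h1
    exact zero_ne_one h1
  exact h1 ▸ this.hasSum

theorem kerNorm_dsym (θ : RR n → ℝ) (j : ℤ) :
    kerNorm (dsym θ j) = kerNorm fun ξ => (θ ξ : ℂ) :=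
  kerNorm_comp_smul (fun ξ => (θ ξ : ℂ)) (c := (2 : ℝ) ^ (-j)) (by positivity)

theorem enorm_le_tsum_of_hasSum {ι F : Type*} [NormedAddCommGroup F] {f : ι → F} {a : F}
    (h : HasSum f a) : ‖a‖ₑ ≤ ∑' i, ‖f i‖ₑ :=
  le_of_tendsto (continuous_enorm.tendsto a |>.comp h) (Eventually.of_forall fun s =>
    (enorm_sum_le s f).trans (ENNReal.sum_le_tsum s))

/-- Dominated convergence: the cutoffs are nonnegative and sum to one, so `|m|` dominates. The
condition `m 0 = 0` handles the origin, where the homogeneous partition of unity fails. -/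
theorem IsLittlewoodPaley.hasSum_ker (h : IsLittlewoodPaley χ φ) {m : RR n → ℂ}
    (hm : Integrable m volume) (hmm : Measurable m) (h0 : m 0 = 0) (x : RR n) :
    HasSum (fun j : ℤ => ker (fun ξ => m ξ * dsym φ j ξ) x) (ker m x) := by
  simp_rw [ker, Real.fourierInv_eq]
  have hs : ∀ η : RR n, HasSum (fun j : ℤ => ‖m ((2 * Real.pi) • η)‖ *
      φ ((2 : ℝ) ^ (-j) • ((2 * Real.pi) • η))) ‖m ((2 * Real.pi) • η)‖ := by
    intro η
    by_cases hη : (2 * Real.pi) • η = 0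
    · rw [hη, h0]; simp [hasSum_zero]
    · simpa using (h.hasSum_phi hη).mul_left ‖m ((2 * Real.pi) • η)‖
  refine hasSum_integral_of_dominated_convergence
    (fun (j : ℤ) (η : RR n) => ‖m ((2 * Real.pi) • η)‖ * φ ((2 : ℝ) ^ (-j) • ((2 * Real.pi) • η)))
    (fun j => ?_) (fun j => Eventually.of_forall fun η => ?_)
    (Eventually.of_forall fun η => (hs η).summable) ?_ (Eventually.of_forall fun η => ?_)
  · have hd := (h.isSch_phi j).continuous.measurable
    have h1 : Measurable fun η : RR n => (Real.fourierChar (inner ℝ η x) : ℂ) :=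
      (continuous_subtype_val.comp Real.continuous_fourierChar).measurable.comp
        (f := fun η : RR n => inner ℝ η x) (by fun_prop)
    exact (h1.mul (((hmm.mul hd).comp (g := fun ξ => m ξ * dsym φ j ξ)
      (f := fun η : RR n => (2 * Real.pi) • η) (by fun_prop)))).aestronglyMeasurable
  · rw [Circle.norm_smul, norm_mul, dsym, Complex.norm_real, Real.norm_of_nonneg (h.range_φ _).1]
  · have : (fun η : RR n => ∑' j : ℤ, ‖m ((2 * Real.pi) • η)‖ *
      φ ((2 : ℝ) ^ (-j) • ((2 * Real.pi) • η))) = fun η => ‖m ((2 * Real.pi) • η)‖ := by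
      ext η; exact (hs η).tsum_eq
    rw [this]
    exact (integrable_comp_two_pi hm).norm
  · by_cases hη : (2 * Real.pi) • η = 0
    · rw [hη, h0]; simp [hasSum_zero]
    · have h1 := (Complex.hasSum_ofReal.2 (h.hasSum_phi hη)).mul_left
        ((Real.fourierChar (inner ℝ η x) : ℂ) * m ((2 * Real.pi) • η))
      simp only [Complex.ofReal_one, mul_one] at h1
      simpa [Circle.smul_def, dsym, mul_assoc] using h1

theorem tsum_two_zpow_neg_abs_lt_top :
    ∑' j : ℤ, ENNReal.ofReal ((2 : ℝ) ^ (-|j|)) < ⊤ := by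
  have : Summable fun j : ℤ => (2 : ℝ) ^ (-|j|) := by
    have h1 : Summable fun j : ℕ => (2 : ℝ) ^ (-(j : ℤ)) := by
      simpa using summable_geometric_two
    refine Summable.of_nat_of_neg ?_ ?_ <;> simpa using h1
  exact this.tsum_ofReal_lt_top

/-- The symbol is not smooth at the origin, so its kernel need not be Schwartz, but it is the sum of
dyadic pieces with summable `L¹` norms. Homogeneity of degree one gives `2^l` at low frequencies;
moving `|ξ|⁴` to the Schwartz factor leaves degree `-3` and gives `2^{-3l}` at high ones. -/
theorem IsLittlewoodPaley.kerNorm_lerayGradSymbol_mul_lt_top (h : IsLittlewoodPaley χ φ)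
    {m : RR n → ℂ} (hm : IsSch m) (i j k : Fin n) :
    kerNorm (fun ξ => lerayGradSymbol i j k ξ * m ξ) < ⊤ := by
  set σ := lerayGradSymbol i j k
  have hσ := contDiffOn_lerayGradSymbol i j k
  have h0 : σ 0 * m 0 = 0 := by
    have : σ 0 = 0 := by simp [σ, lerayGradSymbol]
    rw [this, zero_mul]
  have hm4 : IsSch fun ξ : RR n => ((‖ξ‖ ^ 4 : ℝ) : ℂ) * m ξ :=
    hm.mul_left hasTemperateGrowth_norm_pow_four
  have hp := h.annular_phi
  set A := kerNorm fun ξ => σ ξ * (φ ξ : ℂ)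
  set B := kerNorm fun ξ => σ ξ * (((‖ξ‖ ^ 4)⁻¹ : ℝ) : ℂ) * (φ ξ : ℂ)
  have hA : A < ⊤ := (hp.isSch_mul hσ).kerNorm_lt_top
  have hB : B < ⊤ := (hp.isSch_mul (hσ.mul contDiffOn_norm_pow_four_inv)).kerNorm_lt_top
  have s1 : ∀ l : ℤ, (fun ξ => σ ξ * dsym φ l ξ) = fun ξ => (((2 : ℝ) ^ l : ℝ) : ℂ) *
      (fun ξ => σ ξ * (φ ξ : ℂ)) ((2 : ℝ) ^ (-l) • ξ) := fun l => by
    ext ξ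
    simp only [σ]
    rw [lerayGradSymbol_smul _ _ _ (by positivity), ← mul_assoc, ← mul_assoc, ← Complex.ofReal_mul,
      ← zpow_add₀ two_ne_zero, dsym]
    simp
  have s2 : ∀ l : ℤ, (fun ξ => (σ ξ * dsym φ l ξ) * m ξ) = fun ξ => (((2 : ℝ) ^ (-3 * l) : ℝ) : ℂ) *
      ((fun ξ => σ ξ * (((‖ξ‖ ^ 4)⁻¹ : ℝ) : ℂ) * (φ ξ : ℂ)) ((2 : ℝ) ^ (-l) • ξ) *
        (((‖ξ‖ ^ 4 : ℝ) : ℂ) * m ξ)) := fun l => by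
    ext ξ
    simp only [σ]
    rw [lerayGradSymbol_smul _ _ _ (by positivity), norm_two_zpow_smul, dsym]
    by_cases hξ : ξ = 0
    · simp [hξ, lerayGradSymbol]
    · have hn : (‖ξ‖ : ℂ) ≠ 0 := by simpa using hξ
      have e : (2 : ℝ) ^ (-3 * l) = (2 ^ (-l)) ^ 3 := by
        rw [← zpow_natCast, ← zpow_mul]; congr 1; push_cast; ring
      rw [e]
      have : (((2 : ℝ) ^ (-l) : ℝ) : ℂ) ≠ 0 := by
        exact_mod_cast (by positivity : (2 : ℝ) ^ (-l) ≠ 0)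
      push_cast at this ⊢
      field_simp
  have b1 : ∀ l : ℤ, kerNorm (fun ξ => (σ ξ * dsym φ l ξ) * m ξ) ≤
      ENNReal.ofReal (2 ^ l) * (A * kerNorm m) := fun l => by
    have hs : IsSch fun ξ => σ ξ * dsym φ l ξ := by
      rw [s1]
      exact ((hp.isSch_mul hσ).comp_smul (c := (2 : ℝ) ^ (-l)) (by positivity)).mul_left (.const _)
    refine (kerNorm_mul_le hs.integrable hm).trans_eq ?_
    rw [s1, kerNorm_const_mul, kerNorm_comp_smul (fun ξ => σ ξ * (φ ξ : ℂ)) (c := (2 : ℝ) ^ (-l))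
      (by positivity), ← ofReal_norm, Complex.norm_real, Real.norm_of_nonneg (by positivity),
      mul_assoc]
  have b2 : ∀ l : ℤ, kerNorm (fun ξ => (σ ξ * dsym φ l ξ) * m ξ) ≤
      ENNReal.ofReal (2 ^ (-3 * l)) * (B * kerNorm fun ξ : RR n => ((‖ξ‖ ^ 4 : ℝ) : ℂ) * m ξ) :=
    fun l => by
    rw [s2, kerNorm_const_mul, ← ofReal_norm, Complex.norm_real, Real.norm_of_nonneg (by positivity)]
    gcongr
    refine (kerNorm_mul_le ((hp.isSch_mul (hσ.mul contDiffOn_norm_pow_four_inv)).comp_smul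
      (c := (2 : ℝ) ^ (-l)) (by positivity)).integrable hm4).trans_eq ?_
    rw [kerNorm_comp_smul (fun ξ => σ ξ * (((‖ξ‖ ^ 4)⁻¹ : ℝ) : ℂ) * (φ ξ : ℂ)) (c := (2 : ℝ) ^ (-l))
      (by positivity)]
  set D := A * kerNorm m + B * kerNorm fun ξ : RR n => ((‖ξ‖ ^ 4 : ℝ) : ℂ) * m ξ
  have hD : D < ⊤ := by
    have := hm.kerNorm_lt_top
    have := hm4.kerNorm_lt_top
    finiteness
  have b3 : ∀ l : ℤ, kerNorm (fun ξ => (σ ξ * dsym φ l ξ) * m ξ) ≤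
      ENNReal.ofReal (2 ^ (-|l|)) * D := fun l => by
    rcases le_total 0 l with hl | hl
    · refine (b2 l).trans ?_
      gcongr ENNReal.ofReal ?_ * ?_
      · exact zpow_le_zpow_right₀ one_le_two (by rw [abs_of_nonneg hl]; omega)
      · exact le_add_self
    · refine (b1 l).trans ?_
      gcongr ENNReal.ofReal ?_ * ?_
      · exact zpow_le_zpow_right₀ one_le_two (by rw [abs_of_nonpos hl]; omega)
      · exact le_self_add
  calc kerNorm (fun ξ => σ ξ * m ξ)
      ≤ ∫⁻ x, ∑' l : ℤ, ‖ker (fun ξ => (σ ξ * dsym φ l ξ) * m ξ) x‖ₑ := by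
        refine lintegral_mono fun x => ?_
        have := enorm_le_tsum_of_hasSum (h.hasSum_ker (hm.integrable_lerayGradSymbol_mul i j k)
          ((measurable_lerayGradSymbol i j k).mul hm.continuous.measurable) h0 x)
        refine this.trans_eq (tsum_congr fun l => ?_)
        congr 2; ext ξ; ring
    _ = ∑' l : ℤ, kerNorm (fun ξ => (σ ξ * dsym φ l ξ) * m ξ) := by
        refine lintegral_tsum fun l => ?_
        refine (Continuous.measurable ?_).enorm.aemeasurable
        refine continuous_ker ?_
        have := (hm.mul_left (h.isSch_phi l).hasTemperateGrowth).integrable_lerayGradSymbol_mul i j k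
        simpa [σ, mul_assoc] using this
    _ ≤ ∑' l : ℤ, ENNReal.ofReal (2 ^ (-|l|)) * D := ENNReal.tsum_le_tsum b3
    _ < ⊤ := by
        rw [ENNReal.tsum_mul_right]
        exact ENNReal.mul_lt_top tsum_two_zpow_neg_abs_lt_top hD

end LP

end

section

/-! ### Scalar estimates -/

/-- Convexity of `x ↦ 2^x` between `-1` and `0`. It yields `(1 - 2^{-β})⁻¹ ≤ 2/β`, hence the
explicit dependence of the constants on `ε`. -/
theorem two_rpow_neg_le {β : ℝ} (h0 : 0 ≤ β) (h1 : β ≤ 1) : (2 : ℝ) ^ (-β) ≤ 1 - β / 2 := by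
  have h := (convexOn_rpow_left (b := 2) two_pos).2 (mem_univ (0 : ℝ)) (mem_univ (-1 : ℝ))
    (show (0 : ℝ) ≤ 1 - β by linarith) h0 (by ring)
  simp only [smul_eq_mul, mul_zero, zero_add, mul_neg, mul_one, Real.rpow_zero] at h
  rw [Real.rpow_neg_one] at h
  linarith

theorem decay_le_inv_sq {y : ℝ} (hy : 0 < y) : decay y ≤ ENNReal.ofReal ((y ^ 2)⁻¹) := by
  refine ENNReal.ofReal_le_ofReal (inv_anti₀ (by positivity) (by linarith))

theorem two_zpow_rpow (l : ℤ) (β : ℝ) : ((2 : ℝ) ^ l) ^ β = 2 ^ (l * β) := by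
  rw [← Real.rpow_intCast, ← Real.rpow_mul zero_le_two]

/-- Summation of the dyadic heat flow estimates. -/
theorem tsum_dyadic_decay_le {β t : ℝ} (h0 : 0 < β) (h1 : β ≤ 1) (ht : 0 < t) :
    ∑' l : ℤ, ENNReal.ofReal (((2 : ℝ) ^ l) ^ β) * decay (4 ^ l * t) ≤
      ENNReal.ofReal (21 / β * t ^ (-(β / 2))) := by
  -- Shifting the summation by `i₀`, where `4^{i₀}` is comparable with `1/t`, normalizes the time to
  -- `y ∈ [1/4, 1]`; the shift costs `2^{i₀β} ≤ t^{-β/2}`.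
  obtain ⟨i₀, hi, hi'⟩ := exists_mem_Ico_zpow (inv_pos.2 ht) (show (1 : ℝ) < 4 by norm_num)
  set y := (4 : ℝ) ^ i₀ * t with hy
  have hy1 : y ≤ 1 := by
    rw [hy]
    calc (4 : ℝ) ^ i₀ * t ≤ t⁻¹ * t := by gcongr
      _ = 1 := inv_mul_cancel₀ ht.ne'
  have hy0 : 1 / 4 ≤ y := by
    rw [zpow_add_one₀ (by norm_num)] at hi'
    have : t⁻¹ * t < (4 ^ i₀ * 4) * t := by gcongr
    rw [inv_mul_cancel₀ ht.ne'] at this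
    rw [hy]; linarith
  have hr : ((2 : ℝ) ^ i₀) ^ β ≤ t ^ (-(β / 2)) := by
    have e : ((2 : ℝ) ^ i₀) ^ β = ((4 : ℝ) ^ i₀) ^ (β / 2) := by
      rw [show (4 : ℝ) = 2 ^ (2 : ℝ) by norm_num, ← Real.rpow_intCast, ← Real.rpow_intCast,
        ← Real.rpow_mul two_pos.le, ← Real.rpow_mul two_pos.le, ← Real.rpow_mul two_pos.le]
      congr 1; ring
    rw [e, Real.rpow_neg ht.le, ← Real.inv_rpow ht.le]
    exact Real.rpow_le_rpow (by positivity) hi (by positivity)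
  rw [← (Equiv.addLeft i₀).tsum_eq]
  have key : ∀ i : ℤ, ENNReal.ofReal (((2 : ℝ) ^ (i₀ + i)) ^ β) * decay (4 ^ (i₀ + i) * t) ≤
      ENNReal.ofReal (t ^ (-(β / 2))) * (ENNReal.ofReal (((2 : ℝ) ^ i) ^ β) * decay (4 ^ i * y)) := by
    intro i
    rw [zpow_add₀ two_ne_zero, zpow_add₀ four_ne_zero, Real.mul_rpow (by positivity) (by positivity),
      ENNReal.ofReal_mul (by positivity), mul_assoc]
    rw [show (4 : ℝ) ^ i₀ * 4 ^ i * t = 4 ^ i * y by rw [hy]; ring]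
    gcongr
  refine (ENNReal.tsum_le_tsum key).trans ?_
  rw [ENNReal.tsum_mul_left, mul_comm (21 / β), ENNReal.ofReal_mul (by positivity)]
  gcongr
  rw [tsum_of_nat_of_neg_add_one ENNReal.summable ENNReal.summable]
  -- High frequencies: `2^{iβ} ≤ 2^i` and `(4^i y)^{-2} ≤ 16 · 16^{-i}`, a geometric series of ratio
  -- `1/8` whose bound does not depend on `β`. Only the low frequencies in `a2` produce `1/β`.
  have a1 : ∑' i : ℕ, ENNReal.ofReal (((2 : ℝ) ^ (i : ℤ)) ^ β) * decay (4 ^ (i : ℤ) * y) ≤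
      ENNReal.ofReal (16 * (1 - 8⁻¹)⁻¹) := by
    have hs : HasSum (fun i : ℕ => 16 * (8⁻¹ : ℝ) ^ i) (16 * (1 - 8⁻¹)⁻¹) :=
      (hasSum_geometric_of_lt_one (by norm_num) (by norm_num)).mul_left 16
    rw [← hs.tsum_eq, ENNReal.ofReal_tsum_of_nonneg (fun i => by positivity) hs.summable]
    refine ENNReal.tsum_le_tsum fun i => ?_
    have hp : 0 < (4 : ℝ) ^ (i : ℤ) * y := by positivity
    calc _ ≤ ENNReal.ofReal (2 ^ i) * ENNReal.ofReal ((((4 : ℝ) ^ (i : ℤ) * y) ^ 2)⁻¹) := by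
          gcongr
          · rw [zpow_natCast]
            calc ((2 : ℝ) ^ i) ^ β ≤ ((2 : ℝ) ^ i) ^ (1 : ℝ) :=
                  Real.rpow_le_rpow_of_exponent_le (one_le_pow₀ one_le_two) h1
              _ = _ := Real.rpow_one _
          · exact decay_le_inv_sq hp
      _ ≤ _ := by
          rw [← ENNReal.ofReal_mul (by positivity)]
          refine ENNReal.ofReal_le_ofReal ?_
          have : (((4 : ℝ) ^ (i : ℤ) * y) ^ 2)⁻¹ ≤ 16 * (16⁻¹) ^ i := by
            rw [inv_pow, ← div_eq_mul_inv, inv_le_comm₀ (by positivity) (by positivity), inv_div,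
              zpow_natCast, mul_pow, ← pow_mul, mul_comm i, pow_mul]
            norm_num
            rw [div_le_iff₀ (by norm_num), mul_assoc]
            exact le_mul_of_one_le_right (by positivity) (by nlinarith)
          calc (2 : ℝ) ^ i * (((4 : ℝ) ^ (i : ℤ) * y) ^ 2)⁻¹ ≤ 2 ^ i * (16 * (16⁻¹) ^ i) := by gcongr
            _ = 16 * (2 * 16⁻¹) ^ i := by rw [mul_pow]; ring
            _ = _ := by norm_num
  have a2 : ∑' i : ℕ, ENNReal.ofReal (((2 : ℝ) ^ (-((i : ℤ) + 1))) ^ β) *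
      decay (4 ^ (-((i : ℤ) + 1)) * y) ≤ ENNReal.ofReal (2 / β) := by
    have hr0 : (0 : ℝ) ≤ 2 ^ (-β) := by positivity
    have hr1 : (2 : ℝ) ^ (-β) < 1 := Real.rpow_lt_one_of_one_lt_of_neg one_lt_two (by linarith)
    have hs : HasSum (fun i : ℕ => ((2 : ℝ) ^ (-β)) ^ i) (1 - 2 ^ (-β))⁻¹ :=
      hasSum_geometric_of_lt_one hr0 hr1
    calc _ ≤ ∑' i : ℕ, ENNReal.ofReal (((2 : ℝ) ^ (-β)) ^ i) := by
          refine ENNReal.tsum_le_tsum fun i => ?_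
          refine (mul_le_of_le_one_right' (decay_le_one _)).trans (ENNReal.ofReal_le_ofReal ?_)
          rw [two_zpow_rpow, ← Real.rpow_natCast, ← Real.rpow_mul two_pos.le]
          refine Real.rpow_le_rpow_of_exponent_le one_le_two ?_
          push_cast; nlinarith
      _ = ENNReal.ofReal ((1 - 2 ^ (-β))⁻¹) := by
          rw [← ENNReal.ofReal_tsum_of_nonneg (fun i => by positivity) hs.summable, hs.tsum_eq]
      _ ≤ _ := by
          refine ENNReal.ofReal_le_ofReal ?_
          rw [inv_le_comm₀ (by linarith) (by positivity), inv_div]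
          linarith [two_rpow_neg_le h0.le h1]
  refine (add_le_add a1 a2).trans ?_
  rw [← ENNReal.ofReal_add (by norm_num) (by positivity)]
  refine ENNReal.ofReal_le_ofReal ?_
  -- The first series is `16 · 8/7 < 19 ≤ 19/β` since `β ≤ 1`.
  rw [show 21 / β = 19 / β + 2 / β by ring]
  have : 19 ≤ 19 / β := by rw [le_div_iff₀ h0]; linarith
  have h3 : (16 : ℝ) * (1 - 8⁻¹)⁻¹ ≤ 19 := by norm_num
  linarith

theorem lintegral_Ioi_decay : ∫⁻ τ in Ioi (0 : ℝ), decay τ ≤ ENNReal.ofReal Real.pi := by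
  refine (setLIntegral_le_lintegral _ _).trans ?_
  unfold decay
  rw [← ofReal_integral_eq_lintegral_ofReal integrable_inv_one_add_sq
    (Eventually.of_forall fun x => by positivity), integral_univ_inv_one_add_sq]

theorem lintegral_Ioi_comp_mul (f : ℝ → ℝ≥0∞) {c : ℝ} (hc : 0 < c) :
    ENNReal.ofReal c * ∫⁻ τ in Ioi (0 : ℝ), f (c * τ) = ∫⁻ τ in Ioi (0 : ℝ), f τ := by
  have h := lintegral_image_eq_lintegral_abs_deriv_mul (s := Ioi (0 : ℝ)) (f := fun τ => c * τ)
    (f' := fun _ => c) measurableSet_Ioi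
    (fun x _ => by simpa using ((hasDerivAt_id x).const_mul c).hasDerivWithinAt)
    (fun x _ y _ hxy => mul_left_cancel₀ hc.ne' hxy) f
  have h2 : (fun τ => c * τ) '' Ioi (0 : ℝ) = Ioi 0 := by
    rw [Set.image_mul_left_Ioi hc, mul_zero]
  rw [h2, abs_of_pos hc, lintegral_const_mul' _ _ ENNReal.ofReal_ne_top] at h
  exact h.symm

theorem lintegral_dyadic_decay_le (l : ℤ) :
    ENNReal.ofReal (4 ^ l) * ∫⁻ τ in Ioi (0 : ℝ), decay (4 ^ l * τ) ≤ ENNReal.ofReal Real.pi := by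
  rw [lintegral_Ioi_comp_mul decay (by positivity)]
  exact lintegral_Ioi_decay

/-! ### Duhamel integrals -/

theorem setLIntegral_Ioo_eq_indicator (f : ℝ → ℝ≥0∞) (t : ℝ) :
    ∫⁻ s in Ioo 0 t, f s = ∫⁻ s, {s : ℝ | 0 < s ∧ s < t}.indicator f s := by
  rw [← lintegral_indicator measurableSet_Ioo]; rfl

theorem measurable_setLIntegral_Ioo {X : Type*} [MeasurableSpace X] {Φ : X → ℝ → ℝ → ℝ≥0∞}
    (h : Measurable fun q : (X × ℝ) × ℝ => Φ q.1.1 q.1.2 q.2) :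
    Measurable fun p : X × ℝ => ∫⁻ s in Ioo 0 p.2, Φ p.1 p.2 s := by
  simp_rw [setLIntegral_Ioo_eq_indicator]
  have h2 : Measurable fun q : (X × ℝ) × ℝ =>
      {q : (X × ℝ) × ℝ | 0 < q.2 ∧ q.2 < q.1.2}.indicator
        (fun q : (X × ℝ) × ℝ => Φ q.1.1 q.1.2 q.2) q := by
    refine h.indicator (MeasurableSet.inter ?_ ?_)
    · exact measurableSet_lt measurable_const measurable_snd
    · exact measurableSet_lt measurable_snd (measurable_snd.comp measurable_fst)
  exact h2.lintegral_prod_right'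

theorem measurable_duhamel {Φ : ℝ → ℝ → ℝ≥0∞} (h : Measurable (Function.uncurry Φ)) :
    Measurable fun t : ℝ => ∫⁻ s in Ioo 0 t, Φ t s := by
  have := measurable_setLIntegral_Ioo (X := Unit) (Φ := fun _ t s => Φ t s)
    (h.comp (f := fun q : (Unit × ℝ) × ℝ => (q.1.2, q.2)) (by fun_prop))
  exact this.comp (f := fun t : ℝ => ((), t)) (by fun_prop)

theorem lintegral_duhamel_le {k f : ℝ → ℝ≥0∞} (hk : Measurable k) (hf : Measurable f) (T : ℝ) :
    ∫⁻ t in Ioo 0 T, ∫⁻ s in Ioo 0 t, k (t - s) * f s ≤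
      (∫⁻ τ in Ioi (0 : ℝ), k τ) * ∫⁻ s in Ioo 0 T, f s := by
  have h1 : ∀ t ∈ Ioo 0 T, ∫⁻ s in Ioo 0 t, k (t - s) * f s ≤
      ∫⁻ s in Ioo 0 T, (Ioi 0).indicator k (t - s) * f s := by
    intro t ht
    calc _ = ∫⁻ s in Ioo 0 t, (Ioi 0).indicator k (t - s) * f s := by
          refine setLIntegral_congr_fun measurableSet_Ioo fun s hs => ?_
          rw [indicator_of_mem (show t - s ∈ Ioi 0 from sub_pos.2 hs.2)]
      _ ≤ _ := lintegral_mono_set (Ioo_subset_Ioo_right ht.2.le)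
  have hk' : Measurable ((Ioi (0 : ℝ)).indicator k) := hk.indicator measurableSet_Ioi
  calc _ ≤ ∫⁻ t in Ioo 0 T, ∫⁻ s in Ioo 0 T, (Ioi 0).indicator k (t - s) * f s :=
        setLIntegral_mono' measurableSet_Ioo h1
    _ ≤ ∫⁻ t, ∫⁻ s in Ioo 0 T, (Ioi 0).indicator k (t - s) * f s := setLIntegral_le_lintegral _ _
    _ = ∫⁻ s in Ioo 0 T, ∫⁻ t, (Ioi 0).indicator k (t - s) * f s := by
        refine lintegral_lintegral_swap (Measurable.aemeasurable ?_)
        exact (hk'.comp (measurable_fst.sub measurable_snd)).mul (hf.comp measurable_snd)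
    _ = ∫⁻ s in Ioo 0 T, (∫⁻ τ in Ioi (0 : ℝ), k τ) * f s := by
        refine lintegral_congr fun s => ?_
        rw [lintegral_mul_const _ (by fun_prop), lintegral_sub_right_eq_self,
          lintegral_indicator measurableSet_Ioi]
    _ = _ := lintegral_const_mul _ hf

theorem lintegral_mul_sq_le {X : Type*} [MeasurableSpace X] {μ : Measure X} {f g : X → ℝ≥0∞}
    (hf : Measurable f) (hg : Measurable g) :
    (∫⁻ x, f x * g x ∂μ) ^ 2 ≤ (∫⁻ x, f x ^ 2 ∂μ) * ∫⁻ x, g x ^ 2 ∂μ := by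
  have h := ENNReal.lintegral_mul_le_Lp_mul_Lq μ Real.HolderConjugate.two_two hf.aemeasurable
    hg.aemeasurable
  simp only [Pi.mul_apply, ENNReal.rpow_two] at h
  calc _ ≤ ((∫⁻ x, f x ^ 2 ∂μ) ^ (1 / 2 : ℝ) * (∫⁻ x, g x ^ 2 ∂μ) ^ (1 / 2 : ℝ)) ^ 2 := by gcongr
    _ = _ := by
      rw [mul_pow, ← ENNReal.rpow_natCast, ← ENNReal.rpow_natCast, ← ENNReal.rpow_mul,
        ← ENNReal.rpow_mul]
      norm_num

/-- The Schur type estimate behind all contraction arguments. -/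
theorem lintegral_duhamel_sq_le {k₁ k₂ g b : ℝ → ℝ≥0∞} (h₁ : Measurable k₁) (h₂ : Measurable k₂)
    (hg : Measurable g) (hb : Measurable b) {T : ℝ} {A : ℝ≥0∞}
    (hA : ∀ t ∈ Ioo 0 T, ∫⁻ s in Ioo 0 t, (k₁ (t - s) * g s) ^ 2 ≤ A) :
    ∫⁻ t in Ioo 0 T, (∫⁻ s in Ioo 0 t, (k₁ (t - s) * g s) * (k₂ (t - s) * b s)) ^ 2 ≤
      A * ((∫⁻ τ in Ioi (0 : ℝ), k₂ τ ^ 2) * ∫⁻ s in Ioo 0 T, b s ^ 2) := by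
  -- Cauchy–Schwarz in `s`: the factor containing `g` is bounded by `A` uniformly in `t`, and the
  -- integral in `t` of the other one is a convolution, to be treated by Tonelli.
  calc _ ≤ ∫⁻ t in Ioo 0 T, A * ∫⁻ s in Ioo 0 t, k₂ (t - s) ^ 2 * b s ^ 2 := by
        refine setLIntegral_mono' measurableSet_Ioo fun t ht => ?_
        refine (lintegral_mul_sq_le (by fun_prop) (by fun_prop)).trans ?_
        simp_rw [mul_pow (k₂ _)]
        gcongr
        exact hA t ht
    _ = A * ∫⁻ t in Ioo 0 T, ∫⁻ s in Ioo 0 t, k₂ (t - s) ^ 2 * b s ^ 2 :=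
        lintegral_const_mul _ (measurable_duhamel (Φ := fun t s => k₂ (t - s) ^ 2 * b s ^ 2)
          (by simp only [Function.uncurry_def]; fun_prop))
    _ ≤ _ := by
        gcongr
        exact lintegral_duhamel_le (h₂.pow_const 2) (hb.pow_const 2) T

/-! ### Time weights -/

/-- The integrability in time that the bounds of the solutions have. -/
def TimeGood (α T : ℝ) (g : ℝ → ℝ≥0∞) : Prop :=
  Measurable g ∧ ∃ K : ℝ≥0∞, K ≠ ⊤ ∧ ∀ t, 0 < t → t ≤ T →
    ∫⁻ s in Ioo 0 t, ENNReal.ofReal ((t - s) ^ (-α)) * g s ^ 2 ≤ K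

theorem add_sq_le_two (a b : ℝ≥0∞) : (a + b) ^ 2 ≤ 2 * (a ^ 2 + b ^ 2) := by
  have h := ENNReal.rpow_add_le_mul_rpow_add_rpow a b (p := 2) (by norm_num)
  simp only [ENNReal.rpow_two] at h
  refine h.trans_eq ?_
  norm_num

theorem TimeGood.add {α T : ℝ} {g₁ g₂ : ℝ → ℝ≥0∞} (h₁ : TimeGood α T g₁) (h₂ : TimeGood α T g₂) :
    TimeGood α T fun t => g₁ t + g₂ t := by
  obtain ⟨m₁, K₁, hK₁, h₁⟩ := h₁
  obtain ⟨m₂, K₂, hK₂, h₂⟩ := h₂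
  refine ⟨m₁.add m₂, 2 * (K₁ + K₂), by finiteness, fun t ht htT => ?_⟩
  calc _ ≤ ∫⁻ s in Ioo 0 t, 2 * (ENNReal.ofReal ((t - s) ^ (-α)) * g₁ s ^ 2 +
        ENNReal.ofReal ((t - s) ^ (-α)) * g₂ s ^ 2) := by
        refine lintegral_mono fun s => ?_
        simp only []
        rw [← mul_add, mul_left_comm]
        gcongr
        exact add_sq_le_two _ _
    _ = 2 * ((∫⁻ s in Ioo 0 t, ENNReal.ofReal ((t - s) ^ (-α)) * g₁ s ^ 2) +
        ∫⁻ s in Ioo 0 t, ENNReal.ofReal ((t - s) ^ (-α)) * g₂ s ^ 2) := by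
        rw [lintegral_const_mul _ (by fun_prop), lintegral_add_left (by fun_prop)]
    _ ≤ _ := by
        gcongr
        · exact h₁ t ht htT
        · exact h₂ t ht htT

theorem TimeGood.lintegral_sq_lt_top {α T : ℝ} {g : ℝ → ℝ≥0∞} (h : TimeGood α T g) (hα : 0 ≤ α)
    (hT : 0 < T) : ∫⁻ s in Ioo 0 T, g s ^ 2 < ⊤ := by
  obtain ⟨m, K, hK, h⟩ := h
  have h1 := h T hT le_rfl
  have h2 : ENNReal.ofReal (T ^ (-α)) * ∫⁻ s in Ioo 0 T, g s ^ 2 ≤ K := by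
    rw [← lintegral_const_mul _ (by fun_prop)]
    refine le_trans (setLIntegral_mono' measurableSet_Ioo fun s hs => ?_) h1
    gcongr ENNReal.ofReal ?_ * _
    exact Real.rpow_le_rpow_of_nonpos (by linarith [hs.2]) (by linarith [hs.1]) (by linarith)
  by_contra h3
  rw [not_lt, top_le_iff] at h3
  rw [h3, ENNReal.mul_top (by simp; positivity), top_le_iff] at h2
  exact hK h2

theorem exp_neg_le_rpow {α x : ℝ} (h0 : 0 ≤ α) (h1 : α ≤ 1) (hx : 0 < x) :
    Real.exp (-x) ≤ x ^ (-α) := by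
  rw [Real.exp_neg, Real.rpow_neg hx.le]
  refine inv_anti₀ (by positivity) ?_
  calc x ^ α ≤ 1 + x := by
        rcases le_total x 1 with h | h
        · linarith [Real.rpow_le_one hx.le h h0]
        · calc x ^ α ≤ x ^ (1 : ℝ) := Real.rpow_le_rpow_of_exponent_le h h1
            _ ≤ 1 + x := by rw [Real.rpow_one]; linarith
    _ ≤ Real.exp x := by linarith [Real.add_one_le_exp x]

/-- The exponential weight `e^{-λ t}`. -/
def expw (lam t : ℝ) : ℝ≥0∞ := ENNReal.ofReal (Real.exp (-lam * t))

theorem measurable_expw (lam : ℝ) : Measurable (expw lam) := by unfold expw; fun_prop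

theorem expw_add (lam s t : ℝ) : expw lam (s + t) = expw lam s * expw lam t := by
  rw [expw, expw, expw, ← ENNReal.ofReal_mul (by positivity), ← Real.exp_add]; congr 2; ring

theorem expw_mul_neg (lam t : ℝ) : expw lam t * expw (-lam) t = 1 := by
  rw [expw, expw, ← ENNReal.ofReal_mul (by positivity), ← Real.exp_add]; simp

theorem expw_ne_top (lam t : ℝ) : expw lam t ≠ ⊤ := ENNReal.ofReal_ne_top

theorem expw_le_one {lam t : ℝ} (h : 0 ≤ lam) (ht : 0 ≤ t) : expw lam t ≤ 1 := by
  rw [expw, ENNReal.ofReal_le_one, Real.exp_le_one_iff]; nlinarith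

theorem expw_neg_le {lam t T : ℝ} (h : 0 ≤ lam) (ht : t ≤ T) : expw (-lam) t ≤ expw (-lam) T := by
  refine ENNReal.ofReal_le_ofReal (Real.exp_le_exp.2 ?_); nlinarith

/-- Since `e^{-x} ≤ x^{-α}`, the weight `e^{-λ(t-s)}` is at most `λ^{-α} (t-s)^{-α}`. The factor
`λ^{-α}` makes the linear operators contractive on the whole interval for large `λ`. -/
theorem lintegral_expw_mul_sq_le {α T lam : ℝ} {g : ℝ → ℝ≥0∞} {K : ℝ≥0∞} (h0 : 0 ≤ α) (h1 : α ≤ 1)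
    (hl : 0 < lam) (hg : Measurable g)
    (h : ∀ t, 0 < t → t ≤ T → ∫⁻ s in Ioo 0 t, ENNReal.ofReal ((t - s) ^ (-α)) * g s ^ 2 ≤ K)
    {t : ℝ} (ht : t ∈ Ioo 0 T) :
    ∫⁻ s in Ioo 0 t, (expw lam (t - s) * g s) ^ 2 ≤ ENNReal.ofReal (lam ^ (-α)) * K := by
  calc _ ≤ ∫⁻ s in Ioo 0 t, ENNReal.ofReal (lam ^ (-α)) *
        (ENNReal.ofReal ((t - s) ^ (-α)) * g s ^ 2) := by
        refine setLIntegral_mono' measurableSet_Ioo fun s hs => ?_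
        have hts : 0 < t - s := sub_pos.2 hs.2
        rw [mul_pow, ← mul_assoc, ← ENNReal.ofReal_mul (by positivity),
          ← Real.mul_rpow hl.le hts.le]
        gcongr
        calc expw lam (t - s) ^ 2 ≤ expw lam (t - s) :=
              pow_le_of_le_one zero_le (expw_le_one hl.le hts.le) two_ne_zero
          _ ≤ _ := by
              rw [expw, neg_mul]
              exact ENNReal.ofReal_le_ofReal (exp_neg_le_rpow h0 h1 (by positivity))
    _ = ENNReal.ofReal (lam ^ (-α)) * ∫⁻ s in Ioo 0 t, ENNReal.ofReal ((t - s) ^ (-α)) * g s ^ 2 :=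
        lintegral_const_mul _ (by fun_prop)
    _ ≤ _ := by gcongr; exact h t ht.1 ht.2.le

end

section

/-! ### The scalar model of the bilinear term -/

theorem eLpNorm_tsum_le {ι X : Type*} [Countable ι] [MeasurableSpace X] {ν : Measure X}
    [SigmaFinite ν] {p : ℝ≥0∞} (hp : 1 ≤ p) {F : ι → X → ℝ≥0∞} (hF : ∀ i, Measurable (F i)) :
    eLpNorm (fun x => ∑' i, F i x) p ν ≤ ∑' i, eLpNorm (F i) p ν := by
  let _ : MeasurableSpace ι := ⊤
  have : DiscreteMeasurableSpace ι := ⟨fun _ => trivial⟩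
  have h := eLpNorm_lintegral_le (μ := (Measure.count : Measure ι)) (ν := ν) hp (F := F)
    (measurable_from_prod_countable_right hF) (N := fun i => eLpNorm (F i) p ν)
    (measurable_of_countable _) (Eventually.of_forall fun _ => le_rfl)
  simpa only [lintegral_count] using h

theorem eLpNorm_two_sq {X : Type*} [MeasurableSpace X] (f : X → ℝ≥0∞) (ν : Measure X) :
    eLpNorm f 2 ν ^ 2 = ∫⁻ x, f x ^ 2 ∂ν := by
  rw [eLpNorm_eq_lintegral_rpow_enorm_toReal two_ne_zero ENNReal.ofNat_ne_top]
  simp only [enorm_eq_self, ENNReal.toReal_ofNat, ENNReal.rpow_two]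
  rw [← ENNReal.rpow_two, ← ENNReal.rpow_mul]; norm_num

theorem le_of_sq_le_sq {a b : ℝ≥0∞} (h : a ^ 2 ≤ b ^ 2) : a ≤ b :=
  (ENNReal.pow_le_pow_left_iff two_ne_zero).1 h

theorem lintegral_mul_le_eLpNorm_two {X : Type*} [MeasurableSpace X] {ν : Measure X}
    {f g : X → ℝ≥0∞} (hf : Measurable f) (hg : Measurable g) :
    ∫⁻ x, f x * g x ∂ν ≤ eLpNorm f 2 ν * eLpNorm g 2 ν := by
  refine le_of_sq_le_sq ?_
  rw [mul_pow, eLpNorm_two_sq, eLpNorm_two_sq]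
  exact lintegral_mul_sq_le hf hg

/-- The norm of `e^{-λ t} f(t)` in `L²(0,T)`. -/
def wN (lam T : ℝ) (f : ℝ → ℝ≥0∞) : ℝ≥0∞ :=
  eLpNorm (fun t => expw lam t * f t) 2 (volume.restrict (Ioo 0 T))

theorem wN_sq (lam T : ℝ) (f : ℝ → ℝ≥0∞) :
    wN lam T f ^ 2 = ∫⁻ t in Ioo 0 T, (expw lam t * f t) ^ 2 := eLpNorm_two_sq _ _

theorem wN_tsum_le {ι : Type*} [Countable ι] (lam T : ℝ) {F : ι → ℝ → ℝ≥0∞}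
    (hF : ∀ i, Measurable (F i)) : wN lam T (fun t => ∑' i, F i t) ≤ ∑' i, wN lam T (F i) := by
  unfold wN
  simp_rw [← ENNReal.tsum_mul_left]
  exact eLpNorm_tsum_le one_le_two fun i => (measurable_expw lam).mul (hF i)

theorem wN_le_eLpNorm {lam T : ℝ} (hl : 0 ≤ lam) (f : ℝ → ℝ≥0∞) :
    wN lam T f ≤ eLpNorm f 2 (volume.restrict (Ioo 0 T)) := by
  refine eLpNorm_mono_enorm_ae ?_
  filter_upwards [ae_restrict_mem measurableSet_Ioo] with t ht
  exact mul_le_of_le_one_left' (expw_le_one hl ht.1.le)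

theorem eLpNorm_le_wN {lam T : ℝ} (hl : 0 ≤ lam) {f : ℝ → ℝ≥0∞} (hf : Measurable f) :
    eLpNorm f 2 (volume.restrict (Ioo 0 T)) ≤ expw (-lam) T * wN lam T f := by
  rw [wN, ← eLpNorm_const_mul two_ne_zero (a := fun t => expw lam t * f t) _
    ((measurable_expw lam).mul hf)]
  refine eLpNorm_mono_enorm_ae ?_
  filter_upwards [ae_restrict_mem measurableSet_Ioo] with t ht
  simp only [enorm_eq_self]
  calc f t = expw (-lam) t * (expw lam t * f t) := by
        rw [← mul_assoc, mul_comm (expw (-lam) t), expw_mul_neg, one_mul]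
    _ ≤ _ := by gcongr; exact expw_neg_le hl ht.2.le

/-- The linear operator that dominates the bilinear term, blockwise. -/
def lop (c : ℝ≥0∞) (g : ℝ → ℝ≥0∞) (b : ℤ → ℝ → ℝ≥0∞) (l : ℤ) (t : ℝ) : ℝ≥0∞ :=
  ∫⁻ s in Ioo 0 t, (c * ENNReal.ofReal (2 ^ l) * decay (4 ^ l * (t - s))) *
    (g s * ∑' i : ℕ, b (l - 2 + i) s)

theorem measurable_high {b : ℤ → ℝ → ℝ≥0∞} (hb : ∀ l, Measurable (b l)) (l : ℤ) :
    Measurable fun s => ∑' i : ℕ, b (l - 2 + i) s := Measurable.tsum fun _ => hb _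

theorem measurable_lop {c : ℝ≥0∞} {g : ℝ → ℝ≥0∞} {b : ℤ → ℝ → ℝ≥0∞} (hg : Measurable g)
    (hb : ∀ l, Measurable (b l)) (l : ℤ) : Measurable (lop c g b l) := by
  have := measurable_high hb l
  refine measurable_duhamel (Φ := fun t s => (c * ENNReal.ofReal (2 ^ l) *
    decay (4 ^ l * (t - s))) * (g s * ∑' i : ℕ, b (l - 2 + i) s)) ?_
  have hd := measurable_decay
  simp only [Function.uncurry_def]
  fun_prop

/-- The bound is the same for all `l`: square integrability in time is the scale invariant choice
for this kernel, which is why the contraction takes place in `L²`. -/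
theorem lintegral_dyadic_decay_sq_le (c : ℝ≥0∞) (l : ℤ) :
    ∫⁻ τ in Ioi (0 : ℝ), (c * ENNReal.ofReal (2 ^ l) * decay (4 ^ l * τ)) ^ 2 ≤
      c ^ 2 * ENNReal.ofReal Real.pi := by
  have hd := measurable_decay
  calc _ ≤ ∫⁻ τ in Ioi (0 : ℝ), c ^ 2 * (ENNReal.ofReal (4 ^ l) * decay (4 ^ l * τ)) := by
        refine lintegral_mono fun τ => ?_
        have e : ENNReal.ofReal (4 ^ l) = ENNReal.ofReal (2 ^ l) ^ 2 := by
          rw [← ENNReal.ofReal_pow (by positivity), ← zpow_natCast, ← zpow_mul, mul_comm, zpow_mul]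
          norm_num
        rw [mul_pow, mul_pow, e, mul_assoc]
        gcongr
        exact pow_le_of_le_one zero_le (decay_le_one _) two_ne_zero
    _ ≤ _ := by
        rw [lintegral_const_mul _ (by fun_prop), lintegral_const_mul _ (by fun_prop)]
        gcongr
        exact lintegral_dyadic_decay_le l

/-- The weight factorizes as `e^{-λt} = e^{-λ(t-s)} e^{-λs}`. The first factor goes with `g` and is
small, the second one reproduces the weighted norm of `b`. -/
theorem wN_lop_sq_le {α T lam : ℝ} {c K : ℝ≥0∞} {g : ℝ → ℝ≥0∞} {b : ℤ → ℝ → ℝ≥0∞} (h0 : 0 ≤ α)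
    (h1 : α ≤ 1) (hl : 0 < lam) (hg : Measurable g)
    (h : ∀ t, 0 < t → t ≤ T → ∫⁻ s in Ioo 0 t, ENNReal.ofReal ((t - s) ^ (-α)) * g s ^ 2 ≤ K)
    (hb : ∀ l, Measurable (b l)) (l : ℤ) :
    wN lam T (lop c g b l) ^ 2 ≤ (ENNReal.ofReal (lam ^ (-α)) * K *
      (c ^ 2 * ENNReal.ofReal Real.pi)) * wN lam T (fun s => ∑' i : ℕ, b (l - 2 + i) s) ^ 2 := by
  have hm := measurable_high hb l
  have hd := measurable_decay
  have he := measurable_expw lam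
  rw [wN_sq, wN_sq, mul_assoc]
  have key := lintegral_duhamel_sq_le (T := T) he (k₂ := fun τ => c * ENNReal.ofReal (2 ^ l) *
    decay (4 ^ l * τ)) (by fun_prop) hg (b := fun s => expw lam s * ∑' i : ℕ, b (l - 2 + i) s)
    (by fun_prop) (fun t ht => lintegral_expw_mul_sq_le h0 h1 hl hg h ht)
  refine le_trans (le_of_eq ?_) (key.trans ?_)
  · refine lintegral_congr fun t => ?_
    congr 1
    rw [lop, ← lintegral_const_mul' _ _ (expw_ne_top _ _)]
    refine lintegral_congr fun s => ?_
    have : expw lam t = expw lam (t - s) * expw lam s := by rw [← expw_add, sub_add_cancel]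
    rw [this]; ring
  · gcongr
    exact lintegral_dyadic_decay_sq_le c l

/-- The weight `λ` depends on `g`, `c` and `A` only, so one choice serves every majorant `D` and can
be used in all iterations. The condition on `D` states that `D` controls its own sum over the
frequencies above `l - 2`. -/
theorem TimeGood.exists_wN_lop_le {α T : ℝ} {g : ℝ → ℝ≥0∞} (hg : TimeGood α T g) (h0 : 0 < α)
    (h1 : α ≤ 1) {c A : ℝ≥0∞} (hc : c ≠ ⊤) (hA : A ≠ ⊤) :
    ∃ lam : ℝ, 0 < lam ∧ ∀ D : ℤ → ℝ≥0∞, (∀ l, ∑' i : ℕ, D (l - 2 + i) ≤ A * D l) →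
      ∀ b : ℤ → ℝ → ℝ≥0∞, (∀ l, Measurable (b l)) → (∀ l, wN lam T (b l) ≤ D l) →
        ∀ l, wN lam T (lop c g b l) ≤ 2⁻¹ * D l := by
  obtain ⟨hgm, K, hK, h⟩ := hg
  set M := K * (c ^ 2 * ENNReal.ofReal Real.pi) * A ^ 2 with hM
  have hMt : M ≠ ⊤ := by finiteness
  have hlim : Tendsto (fun lam : ℝ => ENNReal.ofReal (lam ^ (-α)) * M) atTop (𝓝 (0 * M)) := by
    refine ENNReal.Tendsto.mul_const ?_ (Or.inr hMt)
    have := ENNReal.tendsto_ofReal (tendsto_rpow_neg_atTop h0)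
    rwa [ENNReal.ofReal_zero] at this
  rw [zero_mul] at hlim
  have hev := (hlim.eventually_le_const (show (0 : ℝ≥0∞) < 2⁻¹ ^ 2 from
    ENNReal.pow_pos (ENNReal.inv_pos.2 ENNReal.ofNat_ne_top) 2)).and
    (eventually_gt_atTop 0)
  obtain ⟨lam, hlam, hl⟩ := hev.exists
  refine ⟨lam, hl, fun D hD b hb hbD l => le_of_sq_le_sq ?_⟩
  refine (wN_lop_sq_le h0.le h1 hl hgm h hb l).trans ?_
  have h2 : wN lam T (fun s => ∑' i : ℕ, b (l - 2 + i) s) ≤ A * D l :=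
    (wN_tsum_le lam T fun i => hb _).trans ((ENNReal.tsum_le_tsum fun i => hbD _).trans (hD l))
  calc _ ≤ ENNReal.ofReal (lam ^ (-α)) * K * (c ^ 2 * ENNReal.ofReal Real.pi) * (A * D l) ^ 2 := by
        gcongr
    _ = ENNReal.ofReal (lam ^ (-α)) * M * D l ^ 2 := by rw [hM]; ring
    _ ≤ _ := by rw [mul_pow]; gcongr

theorem iterate_lop_wN_le {T lam : ℝ} {c A : ℝ≥0∞} {g : ℝ → ℝ≥0∞} (hg : Measurable g)
    (h : ∀ D : ℤ → ℝ≥0∞, (∀ l, ∑' i : ℕ, D (l - 2 + i) ≤ A * D l) →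
      ∀ b : ℤ → ℝ → ℝ≥0∞, (∀ l, Measurable (b l)) → (∀ l, wN lam T (b l) ≤ D l) →
        ∀ l, wN lam T (lop c g b l) ≤ 2⁻¹ * D l)
    {D : ℤ → ℝ≥0∞} (hD : ∀ l, ∑' i : ℕ, D (l - 2 + i) ≤ A * D l) {b : ℤ → ℝ → ℝ≥0∞}
    (hb : ∀ l, Measurable (b l)) (hbD : ∀ l, wN lam T (b l) ≤ D l) (M : ℕ) :
    (∀ l, Measurable ((lop c g)^[M] b l)) ∧
      ∀ l, wN lam T ((lop c g)^[M] b l) ≤ 2⁻¹ ^ M * D l := by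
  induction M with
  | zero => exact ⟨hb, by simpa using hbD⟩
  | succ M ih =>
    rw [Function.iterate_succ_apply']
    refine ⟨fun l => measurable_lop hg ih.1 l, fun l => ?_⟩
    have := h (fun l => 2⁻¹ ^ M * D l) (fun l => ?_) _ ih.1 ih.2 l
    · rw [pow_succ']; rwa [mul_assoc]
    · rw [ENNReal.tsum_mul_left, mul_left_comm]
      gcongr
      exact hD l

/-- For the supremum in time the decay of the kernel is discarded; the integral in time in
`lintegral_lop_le` uses it and is better by `4^{-l}`. This is the difference of two derivatives
between the two norms of `Z^s_{p,q}`. -/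
theorem lop_le {c : ℝ≥0∞} {g : ℝ → ℝ≥0∞} {b : ℤ → ℝ → ℝ≥0∞} (hg : Measurable g)
    (hb : ∀ l, Measurable (b l)) (l : ℤ) {t T : ℝ} (ht : t ≤ T) : lop c g b l t ≤ c * ENNReal.ofReal (2 ^ l) *
      ∫⁻ s in Ioo 0 T, g s * ∑' i : ℕ, b (l - 2 + i) s := by
  unfold lop
  have hm := measurable_high hb l
  calc _ ≤ ∫⁻ s in Ioo 0 t, c * ENNReal.ofReal (2 ^ l) * (g s * ∑' i : ℕ, b (l - 2 + i) s) := by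
        refine lintegral_mono fun s => ?_
        gcongr ?_ * _
        exact mul_le_of_le_one_right' (decay_le_one _)
    _ = c * ENNReal.ofReal (2 ^ l) * ∫⁻ s in Ioo 0 t, g s * ∑' i : ℕ, b (l - 2 + i) s :=
        lintegral_const_mul _ (hg.mul hm)
    _ ≤ _ := by
        gcongr

theorem lintegral_lop_le {c : ℝ≥0∞} {g : ℝ → ℝ≥0∞} {b : ℤ → ℝ → ℝ≥0∞} (hg : Measurable g)
    (hb : ∀ l, Measurable (b l)) (l : ℤ) (T : ℝ) :
    ∫⁻ t in Ioo 0 T, lop c g b l t ≤ c * ENNReal.ofReal Real.pi * ENNReal.ofReal (2 ^ (-l)) *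
      ∫⁻ s in Ioo 0 T, g s * ∑' i : ℕ, b (l - 2 + i) s := by
  have hm := measurable_high hb l
  have hd := measurable_decay
  refine (lintegral_duhamel_le (k := fun τ => c * ENNReal.ofReal (2 ^ l) * decay (4 ^ l * τ))
    (by fun_prop) (f := fun s => g s * ∑' i : ℕ, b (l - 2 + i) s) (hg.mul hm) T).trans ?_
  gcongr
  rw [lintegral_const_mul _ (by fun_prop)]
  have e : ENNReal.ofReal (2 ^ l) = ENNReal.ofReal (2 ^ (-l)) * ENNReal.ofReal (4 ^ l) := by
    rw [← ENNReal.ofReal_mul (by positivity), show (4 : ℝ) = 2 * 2 by norm_num, mul_zpow,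
      ← mul_assoc, zpow_neg, inv_mul_cancel₀ (by positivity), one_mul]
  rw [e]
  calc _ = c * (ENNReal.ofReal (4 ^ l) * ∫⁻ τ in Ioi (0 : ℝ), decay (4 ^ l * τ)) *
      ENNReal.ofReal (2 ^ (-l)) := by ring
    _ ≤ c * ENNReal.ofReal Real.pi * ENNReal.ofReal (2 ^ (-l)) := by
      gcongr; exact lintegral_dyadic_decay_le l

theorem lintegral_mul_high_le {T lam : ℝ} (hl : 0 ≤ lam) {A : ℝ≥0∞} {g : ℝ → ℝ≥0∞}
    {D : ℤ → ℝ≥0∞} (hD : ∀ l, ∑' i : ℕ, D (l - 2 + i) ≤ A * D l) {b : ℤ → ℝ → ℝ≥0∞}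
    (hg : Measurable g)
    (hb : ∀ l, Measurable (b l)) (hbD : ∀ l, wN lam T (b l) ≤ D l) (l : ℤ) :
    ∫⁻ s in Ioo 0 T, g s * ∑' i : ℕ, b (l - 2 + i) s ≤
      eLpNorm g 2 (volume.restrict (Ioo 0 T)) * expw (-lam) T * A * D l := by
  have hm := measurable_high hb l
  refine (lintegral_mul_le_eLpNorm_two hg hm).trans ?_
  rw [mul_assoc, mul_assoc]
  gcongr
  refine (eLpNorm_le_wN hl hm).trans ?_
  gcongr
  exact (wN_tsum_le lam T fun i => hb _).trans ((ENNReal.tsum_le_tsum fun i => hbD _).trans (hD l))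

/-! ### Supersolutions -/

/-- A sequence above `d` that is almost constant at scale one, relative to `2^{-lr}`. -/
def maj (r : ℝ) (d : ℤ → ℝ≥0∞) (l : ℤ) : ℝ≥0∞ :=
  ∑' i : ℤ, ENNReal.ofReal ((2 : ℝ) ^ (-(i * r) - |(i : ℝ)| * (r / 2))) * d (l - i)

theorem le_maj (r : ℝ) (d : ℤ → ℝ≥0∞) (l : ℤ) : d l ≤ maj r d l := by
  refine le_trans (le_of_eq ?_) (ENNReal.le_tsum (0 : ℤ))
  simp

/-- Moving up by `i` multiplies `maj r d` by about `2^{-ir}`, up to a loss of at most `2^{|i|r/2}`.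
The sum over high frequencies is therefore geometric with ratio `2^{-r/2}`; this is where `r > 0` is
indispensable. -/
theorem exists_tsum_maj_le {r : ℝ} (hr : 0 < r) : ∃ A : ℝ≥0∞, A ≠ ⊤ ∧ ∀ (d : ℤ → ℝ≥0∞) (l : ℤ),
    ∑' i : ℕ, maj r d (l - 2 + i) ≤ A * maj r d l := by
  have hr1 : (2 : ℝ) ^ (-(r / 2)) < 1 := Real.rpow_lt_one_of_one_lt_of_neg one_lt_two (by linarith)
  have hs : Summable fun i : ℕ => (2 : ℝ) ^ (3 * r) * ((2 : ℝ) ^ (-(r / 2))) ^ i :=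
    (summable_geometric_of_lt_one (by positivity) hr1).mul_left _
  refine ⟨∑' i : ℕ, ENNReal.ofReal ((2 : ℝ) ^ (3 * r) * ((2 : ℝ) ^ (-(r / 2))) ^ i), ?_,
    fun d l => ?_⟩
  · rw [← ENNReal.ofReal_tsum_of_nonneg (fun i => by positivity) hs]; exact ENNReal.ofReal_ne_top
  rw [← ENNReal.tsum_mul_right]
  refine ENNReal.tsum_le_tsum fun i => ?_
  rw [maj, maj, ← ENNReal.tsum_mul_left, ← (Equiv.addRight ((i : ℤ) - 2)).tsum_eq]
  refine ENNReal.tsum_le_tsum fun k => ?_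
  have e : l - 2 + (i : ℤ) - (Equiv.addRight ((i : ℤ) - 2)) k = l - k := by
    simp only [Equiv.coe_addRight]; ring
  rw [e, ← mul_assoc, ← ENNReal.ofReal_mul (by positivity)]
  gcongr
  rw [← Real.rpow_natCast, ← Real.rpow_mul two_pos.le, ← Real.rpow_add two_pos,
    ← Real.rpow_add two_pos]
  refine Real.rpow_le_rpow_of_exponent_le one_le_two ?_
  simp only [Equiv.coe_addRight]
  push_cast
  have h1 : |(k : ℝ)| ≤ |(k : ℝ) + (i - 2)| + |(i : ℝ) - 2| := by
    calc |(k : ℝ)| = |((k : ℝ) + (i - 2)) - (i - 2)| := by ring_nf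
      _ ≤ _ := abs_sub _ _
  have h2 : |(i : ℝ) - 2| ≤ i + 2 := by
    rw [abs_le]; constructor <;> [skip; skip] <;> linarith [(Nat.cast_nonneg i : (0 : ℝ) ≤ i)]
  -- Equality holds at `i = 0`; this fixes the constant `2 ^ (3 * r)`.
  have h3 : |(i : ℝ) - 2| - 2 * (i - 2) ≤ 6 - i := by
    rcases le_total (i : ℝ) 2 with h | h
    · rcases Nat.eq_zero_or_pos i with rfl | hi
      · norm_num
      · have : (1 : ℝ) ≤ i := by exact_mod_cast hi
        rw [abs_of_nonpos (by linarith)]; linarith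
    · rw [abs_of_nonneg (by linarith)]; linarith
  nlinarith

theorem weightedSeqNorm_mono {s : ℝ} {q : ℝ≥0∞} {a b : ℤ → ℝ≥0∞} (h : ∀ j, a j ≤ b j) :
    weightedSeqNorm s q a ≤ weightedSeqNorm s q b := by
  refine eLpNorm_mono_enorm fun j => ?_
  simp only [enorm_eq_self]
  gcongr
  exact h j

theorem weightedSeqNorm_const_mul (s : ℝ) {q : ℝ≥0∞} (hq : q ≠ 0) (c : ℝ≥0∞) (a : ℤ → ℝ≥0∞) :
    weightedSeqNorm s q (fun j => c * a j) = c * weightedSeqNorm s q a := by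
  unfold weightedSeqNorm
  simp_rw [mul_left_comm _ c]
  exact eLpNorm_const_mul hq c (measurable_of_countable _)

theorem weightedSeqNorm_add_le (s : ℝ) {q : ℝ≥0∞} (hq : 1 ≤ q) (a b : ℤ → ℝ≥0∞) :
    weightedSeqNorm s q (fun j => a j + b j) ≤ weightedSeqNorm s q a + weightedSeqNorm s q b := by
  unfold weightedSeqNorm
  simp_rw [mul_add]
  exact eLpNorm_add_le (measurable_of_countable _).aestronglyMeasurable
    (measurable_of_countable _).aestronglyMeasurable hq

theorem weightedSeqNorm_shift (s r : ℝ) (q : ℝ≥0∞) (a : ℤ → ℝ≥0∞) :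
    weightedSeqNorm s q (fun j => ENNReal.ofReal ((2 : ℝ) ^ ((j : ℝ) * r)) * a j) =
      weightedSeqNorm (s + r) q a := by
  unfold weightedSeqNorm
  congr 1 with j
  rw [← mul_assoc, ← ENNReal.ofReal_mul (by positivity), ← Real.rpow_add two_pos, mul_add]

theorem le_weightedSeqNorm {s : ℝ} {q : ℝ≥0∞} (hq : q ≠ 0) (a : ℤ → ℝ≥0∞) (j : ℤ) :
    ENNReal.ofReal ((2 : ℝ) ^ ((j : ℝ) * s)) * a j ≤ weightedSeqNorm s q a := by
  have h := enorm_le_eLpNorm_count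
    (fun j : ℤ => ENNReal.ofReal ((2 : ℝ) ^ ((j : ℝ) * s)) * a j) j hq
  rw [enorm_eq_self] at h
  exact h

theorem le_weightedSeqNorm_top (s : ℝ) (a : ℤ → ℝ≥0∞) (j : ℤ) :
    a j ≤ ENNReal.ofReal ((2 : ℝ) ^ (-((j : ℝ) * s))) * weightedSeqNorm s ⊤ a := by
  calc a j = ENNReal.ofReal ((2 : ℝ) ^ (-((j : ℝ) * s))) *
        (ENNReal.ofReal ((2 : ℝ) ^ ((j : ℝ) * s)) * a j) := by
        rw [← mul_assoc, ← ENNReal.ofReal_mul (by positivity), ← Real.rpow_add two_pos]; simp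
    _ ≤ _ := by
        gcongr
        exact le_weightedSeqNorm ENNReal.top_ne_zero a j

theorem tsum_two_rpow_neg_abs_ne_top {σ : ℝ} (hσ : 0 < σ) :
    ∑' i : ℤ, ENNReal.ofReal ((2 : ℝ) ^ (-(|(i : ℝ)| * σ))) ≠ ⊤ := by
  have hr1 : (2 : ℝ) ^ (-σ) < 1 := Real.rpow_lt_one_of_one_lt_of_neg one_lt_two (by linarith)
  have h1 : Summable fun j : ℕ => (2 : ℝ) ^ (-((j : ℝ) * σ)) := by
    refine (summable_geometric_of_lt_one (by positivity) hr1).congr fun j => ?_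
    rw [← Real.rpow_natCast, ← Real.rpow_mul two_pos.le]
    congr 1; ring
  have h2 : Summable fun j : ℤ => (2 : ℝ) ^ (-(|(j : ℝ)| * σ)) := by
    refine Summable.of_nat_of_neg ?_ ?_ <;> simpa using h1
  exact h2.tsum_ofReal_ne_top

/-- After the weight `2^{jr}` is absorbed, `maj` is a discrete convolution with the summable
sequence `2^{-|i|r/2}`, and Minkowski's inequality applies for every `q`. -/
theorem exists_weightedSeqNorm_maj_le {r : ℝ} (hr : 0 < r) : ∃ A : ℝ≥0∞, A ≠ ⊤ ∧
    ∀ (q : ℝ≥0∞) (_ : 1 ≤ q) (d : ℤ → ℝ≥0∞),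
      weightedSeqNorm r q (maj r d) ≤ A * weightedSeqNorm r q d := by
  refine ⟨∑' i : ℤ, ENNReal.ofReal ((2 : ℝ) ^ (-(|(i : ℝ)| * (r / 2)))),
    tsum_two_rpow_neg_abs_ne_top (half_pos hr), fun q hq d => ?_⟩
  rw [← ENNReal.tsum_mul_right]
  have hsum : ∀ j : ℤ, ENNReal.ofReal ((2 : ℝ) ^ ((j : ℝ) * r)) * maj r d j =
      ∑' i : ℤ, ENNReal.ofReal ((2 : ℝ) ^ (-(|(i : ℝ)| * (r / 2)))) *
        (ENNReal.ofReal ((2 : ℝ) ^ (((j - i : ℤ) : ℝ) * r)) * d (j - i)) := by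
    intro j
    rw [maj, ← ENNReal.tsum_mul_left]
    refine tsum_congr fun i => ?_
    rw [← mul_assoc, ← mul_assoc, ← ENNReal.ofReal_mul (by positivity),
      ← ENNReal.ofReal_mul (by positivity), ← Real.rpow_add two_pos, ← Real.rpow_add two_pos]
    congr 3
    push_cast; ring
  unfold weightedSeqNorm
  simp_rw [hsum]
  refine (eLpNorm_tsum_le hq fun i => measurable_of_countable _).trans ?_
  refine ENNReal.tsum_le_tsum fun i => ?_
  rw [eLpNorm_const_mul (zero_lt_one.trans_le hq).ne' _ (measurable_of_countable _)]
  gcongr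
  have hmp : MeasurePreserving (fun j : ℤ => j - i) Measure.count Measure.count :=
    measurePreserving_sub_right _ i
  exact (eLpNorm_comp_measurePreserving (g := fun j : ℤ =>
    ENNReal.ofReal ((2 : ℝ) ^ ((j : ℝ) * r)) * d j)
    (measurable_of_countable _).aestronglyMeasurable hmp).le

/-- Geometric decay of the norms makes the sum of the sequence square integrable with the weight,
hence finite almost everywhere, so the terms tend to zero there. -/
theorem ae_tendsto_zero_of_wN_le {T lam : ℝ} {D : ℝ≥0∞} (hD : D ≠ ⊤) {f : ℕ → ℝ → ℝ≥0∞}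
    (hf : ∀ M, Measurable (f M)) (h : ∀ M, wN lam T (f M) ≤ 2⁻¹ ^ M * D) :
    ∀ᵐ t ∂volume.restrict (Ioo 0 T), Tendsto (fun M => f M t) atTop (𝓝 0) := by
  have he := measurable_expw lam
  have h1 : wN lam T (fun t => ∑' M, f M t) < ⊤ := by
    refine (wN_tsum_le lam T hf).trans_lt ((ENNReal.tsum_le_tsum h).trans_lt ?_)
    rw [ENNReal.tsum_mul_right, ENNReal.tsum_geometric]
    exact ENNReal.mul_lt_top (by simp) hD.lt_top
  have h2 := (ENNReal.pow_lt_top h1 (n := 2)).ne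
  rw [wN_sq] at h2
  have h3 := ae_lt_top (by
    have : Measurable fun t => ∑' M, f M t := Measurable.tsum hf
    fun_prop) h2
  filter_upwards [h3] with t ht
  refine ENNReal.tendsto_atTop_zero_of_tsum_ne_top fun h4 => ?_
  rw [h4, ENNReal.mul_top (by simp [expw, Real.exp_pos])] at ht
  simp at ht

/-- The quadratic Duhamel term gains `2^{-lα}`. In the Schur estimate, `(t-s)^{-α/2}` is attached to
one factor `g` and `(t-s)^{α/2}` to the kernel; since `τ^α = 2^{-2lα} (4^l τ)^α`, the latter gives
the gain, and the power of `4^l τ` is absorbed by the decay because `α ≤ 1`. -/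
theorem duhamel_self_sq_le {α T : ℝ} (h0 : 0 ≤ α) (h1 : α ≤ 1) {c K : ℝ≥0∞} {g : ℝ → ℝ≥0∞}
    (hg : Measurable g)
    (h : ∀ t, 0 < t → t ≤ T → ∫⁻ s in Ioo 0 t, ENNReal.ofReal ((t - s) ^ (-α)) * g s ^ 2 ≤ K)
    (l : ℤ) :
    eLpNorm (fun t => ∫⁻ s in Ioo 0 t, (c * ENNReal.ofReal (2 ^ l) * decay (4 ^ l * (t - s))) *
      g s ^ 2) 2 (volume.restrict (Ioo 0 T)) ^ 2 ≤
      K * (c ^ 2 * ENNReal.ofReal Real.pi * ∫⁻ s in Ioo 0 T, g s ^ 2) *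
        ENNReal.ofReal ((2 : ℝ) ^ (-((l : ℝ) * α))) ^ 2 := by
  have hd := measurable_decay
  rw [eLpNorm_two_sq]
  have key := lintegral_duhamel_sq_le (T := T) (k₁ := fun τ => ENNReal.ofReal (τ ^ (-(α / 2))))
    (k₂ := fun τ => c * ENNReal.ofReal (2 ^ l) * decay (4 ^ l * τ) * ENNReal.ofReal (τ ^ (α / 2)))
    (by fun_prop) (by fun_prop) hg hg (A := K) (fun t ht => by
      refine le_trans (le_of_eq ?_) (h t ht.1 ht.2.le)
      refine setLIntegral_congr_fun measurableSet_Ioo fun s hs => ?_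
      have hts : 0 < t - s := sub_pos.2 hs.2
      simp only [mul_pow]
      rw [← ENNReal.ofReal_pow (by positivity), ← Real.rpow_mul_natCast hts.le]
      congr 4; push_cast; ring)
  refine le_trans (le_of_eq ?_) (key.trans ?_)
  · refine lintegral_congr fun t => ?_
    congr 1
    refine setLIntegral_congr_fun measurableSet_Ioo fun s hs => ?_
    have hts : 0 < t - s := sub_pos.2 hs.2
    have : ENNReal.ofReal ((t - s) ^ (-(α / 2))) * ENNReal.ofReal ((t - s) ^ (α / 2)) = 1 := by
      rw [← ENNReal.ofReal_mul (by positivity), ← Real.rpow_add hts]; simp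
    calc _ = (c * ENNReal.ofReal (2 ^ l) * decay (4 ^ l * (t - s))) * g s ^ 2 *
          (ENNReal.ofReal ((t - s) ^ (-(α / 2))) * ENNReal.ofReal ((t - s) ^ (α / 2))) := by
          rw [this, mul_one]
      _ = _ := by ring
  · suffices hk : ∫⁻ τ in Ioi (0 : ℝ), (c * ENNReal.ofReal (2 ^ l) * decay (4 ^ l * τ) *
        ENNReal.ofReal (τ ^ (α / 2))) ^ 2 ≤
        c ^ 2 * ENNReal.ofReal ((2 : ℝ) ^ (-((l : ℝ) * α))) ^ 2 * ENNReal.ofReal Real.pi by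
      calc _ ≤ K * ((c ^ 2 * ENNReal.ofReal ((2 : ℝ) ^ (-((l : ℝ) * α))) ^ 2 *
            ENNReal.ofReal Real.pi) * ∫⁻ s in Ioo 0 T, g s ^ 2) := by gcongr
        _ = _ := by ring
    calc _ ≤ ∫⁻ τ in Ioi (0 : ℝ), (c ^ 2 * ENNReal.ofReal ((2 : ℝ) ^ (-((l : ℝ) * α))) ^ 2) *
          (ENNReal.ofReal (4 ^ l) * decay (4 ^ l * τ)) := by
          refine setLIntegral_mono' measurableSet_Ioi fun τ hτ => ?_
          have hτ : 0 < τ := hτ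
          have hy : (0 : ℝ) < 4 ^ l * τ := by positivity
          have e : ENNReal.ofReal (2 ^ l) ^ 2 = ENNReal.ofReal (4 ^ l) := by
            rw [← ENNReal.ofReal_pow (by positivity), ← zpow_natCast, ← zpow_mul, mul_comm, zpow_mul]
            norm_num
          have e2 : ENNReal.ofReal (τ ^ (α / 2)) ^ 2 = ENNReal.ofReal ((2 : ℝ) ^ (-((l : ℝ) * α))) ^ 2
              * ENNReal.ofReal ((4 ^ l * τ) ^ α) := by
            rw [← ENNReal.ofReal_pow (by positivity), ← ENNReal.ofReal_pow (by positivity),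
              ← ENNReal.ofReal_mul (by positivity), ← Real.rpow_mul_natCast hτ.le,
              ← Real.rpow_mul_natCast two_pos.le, Real.mul_rpow (by positivity) hτ.le,
              show (4 : ℝ) = 2 ^ (2 : ℝ) by norm_num, ← Real.rpow_intCast, ← Real.rpow_mul two_pos.le,
              ← Real.rpow_mul two_pos.le, ← mul_assoc, ← Real.rpow_add two_pos]
            push_cast
            congr 1
            rw [show -((l : ℝ) * α) * 2 + 2 * l * α = 0 by ring, Real.rpow_zero, one_mul]
            congr 1; ring
          have h3 : decay (4 ^ l * τ) * ENNReal.ofReal ((4 ^ l * τ) ^ α) ≤ 1 := by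
            set y := (4 : ℝ) ^ l * τ
            rw [decay, ← ENNReal.ofReal_mul (by positivity), ENNReal.ofReal_le_one,
              inv_mul_le_one₀ (by positivity)]
            rcases le_total y 1 with hy1 | hy1
            · linarith [Real.rpow_le_one hy.le hy1 h0, sq_nonneg y]
            · calc y ^ α ≤ y ^ (1 : ℝ) := Real.rpow_le_rpow_of_exponent_le hy1 h1
                _ ≤ 1 + y ^ 2 := by rw [Real.rpow_one]; nlinarith
          calc _ = c ^ 2 * ENNReal.ofReal ((2 : ℝ) ^ (-((l : ℝ) * α))) ^ 2 *
                (ENNReal.ofReal (4 ^ l) * (decay (4 ^ l * τ) *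
                  (decay (4 ^ l * τ) * ENNReal.ofReal ((4 ^ l * τ) ^ α)))) := by
                rw [mul_pow, mul_pow, mul_pow, e, e2]; ring
            _ ≤ _ := by gcongr; exact mul_le_of_le_one_right' h3
      _ ≤ c ^ 2 * ENNReal.ofReal ((2 : ℝ) ^ (-((l : ℝ) * α))) ^ 2 * ENNReal.ofReal Real.pi := by
          rw [lintegral_const_mul _ (by fun_prop), lintegral_const_mul _ (by fun_prop)]
          gcongr
          exact lintegral_dyadic_decay_le l

end

section

/-! ### Reconstruction from the dyadic blocks -/

variable {χ φ : RR n → ℝ}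

theorem mult_add {a b : RR n → ℂ} (ha : a.HasTemperateGrowth) (hb : b.HasTemperateGrowth)
    (v : TDist n) : mult (fun ξ => a ξ + b ξ) v = mult a v + mult b v := by
  ext1 ψ
  have ha' := Function.HasTemperateGrowth.comp_const_smul ha (2 * Real.pi)
  have hb' := Function.HasTemperateGrowth.comp_const_smul hb (2 * Real.pi)
  have h : multT (fun ξ => a ξ + b ξ) ψ = multT a ψ + multT b ψ := by
    rw [multT, multT, multT, ← FourierTransform.fourier_add]
    congr 1
    ext η
    have hab : Function.HasTemperateGrowth fun η : RR n =>
      a ((2 * Real.pi) • η) + b ((2 * Real.pi) • η) := ha'.add hb'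
    rw [add_apply, SchwartzMap.smulLeftCLM_apply_apply hab,
      SchwartzMap.smulLeftCLM_apply_apply ha', SchwartzMap.smulLeftCLM_apply_apply hb', add_smul]
  rw [mult_apply, h, map_add]
  rfl

theorem IsLittlewoodPaley.dyadic_chi_succ (h : IsLittlewoodPaley χ φ) (j : ℤ) (v : TDist n) :
    dyadic χ (j + 1) v = dyadic χ j v + dyadic φ j v := by
  rw [dyadic_eq, dyadic_eq, dyadic_eq,
    ← mult_add (h.isSch_chi j).hasTemperateGrowth (h.isSch_phi j).hasTemperateGrowth]
  congr 1
  ext ξ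
  exact h.dsym_chi_succ j ξ

/-- By transposition this is the convergence of the truncations `χ(c ·)` of the inverse Fourier
transform of `ψ`, with `c` tending to `0`. -/
theorem IsLittlewoodPaley.tendsto_dyadic_chi (h : IsLittlewoodPaley χ φ) (M : ℤ) (v : TDist n)
    (ψ : 𝓢(RR n, ℂ)) : Tendsto (fun J : ℕ => dyadic χ (M + J) v ψ) atTop (𝓝 (v ψ)) := by
  have ht := tendsto_smulLeftCLM_truncation h.smooth_χ h.compact_chi
    (show (0 : ℝ) < 3 / 4 by norm_num) (fun x hx => h.chi_eq_one hx.le) (𝓕⁻ ψ)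
  have hc : Tendsto (fun J : ℕ => (2 : ℝ) ^ (-(M + J)) * (2 * Real.pi)) atTop (𝓝[>] 0) := by
    refine tendsto_nhdsWithin_iff.2 ⟨?_, Eventually.of_forall fun J => mem_Ioi.2 (by positivity)⟩
    have h1 := (tendsto_pow_atTop_nhds_zero_of_lt_one (r := (1 / 2 : ℝ)) (by norm_num)
      (by norm_num)).const_mul ((2 : ℝ) ^ (-M) * (2 * Real.pi))
    rw [mul_zero] at h1
    refine h1.congr fun J => ?_
    rw [neg_add, zpow_add₀ two_ne_zero]
    simp
    ring
  have h2 := ((FourierTransform.continuous_fourier).tendsto _).comp (ht.comp hc)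
  rw [FourierTransform.fourier_fourierInv_eq] at h2
  refine ((v.continuous.tendsto ψ).comp h2).congr fun J => ?_
  rw [dyadic_eq, mult_apply]
  simp only [Function.comp_apply, multT, dsym, smul_smul]
  rfl

theorem BRep.add {v w : TDist n} {g h : RR n → CC n} (hv : BRep v g) (hw : BRep w h) :
    BRep (v + w) fun x => g x + h x := by
  obtain ⟨A, hA⟩ := hv.bdd
  obtain ⟨B, hB⟩ := hw.bdd
  refine ⟨hv.meas.add hw.meas, ⟨A + B, fun x => (norm_add_le _ _).trans (add_le_add (hA x) (hB x))⟩,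
    fun ψ => ?_⟩
  have i1 : Integrable (fun x => ψ x • g x) volume :=
    ψ.integrable.smul_bdd A hv.meas.aestronglyMeasurable (Eventually.of_forall hA)
  have i2 : Integrable (fun x => ψ x • h x) volume :=
    ψ.integrable.smul_bdd B hw.meas.aestronglyMeasurable (Eventually.of_forall hB)
  simp_rw [smul_add]
  rw [integral_add i1 i2, ← hv.rep, ← hw.rep]
  rfl

theorem BRep.of_tendsto_sum {w : TDist n} {v : ℕ → TDist n} {h : ℕ → RR n → CC n}
    (H : ∀ i, BRep (v i) (h i)) {ρ : ℕ → ℝ≥0∞} (hρ : ∀ i x, ‖h i x‖ₑ ≤ ρ i)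
    (hs : ∑' i, ρ i ≠ ⊤)
    (hw : ∀ ψ : 𝓢(RR n, ℂ), Tendsto (fun J => ∑ i ∈ Finset.range J, v i ψ) atTop (𝓝 (w ψ))) :
    BRep w fun x => ∑' i, h i x := by
  have hρi : ∀ i, ρ i ≠ ⊤ := fun i => ENNReal.ne_top_of_tsum_ne_top hs i
  have hn : ∀ i x, ‖h i x‖ ≤ (ρ i).toReal := fun i x => by
    rw [← toReal_enorm]; exact ENNReal.toReal_mono (hρi i) (hρ i x)
  have hsum : Summable fun i => (ρ i).toReal := ENNReal.summable_toReal hs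
  have hsx : ∀ x, Summable fun i => h i x := fun x => hsum.of_norm_bounded (fun i => hn i x)
  refine ⟨?_, ⟨∑' i, (ρ i).toReal, fun x => tsum_of_norm_bounded hsum.hasSum fun i => hn i x⟩,
    fun ψ => ?_⟩
  · refine measurable_of_tendsto_metrizable (f := fun J x => ∑ i ∈ Finset.range J, h i x)
      (fun J => Finset.measurable_fun_sum _ fun i _ => (H i).meas) ?_
    rw [tendsto_pi_nhds]
    exact fun x => (hsx x).hasSum.tendsto_sum_nat
  · have h1 : ∫ x, ψ x • ∑' i, h i x = ∑' i, ∫ x, ψ x • h i x := by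
      simp_rw [← (hsx _).tsum_const_smul]
      refine integral_tsum (fun i => ?_) ?_
      · exact (ψ.continuous.measurable.smul (H i).meas).aestronglyMeasurable
      · refine ((ENNReal.tsum_le_tsum fun i => ?_).trans_lt (b := ∑' i, (∫⁻ x, ‖ψ x‖ₑ) * ρ i) ?_).ne
        · rw [← lintegral_mul_const' _ _ (hρi i)]
          refine lintegral_mono fun x => ?_
          rw [enorm_smul]
          gcongr
          exact hρ i x
        · rw [ENNReal.tsum_mul_left]
          exact ENNReal.mul_lt_top ψ.integrable.2 hs.lt_top
    have h2 : Summable fun i => v i ψ := by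
      refine (hsum.mul_left (∫ x, ‖ψ x‖)).of_norm_bounded fun i => ?_
      rw [(H i).rep, ← integral_mul_const]
      refine norm_integral_le_of_norm_le (ψ.integrable.norm.mul_const _)
        (Eventually.of_forall fun x => ?_)
      rw [norm_smul]
      gcongr
      exact hn i x
    rw [h1, tsum_congr fun i => ((H i).rep ψ).symm]
    exact tendsto_nhds_unique (hw ψ) h2.hasSum.tendsto_sum_nat

theorem IsLittlewoodPaley.dyadic_chi_add (h : IsLittlewoodPaley χ φ) (M : ℤ) (v : TDist n)
    (ψ : 𝓢(RR n, ℂ)) (J : ℕ) : dyadic χ (M + J) v ψ =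
      dyadic χ M v ψ + ∑ i ∈ Finset.range J, dyadic φ (M + i) v ψ := by
  induction J with
  | zero => simp
  | succ J ih =>
    rw [Finset.sum_range_succ, ← add_assoc, ← ih, Nat.cast_succ, ← add_assoc, h.dyadic_chi_succ]
    rfl

theorem IsLittlewoodPaley.bRep_of_high (h : IsLittlewoodPaley χ φ) {v : TDist n} {M : ℤ}
    {h₀ : RR n → CC n} (H₀ : BRep (dyadic χ M v) h₀) {g : ℕ → RR n → CC n}
    (H : ∀ i : ℕ, BRep (dyadic φ (M + i) v) (g i)) {ρ : ℕ → ℝ≥0∞} (hρ : ∀ i x, ‖g i x‖ₑ ≤ ρ i)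
    (hs : ∑' i, ρ i ≠ ⊤) : BRep v fun x => h₀ x + ∑' i, g i x := by
  have h1 : BRep (v - dyadic χ M v) fun x => ∑' i, g i x := by
    refine BRep.of_tendsto_sum H hρ hs fun ψ => ?_
    have h2 := (h.tendsto_dyadic_chi M v ψ).sub_const (dyadic χ M v ψ)
    refine h2.congr fun J => ?_
    rw [h.dyadic_chi_add, add_sub_cancel_left]
  have h2 := H₀.add h1
  rwa [add_sub_cancel] at h2

theorem enorm_apply_le_distLpNorm {v : TDist n} (hv : distLpNorm ⊤ v < ⊤) (ψ : 𝓢(RR n, ℂ)) :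
    ‖v ψ‖ₑ ≤ (∫⁻ x, ‖ψ x‖ₑ) * distLpNorm ⊤ v := by
  obtain ⟨g, hg, hb⟩ := exists_bRep_of_distLpNorm_lt_top hv
  rw [hg.rep, ← lintegral_mul_const' _ _ hv.ne]
  refine (enorm_integral_le_lintegral_enorm _).trans (lintegral_mono fun x => ?_)
  rw [enorm_smul]
  gcongr
  exact hb x

theorem InSh.tendsto_apply {v : TDist n} (hv : InSh χ v) (ψ : 𝓢(RR n, ℂ)) :
    Tendsto (fun j : ℤ => dyadic χ j v ψ) atBot (𝓝 0) := by
  rw [tendsto_zero_iff_enorm_tendsto_zero]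
  have h1 : Tendsto (fun j : ℤ => (∫⁻ x, ‖ψ x‖ₑ) * distLpNorm ⊤ (dyadic χ j v)) atBot (𝓝 0) := by
    have := ENNReal.Tendsto.const_mul hv (Or.inr ψ.integrable.2.ne) (a := ∫⁻ x, ‖ψ x‖ₑ)
    rwa [mul_zero] at this
  have h2 : ∀ᶠ j : ℤ in atBot, distLpNorm ⊤ (dyadic χ j v) < ⊤ :=
    hv.eventually_lt_const ENNReal.zero_lt_top
  exact tendsto_of_tendsto_of_tendsto_of_le_of_le' tendsto_const_nhds h1
    (Eventually.of_forall fun _ => zero_le)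
    (by filter_upwards [h2] with j hj using enorm_apply_le_distLpNorm hj ψ)

/-- The low frequencies telescope, `Ṡ_0 v - Ṡ_{-J} v = ∑ Δ̇_j v` over `-J ≤ j < 0`, and membership
in `𝓢'_h` makes the remainder vanish as `J → ∞`, so that no polynomial part is left. The high
frequencies need no such condition. -/
theorem InSh.bRep_tsum (h : IsLittlewoodPaley χ φ) {v : TDist n} (hv : InSh χ v)
    {g : ℤ → RR n → CC n} (H : ∀ l, BRep (dyadic φ l v) (g l)) {ρ : ℤ → ℝ≥0∞}
    (hρ : ∀ l x, ‖g l x‖ₑ ≤ ρ l) (hs : ∑' l, ρ l ≠ ⊤) : BRep v fun x => ∑' l, g l x := by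
  have hs' := tsum_of_nat_of_neg_add_one (f := ρ) ENNReal.summable ENNReal.summable
  rw [hs'] at hs
  have hs1 : ∑' i : ℕ, ρ i ≠ ⊤ := fun h => hs (by rw [h]; exact top_add _)
  have hs2 : ∑' i : ℕ, ρ (-((i : ℤ) + 1)) ≠ ⊤ := fun h => hs (by rw [h]; exact add_top _)
  have h0 : BRep (dyadic χ 0 v) fun x => ∑' i : ℕ, g (-((i : ℤ) + 1)) x := by
    refine BRep.of_tendsto_sum (fun i : ℕ => H (-((i : ℤ) + 1))) (fun i => hρ _) hs2 fun ψ => ?_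
    have h1 : Tendsto (fun J : ℕ => dyadic χ 0 v ψ - dyadic χ (-(J : ℤ)) v ψ) atTop
        (𝓝 (dyadic χ 0 v ψ - 0)) := tendsto_const_nhds.sub ((hv.tendsto_apply ψ).comp
          (tendsto_neg_atTop_atBot.comp tendsto_natCast_atTop_atTop))
    rw [sub_zero] at h1
    refine h1.congr fun J => ?_
    induction J with
    | zero => simp
    | succ J ih =>
      rw [Finset.sum_range_succ, ← ih]
      have h2 := h.dyadic_chi_succ (-((J : ℤ) + 1)) v
      rw [show -((J : ℤ) + 1) + 1 = -J by ring] at h2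
      rw [h2]
      push_cast
      change _ = _ - (dyadic χ (-((J : ℤ) + 1)) v ψ + dyadic φ (-((J : ℤ) + 1)) v ψ) + _
      abel
  have h1 := h.bRep_of_high h0 (g := fun i : ℕ => g i)
    (fun i => by rw [zero_add]; exact H i) (fun i => hρ i) hs1
  have he : ∀ x, ∑' l, g l x = ∑' i : ℕ, g (-((i : ℤ) + 1)) x + ∑' i : ℕ, g i x := by
    intro x
    have hn : ∀ f : ℕ → ℤ, ∑' i, ρ (f i) ≠ ⊤ → Summable fun i => g (f i) x := fun f hf => by
      refine (ENNReal.summable_toReal hf).of_norm_bounded fun i => ?_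
      rw [← toReal_enorm]
      exact ENNReal.toReal_mono (ENNReal.ne_top_of_tsum_ne_top hf i) (hρ _ x)
    rw [tsum_of_nat_of_neg_add_one (f := fun l => g l x) (hn _ hs1) (hn _ hs2), add_comm]
  simp_rw [he]
  exact h1

/-! ### Spectral supports of products -/

theorem integral_mul_fourierInv {f c : RR n → ℂ} (hf : Integrable f volume)
    (hc : Integrable c volume) : ∫ x, f x * 𝓕⁻ c x = ∫ η, 𝓕⁻ f η * c η := by
  have hf' : Integrable (fun x => f (-x)) volume := hf.comp_neg
  have h1 := VectorFourier.integral_fourierIntegral_smul_eq_flip (μ := (volume : Measure (RR n)))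
    (ν := (volume : Measure (RR n))) (L := innerₗ (RR n)) Real.continuous_fourierChar
    (by simpa using continuous_inner) hf' hc
  rw [flip_innerₗ] at h1
  rw [← integral_neg_eq_self]
  simp_rw [Real.fourierInv_eq_fourier_neg c, neg_neg, Real.fourierInv_eq_fourier_comp_neg f]
  exact h1.symm

theorem fourierInv_ker {m : RR n → ℂ} (hm : IsSch m) (ζ : RR n) :
    𝓕⁻ (ker m) ζ = m (-((2 * Real.pi) • ζ)) := by
  obtain ⟨g, hg⟩ := (hm.comp_smul two_pi_ne_zero).eq
  have hk : ker m = ⇑(𝓕⁻ g : 𝓢(RR n, ℂ)) := by rw [SchwartzMap.fourierInv_coe, hg]; rfl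
  rw [hk, Real.fourierInv_eq_fourier_neg, ← SchwartzMap.fourier_coe,
    FourierTransform.fourier_fourierInv_eq, hg]
  simp only [smul_neg]

theorem fourierInv_comp_sub (f : RR n → ℂ) (y ζ : RR n) :
    𝓕⁻ (fun x => f (x - y)) ζ = Real.fourierChar (inner ℝ y ζ) • 𝓕⁻ f ζ := by
  rw [Real.fourierInv_eq, Real.fourierInv_eq,
    ← integral_add_right_eq_self (μ := volume) (fun v => Real.fourierChar (inner ℝ v ζ) • f (v - y)) y]
  simp_rw [add_sub_cancel_right, inner_add_left, AddChar.map_add_eq_mul, mul_comm _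
    (Real.fourierChar (inner ℝ y ζ)), mul_smul]
  simp_rw [Circle.smul_def (Real.fourierChar (inner ℝ y ζ))]
  exact integral_smul _ _

theorem ker_sub_eq (a : RR n → ℂ) (x z : RR n) : ker a (x - z) =
    𝓕⁻ (fun η : RR n => Real.fourierChar (-inner ℝ η z) • a ((2 * Real.pi) • η)) x := by
  rw [ker, Real.fourierInv_eq, Real.fourierInv_eq]
  congr 1
  ext η
  rw [smul_smul, ← AddChar.map_add_eq_mul, inner_sub_right, sub_eq_add_neg]

theorem integrable_char_smul {f : RR n → ℂ} (hf : Integrable f volume) {e : RR n → ℝ}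
    (he : Continuous e) : Integrable (fun x => Real.fourierChar (e x) • f x) volume := by
  have hm : Continuous fun x => ((Real.fourierChar (e x) : Circle) : ℂ) :=
    continuous_subtype_val.comp (Real.continuous_fourierChar.comp he)
  refine (hf.bdd_mul (c := 1) hm.aestronglyMeasurable
    (Eventually.of_forall fun x => (Circle.norm_coe _).le)).congr (Eventually.of_forall fun x => ?_)
  exact (Circle.smul_def _ _).symm

/-- Passing two of the three kernels to the Fourier side leaves an integral over `(ξ, η)` whose
integrand contains `a(ξ) b(η) m(-(ξ+η))`, which vanishes identically. -/
theorem integral_ker_mul_ker_mul_ker {m a b : RR n → ℂ} (hm : IsSch m) (ha : IsSch a)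
    (hb : IsSch b) (h : ∀ ξ η, a ξ * b η * m (-(ξ + η)) = 0) (y z w : RR n) :
    ∫ x, ker m (x - y) * ker a (x - z) * ker b (x - w) = 0 := by
  have cm := hm.ker.continuous
  have ca := hm.ker.continuous
  have hbd : ∃ A, ∀ x, ‖ker a x‖ ≤ A := by
    obtain ⟨g, hg⟩ := ha.ker.eq
    obtain ⟨C, -, hC⟩ := g.decay 0 0
    exact ⟨C, fun x => by simpa [hg] using hC x⟩
  obtain ⟨A, hA⟩ := hbd
  have im : Integrable (fun x => ker m (x - y)) volume := hm.ker.integrable.comp_sub_right y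
  have iF : Integrable (fun x => ker m (x - y) * ker a (x - z)) volume :=
    im.mul_bdd (ha.ker.continuous.comp (continuous_sub_right z)).aestronglyMeasurable
      (Eventually.of_forall fun x => hA _)
  simp_rw [ker_sub_eq b]
  rw [integral_mul_fourierInv iF (integrable_char_smul (integrable_comp_two_pi hb.integrable)
    (by fun_prop))]
  refine integral_eq_zero_of_ae (Eventually.of_forall fun η => ?_)
  simp only [Pi.zero_apply]
  by_cases hη : b ((2 * Real.pi) • η) = 0
  · rw [hη, smul_zero, mul_zero]
  suffices h0 : 𝓕⁻ (fun x => ker m (x - y) * ker a (x - z)) η = 0 by rw [h0, zero_mul]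
  rw [Real.fourierInv_eq]
  have h1 : ∀ x, Real.fourierChar (inner ℝ x η) • (ker m (x - y) * ker a (x - z)) =
      (Real.fourierChar (inner ℝ x η) • ker m (x - y)) * ker a (x - z) := fun x =>
    (smul_mul_assoc _ _ _).symm
  simp_rw [h1, ker_sub_eq a]
  rw [integral_mul_fourierInv (integrable_char_smul im (by fun_prop))
    (integrable_char_smul (integrable_comp_two_pi ha.integrable) (by fun_prop))]
  refine integral_eq_zero_of_ae (Eventually.of_forall fun ξ => ?_)
  simp only [Pi.zero_apply]
  have h2 : 𝓕⁻ (fun x => Real.fourierChar (inner ℝ x η) • ker m (x - y)) ξ =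
      𝓕⁻ (fun x => ker m (x - y)) (ξ + η) := by
    rw [Real.fourierInv_eq, Real.fourierInv_eq]
    congr 1
    ext x
    rw [smul_smul, ← AddChar.map_add_eq_mul, inner_add_right]
  rw [h2, fourierInv_comp_sub, fourierInv_ker hm, smul_mul_smul_comm]
  have h3 := h ((2 * Real.pi) • ξ) ((2 * Real.pi) • η)
  rw [mul_right_comm, mul_eq_zero, or_iff_left hη, ← smul_add] at h3
  rw [mul_comm (m _), h3, smul_zero]

theorem integral_mul_conv {P k u : RR n → ℂ} (hP : Integrable P volume) (hPm : Measurable P)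
    (hk : Integrable k volume) (hkm : Measurable k) (hu : Measurable u) {A : ℝ}
    (hA : ∀ x, ‖u x‖ ≤ A) :
    ∫ x, P x * ∫ z, k (x - z) * u z = ∫ z, u z * ∫ x, P x * k (x - z) := by
  have hAe : ∀ x, ‖u x‖ₑ ≤ ENNReal.ofReal A := fun x => by
    rw [← ofReal_norm]; exact ENNReal.ofReal_le_ofReal (hA x)
  simp_rw [← integral_const_mul]
  rw [integral_integral_swap]
  · congr 1; ext z; congr 1; ext x; ring
  · refine ⟨Measurable.aestronglyMeasurable (by simp only [Function.uncurry_def]; fun_prop), ?_⟩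
    rw [hasFiniteIntegral_def, lintegral_prod _ (by simp only [Function.uncurry_def]; fun_prop)]
    calc _ ≤ ∫⁻ x, ∫⁻ z, ‖P x‖ₑ * ENNReal.ofReal A * ‖k (x - z)‖ₑ := by
          refine lintegral_mono fun x => lintegral_mono fun z => ?_
          simp only [Function.uncurry_apply_pair]
          rw [enorm_mul, enorm_mul, mul_comm ‖k _‖ₑ, ← mul_assoc]
          gcongr
          exact hAe z
      _ = (∫⁻ x, ‖P x‖ₑ) * ENNReal.ofReal A * ∫⁻ z, ‖k z‖ₑ := by
          have : ∀ x, ∫⁻ z, ‖P x‖ₑ * ENNReal.ofReal A * ‖k (x - z)‖ₑ =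
              ‖P x‖ₑ * (ENNReal.ofReal A * ∫⁻ z, ‖k z‖ₑ) := fun x => by
            rw [lintegral_const_mul _ (by fun_prop),
              lintegral_sub_left_eq_self (fun y => ‖k y‖ₑ) x, mul_assoc]
          simp_rw [this]
          rw [lintegral_mul_const _ (by fun_prop), mul_assoc]
      _ < ⊤ := ENNReal.mul_lt_top (ENNReal.mul_lt_top hP.2 ENNReal.ofReal_lt_top) hk.2

theorem cv_apply {k : RR n → ℂ} {h : RR n → CC n} (hk : Integrable k volume) (hh : Measurable h)
    (hb : ∃ A, ∀ x, ‖h x‖ ≤ A) (x : RR n) (j : Fin n) : cv k h x j = ∫ z, k (x - z) * h z j := by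
  obtain ⟨A, hA⟩ := hb
  have hi : Integrable (fun z => k (x - z) • h z) volume :=
    (hk.comp_sub_left x).smul_bdd A hh.aestronglyMeasurable (Eventually.of_forall hA)
  exact ((EuclideanSpace.proj (𝕜 := ℂ) j).integral_comp_comm hi).symm

/-- The product of two functions with spectra in small balls has no high frequencies. -/
theorem integral_ker_mul_cv_mul_cv {m a b : RR n → ℂ} (hm : IsSch m) (ha : IsSch a)
    (hb : IsSch b) (h : ∀ ξ η, a ξ * b η * m (-(ξ + η)) = 0) {u v : RR n → CC n}
    (hu : Measurable u) (hub : ∃ A, ∀ x, ‖u x‖ ≤ A) (hv : Measurable v)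
    (hvb : ∃ A, ∀ x, ‖v x‖ ≤ A) (y : RR n) (j k : Fin n) :
    ∫ x, ker m (x - y) * (cv (ker a) u x j * cv (ker b) v x k) = 0 := by
  have cm := hm.ker.continuous
  have ca := ha.ker.continuous
  have cb := hb.ker.continuous
  have hbd : ∀ {a : RR n → ℂ}, IsSch a → ∃ A, ∀ x, ‖ker a x‖ ≤ A := fun ha => by
    obtain ⟨g, hg⟩ := ha.ker.eq
    obtain ⟨C, -, hC⟩ := g.decay 0 0
    exact ⟨C, fun x => by simpa [hg] using hC x⟩
  have im : Integrable (fun x => ker m (x - y)) volume := hm.ker.integrable.comp_sub_right y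
  obtain ⟨B, hB⟩ := hvb
  obtain ⟨A, hA⟩ := hub
  have hcb : ∀ x, ‖cv (ker b) v x‖ₑ ≤ kerNorm b * ENNReal.ofReal B :=
    enorm_cv_le_of_bound cb.measurable (Eventually.of_forall fun x => by
      rw [← ofReal_norm]; exact ENNReal.ofReal_le_ofReal (hB x))
  obtain ⟨B', hB'⟩ := enorm_bdd_iff (ENNReal.mul_ne_top hb.kerNorm_lt_top.ne ENNReal.ofReal_ne_top)
    hcb
  have hmb : Measurable fun x => cv (ker b) v x k :=
    (EuclideanSpace.proj (𝕜 := ℂ) k).continuous.measurable.comp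
      (measurable_cv cb.measurable hv)
  have hum : ∀ j, Measurable fun x => u x j := fun j =>
    (EuclideanSpace.proj (𝕜 := ℂ) j).continuous.measurable.comp hu
  have hvm : Measurable fun x => v x k :=
    (EuclideanSpace.proj (𝕜 := ℂ) k).continuous.measurable.comp hv
  have iP : Integrable (fun x => ker m (x - y) * cv (ker b) v x k) volume :=
    im.mul_bdd hmb.aestronglyMeasurable
      (Eventually.of_forall fun x => (PiLp.norm_apply_le _ k).trans (hB' x))
  -- Fubini takes the convolutions off `u` and then off `v`, so that only the triple product of
  -- kernels is integrated in `x`.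
  have e1 : ∀ x, ker m (x - y) * (cv (ker a) u x j * cv (ker b) v x k) =
      (ker m (x - y) * cv (ker b) v x k) * ∫ z, ker a (x - z) * u z j := fun x => by
    rw [cv_apply ha.ker.integrable hu ⟨A, hA⟩]; ring
  simp_rw [e1]
  have mP : Measurable fun x => ker m (x - y) * cv (ker b) v x k :=
    (cm.measurable.comp (measurable_sub_const y)).mul hmb
  rw [integral_mul_conv iP mP ha.ker.integrable ca.measurable (hum j)
    (fun x => (PiLp.norm_apply_le _ j).trans (hA x))]
  refine integral_eq_zero_of_ae (Eventually.of_forall fun z => ?_)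
  obtain ⟨A', hA'⟩ := hbd ha
  have iP' : Integrable (fun x => ker m (x - y) * ker a (x - z)) volume :=
    im.mul_bdd (ca.comp (continuous_sub_right z)).aestronglyMeasurable
      (Eventually.of_forall fun x => hA' _)
  have e2 : ∀ x, ker m (x - y) * cv (ker b) v x k * ker a (x - z) =
      (ker m (x - y) * ker a (x - z)) * ∫ w, ker b (x - w) * v w k := fun x => by
    rw [cv_apply hb.ker.integrable hv ⟨B, hB⟩]; ring
  simp_rw [e2]
  have mP' : Measurable fun x => ker m (x - y) * ker a (x - z) :=
    (cm.measurable.comp (measurable_sub_const y)).mul (ca.measurable.comp (measurable_sub_const z))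
  rw [integral_mul_conv iP' mP' hb.ker.integrable cb.measurable hvm
    (fun x => (PiLp.norm_apply_le _ k).trans (hB x))]
  simp only [Pi.zero_apply]
  rw [integral_eq_zero_of_ae (Eventually.of_forall fun w => ?_), mul_zero]
  simp only [Pi.zero_apply]
  rw [integral_ker_mul_ker_mul_ker hm ha hb h, mul_zero]

/-! ### Continuity -/

/-- Dominated convergence. The kernel decays like `(1 + |x|)^{-(n+1)}`, which is integrable, and
moving `x` by at most one changes this majorant by the factor `2^{n+1}`. -/
theorem continuous_cv {m : RR n → ℂ} (hm : IsSch m) {h : RR n → CC n} (hh : Measurable h)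
    (hb : ∃ A, ∀ x, ‖h x‖ ≤ A) : Continuous (cv (ker m) h) := by
  obtain ⟨A, hA⟩ := hb
  obtain ⟨g, hg⟩ := hm.ker.eq
  set N := n + 1
  obtain ⟨C, hC⟩ : ∃ C, ∀ x, ‖g x‖ ≤ C * (1 + ‖x‖) ^ (-(N : ℝ)) := by
    refine ⟨2 ^ N * (Finset.Iic (N, 0)).sup (fun m => SchwartzMap.seminorm ℝ m.1 m.2) g,
      fun x => ?_⟩
    · have h1 := SchwartzMap.one_add_le_sup_seminorm_apply (𝕜 := ℝ) (m := (N, 0)) le_rfl le_rfl g x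
      rw [norm_iteratedFDeriv_zero] at h1
      rw [Real.rpow_neg (by positivity), Real.rpow_natCast, ← div_eq_mul_inv,
        le_div_iff₀ (by positivity), mul_comm]
      exact h1
  have hC0 : 0 ≤ C := by
    have := (norm_nonneg _).trans (hC 0)
    simpa using this
  rw [← hg]
  refine continuous_iff_continuousAt.2 fun x₀ => ?_
  refine continuousAt_of_dominated
    (bound := fun y => C * 2 ^ N * (1 + ‖x₀ - y‖) ^ (-(N : ℝ)) * A) ?_ ?_ ?_ ?_
  · refine Eventually.of_forall fun x => Measurable.aestronglyMeasurable ?_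
    have := g.continuous.measurable
    fun_prop
  · filter_upwards [Metric.ball_mem_nhds x₀ one_pos] with x hx
    refine Eventually.of_forall fun y => ?_
    rw [norm_smul]
    have h1 : ‖x₀ - x‖ ≤ 1 := by rw [← dist_eq_norm, dist_comm]; exact (Metric.mem_ball.1 hx).le
    have h2 : 1 + ‖x₀ - y‖ ≤ 2 * (1 + ‖x - y‖) := by
      have : ‖x₀ - y‖ ≤ ‖x₀ - x‖ + ‖x - y‖ := norm_sub_le_norm_sub_add_norm_sub _ _ _
      linarith [norm_nonneg (x - y)]
    gcongr
    · refine (hC _).trans ?_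
      rw [mul_assoc]
      gcongr
      rw [Real.rpow_neg (by positivity), Real.rpow_neg (by positivity), Real.rpow_natCast,
        Real.rpow_natCast, ← div_eq_mul_inv, inv_le_comm₀ (by positivity) (by positivity), inv_div,
        div_le_iff₀ (by positivity), mul_comm, ← mul_pow]
      gcongr
    · exact hA y
  · refine Integrable.mul_const (Integrable.const_mul ?_ _) _
    have h1 : Integrable (fun x : RR n => (1 + ‖x‖) ^ (-(N : ℝ))) volume :=
      integrable_one_add_norm (by rw [finrank_euclideanSpace_fin]; simp [N])
    exact h1.comp_sub_left x₀
  · refine Eventually.of_forall fun y => ?_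
    have := g.continuous
    fun_prop

end

section

/-! ### The Duhamel term -/

/-- The kernel of `θ(D) ℙ_{ij} ∇_k e^{τΔ}`. -/
def dker (θ : RR n → ℂ) (i j k : Fin n) (τ : ℝ) : RR n → ℂ :=
  ker fun ξ => lerayGradSymbol i j k ξ * θ ξ * heatSymbol τ ξ

theorem measurable_dker {θ : RR n → ℂ} (hθ : Measurable θ) (i j k : Fin n) :
    Measurable fun p : ℝ × RR n => dker θ i j k p.1 p.2 := by
  refine measurable_ker_family (m := fun τ ξ => lerayGradSymbol i j k ξ * θ ξ * heatSymbol τ ξ) ?_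
  have := measurable_lerayGradSymbol i j k
  simp only [Function.uncurry_def, heatSymbol]
  fun_prop

/-- The sum of the absolute values of the kernels of `θ(D) ℙ_{ij} ∇_k e^{τΔ}`. -/
def dabs (θ : RR n → ℂ) (τ : ℝ) (x : RR n) : ℝ≥0∞ := ∑ i, ∑ j, ∑ k, ‖dker θ i j k τ x‖ₑ

theorem measurable_dabs {θ : RR n → ℂ} (hθ : Measurable θ) :
    Measurable fun p : ℝ × RR n => dabs θ p.1 p.2 :=
  Finset.measurable_fun_sum _ fun i _ => Finset.measurable_fun_sum _ fun j _ =>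
    Finset.measurable_fun_sum _ fun k _ => (measurable_dker hθ i j k).enorm

theorem enorm_dker_le (θ : RR n → ℂ) (i j k : Fin n) (τ : ℝ) (x : RR n) :
    ‖dker θ i j k τ x‖ₑ ≤ dabs θ τ x :=
  (Finset.single_le_sum (f := fun k => ‖dker θ i j k τ x‖ₑ) (fun _ _ => zero_le)
    (Finset.mem_univ k)).trans <|
  (Finset.single_le_sum (f := fun j => ∑ k, ‖dker θ i j k τ x‖ₑ) (fun _ _ => zero_le)
    (Finset.mem_univ j)).trans <|
  Finset.single_le_sum (f := fun i => ∑ j, ∑ k, ‖dker θ i j k τ x‖ₑ) (fun _ _ => zero_le)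
    (Finset.mem_univ i)

/-- The `L¹` norm of the kernels of `θ(D) ℙ ∇ e^{τΔ}`. -/
def dnorm (θ : RR n → ℂ) (τ : ℝ) : ℝ≥0∞ := ∫⁻ x, dabs θ τ x

theorem measurable_dnorm {θ : RR n → ℂ} (hθ : Measurable θ) : Measurable (dnorm θ) :=
  (measurable_dabs hθ).lintegral_prod_right'

theorem lintegral_sum_sum_sum {X : Type*} [MeasurableSpace X] {μ : Measure X}
    {f : Fin n → Fin n → Fin n → X → ℝ≥0∞} (hf : ∀ i j k, Measurable (f i j k)) :
    ∫⁻ x, ∑ i, ∑ j, ∑ k, f i j k x ∂μ = ∑ i, ∑ j, ∑ k, ∫⁻ x, f i j k x ∂μ := by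
  rw [lintegral_finsetSum _ fun i _ => by fun_prop]
  refine Finset.sum_congr rfl fun i _ => ?_
  rw [lintegral_finsetSum _ fun j _ => by fun_prop]
  refine Finset.sum_congr rfl fun j _ => ?_
  rw [lintegral_finsetSum _ fun k _ => by fun_prop]

theorem dnorm_eq {θ : RR n → ℂ} (hθ : Measurable θ) (τ : ℝ) : dnorm θ τ =
    ∑ i, ∑ j, ∑ k, kerNorm fun ξ => lerayGradSymbol i j k ξ * θ ξ * heatSymbol τ ξ :=
  lintegral_sum_sum_sum fun i j k =>
    ((measurable_dker hθ i j k).comp (measurable_const.prodMk measurable_id)).enorm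

/-- Fubini in `(s, x, y)`. It moves the kernel from the test function, where the definition of the
bilinear term puts it, onto the product, and thereby exhibits the bilinear term as a function of
`y`. -/
theorem integral_kernel_swap {μ : Measure ℝ} [SFinite μ] {P k : ℝ → RR n → ℂ}
    (hP : Measurable (Function.uncurry P)) (hk : Measurable (Function.uncurry k))
    {G : ℝ → ℝ≥0∞} (hG : ∀ s x, ‖P s x‖ₑ ≤ G s)
    (hfin : ∫⁻ s, (∫⁻ x : RR n, ‖k s x‖ₑ) * G s ∂μ < ⊤) {ψ : RR n → ℂ} (hψ : Integrable ψ volume)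
    (hψm : Measurable ψ) :
    Integrable (fun s => ∫ x, P s x * ∫ y, k s (x - y) * ψ y) μ ∧
      Integrable (fun y => ψ y * ∫ s, (∫ x, P s x * k s (x - y)) ∂μ) volume ∧
      ∫ s, (∫ x, P s x * ∫ y, k s (x - y) * ψ y) ∂μ =
        ∫ y, ψ y * ∫ s, (∫ x, P s x * k s (x - y)) ∂μ := by
  have hP' : ∀ {α : Type} [MeasurableSpace α] {a : α → ℝ} {b : α → RR n}, Measurable a →
      Measurable b → Measurable fun q => P (a q) (b q) := fun ha hb => hP.comp (ha.prodMk hb)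
  have hk' : ∀ {α : Type} [MeasurableSpace α] {a : α → ℝ} {b : α → RR n}, Measurable a →
      Measurable b → Measurable fun q => k (a q) (b q) := fun ha hb => hk.comp (ha.prodMk hb)
  have hkk : ∀ y, ∫⁻ s, (∫⁻ x, ‖P s x * k s (x - y)‖ₑ) ∂μ ≤ ∫⁻ s, (∫⁻ x, ‖k s x‖ₑ) * G s ∂μ := by
    intro y
    refine lintegral_mono fun s => ?_
    calc ∫⁻ x, ‖P s x * k s (x - y)‖ₑ ≤ ∫⁻ x, ‖k s (x - y)‖ₑ * G s := by
          refine lintegral_mono fun x => ?_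
          simp only []
          rw [enorm_mul, mul_comm]
          gcongr
          exact hG s x
      _ = (∫⁻ x, ‖k s (x - y)‖ₑ) * G s := by
          refine lintegral_mul_const _ (Measurable.enorm ?_)
          exact hk' measurable_const (measurable_sub_const y)
      _ = _ := by rw [lintegral_sub_right_eq_self (fun x => ‖k s x‖ₑ) y]
  have mPk : ∀ y, Measurable fun p : ℝ × RR n => P p.1 p.2 * k p.1 (p.2 - y) := fun y =>
    (hP' measurable_fst measurable_snd).mul (hk' measurable_fst (measurable_snd.sub_const y))
  have iPk : ∀ y, Integrable (fun p : ℝ × RR n => P p.1 p.2 * k p.1 (p.2 - y)) (μ.prod volume) := by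
    intro y
    refine ⟨(mPk y).aestronglyMeasurable, ?_⟩
    rw [hasFiniteIntegral_def, lintegral_prod _ (mPk y).enorm.aemeasurable]
    exact (hkk y).trans_lt hfin
  have mf : Measurable fun q : (ℝ × RR n) × RR n =>
      P q.1.1 q.1.2 * (k q.1.1 (q.1.2 - q.2) * ψ q.2) :=
    (hP' (by fun_prop) (by fun_prop)).mul ((hk' (by fun_prop) (by fun_prop)).mul (by fun_prop))
  have i_f : Integrable (fun q : (ℝ × RR n) × RR n =>
      P q.1.1 q.1.2 * (k q.1.1 (q.1.2 - q.2) * ψ q.2)) ((μ.prod volume).prod volume) := by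
    refine ⟨mf.aestronglyMeasurable, ?_⟩
    rw [hasFiniteIntegral_def, lintegral_prod_symm _ mf.enorm.aemeasurable]
    calc _ = ∫⁻ y, (∫⁻ p, ‖P p.1 p.2 * k p.1 (p.2 - y)‖ₑ ∂(μ.prod volume)) * ‖ψ y‖ₑ := by
          refine lintegral_congr fun y => ?_
          rw [← lintegral_mul_const _ (mPk y).enorm]
          refine lintegral_congr fun p => ?_
          rw [← mul_assoc, enorm_mul]
      _ ≤ ∫⁻ y, (∫⁻ s, (∫⁻ x, ‖k s x‖ₑ) * G s ∂μ) * ‖ψ y‖ₑ := by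
          refine lintegral_mono fun y => ?_
          simp only []
          gcongr
          rw [lintegral_prod _ (mPk y).enorm.aemeasurable]
          exact hkk y
      _ < ⊤ := by
          rw [lintegral_const_mul _ (by fun_prop)]
          exact ENNReal.mul_lt_top hfin hψ.2
  have e1 : ∀ p : ℝ × RR n, ∫ y, P p.1 p.2 * (k p.1 (p.2 - y) * ψ y) =
      P p.1 p.2 * ∫ y, k p.1 (p.2 - y) * ψ y := fun p => integral_const_mul _ _
  have i1 := i_f.integral_prod_left
  simp only [e1] at i1
  have e2 : ∀ y, ∫ p, P p.1 p.2 * (k p.1 (p.2 - y) * ψ y) ∂(μ.prod volume) =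
      ψ y * ∫ s, (∫ x, P s x * k s (x - y)) ∂μ := fun y => by
    rw [← integral_prod _ (iPk y), ← integral_const_mul]
    congr 1
    ext p
    ring
  have i2 := i_f.integral_prod_right
  simp only [e2] at i2
  have h1 := integral_integral_swap (f := fun (p : ℝ × RR n) y =>
    P p.1 p.2 * (k p.1 (p.2 - y) * ψ y)) i_f
  simp only [e1, e2] at h1
  rw [integral_prod _ i1] at h1
  exact ⟨i1.integral_prod_left, i2, h1⟩

/-- The function `∫_0^t θ(D) e^{(t-s)Δ} ℙ∇·(U ⊗ V)(s) ds`, up to the sign. -/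
def duh (θ : RR n → ℂ) (U V : ℝ → RR n → CC n) (t : ℝ) (y : RR n) : CC n :=
  WithLp.toLp 2 fun i => ∑ j, ∑ k, ∫ s in Ioo 0 t, ∫ x,
    U s x j * V s x k * dker θ i j k (t - s) (x - y)

theorem enorm_le_sum_enorm (v : CC n) : ‖v‖ₑ ≤ ∑ i, ‖v i‖ₑ := by
  have h : v = ∑ i, EuclideanSpace.single i (v i) := by
    ext j
    simp [Finset.sum_apply]
  calc ‖v‖ₑ = ‖∑ i, EuclideanSpace.single i (v i)‖ₑ := by rw [← h]
    _ ≤ ∑ i, ‖EuclideanSpace.single i (v i)‖ₑ := enorm_sum_le _ _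
    _ = ∑ i, ‖v i‖ₑ := by simp [enorm_eq_nnnorm]

theorem enorm_apply_le (v : CC n) (i : Fin n) : ‖v i‖ₑ ≤ ‖v‖ₑ := by
  rw [← ofReal_norm, ← ofReal_norm]
  exact ENNReal.ofReal_le_ofReal (PiLp.norm_apply_le v i)

theorem measurable_coord (i : Fin n) : Measurable fun v : CC n => v i :=
  (EuclideanSpace.proj (𝕜 := ℂ) i).continuous.measurable

theorem measurable_coord_comp {α : Type*} [MeasurableSpace α] {U : ℝ → RR n → CC n}
    (hU : Measurable (Function.uncurry U)) (i : Fin n) {a : α → ℝ} {b : α → RR n}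
    (ha : Measurable a) (hb : Measurable b) : Measurable fun q => U (a q) (b q) i :=
  (measurable_coord i).comp (hU.comp (ha.prodMk hb))

theorem lintegral_dabs_mul {θ : RR n → ℂ} (hθ : Measurable θ) {N : ℝ → RR n → ℝ≥0∞}
    (hN : Measurable (Function.uncurry N)) (t : ℝ) (y : RR n) :
    ∫⁻ s in Ioo 0 t, ∫⁻ x, dabs θ (t - s) (x - y) * N s x =
      ∑ i, ∑ j, ∑ k, ∫⁻ s in Ioo 0 t, ∫⁻ x, ‖dker θ i j k (t - s) (x - y)‖ₑ * N s x := by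
  have hm : ∀ i j k, Measurable fun p : ℝ × RR n =>
      ‖dker θ i j k (t - p.1) (p.2 - y)‖ₑ * N p.1 p.2 := fun i j k =>
    ((measurable_dker hθ i j k).comp (f := fun p : ℝ × RR n => (t - p.1, p.2 - y))
      (by fun_prop)).enorm.mul hN
  have hm' : ∀ s i j k, Measurable fun x => ‖dker θ i j k (t - s) (x - y)‖ₑ * N s x :=
    fun s i j k => (hm i j k).comp (f := fun x => (s, x)) measurable_prodMk_left
  have hmi : ∀ i j k, Measurable fun s => ∫⁻ x, ‖dker θ i j k (t - s) (x - y)‖ₑ * N s x :=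
    fun i j k => Measurable.lintegral_prod_right' (f := fun p : ℝ × RR n =>
      ‖dker θ i j k (t - p.1) (p.2 - y)‖ₑ * N p.1 p.2) (hm i j k)
  simp only [dabs, Finset.sum_mul]
  rw [← lintegral_sum_sum_sum hmi]
  exact lintegral_congr fun s => lintegral_sum_sum_sum (hm' s)

theorem enorm_duh_le {θ : RR n → ℂ} (hθ : Measurable θ) {U V : ℝ → RR n → CC n}
    (hU : Measurable (Function.uncurry U)) (hV : Measurable (Function.uncurry V)) (t : ℝ) (y : RR n) :
    ‖duh θ U V t y‖ₑ ≤
      ∫⁻ s in Ioo 0 t, ∫⁻ x, dabs θ (t - s) (x - y) * (‖U s x‖ₑ * ‖V s x‖ₑ) := by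
  rw [lintegral_dabs_mul hθ (N := fun s x => ‖U s x‖ₑ * ‖V s x‖ₑ) (hU.enorm.mul hV.enorm)]
  refine (enorm_le_sum_enorm _).trans (Finset.sum_le_sum fun i _ => ?_)
  refine (enorm_sum_le _ _).trans (Finset.sum_le_sum fun j _ => ?_)
  refine (enorm_sum_le _ _).trans (Finset.sum_le_sum fun k _ => ?_)
  refine (enorm_integral_le_lintegral_enorm _).trans (lintegral_mono fun s => ?_)
  refine (enorm_integral_le_lintegral_enorm _).trans (lintegral_mono fun x => ?_)
  simp only []
  rw [enorm_mul, enorm_mul, mul_comm]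
  exact mul_le_mul' le_rfl (mul_le_mul' (enorm_apply_le _ _) (enorm_apply_le _ _))

theorem enorm_duh_le_of_bound {θ : RR n → ℂ} (hθ : Measurable θ) {U V : ℝ → RR n → CC n}
    (hU : Measurable (Function.uncurry U)) (hV : Measurable (Function.uncurry V))
    {G : ℝ → ℝ≥0∞} {t : ℝ} (hG : ∀ᵐ s ∂volume.restrict (Ioo 0 t), ∀ᵐ x, ‖U s x‖ₑ * ‖V s x‖ₑ ≤ G s)
    (y : RR n) : ‖duh θ U V t y‖ₑ ≤ ∫⁻ s in Ioo 0 t, dnorm θ (t - s) * G s := by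
  refine (enorm_duh_le hθ hU hV t y).trans (lintegral_mono_ae ?_)
  filter_upwards [hG] with s hs
  have hm : Measurable fun x => dabs θ (t - s) (x - y) :=
    (measurable_dabs hθ).comp (f := fun x => (t - s, x - y)) (by fun_prop)
  calc _ ≤ ∫⁻ x, dabs θ (t - s) (x - y) * G s := by
        refine lintegral_mono_ae ?_
        filter_upwards [hs] with x hx
        gcongr
    _ = _ := by
        rw [lintegral_mul_const _ hm, lintegral_sub_right_eq_self (fun x => dabs θ (t - s) x) y]
        rfl

theorem measurable_duh {θ : RR n → ℂ} (hθ : Measurable θ) {U V : ℝ → RR n → CC n}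
    (hU : Measurable (Function.uncurry U)) (hV : Measurable (Function.uncurry V)) :
    Measurable (Function.uncurry (duh θ U V)) := by
  refine (PiLp.continuous_toLp 2 _).measurable.comp (measurable_pi_lambda _ fun i => ?_)
  refine Finset.measurable_fun_sum _ fun j _ => Finset.measurable_fun_sum _ fun k _ => ?_
  have h1 : ∀ p : ℝ × RR n, ∫ s in Ioo 0 p.1, ∫ x, U s x j * V s x k * dker θ i j k (p.1 - s) (x - p.2)
      = ∫ s, {q : (ℝ × RR n) × ℝ | 0 < q.2 ∧ q.2 < q.1.1}.indicator (fun q => ∫ x,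
        U q.2 x j * V q.2 x k * dker θ i j k (q.1.1 - q.2) (x - q.1.2)) (p, s) := fun p => by
    rw [← integral_indicator measurableSet_Ioo]; rfl
  simp_rw [h1]
  refine (StronglyMeasurable.integral_prod_right' (StronglyMeasurable.indicator ?_
    (MeasurableSet.inter ?_ ?_))).measurable
  · refine StronglyMeasurable.integral_prod_right' (f := fun r : ((ℝ × RR n) × ℝ) × RR n =>
      U r.1.2 r.2 j * V r.1.2 r.2 k * dker θ i j k (r.1.1.1 - r.1.2) (r.2 - r.1.1.2))
      (Measurable.stronglyMeasurable ?_)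
    have hd := (measurable_dker hθ i j k).comp (f := fun r : ((ℝ × RR n) × ℝ) × RR n =>
      (r.1.1.1 - r.1.2, r.2 - r.1.1.2)) (by fun_prop)
    exact ((measurable_coord_comp hU j (by fun_prop) (by fun_prop)).mul
      (measurable_coord_comp hV k (by fun_prop) (by fun_prop))).mul hd
  · exact measurableSet_lt measurable_const measurable_snd
  · exact measurableSet_lt measurable_snd (by fun_prop)

/-! ### Flows -/

/-- `u(s)` is given by the functions `U(s)`, bounded by `g(s)`, for almost all `s ∈ (0,T)`. -/
structure Flow (T : ℝ) (g : ℝ → ℝ≥0∞) (u : ℝ → TDist n) (U : ℝ → RR n → CC n) : Prop where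
  meas : Measurable (Function.uncurry U)
  gmeas : Measurable g
  bound : ∀ s x, ‖U s x‖ₑ ≤ g s
  rep : ∀ᵐ s : ℝ, s ∈ Ioo 0 T → BRep (u s) (U s)

theorem fourier_multS {m : RR n → ℂ} (hm : m.HasTemperateGrowth) (ψ : 𝓢(RR n, ℂ)) (η : RR n) :
    𝓕 (multS m ψ : RR n → ℂ) η = m ((2 * Real.pi) • η) * 𝓕 (ψ : RR n → ℂ) η := by
  have htt := Function.HasTemperateGrowth.comp_const_smul hm (2 * Real.pi)
  rw [← SchwartzMap.fourier_coe, multS, SchwartzMap.fourierMultiplierCLM_apply,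
    FourierTransform.fourier_fourierInv_eq, SchwartzMap.smulLeftCLM_apply_apply htt,
    SchwartzMap.fourier_coe, smul_eq_mul]

theorem lerayGrad_multS_multT {θ : RR n → ℂ} (hθ : θ.HasTemperateGrowth) (he : ∀ ξ, θ (-ξ) = θ ξ)
    {τ : ℝ} (hτ : 0 < τ) {i j k : Fin n}
    (hi : Integrable (fun ξ => lerayGradSymbol i j k ξ * θ ξ * heatSymbol τ ξ) volume)
    (ψ : 𝓢(RR n, ℂ)) (x : RR n) :
    lerayGrad i j k (multS (heatSymbol τ) (multT θ ψ)) x = ∫ y, dker θ i j k τ (x - y) * ψ y := by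
  rw [lerayGrad]
  refine Eq.trans ?_ (fourierInv_mul_fourier (integrable_comp_two_pi hi) ψ.integrable x)
  refine congrFun (congrArg _ (funext fun η => ?_)) x
  rw [multT_eq_multS he hθ, fourier_multS (hasTemperateGrowth_heatSymbol hτ.le), fourier_multS hθ]
  ring

variable {T : ℝ} {g : ℝ → ℝ≥0∞} {u : ℝ → TDist n} {U : ℝ → RR n → CC n}

/-- Identifies `-θ(D) B[u,u](t)` with the function `duh θ U U t`. The minus sign in the definition
of the weak divergence is why `-B` comes out with a plus sign. Testing with `multT θ ψ` makes the
formula available for frequency blocks, whose kernels decay better than that of the full operator.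
-/
theorem Flow.bilin_multT (hF : Flow T g u U) {θ : RR n → ℂ} (hθ : θ.HasTemperateGrowth)
    (he : ∀ ξ, θ (-ξ) = θ ξ)
    (hi : ∀ τ : ℝ, 0 < τ → ∀ i j k : Fin n,
      Integrable (fun ξ => lerayGradSymbol i j k ξ * θ ξ * heatSymbol τ ξ) volume)
    {t : ℝ} (ht : t ∈ Ioo 0 T)
    (hfin : ∫⁻ s in Ioo 0 t, dnorm θ (t - s) * g s ^ 2 < ⊤) (ψ : 𝓢(RR n, ℂ)) (i : Fin n) :
    IntervalIntegrable (bilinIntegrand u u t i (multT θ ψ)) volume 0 t ∧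
      -bilin u u t i (multT θ ψ) = ∫ y, ψ y * duh θ U U t y i := by
  have hθm : Measurable θ := hθ.1.continuous.measurable
  have hae : ∀ᵐ s ∂volume.restrict (Ioo 0 t), bilinIntegrand u u t i (multT θ ψ) s =
      -∑ j, ∑ k, ∫ x, (U s x j * U s x k) * ∫ y, dker θ i j k (t - s) (x - y) * ψ y := by
    filter_upwards [ae_restrict_of_ae hF.rep, ae_restrict_mem measurableSet_Ioo] with s hs hst
    have H := (hs ⟨hst.1, hst.2.trans ht.2⟩).isRep.toFn_ae_eq
    rw [bilinIntegrand, lerayDivProd]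
    congr 1
    refine Finset.sum_congr rfl fun j _ => Finset.sum_congr rfl fun k _ => ?_
    refine integral_congr_ae ?_
    filter_upwards [H] with x hx
    rw [hx, lerayGrad_multS_multT hθ he (sub_pos.2 hst.2) (hi _ (sub_pos.2 hst.2) i j k)]
  have hk : ∀ j k, Integrable (fun s => ∫ x, (U s x j * U s x k) *
        ∫ y, dker θ i j k (t - s) (x - y) * ψ y) (volume.restrict (Ioo 0 t)) ∧
      Integrable (fun y => ψ y * ∫ s in Ioo 0 t, ∫ x, (U s x j * U s x k) *
        dker θ i j k (t - s) (x - y)) volume ∧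
      ∫ s in Ioo 0 t, ∫ x, (U s x j * U s x k) * ∫ y, dker θ i j k (t - s) (x - y) * ψ y =
        ∫ y, ψ y * ∫ s in Ioo 0 t, ∫ x, (U s x j * U s x k) * dker θ i j k (t - s) (x - y) := by
    intro j k
    refine integral_kernel_swap (P := fun s x => U s x j * U s x k)
      (k := fun s x => dker θ i j k (t - s) x) ?_ ?_ (G := fun s => g s ^ 2) (fun s x => ?_) ?_
      ψ.integrable ψ.continuous.measurable
    · exact (measurable_coord_comp hF.meas j measurable_fst measurable_snd).mul
        (measurable_coord_comp hF.meas k measurable_fst measurable_snd)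
    · exact (measurable_dker hθm i j k).comp (f := fun p : ℝ × RR n => (t - p.1, p.2))
        (by fun_prop)
    · rw [enorm_mul, sq]
      gcongr
      · exact (enorm_apply_le _ _).trans (hF.bound s x)
      · exact (enorm_apply_le _ _).trans (hF.bound s x)
    · refine lt_of_le_of_lt (lintegral_mono fun s => ?_) hfin
      simp only [dnorm]
      gcongr
      exact enorm_dker_le θ i j k _ _
  have hint : Integrable (bilinIntegrand u u t i (multT θ ψ)) (volume.restrict (Ioo 0 t)) :=
    (integrable_finsetSum _ fun j _ => integrable_finsetSum _ fun k _ => (hk j k).1).neg.congr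
      (hae.mono fun s hs => hs.symm)
  refine ⟨?_, ?_⟩
  · rw [intervalIntegrable_iff_integrableOn_Ioo_of_le ht.1.le]
    exact hint
  · rw [bilin, intervalIntegral.integral_of_le ht.1.le, integral_Ioc_eq_integral_Ioo,
      integral_congr_ae hae, integral_neg, neg_neg,
      integral_finsetSum _ fun j _ => integrable_finsetSum _ fun k _ => (hk j k).1]
    rw [Finset.sum_congr rfl fun j _ => integral_finsetSum _ fun k _ => (hk j k).1]
    simp_rw [fun j k => (hk j k).2.2]
    rw [← Finset.sum_congr rfl fun j _ => integral_finsetSum _ fun k _ => (hk j k).2.1,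
      ← integral_finsetSum _ fun j _ => integrable_finsetSum _ fun k _ => (hk j k).2.1]
    refine integral_congr_ae (Eventually.of_forall fun y => ?_)
    simp only [duh, Finset.mul_sum]

/-- The blocks of a mild solution satisfy Duhamel's formula at all times. -/
theorem Flow.block (hF : Flow T g u U) {f : TDist n} (hm : IsMildSolution (ENNReal.ofReal T) f u)
    {θ : RR n → ℂ} (hθ : θ.HasTemperateGrowth) (he : ∀ ξ, θ (-ξ) = θ ξ)
    (hi : ∀ τ : ℝ, 0 < τ → ∀ i j k : Fin n,
      Integrable (fun ξ => lerayGradSymbol i j k ξ * θ ξ * heatSymbol τ ξ) volume)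
    {t : ℝ} (ht : t ∈ Ioo 0 T)
    (hfin : ∫⁻ s in Ioo 0 t, dnorm θ (t - s) * g s ^ 2 < ⊤) {A : RR n → CC n}
    (hA : BRep (mult θ (heat t f)) A) :
    BRep (mult θ (u t)) fun y => A y + duh θ U U t y := by
  have hθm : Measurable θ := hθ.1.continuous.measurable
  have hdm : Measurable (duh θ U U t) :=
    (measurable_duh hθm hF.meas hF.meas).comp (f := fun y => (t, y)) measurable_prodMk_left
  have hdb : ∀ y, ‖duh θ U U t y‖ₑ ≤ ∫⁻ s in Ioo 0 t, dnorm θ (t - s) * g s ^ 2 :=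
    enorm_duh_le_of_bound hθm hF.meas hF.meas (Eventually.of_forall fun s =>
      Eventually.of_forall fun x => by
        rw [sq]; exact mul_le_mul' (hF.bound s x) (hF.bound s x))
  have hdb' := enorm_bdd_iff hfin.ne hdb
  obtain ⟨w, hw⟩ := exists_bRep hdm hdb'
  suffices h : mult θ (u t) = mult θ (heat t f) + w by rw [h]; exact hA.add hw
  ext ψ i
  have h1 := (hm.2 t ht.1 ((ENNReal.ofReal_lt_ofReal_iff (ht.1.trans ht.2)).2 ht.2) i
    (multT θ ψ)).2
  have h2 := (hF.bilin_multT hθ he hi ht hfin ψ i).2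
  obtain ⟨B, hB⟩ := hdb'
  have i3 : Integrable (fun y => ψ y • duh θ U U t y) volume :=
    ψ.integrable.smul_bdd B hdm.aestronglyMeasurable (Eventually.of_forall hB)
  rw [mult_apply, h1, sub_eq_add_neg, h2]
  change _ = mult θ (heat t f) ψ i + w ψ i
  rw [hw.rep, mult_apply]
  congr 1
  exact (EuclideanSpace.proj (𝕜 := ℂ) i).integral_comp_comm i3

end

section

/-! ### Bounds of the Duhamel kernels -/

variable {χ φ : RR n → ℝ}

theorem integrable_leray_heat {θ : RR n → ℂ} (hθ : θ.HasTemperateGrowth) {τ : ℝ} (hτ : 0 < τ)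
    (i j k : Fin n) :
    Integrable (fun ξ => lerayGradSymbol i j k ξ * θ ξ * heatSymbol τ ξ) volume := by
  simp_rw [mul_assoc]
  exact ((isSch_heatSymbol hτ).mul_left hθ).integrable_lerayGradSymbol_mul i j k

theorem exists_sum_bound {I : Type*} {w : Fin n → Fin n → Fin n → I → ℝ≥0∞} {b : I → ℝ≥0∞}
    (h : ∀ i j k, ∃ C : ℝ≥0∞, C ≠ ⊤ ∧ ∀ a, w i j k a ≤ C * b a) :
    ∃ C : ℝ≥0∞, C ≠ ⊤ ∧ ∀ a, ∑ i, ∑ j, ∑ k, w i j k a ≤ C * b a := by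
  choose C hC h using h
  refine ⟨∑ i, ∑ j, ∑ k, C i j k, ?_, fun a => ?_⟩
  · exact ENNReal.sum_ne_top.2 fun i _ => ENNReal.sum_ne_top.2 fun j _ =>
      ENNReal.sum_ne_top.2 fun k _ => hC i j k
  · simp only [Finset.sum_mul]
    exact Finset.sum_le_sum fun i _ => Finset.sum_le_sum fun j _ => Finset.sum_le_sum fun k _ =>
      h i j k a

theorem IsLittlewoodPaley.exists_dnorm_phi_le (h : IsLittlewoodPaley χ φ) :
    ∃ C : ℝ≥0∞, C ≠ ⊤ ∧ ∀ (l : ℤ) (τ : ℝ), 0 ≤ τ →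
      dnorm (dsym φ l) τ ≤ C * ENNReal.ofReal (2 ^ l) * decay (4 ^ l * τ) := by
  have h1 := exists_sum_bound (I := ℤ × {τ : ℝ // 0 ≤ τ})
    (w := fun i j k a => kerNorm fun ξ => lerayGradSymbol i j k ξ * dsym φ a.1 ξ *
      heatSymbol (a.2 : ℝ) ξ)
    (b := fun a => ENNReal.ofReal (2 ^ a.1) * decay (4 ^ a.1 * a.2)) fun i j k => by
      obtain ⟨C, hC, hb⟩ := exists_kerNorm_dyadic_heat_le h.annular_phi
        (contDiffOn_lerayGradSymbol i j k) (d := 1)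
        (fun c hc ξ => by rw [lerayGradSymbol_smul i j k hc.ne', pow_one])
      exact ⟨C, hC, fun a => by simpa only [pow_one, mul_assoc] using hb a.1 a.2 a.2.2⟩
  obtain ⟨C, hC, hb⟩ := h1
  refine ⟨C, hC, fun l τ hτ => ?_⟩
  rw [dnorm_eq (h.isSch_phi l).continuous.measurable, mul_assoc]
  exact hb (l, ⟨τ, hτ⟩)

/-- The factor `2^l`, coming from the derivative, tends to zero as `l → -∞`; this keeps the Duhamel
term in `𝓢'_h`. -/
theorem IsLittlewoodPaley.exists_dnorm_chi_le (h : IsLittlewoodPaley χ φ) :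
    ∃ C : ℝ≥0∞, C ≠ ⊤ ∧ ∀ (l : ℤ) (τ : ℝ), 0 < τ →
      dnorm (dsym χ l) τ ≤ C * ENNReal.ofReal (2 ^ l) := by
  have h1 := exists_sum_bound (I := ℤ × {τ : ℝ // 0 < τ})
    (w := fun i j k a => kerNorm fun ξ => lerayGradSymbol i j k ξ * dsym χ a.1 ξ *
      heatSymbol (a.2 : ℝ) ξ)
    (b := fun a => ENNReal.ofReal (2 ^ a.1)) fun i j k => by
      refine ⟨kerNorm (fun ξ => lerayGradSymbol i j k ξ * (χ ξ : ℂ)) *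
        kerNorm (heatSymbol (n := n) 1), ?_, fun a => ?_⟩
      · have hs : IsSch fun ξ => (χ ξ : ℂ) :=
          IsSch.of_hasCompactSupport (h.compact_chi.comp_left (g := Complex.ofReal) rfl)
            (Complex.ofRealCLM.contDiff.comp h.smooth_χ)
        exact ENNReal.mul_ne_top (h.kerNorm_lerayGradSymbol_mul_lt_top hs i j k).ne
          (isSch_heatSymbol one_pos).kerNorm_lt_top.ne
      · refine (kerNorm_mul_le ((h.isSch_chi a.1).integrable_lerayGradSymbol_mul i j k)
          (isSch_heatSymbol a.2.2)).trans ?_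
        rw [kerNorm_heatSymbol a.2.2, mul_right_comm]
        gcongr
        have h2 : (0 : ℝ) < 2 ^ (-a.1) := by positivity
        have e : (fun ξ => lerayGradSymbol i j k ξ * dsym χ a.1 ξ) = fun ξ =>
            (((2 : ℝ) ^ a.1 : ℝ) : ℂ) * (fun ζ => lerayGradSymbol i j k ζ * (χ ζ : ℂ))
              ((2 : ℝ) ^ (-a.1) • ξ) := by
          ext ξ
          simp only [dsym]
          rw [lerayGradSymbol_smul i j k h2.ne', ← mul_assoc, ← mul_assoc, ← Complex.ofReal_mul,
            ← zpow_add₀ two_ne_zero]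
          simp
        rw [e, kerNorm_const_mul, kerNorm_comp_smul (fun ζ => lerayGradSymbol i j k ζ * (χ ζ : ℂ)) h2,
          mul_comm, ← ofReal_norm, Complex.norm_real, Real.norm_of_nonneg (by positivity)]
  obtain ⟨C, hC, hb⟩ := h1
  refine ⟨C, hC, fun l τ hτ => ?_⟩
  rw [dnorm_eq (h.isSch_chi l).continuous.measurable]
  exact hb (l, ⟨τ, hτ⟩)

/-- By homogeneity of degree one the symbol at time `τ` is `τ^{-1/2}` times a dilation of the one at
time one, whose kernel is integrable. -/
theorem IsLittlewoodPaley.exists_dnorm_one_le (h : IsLittlewoodPaley χ φ) :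
    ∃ C : ℝ≥0∞, C ≠ ⊤ ∧ ∀ τ : ℝ, 0 < τ →
      dnorm (fun _ : RR n => 1) τ ≤ C * ENNReal.ofReal (τ ^ (-(1 / 2) : ℝ)) := by
  have h1 := exists_sum_bound (I := {τ : ℝ // 0 < τ})
    (w := fun i j k τ => kerNorm fun ξ : RR n => lerayGradSymbol i j k ξ * 1 *
      heatSymbol (τ : ℝ) ξ)
    (b := fun τ => ENNReal.ofReal ((τ : ℝ) ^ (-(1 / 2) : ℝ))) fun i j k => by
      refine ⟨kerNorm (fun ξ : RR n => lerayGradSymbol i j k ξ * heatSymbol 1 ξ),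
        (h.kerNorm_lerayGradSymbol_mul_lt_top (isSch_heatSymbol one_pos) i j k).ne, fun τ => ?_⟩
      obtain ⟨τ, hτ⟩ := τ
      have h2 : 0 < √τ := Real.sqrt_pos.2 hτ
      have e : (fun ξ : RR n => lerayGradSymbol i j k ξ * 1 * heatSymbol τ ξ) = fun ξ =>
          (((√τ)⁻¹ : ℝ) : ℂ) * (fun ζ : RR n => lerayGradSymbol i j k ζ * heatSymbol 1 ζ)
            (√τ • ξ) := by
        ext ξ
        simp only [heatSymbol_eq_comp_sqrt hτ.le]
        rw [lerayGradSymbol_smul i j k h2.ne', ← mul_assoc, ← mul_assoc, ← Complex.ofReal_mul,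
          inv_mul_cancel₀ h2.ne', Complex.ofReal_one, one_mul, mul_one]
      simp only []
      rw [e, kerNorm_const_mul,
        kerNorm_comp_smul (fun ζ : RR n => lerayGradSymbol i j k ζ * heatSymbol 1 ζ) h2,
        mul_comm, ← ofReal_norm, Complex.norm_real, Real.norm_of_nonneg (by positivity),
        Real.sqrt_eq_rpow, Real.rpow_neg hτ.le]
  obtain ⟨C, hC, hb⟩ := h1
  refine ⟨C, hC, fun τ hτ => ?_⟩
  rw [dnorm_eq measurable_const]
  exact hb ⟨τ, hτ⟩

/-! ### The heat flow -/

theorem InSh.mult {v : TDist n} (h : IsLittlewoodPaley χ φ) (hv : InSh χ v) {m : RR n → ℂ}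
    (hm : IsSch m) : InSh χ (mult m v) := by
  have h1 : Tendsto (fun j : ℤ => kerNorm m * distLpNorm ⊤ (dyadic χ j v)) atBot (𝓝 0) := by
    have := ENNReal.Tendsto.const_mul hv (Or.inr hm.kerNorm_lt_top.ne) (a := kerNorm m)
    rwa [mul_zero] at this
  have h2 : ∀ᶠ j : ℤ in atBot, distLpNorm ⊤ (dyadic χ j v) < ⊤ :=
    hv.eventually_lt_const ENNReal.zero_lt_top
  refine tendsto_of_tendsto_of_tendsto_of_le_of_le' tendsto_const_nhds h1
    (Eventually.of_forall fun _ => zero_le) ?_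
  filter_upwards [h2] with j hj
  obtain ⟨g, hg, -⟩ := exists_bRep_of_distLpNorm_lt_top hj
  have e : dyadic χ j (BesovNS.mult m v) = BesovNS.mult m (dyadic χ j v) := by
    rw [dyadic_eq, dyadic_eq, mult_mult hm.hasTemperateGrowth (h.isSch_chi j).hasTemperateGrowth,
      mult_mult (h.isSch_chi j).hasTemperateGrowth hm.hasTemperateGrowth]
    simp_rw [mul_comm]
  rw [e]
  exact hg.distLpNorm_mult_le hm le_top

theorem measurable_cv_family {m : ℝ → RR n → ℂ} (hm : Measurable (Function.uncurry m))
    {h : RR n → CC n} (hh : Measurable h) :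
    Measurable (Function.uncurry fun t => cv (ker (m t)) h) := by
  have hk := measurable_ker_family hm
  have : StronglyMeasurable fun p : ℝ × RR n => ∫ y, ker (m p.1) (p.2 - y) • h y := by
    refine StronglyMeasurable.integral_prod_right' (f := fun q : (ℝ × RR n) × RR n =>
      ker (m q.1.1) (q.1.2 - q.2) • h q.2) (Measurable.stronglyMeasurable ?_)
    exact (hk.comp (f := fun q : (ℝ × RR n) × RR n => (q.1.1, q.1.2 - q.2)) (by fun_prop)).smul
      (hh.comp measurable_snd)
  exact this.measurable

theorem measurable_heatSymbol : Measurable (Function.uncurry (heatSymbol (n := n))) := by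
  simp only [Function.uncurry_def, heatSymbol]
  fun_prop

/-- The blocks of the heat flow are given by functions with the expected decay. -/
structure HeatBlocks (C : ℝ≥0∞) (φ : RR n → ℝ) (f : TDist n) (A : ℤ → ℝ → RR n → CC n) :
    Prop where
  meas : ∀ l, Measurable (Function.uncurry (A l))
  rep : ∀ l t, 0 < t → BRep (dyadic φ l (heat t f)) (A l t)
  le : ∀ l t, 0 < t → ∀ p, 1 ≤ p →
    eLpNorm (A l t) p volume ≤ C * decay (4 ^ l * t) * distLpNorm p (dyadic φ l f)
  le_top : ∀ l t, 0 < t → ∀ x,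
    ‖A l t x‖ₑ ≤ C * decay (4 ^ l * t) * distLpNorm ⊤ (dyadic φ l f)

/-- The fattened cutoff is one on the support of `φ` and can be inserted in front of the heat flow.
The operator acting on the block is then localized to an annulus, and the annular bound of degree
zero applies in every `L^p`. -/
theorem IsLittlewoodPaley.exists_heatBlocks (h : IsLittlewoodPaley χ φ) :
    ∃ C : ℝ≥0∞, C ≠ ⊤ ∧ ∀ f : TDist n, (∀ l, distLpNorm ⊤ (dyadic φ l f) < ⊤) →
      ∃ A, HeatBlocks C φ f A := by
  obtain ⟨C, hC, hb⟩ := exists_kerNorm_dyadic_heat_le h.annular_fatten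
    (a := fun _ => 1) contDiffOn_const (d := 0) (fun c _ ξ => by simp)
  refine ⟨C, hC, fun f hf => ?_⟩
  choose F hF hFb using fun l => exists_bRep_of_distLpNorm_lt_top (hf l)
  have hs : ∀ l, IsSch (dsym (fatten χ) l) := fun l =>
    isSch_dsym h.annular_fatten.smooth h.annular_fatten.compact l
  have hsh : ∀ l t, 0 < t → IsSch fun ξ => dsym (fatten χ) l ξ * heatSymbol t ξ := fun l t ht =>
    (isSch_heatSymbol ht).mul_left (hs l).hasTemperateGrowth
  have hk : ∀ l t, 0 < t → kerNorm (fun ξ => dsym (fatten χ) l ξ * heatSymbol t ξ) ≤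
      C * decay (4 ^ l * t) := fun l t ht => by simpa using hb l t ht.le
  refine ⟨fun l t => cv (ker fun ξ => dsym (fatten χ) l ξ * heatSymbol t ξ) (F l), ?_, ?_, ?_, ?_⟩
  · intro l
    refine measurable_cv_family (m := fun t ξ => dsym (fatten χ) l ξ * heatSymbol t ξ) ?_ (hF l).meas
    exact ((hs l).continuous.measurable.comp measurable_snd).mul measurable_heatSymbol
  · intro l t ht
    have e : dyadic φ l (heat t f) =
        mult (fun ξ => dsym (fatten χ) l ξ * heatSymbol t ξ) (dyadic φ l f) := by
      rw [dyadic_eq, dyadic_eq, heat, mult_mult (hasTemperateGrowth_heatSymbol ht.le)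
        (h.isSch_phi l).hasTemperateGrowth, mult_mult (h.isSch_phi l).hasTemperateGrowth
        (hsh l t ht).hasTemperateGrowth]
      congr 1
      ext ξ
      rw [← mul_assoc, mul_comm (dsym φ l ξ) (dsym _ l ξ), h.dsym_fatten_mul, mul_comm]
    rw [e]
    exact (hF l).mult (hsh l t ht)
  · intro l t ht p hp
    refine (eLpNorm_cv_le hp (hsh l t ht).ker.continuous.measurable (hF l).meas).trans ?_
    rw [(hF l).distLpNorm_eq]
    gcongr
    exact hk l t ht
  · intro l t ht x
    refine (enorm_cv_le_of_bound (hsh l t ht).ker.continuous.measurable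
      (Eventually.of_forall (hFb l)) x).trans ?_
    gcongr
    exact hk l t ht

/-- Each block of `f` is at most `2^{l(1-ε)}` times the Besov norm, so the dyadic summation is used
with `β = 1 - ε`. -/
theorem tsum_heatBlocks_le {C : ℝ≥0∞} {f : TDist n} {ε t : ℝ}
    (hε : ε ∈ Ioo (0 : ℝ) 1) (ht : 0 < t) :
    ∑' l : ℤ, C * decay (4 ^ l * t) * distLpNorm ⊤ (dyadic φ l f) ≤
      C * ENNReal.ofReal (21 / (1 - ε) * t ^ (-((1 - ε) / 2))) * besovNorm φ (-1 + ε) ⊤ ⊤ f := by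
  calc _ ≤ ∑' l : ℤ, C * (ENNReal.ofReal (((2 : ℝ) ^ l) ^ (1 - ε)) * decay (4 ^ l * t)) *
        besovNorm φ (-1 + ε) ⊤ ⊤ f := by
        refine ENNReal.tsum_le_tsum fun l => ?_
        have := le_weightedSeqNorm_top (-1 + ε) (fun l => distLpNorm ⊤ (dyadic φ l f)) l
        refine (mul_le_mul' le_rfl this).trans (le_of_eq ?_)
        rw [two_zpow_rpow, show -((l : ℝ) * (-1 + ε)) = l * (1 - ε) by ring, besovNorm]
        ring
    _ ≤ _ := by
        rw [ENNReal.tsum_mul_right, ENNReal.tsum_mul_left]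
        gcongr
        exact tsum_dyadic_decay_le (by linarith [hε.2]) (by linarith [hε.1]) ht

/-- The heat flow as a function. -/
def heatSum (A : ℤ → ℝ → RR n → CC n) (t : ℝ) (x : RR n) : CC n :=
  if 0 < t then ∑' l, A l t x else 0

theorem HeatBlocks.bRep_heatSum (h : IsLittlewoodPaley χ φ) {C : ℝ≥0∞} (hC : C ≠ ⊤) {f : TDist n}
    (hS : InSh χ f) {A : ℤ → ℝ → RR n → CC n} (hA : HeatBlocks C φ f A) {ε : ℝ}
    (hε : ε ∈ Ioo (0 : ℝ) 1) (hf : besovNorm φ (-1 + ε) ⊤ ⊤ f < ⊤) :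
    Measurable (Function.uncurry (heatSum A)) ∧
      (∀ t, 0 < t → BRep (heat t f) (heatSum A t)) ∧
      ∀ t, 0 < t → ∀ x, ‖heatSum A t x‖ₑ ≤
        C * ENNReal.ofReal (21 / (1 - ε) * t ^ (-((1 - ε) / 2))) * besovNorm φ (-1 + ε) ⊤ ⊤ f := by
  have hle := fun t ht => tsum_heatBlocks_le (φ := φ) (C := C) (f := f) (t := t) hε ht
  have hfin : ∀ t, 0 < t →
      ∑' l : ℤ, C * decay (4 ^ l * t) * distLpNorm ⊤ (dyadic φ l f) ≠ ⊤ := fun t ht =>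
    ((hle t ht).trans_lt (by finiteness)).ne
  have hsum : ∀ t, 0 < t → ∀ x, Summable fun l => A l t x := fun t ht x => by
    refine (ENNReal.summable_toReal (hfin t ht)).of_norm_bounded fun l => ?_
    rw [← toReal_enorm]
    exact ENNReal.toReal_mono (ENNReal.ne_top_of_tsum_ne_top (hfin t ht) l) (hA.le_top l t ht x)
  refine ⟨?_, fun t ht => ?_, fun t ht x => ?_⟩
  · have hset : MeasurableSet {p : ℝ × RR n | 0 < p.1} := measurableSet_lt measurable_const
      measurable_fst
    have e : Function.uncurry (heatSum A) = fun p => ∑' l,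
        {p : ℝ × RR n | 0 < p.1}.indicator (Function.uncurry (A l)) p := by
      ext1 ⟨t, x⟩
      by_cases ht : 0 < t
      · simp [heatSum, ht, indicator]
      · simp [heatSum, ht, indicator]
    rw [e]
    have hsp : ∀ p, Summable fun l =>
        {p : ℝ × RR n | 0 < p.1}.indicator (Function.uncurry (A l)) p := by
      rintro ⟨t, x⟩
      by_cases ht : 0 < t
      · simpa [indicator, ht] using hsum t ht x
      · simp [indicator, ht]
    obtain ⟨σ⟩ : Nonempty (ℕ ≃ ℤ) := ⟨Equiv.intEquivNat.symm⟩
    refine measurable_of_tendsto_metrizable (f := fun J p => ∑ i ∈ Finset.range J,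
      {p : ℝ × RR n | 0 < p.1}.indicator (Function.uncurry (A (σ i))) p)
      (fun J => Finset.measurable_fun_sum _ fun i _ => (hA.meas _).indicator hset) ?_
    rw [tendsto_pi_nhds]
    intro p
    have h1 := (σ.hasSum_iff (f := fun l => {p : ℝ × RR n | 0 < p.1}.indicator
      (Function.uncurry (A l)) p)).2 (hsp p).hasSum
    exact h1.tendsto_sum_nat
  · have h1 : heatSum A t = fun x => ∑' l, A l t x := by ext1 x; simp [heatSum, ht]
    rw [h1]
    exact InSh.bRep_tsum h (hS.mult h (isSch_heatSymbol ht)) (fun l => hA.rep l t ht)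
      (fun l x => hA.le_top l t ht x) (hfin t ht)
  · rw [heatSum, if_pos ht]
    refine (enorm_le_tsum_of_hasSum (hsum t ht x).hasSum).trans ?_
    exact (ENNReal.tsum_le_tsum fun l => hA.le_top l t ht x).trans (hle t ht)

end

section

/-! ### The pointwise version of the linear operator -/

variable {χ φ : RR n → ℝ}

/-- The kernel version of `lop`. -/
def flop (C : ℝ≥0∞) (φ : RR n → ℝ) (g : ℝ → ℝ≥0∞) (b : ℤ → ℝ → RR n → ℝ≥0∞) (l : ℤ) (t : ℝ)
    (y : RR n) : ℝ≥0∞ :=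
  ∫⁻ s in Ioo 0 t, ∫⁻ x, dabs (dsym φ l) (t - s) (x - y) * (C * g s * ∑' i : ℕ, b (l - 2 + i) s x)

/-- The hypotheses under which `flop` is bounded by `lop`. -/
structure FlopData (C D : ℝ≥0∞) (φ : RR n → ℝ) (g : ℝ → ℝ≥0∞) : Prop where
  gmeas : Measurable g
  sym : ∀ l, Measurable (dsym φ l)
  ker : ∀ (l : ℤ) (τ : ℝ), 0 ≤ τ →
    dnorm (dsym φ l) τ ≤ D * ENNReal.ofReal (2 ^ l) * decay (4 ^ l * τ)

variable {C D : ℝ≥0∞} {g : ℝ → ℝ≥0∞}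

theorem measurable_flop_integrand (H : FlopData C D φ g) {b : ℤ → ℝ → RR n → ℝ≥0∞}
    (hb : ∀ l, Measurable (Function.uncurry (b l))) (l : ℤ) :
    Measurable fun r : ((ℝ × RR n) × ℝ) × RR n => dabs (dsym φ l) (r.1.1.1 - r.1.2) (r.2 - r.1.1.2) *
      (C * g r.1.2 * ∑' i : ℕ, b (l - 2 + i) r.1.2 r.2) := by
  have h1 := (measurable_dabs (H.sym l)).comp (f := fun r : ((ℝ × RR n) × ℝ) × RR n =>
      (r.1.1.1 - r.1.2, r.2 - r.1.1.2)) (by fun_prop)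
  have h2 : Measurable fun r : ((ℝ × RR n) × ℝ) × RR n => ∑' i : ℕ, b (l - 2 + i) r.1.2 r.2 :=
    Measurable.tsum fun i => (hb (l - 2 + i)).comp (f := fun r : ((ℝ × RR n) × ℝ) × RR n =>
      (r.1.2, r.2)) (by fun_prop)
  have h3 : Measurable fun r : ((ℝ × RR n) × ℝ) × RR n => C * g r.1.2 :=
    (H.gmeas.comp (by fun_prop)).const_mul C
  exact h1.mul (h3.mul h2)

theorem measurable_flop_inner (H : FlopData C D φ g) {b : ℤ → ℝ → RR n → ℝ≥0∞}
    (hb : ∀ l, Measurable (Function.uncurry (b l))) (l : ℤ) :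
    Measurable fun q : (ℝ × RR n) × ℝ => ∫⁻ x, dabs (dsym φ l) (q.1.1 - q.2) (x - q.1.2) *
      (C * g q.2 * ∑' i : ℕ, b (l - 2 + i) q.2 x) :=
  (measurable_flop_integrand H hb l).lintegral_prod_right' (ν := volume)

theorem measurable_flop (H : FlopData C D φ g) {b : ℤ → ℝ → RR n → ℝ≥0∞}
    (hb : ∀ l, Measurable (Function.uncurry (b l))) (l : ℤ) :
    Measurable (Function.uncurry (flop C φ g b l)) := by
  have h1 : ∀ p : ℝ × RR n, Function.uncurry (flop C φ g b l) p =
      ∫⁻ s, {q : (ℝ × RR n) × ℝ | 0 < q.2 ∧ q.2 < q.1.1}.indicator (fun q => ∫⁻ x,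
        dabs (dsym φ l) (q.1.1 - q.2) (x - q.1.2) *
          (C * g q.2 * ∑' i : ℕ, b (l - 2 + i) q.2 x)) (p, s) := fun p => by
    rw [Function.uncurry_def]
    simp only [flop]
    rw [← lintegral_indicator measurableSet_Ioo]; rfl
  have h2 := (measurable_flop_inner H hb l).indicator
    (s := {q : (ℝ × RR n) × ℝ | 0 < q.2 ∧ q.2 < q.1.1}) (MeasurableSet.inter
      (measurableSet_lt measurable_const measurable_snd)
      (measurableSet_lt measurable_snd (by fun_prop)))
  have h3 := h2.lintegral_prod_right' (ν := volume)
  refine (congrArg Measurable (funext h1)).mpr h3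

theorem flop_le_of_le (H : FlopData C D φ g) {b : ℤ → ℝ → RR n → ℝ≥0∞} {β : ℤ → ℝ → ℝ≥0∞}
    (h : ∀ l s x, b l s x ≤ β l s) (l : ℤ) (t : ℝ) (y : RR n) :
    flop C φ g b l t y ≤ lop (D * C) g β l t := by
  refine setLIntegral_mono' measurableSet_Ioo fun s hs => ?_
  have hm : Measurable fun x => dabs (dsym φ l) (t - s) (x - y) :=
    (measurable_dabs (H.sym l)).comp (f := fun x => (t - s, x - y)) (by fun_prop)
  calc _ ≤ ∫⁻ x, dabs (dsym φ l) (t - s) (x - y) * (C * g s * ∑' i : ℕ, β (l - 2 + i) s) := by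
        refine lintegral_mono fun x => ?_
        gcongr
        exact h _ _ _
    _ = dnorm (dsym φ l) (t - s) * (C * g s * ∑' i : ℕ, β (l - 2 + i) s) := by
        rw [lintegral_mul_const _ hm,
          lintegral_sub_right_eq_self (fun x => dabs (dsym φ l) (t - s) x) y]
        rfl
    _ ≤ (D * ENNReal.ofReal (2 ^ l) * decay (4 ^ l * (t - s))) *
          (C * g s * ∑' i : ℕ, β (l - 2 + i) s) := by
        gcongr
        exact H.ker l _ (sub_nonneg.2 hs.2.le)
    _ = _ := by ring

/-- The pointwise operator `flop` is kept alongside its scalar bound `lop` because no `L^p` bound of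
the solution is known beforehand: the comparison is made pointwise with sup norms, and `L^p` norms
are taken only of the resulting majorant. -/
theorem eLpNorm_flop_le (H : FlopData C D φ g) {p : ℝ≥0∞} (hp : 1 ≤ p)
    {b : ℤ → ℝ → RR n → ℝ≥0∞} (hb : ∀ l, Measurable (Function.uncurry (b l)))
    {β : ℤ → ℝ → ℝ≥0∞} (hβ : ∀ l, Measurable (β l))
    (h : ∀ l s, eLpNorm (b l s) p volume ≤ β l s) (l : ℤ) (t : ℝ) :
    eLpNorm (flop C φ g b l t) p volume ≤ lop (D * C) g β l t := by
  have hmβ := measurable_high hβ l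
  have hg := H.gmeas
  have hd := measurable_decay
  have hmx : ∀ s, Measurable fun x => ∑' i : ℕ, b (l - 2 + i) s x := fun s =>
    Measurable.tsum fun i => (hb (l - 2 + i)).comp (f := fun x => (s, x)) measurable_prodMk_left
  refine eLpNorm_lintegral_le hp (F := fun s y => ∫⁻ x, dabs (dsym φ l) (t - s) (x - y) *
    (C * g s * ∑' i : ℕ, b (l - 2 + i) s x)) ?_ ?_ ?_
  · exact (measurable_flop_inner H hb l).comp (f := fun q : ℝ × RR n => ((t, q.2), q.1)) (by fun_prop)
  · fun_prop
  · filter_upwards [ae_restrict_mem measurableSet_Ioo] with s hs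
    have hm : Measurable fun z => dabs (dsym φ l) (t - s) (-z) :=
      (measurable_dabs (H.sym l)).comp (f := fun z => (t - s, -z)) (by fun_prop)
    have h1 := eLpNorm_lconv_le hp hm (a := fun x => C * g s * ∑' i : ℕ, b (l - 2 + i) s x)
      ((hmx s).const_mul _)
    simp only [neg_sub] at h1
    refine h1.trans ?_
    rw [lintegral_neg_eq_self (fun x => dabs (dsym φ l) (t - s) x),
      eLpNorm_const_mul (zero_lt_one.trans_le hp).ne' _ (hmx s)]
    calc _ ≤ (D * ENNReal.ofReal (2 ^ l) * decay (4 ^ l * (t - s))) *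
          (C * g s * ∑' i : ℕ, β (l - 2 + i) s) := by
          gcongr
          · exact H.ker l _ (sub_nonneg.2 hs.2.le)
          · refine (eLpNorm_tsum_le hp fun i => ?_).trans (ENNReal.tsum_le_tsum fun i => h _ _)
            exact (hb (l - 2 + i)).comp (f := fun x => (s, x)) measurable_prodMk_left
      _ = _ := by ring

theorem flop_mono_ae {b b' : ℤ → ℝ → RR n → ℝ≥0∞}
    (h : ∀ᵐ s : ℝ, ∀ l x, b l s x ≤ b' l s x) (l : ℤ) (t : ℝ) (y : RR n) :
    flop C φ g b l t y ≤ flop C φ g b' l t y := by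
  refine lintegral_mono_ae ?_
  filter_upwards [ae_restrict_of_ae h] with s hs
  gcongr
  exact hs _ _

theorem flop_add (H : FlopData C D φ g) {b b' : ℤ → ℝ → RR n → ℝ≥0∞}
    (hb : ∀ l, Measurable (Function.uncurry (b l))) (l : ℤ) (t : ℝ) (y : RR n) :
    flop C φ g (fun l s x => b l s x + b' l s x) l t y =
      flop C φ g b l t y + flop C φ g b' l t y := by
  have h1 := measurable_flop_integrand (C := C) H hb l
  have h2 : Measurable fun s => ∫⁻ x, dabs (dsym φ l) (t - s) (x - y) *
      (C * g s * ∑' i : ℕ, b (l - 2 + i) s x) :=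
    (measurable_flop_inner H hb l).comp (f := fun s : ℝ => ((t, y), s)) (by fun_prop)
  unfold flop
  rw [← lintegral_add_left h2]
  refine lintegral_congr fun s => ?_
  have h3 : Measurable fun x => dabs (dsym φ l) (t - s) (x - y) *
      (C * g s * ∑' i : ℕ, b (l - 2 + i) s x) := h1.comp (f := fun x : RR n => (((t, y), s), x)) (by fun_prop)
  rw [← lintegral_add_left h3]
  refine lintegral_congr fun x => ?_
  rw [ENNReal.tsum_add, mul_add, mul_add]

theorem measurable_iterate_flop (H : FlopData C D φ g) {b : ℤ → ℝ → RR n → ℝ≥0∞}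
    (hb : ∀ l, Measurable (Function.uncurry (b l))) (M : ℕ) (l : ℤ) :
    Measurable (Function.uncurry ((flop C φ g)^[M] b l)) := by
  induction M generalizing l with
  | zero => exact hb l
  | succ M ih => rw [Function.iterate_succ_apply']; exact measurable_flop H ih l

theorem measurable_iterate_lop (hg : Measurable g) {c : ℝ≥0∞} {b : ℤ → ℝ → ℝ≥0∞}
    (hb : ∀ l, Measurable (b l)) (M : ℕ) (l : ℤ) : Measurable ((lop c g)^[M] b l) := by
  induction M generalizing l with
  | zero => exact hb l
  | succ M ih => rw [Function.iterate_succ_apply']; exact measurable_lop hg ih l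

theorem iterate_flop_le_of_le (H : FlopData C D φ g) {b : ℤ → ℝ → RR n → ℝ≥0∞}
    {β : ℤ → ℝ → ℝ≥0∞} (h : ∀ l s x, b l s x ≤ β l s) (M : ℕ) (l : ℤ) (t : ℝ) (y : RR n) :
    (flop C φ g)^[M] b l t y ≤ (lop (D * C) g)^[M] β l t := by
  induction M generalizing l t y with
  | zero => exact h l t y
  | succ M ih =>
    rw [Function.iterate_succ_apply', Function.iterate_succ_apply']
    exact flop_le_of_le H ih l t y

theorem eLpNorm_iterate_flop_le (H : FlopData C D φ g) {p : ℝ≥0∞} (hp : 1 ≤ p)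
    {b : ℤ → ℝ → RR n → ℝ≥0∞} (hb : ∀ l, Measurable (Function.uncurry (b l)))
    {β : ℤ → ℝ → ℝ≥0∞} (hβ : ∀ l, Measurable (β l))
    (h : ∀ l s, eLpNorm (b l s) p volume ≤ β l s) (M : ℕ) (l : ℤ) (t : ℝ) :
    eLpNorm ((flop C φ g)^[M] b l t) p volume ≤ (lop (D * C) g)^[M] β l t := by
  induction M generalizing l t with
  | zero => exact h l t
  | succ M ih =>
    rw [Function.iterate_succ_apply', Function.iterate_succ_apply']
    exact eLpNorm_flop_le H hp (measurable_iterate_flop H hb M)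
      (measurable_iterate_lop H.gmeas hβ M) ih l t

/-- Subsolutions are bounded by the Neumann series up to the iterates. -/
theorem le_tsum_iterate_flop_add (H : FlopData C D φ g) {a b : ℤ → ℝ → RR n → ℝ≥0∞}
    (hb : ∀ l, Measurable (Function.uncurry (b l)))
    (h : ∀ l t y, a l t y ≤ b l t y + flop C φ g a l t y) (M : ℕ) (l : ℤ) (t : ℝ) (y : RR n) :
    a l t y ≤ ∑' m : ℕ, (flop C φ g)^[m] b l t y + (flop C φ g)^[M] a l t y := by
  have h1 : ∀ M l t y, (flop C φ g)^[M] a l t y ≤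
      (flop C φ g)^[M] b l t y + (flop C φ g)^[M + 1] a l t y := by
    intro M
    induction M with
    | zero => exact h
    | succ M ih =>
      intro l t y
      rw [Function.iterate_succ_apply', Function.iterate_succ_apply' _ M b,
        Function.iterate_succ_apply' _ (M + 1),
        ← flop_add H (measurable_iterate_flop H hb M)]
      exact flop_mono_ae (Eventually.of_forall fun s l x => ih l s x) l t y
  have h2 : a l t y ≤ ∑ m ∈ Finset.range M, (flop C φ g)^[m] b l t y + (flop C φ g)^[M] a l t y := by
    induction M with
    | zero => simp
    | succ M ih =>
      rw [Finset.sum_range_succ, add_assoc]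
      exact ih.trans (by gcongr; exact h1 M l t y)
  refine h2.trans ?_
  gcongr
  exact ENNReal.sum_le_tsum _

/-! ### Localization of the products in frequency -/

theorem IsLittlewoodPaley.isSch_leray_phi_heat (h : IsLittlewoodPaley χ φ) (i j k : Fin n) (l : ℤ)
    {τ : ℝ} (hτ : 0 ≤ τ) :
    IsSch fun ξ => lerayGradSymbol i j k ξ * dsym φ l ξ * heatSymbol τ ξ := by
  have h1 := (h.annular_phi.isSch_mul (contDiffOn_lerayGradSymbol i j k)).comp_smul
    (c := (2 : ℝ) ^ (-l)) (by positivity)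
  have h2 : IsSch fun ξ => lerayGradSymbol i j k ξ * dsym φ l ξ := by
    have := h1.mul_left (Function.HasTemperateGrowth.const (((2 : ℝ) ^ l : ℝ) : ℂ))
    convert this using 2 with ξ
    rw [lerayGradSymbol_smul i j k (by positivity), ← mul_assoc, ← mul_assoc, ← Complex.ofReal_mul,
      ← zpow_add₀ two_ne_zero]
    simp [dsym]
  have h3 := h2.mul_left (hasTemperateGrowth_heatSymbol hτ)
  simp_rw [mul_comm (heatSymbol τ _)] at h3
  exact h3

/-- If both factors are nonzero, then `|ξ + η| < 2 · (4/3) · 2^{l-2} = (2/3) 2^l`, which is below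
the support `|ζ| > (3/4) 2^l` of the last one. This is the origin of the shift `l - 2` throughout.
-/
theorem IsLittlewoodPaley.spectral (h : IsLittlewoodPaley χ φ) (l : ℤ) (c : RR n → ℂ)
    (c' : RR n → ℂ) (ξ η : RR n) : dsym χ (l - 2) ξ * dsym χ (l - 2) η *
      (c (-(ξ + η)) * dsym φ l (-(ξ + η)) * c' (-(ξ + η))) = 0 := by
  have h2 : (0 : ℝ) < 2 ^ (-(l - 2)) := by positivity
  have key : ∀ ζ : RR n, 4 / 3 ≤ 2 ^ (-(l - 2)) * ‖ζ‖ → dsym χ (l - 2) ζ = 0 := fun ζ hζ => by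
    rw [dsym, h.chi_eq_zero (by rwa [norm_two_zpow_smul]), Complex.ofReal_zero]
  by_cases hξ : 4 / 3 ≤ 2 ^ (-(l - 2)) * ‖ξ‖
  · rw [key ξ hξ]; ring
  by_cases hη : 4 / 3 ≤ 2 ^ (-(l - 2)) * ‖η‖
  · rw [key η hη]; ring
  have h3 : dsym φ l (-(ξ + η)) = 0 := by
    rw [dsym, h.phi_eq_zero, Complex.ofReal_zero]
    left
    rw [norm_two_zpow_smul, norm_neg]
    have e : (2 : ℝ) ^ (-(l - 2)) = 2 ^ (-l) * 4 := by
      rw [show -(l - 2) = -l + 2 by ring, zpow_add₀ two_ne_zero]; norm_num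
    rw [e] at hξ hη
    have : (2 : ℝ) ^ (-l) * ‖ξ + η‖ ≤ 2 ^ (-l) * (‖ξ‖ + ‖η‖) := by gcongr; exact norm_add_le _ _
    linarith
  rw [h3]; ring

/-- The product of the low frequency parts `S` integrates to zero against the localized kernel and
may be subtracted. The difference is `(V - S)_j V_k + S_j (V - S)_k`, where `V` and `S` are bounded
by multiples of `G`. -/
theorem IsLittlewoodPaley.enorm_integral_leray_le (h : IsLittlewoodPaley χ φ) {V S : RR n → CC n}
    {l : ℤ} (hV : Measurable V) {G : ℝ≥0∞} (hGt : G ≠ ⊤) (hG : ∀ x, ‖V x‖ₑ ≤ G)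
    (hS : S = cv (ker (dsym χ (l - 2))) V) {E : RR n → ℝ≥0∞} (hE : ∀ᵐ x, ‖V x - S x‖ₑ ≤ E x)
    (i j k : Fin n) {τ : ℝ} (hτ : 0 ≤ τ) (y : RR n) :
    ‖∫ x, V x j * V x k * dker (dsym φ l) i j k τ (x - y)‖ₑ ≤
      ∫⁻ x, ‖dker (dsym φ l) i j k τ (x - y)‖ₑ * ((1 + kerNorm fun ξ => (χ ξ : ℂ)) * G * E x) := by
  have hχ := h.isSch_chi (l - 2)
  have hK := h.isSch_leray_phi_heat i j k l hτ
  have hχm := hχ.ker.continuous.measurable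
  have hSm : Measurable S := hS ▸ measurable_cv hχm hV
  set Cχ := kerNorm fun ξ => (χ ξ : ℂ) with hCχ
  have hCe : kerNorm (dsym χ (l - 2)) = Cχ := kerNorm_dsym χ (l - 2)
  have hCt : Cχ ≠ ⊤ := hCe ▸ hχ.kerNorm_lt_top.ne
  have hSb : ∀ x, ‖S x‖ₑ ≤ Cχ * G := fun x => by
    rw [hS, ← hCe]; exact enorm_cv_le_of_bound hχm (Eventually.of_forall hG) x
  obtain ⟨B, hB⟩ := enorm_bdd_iff hGt hG
  obtain ⟨B', hB'⟩ := enorm_bdd_iff (ENNReal.mul_ne_top hCt hGt) hSb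
  have hz : ∫ x, ker (fun ξ => lerayGradSymbol i j k ξ * dsym φ l ξ * heatSymbol τ ξ) (x - y) *
      (cv (ker (dsym χ (l - 2))) V x j * cv (ker (dsym χ (l - 2))) V x k) = 0 :=
    integral_ker_mul_cv_mul_cv hK hχ hχ (h.spectral l _ _) hV ⟨B, hB⟩ hV ⟨B, hB⟩ y j k
  rw [← hS] at hz
  have hKi : Integrable (fun x => dker (dsym φ l) i j k τ (x - y)) volume :=
    hK.ker.integrable.comp_sub_right y
  have hc : ∀ i, ∀ {V : RR n → CC n}, Measurable V → Measurable fun x => V x i := fun i V hV =>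
    (measurable_coord i).comp hV
  have i1 : Integrable (fun x => dker (dsym φ l) i j k τ (x - y) * (V x j * V x k)) volume := by
    refine hKi.mul_bdd (c := B * B) ((hc j hV).mul (hc k hV)).aestronglyMeasurable
      (Eventually.of_forall fun x => ?_)
    rw [norm_mul]
    exact mul_le_mul ((PiLp.norm_apply_le _ j).trans (hB x)) ((PiLp.norm_apply_le _ k).trans (hB x))
      (norm_nonneg _) ((norm_nonneg _).trans (hB x))
  have i2 : Integrable (fun x => dker (dsym φ l) i j k τ (x - y) * (S x j * S x k)) volume := by
    refine hKi.mul_bdd (c := B' * B') ((hc j hSm).mul (hc k hSm)).aestronglyMeasurable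
      (Eventually.of_forall fun x => ?_)
    rw [norm_mul]
    exact mul_le_mul ((PiLp.norm_apply_le _ j).trans (hB' x))
      ((PiLp.norm_apply_le _ k).trans (hB' x)) (norm_nonneg _) ((norm_nonneg _).trans (hB' x))
  have e1 : ∫ x, V x j * V x k * dker (dsym φ l) i j k τ (x - y) =
      ∫ x, dker (dsym φ l) i j k τ (x - y) * (V x j * V x k - S x j * S x k) := by
    simp_rw [mul_sub]
    rw [integral_sub i1 i2, show ∫ x, dker (dsym φ l) i j k τ (x - y) * (S x j * S x k) = 0 from hz,
      sub_zero]
    congr 1; ext x; ring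
  rw [e1]
  refine (enorm_integral_le_lintegral_enorm _).trans (lintegral_mono_ae ?_)
  filter_upwards [hE] with x hx
  rw [enorm_mul]
  gcongr
  have e2 : V x j * V x k - S x j * S x k = (V x - S x) j * V x k + S x j * (V x - S x) k := by
    simp only [PiLp.sub_apply]; ring
  rw [e2]
  refine (enorm_add_le _ _).trans ?_
  rw [enorm_mul, enorm_mul]
  calc _ ≤ E x * G + (Cχ * G) * E x := by
        gcongr
        · exact (enorm_apply_le _ _).trans hx
        · exact (enorm_apply_le _ _).trans (hG x)
        · exact (enorm_apply_le _ _).trans (hSb x)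
        · exact (enorm_apply_le _ _).trans hx
    _ = _ := by ring

end

section

/-! ### Bounds in time of the dyadic blocks -/

variable {χ φ : RR n → ℝ} {T : ℝ} {g : ℝ → ℝ≥0∞}

theorem exists_tsum_geometric_le {σ : ℝ} (hσ : 0 < σ) : ∃ A : ℝ≥0∞, A ≠ ⊤ ∧ ∀ l : ℤ,
    ∑' i : ℕ, ENNReal.ofReal ((2 : ℝ) ^ (-(((l - 2 + i : ℤ) : ℝ) * σ))) ≤
      A * ENNReal.ofReal ((2 : ℝ) ^ (-((l : ℝ) * σ))) := by
  have hr1 : (2 : ℝ) ^ (-σ) < 1 := Real.rpow_lt_one_of_one_lt_of_neg one_lt_two (by linarith)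
  have hs : Summable fun i : ℕ => (2 : ℝ) ^ (2 * σ) * ((2 : ℝ) ^ (-σ)) ^ i :=
    (summable_geometric_of_lt_one (by positivity) hr1).mul_left _
  refine ⟨∑' i : ℕ, ENNReal.ofReal ((2 : ℝ) ^ (2 * σ) * ((2 : ℝ) ^ (-σ)) ^ i),
    hs.tsum_ofReal_ne_top, fun l => ?_⟩
  rw [← ENNReal.tsum_mul_right]
  refine ENNReal.tsum_le_tsum fun i => ?_
  rw [← ENNReal.ofReal_mul (by positivity), ← Real.rpow_natCast, ← Real.rpow_mul two_pos.le,
    ← Real.rpow_add two_pos, ← Real.rpow_add two_pos]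
  refine le_of_eq ?_
  congr 2
  push_cast; ring

theorem lintegral_decay_le (l : ℤ) (T : ℝ) :
    ∫⁻ t in Ioo 0 T, decay (4 ^ l * t) ≤
      ENNReal.ofReal Real.pi * ENNReal.ofReal ((2 : ℝ) ^ (-l)) ^ 2 := by
  have e : ENNReal.ofReal ((2 : ℝ) ^ (-l)) ^ 2 * ENNReal.ofReal (4 ^ l) = 1 := by
    rw [← ENNReal.ofReal_pow (by positivity), ← ENNReal.ofReal_mul (by positivity),
      show (4 : ℝ) = 2 ^ 2 by norm_num, ← zpow_natCast, ← zpow_natCast, ← zpow_mul, ← zpow_mul,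
      ← zpow_add₀ two_ne_zero]
    simp [mul_comm]
  calc _ ≤ ∫⁻ t in Ioi (0 : ℝ), decay (4 ^ l * t) := lintegral_mono_set Ioo_subset_Ioi_self
    _ = ENNReal.ofReal ((2 : ℝ) ^ (-l)) ^ 2 *
        (ENNReal.ofReal (4 ^ l) * ∫⁻ t in Ioi (0 : ℝ), decay (4 ^ l * t)) := by
        rw [← mul_assoc, e, one_mul]
    _ ≤ _ := by
        rw [mul_comm]
        gcongr
        exact lintegral_dyadic_decay_le l

theorem eLpNorm_decay_le (l : ℤ) (T : ℝ) :
    eLpNorm (fun t => decay (4 ^ l * t)) 2 (volume.restrict (Ioo 0 T)) ≤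
      ENNReal.ofReal Real.pi * ENNReal.ofReal ((2 : ℝ) ^ (-l)) := by
  refine le_of_sq_le_sq ?_
  rw [eLpNorm_two_sq, mul_pow]
  calc _ ≤ ∫⁻ t in Ioo 0 T, decay (4 ^ l * t) := lintegral_mono fun t =>
        pow_le_of_le_one zero_le (decay_le_one _) two_ne_zero
    _ ≤ ENNReal.ofReal Real.pi * ENNReal.ofReal ((2 : ℝ) ^ (-l)) ^ 2 := lintegral_decay_le l T
    _ ≤ _ := by
        gcongr
        have : 1 ≤ ENNReal.ofReal Real.pi := by
          rw [ENNReal.one_le_ofReal]; linarith [Real.pi_gt_three]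
        calc _ = ENNReal.ofReal Real.pi * 1 := (mul_one _).symm
          _ ≤ _ := by rw [sq]; gcongr

theorem TimeGood.eLpNorm_lt_top {α : ℝ} (hg : TimeGood α T g) (hα : 0 ≤ α) (hT : 0 < T) :
    eLpNorm g 2 (volume.restrict (Ioo 0 T)) < ⊤ := by
  have h := hg.lintegral_sq_lt_top hα hT
  rw [← eLpNorm_two_sq] at h
  by_contra h2
  rw [not_lt, top_le_iff] at h2
  rw [h2] at h
  simp at h

theorem two_zpow_eq_rpow (l : ℤ) (r : ℝ) (h : r = l) : (2 : ℝ) ^ l = (2 : ℝ) ^ r := by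
  rw [h, Real.rpow_intCast]

/-- The Neumann series with data `a` of the free evolution. -/
theorem TimeGood.exists_neumann_bound {α : ℝ} (hg : TimeGood α T g) (hT : 0 < T) (h0 : 0 < α)
    (h1 : α ≤ 1) {c K : ℝ≥0∞} (hc : c ≠ ⊤) (hK : K ≠ ⊤) {s : ℝ} (hs : -1 < s) {q : ℝ≥0∞}
    (hq : 1 ≤ q) {a : ℤ → ℝ≥0∞} (ha : weightedSeqNorm s q a < ⊤) :
    ∃ D : ℤ → ℝ≥0∞, weightedSeqNorm (s + 1) q D < ⊤ ∧ ∀ l,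
      ∫⁻ t in Ioo 0 T, g t * ∑' i : ℕ, ∑' m : ℕ,
        (lop c g)^[m] (fun l t => K * decay (4 ^ l * t) * a l) (l - 2 + i) t ≤ D l := by
  have hd := measurable_decay
  have hr : 0 < s + 1 := by linarith
  have hq0 : q ≠ 0 := (zero_lt_one.trans_le hq).ne'
  obtain ⟨A, hA, hAm⟩ := exists_tsum_maj_le hr
  obtain ⟨A', hA', hAm'⟩ := exists_weightedSeqNorm_maj_le hr
  obtain ⟨lam, hl, hlop⟩ := hg.exists_wN_lop_le h0 h1 hc hA
  set b : ℤ → ℝ → ℝ≥0∞ := fun l t => K * decay (4 ^ l * t) * a l with hb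
  -- The size of the free blocks in `L²(0,T)`: the decay profile contributes `2^{-l}`. Hence the
  -- weight is raised from `s` to `s + 1 > 0`.
  set d : ℤ → ℝ≥0∞ := fun l => K * ENNReal.ofReal Real.pi *
    (ENNReal.ofReal ((2 : ℝ) ^ ((l : ℝ) * (-1))) * a l) with hd'
  have hbm : ∀ l, Measurable (b l) := fun l => by simp only [hb]; fun_prop
  have hbd : ∀ l, wN lam T (b l) ≤ maj (s + 1) d l := fun l => by
    refine le_trans ?_ (le_maj _ _ _)
    refine (wN_le_eLpNorm hl.le _).trans ?_
    have e : b l = fun t => (K * a l) * decay (4 ^ l * t) := by ext t; simp only [hb]; ring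
    rw [e, eLpNorm_const_mul two_ne_zero _ (by fun_prop)]
    refine (mul_le_mul' le_rfl (eLpNorm_decay_le l T)).trans (le_of_eq ?_)
    simp only [hd']
    rw [two_zpow_eq_rpow (-l) ((l : ℝ) * (-1)) (by push_cast; ring)]
    ring
  have hit := iterate_lop_wN_le hg.1 hlop (hAm d) hbm hbd
  have hP : ∀ l, wN lam T (fun t => ∑' m : ℕ, (lop c g)^[m] b l t) ≤ 2 * maj (s + 1) d l := by
    intro l
    refine (wN_tsum_le lam T fun m => (hit m).1 l).trans
      ((ENNReal.tsum_le_tsum fun m => (hit m).2 l).trans (le_of_eq ?_))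
    rw [ENNReal.tsum_mul_right, ENNReal.tsum_geometric, ENNReal.one_sub_inv_two, inv_inv]
  have hG := hg.eLpNorm_lt_top h0.le hT
  refine ⟨fun l => eLpNorm g 2 (volume.restrict (Ioo 0 T)) * expw (-lam) T * A *
    (2 * maj (s + 1) d l), ?_, fun l => ?_⟩
  · rw [weightedSeqNorm_const_mul _ hq0, weightedSeqNorm_const_mul _ hq0]
    have h2 : weightedSeqNorm (s + 1) q (maj (s + 1) d) < ⊤ := by
      refine (hAm' q hq d).trans_lt (ENNReal.mul_lt_top hA'.lt_top ?_)
      rw [hd', weightedSeqNorm_const_mul _ hq0, weightedSeqNorm_shift, add_neg_cancel_right]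
      finiteness
    have h3 := expw_ne_top (-lam) T
    have h4 := hG.ne
    finiteness
  · refine lintegral_mul_high_le hl.le (D := fun l => 2 * maj (s + 1) d l) (fun l => ?_) hg.1
      (b := fun l t => ∑' m : ℕ, (lop c g)^[m] b l t)
      (fun l => Measurable.tsum fun m => (hit m).1 l) hP l
    rw [ENNReal.tsum_mul_left, mul_left_comm]
    gcongr
    exact hAm d l

/-- The uniform bound of the `l`-th block that follows from Duhamel's formula. -/
def blockBound (K D : ℝ≥0∞) (g : ℝ → ℝ≥0∞) (a : ℤ → ℝ≥0∞) (l : ℤ) (t : ℝ) : ℝ≥0∞ :=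
  K * decay (4 ^ l * t) * a l +
    ∫⁻ s in Ioo 0 t, (D * ENNReal.ofReal (2 ^ l) * decay (4 ^ l * (t - s))) * g s ^ 2

theorem measurable_blockBound {K D : ℝ≥0∞} (hg : Measurable g) (a : ℤ → ℝ≥0∞) (l : ℤ) :
    Measurable (blockBound K D g a l) := by
  have hd := measurable_decay
  refine Measurable.add (by fun_prop) ?_
  refine measurable_duhamel (Φ := fun t s =>
    (D * ENNReal.ofReal (2 ^ l) * decay (4 ^ l * (t - s))) * g s ^ 2) ?_
  simp only [Function.uncurry_def]
  fun_prop

/-- The a priori bound from which the iteration starts: the free part is of order `2^{-lε}` and the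
quadratic part, by `duhamel_self_sq_le`, of order `2^{-lα}`. Both rates are positive, so the sums
over high frequencies converge. -/
theorem TimeGood.exists_blockBound_le {α : ℝ} (hg : TimeGood α T g) (hT : 0 < T) (h0 : 0 ≤ α)
    (h1 : α ≤ 1) {K D : ℝ≥0∞} (hK : K ≠ ⊤) (hD : D ≠ ⊤) {ε : ℝ} {a : ℤ → ℝ≥0∞}
    (ha : weightedSeqNorm (-1 + ε) ⊤ a < ⊤) : ∃ K' : ℝ≥0∞, K' ≠ ⊤ ∧ ∀ l,
      eLpNorm (blockBound K D g a l) 2 (volume.restrict (Ioo 0 T)) ≤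
        K' * (ENNReal.ofReal ((2 : ℝ) ^ (-((l : ℝ) * ε))) +
          ENNReal.ofReal ((2 : ℝ) ^ (-((l : ℝ) * α)))) := by
  have hgg := hg
  obtain ⟨hgm, K₁, hK₁, hb⟩ := hg
  have hG := hgg.lintegral_sq_lt_top h0 hT
  have hd := measurable_decay
  obtain ⟨N, hN⟩ : ∃ N, N = weightedSeqNorm (-1 + ε) ⊤ a := ⟨_, rfl⟩
  set Q := K₁ * (D ^ 2 * ENNReal.ofReal Real.pi * ∫⁻ s in Ioo 0 T, g s ^ 2) with hQ
  have hQt : Q ≠ ⊤ := by have := hG.ne; finiteness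
  refine ⟨K * ENNReal.ofReal Real.pi * N + (1 + Q), ?_, fun l => ?_⟩
  · have := hN ▸ ha.ne
    finiteness
  have hm2 : Measurable fun t => ∫⁻ s in Ioo 0 t,
      (D * ENNReal.ofReal (2 ^ l) * decay (4 ^ l * (t - s))) * g s ^ 2 := by
    refine measurable_duhamel (Φ := fun t s =>
      (D * ENNReal.ofReal (2 ^ l) * decay (4 ^ l * (t - s))) * g s ^ 2) ?_
    simp only [Function.uncurry_def]
    fun_prop
  have e1 : eLpNorm (fun t => K * decay (4 ^ l * t) * a l) 2 (volume.restrict (Ioo 0 T)) ≤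
      K * ENNReal.ofReal Real.pi * N * ENNReal.ofReal ((2 : ℝ) ^ (-((l : ℝ) * ε))) := by
    have e : (fun t => K * decay (4 ^ l * t) * a l) = fun t => (K * a l) * decay (4 ^ l * t) := by
      ext t; ring
    rw [e, eLpNorm_const_mul two_ne_zero _ (by fun_prop)]
    calc _ ≤ K * (ENNReal.ofReal ((2 : ℝ) ^ (-((l : ℝ) * (-1 + ε)))) * N) *
          (ENNReal.ofReal Real.pi * ENNReal.ofReal ((2 : ℝ) ^ (-l))) := by
          gcongr
          · rw [hN]; exact le_weightedSeqNorm_top _ a l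
          · exact eLpNorm_decay_le l T
      _ = K * ENNReal.ofReal Real.pi * N * (ENNReal.ofReal ((2 : ℝ) ^ (-((l : ℝ) * (-1 + ε)))) *
          ENNReal.ofReal ((2 : ℝ) ^ (-l))) := by ring
      _ = _ := by
          rw [two_zpow_eq_rpow (-l) (-(l : ℝ)) (by push_cast; ring),
            ← ENNReal.ofReal_mul (by positivity), ← Real.rpow_add two_pos]
          congr 3; ring
  have e2 : eLpNorm (fun t => ∫⁻ s in Ioo 0 t,
      (D * ENNReal.ofReal (2 ^ l) * decay (4 ^ l * (t - s))) * g s ^ 2) 2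
      (volume.restrict (Ioo 0 T)) ≤ (1 + Q) * ENNReal.ofReal ((2 : ℝ) ^ (-((l : ℝ) * α))) := by
    refine le_of_sq_le_sq ((duhamel_self_sq_le h0 h1 hgm hb l).trans ?_)
    rw [mul_pow]
    gcongr
    calc Q ≤ 1 + Q := le_add_self
      _ = (1 + Q) * 1 := (mul_one _).symm
      _ ≤ _ := by rw [sq]; gcongr; exact le_self_add
  have hm1 : Measurable fun t => K * decay (4 ^ l * t) * a l :=
    ((measurable_decay.comp (measurable_const.mul measurable_id)).const_mul K).mul_const (a l)
  refine (eLpNorm_add_le hm1.aestronglyMeasurable hm2.aestronglyMeasurable one_le_two).trans ?_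
  rw [mul_add]
  refine add_le_add (e1.trans ?_) (e2.trans ?_)
  · exact mul_le_mul' le_self_add le_rfl
  · exact mul_le_mul' le_add_self le_rfl

theorem exists_tsum_two_geometric_le {ε α : ℝ} (hε : 0 < ε) (hα : 0 < α) (K : ℝ≥0∞) :
    ∃ A : ℝ≥0∞, A ≠ ⊤ ∧ ∀ l : ℤ, ∑' i : ℕ, K *
      (ENNReal.ofReal ((2 : ℝ) ^ (-(((l - 2 + i : ℤ) : ℝ) * ε))) +
        ENNReal.ofReal ((2 : ℝ) ^ (-(((l - 2 + i : ℤ) : ℝ) * α)))) ≤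
      A * (K * (ENNReal.ofReal ((2 : ℝ) ^ (-((l : ℝ) * ε))) +
        ENNReal.ofReal ((2 : ℝ) ^ (-((l : ℝ) * α))))) := by
  obtain ⟨A₁, h₁, hA₁⟩ := exists_tsum_geometric_le hε
  obtain ⟨A₂, h₂, hA₂⟩ := exists_tsum_geometric_le hα
  refine ⟨A₁ + A₂, by finiteness, fun l => ?_⟩
  rw [ENNReal.tsum_mul_left, ENNReal.tsum_add, mul_left_comm]
  gcongr
  rw [mul_add]
  gcongr
  · exact (hA₁ l).trans (by gcongr; exact le_self_add)
  · exact (hA₂ l).trans (by gcongr; exact le_add_self)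

/-! ### Persistence of regularity -/

variable {u : ℝ → TDist n} {U : ℝ → RR n → CC n}

/-- The dyadic blocks of a mild solution: Duhamel's formula. -/
theorem Flow.bRep_block (h : IsLittlewoodPaley χ φ) (hF : Flow T g u U) {f : TDist n}
    (hm : IsMildSolution (ENNReal.ofReal T) f u) {K D : ℝ≥0∞} (hD : D ≠ ⊤)
    {A : ℤ → ℝ → RR n → CC n} (hA : HeatBlocks K φ f A)
    (H : FlopData (1 + kerNorm fun ξ => (χ ξ : ℂ)) D φ g)
    (hg2 : ∫⁻ s in Ioo 0 T, g s ^ 2 < ⊤) (l : ℤ) {t : ℝ} (ht : t ∈ Ioo 0 T) :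
    BRep (dyadic φ l (u t)) (fun y => A l t y + duh (dsym φ l) U U t y) ∧
      ∀ y, ‖A l t y + duh (dsym φ l) U U t y‖ₑ ≤
        blockBound K D g (fun l => distLpNorm ⊤ (dyadic φ l f)) l t := by
  have hd := measurable_decay
  have hgm := hF.gmeas
  have hle : ∫⁻ s in Ioo 0 t, dnorm (dsym φ l) (t - s) * g s ^ 2 ≤
      ∫⁻ s in Ioo 0 t, (D * ENNReal.ofReal (2 ^ l) * decay (4 ^ l * (t - s))) * g s ^ 2 := by
    refine setLIntegral_mono' measurableSet_Ioo fun s hs => ?_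
    gcongr
    exact H.ker l _ (sub_nonneg.2 hs.2.le)
  have hfin : ∫⁻ s in Ioo 0 t, dnorm (dsym φ l) (t - s) * g s ^ 2 < ⊤ := by
    refine hle.trans_lt ?_
    calc _ ≤ ∫⁻ s in Ioo 0 t, (D * ENNReal.ofReal (2 ^ l)) * g s ^ 2 := by
          refine lintegral_mono fun s => ?_
          gcongr ?_ * _
          exact mul_le_of_le_one_right' (decay_le_one _)
      _ ≤ (D * ENNReal.ofReal (2 ^ l)) * ∫⁻ s in Ioo 0 T, g s ^ 2 := by
          rw [lintegral_const_mul _ (by fun_prop)]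
          gcongr
          exact ht.2.le
      _ < ⊤ := by have := hg2.ne; finiteness
  refine ⟨hF.block hm (h.isSch_phi l).hasTemperateGrowth (dsym_neg h.radial_φ l)
    (fun τ hτ i j k => integrable_leray_heat (h.isSch_phi l).hasTemperateGrowth hτ i j k) ht hfin
    (hA.rep l t ht.1), fun y => ?_⟩
  refine (enorm_add_le _ _).trans (add_le_add (hA.le_top l t ht.1 y) (le_trans ?_ hle))
  exact enorm_duh_le_of_bound (H.sym l) hF.meas hF.meas (Eventually.of_forall fun s =>
    Eventually.of_forall fun x => by rw [sq]; exact mul_le_mul' (hF.bound s x) (hF.bound s x)) y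

/-- The Duhamel term only sees the high frequencies of one factor. -/
theorem Flow.enorm_duh_le_flop (h : IsLittlewoodPaley χ φ) (hF : Flow T g u U)
    {D : ℝ≥0∞} (H : FlopData (1 + kerNorm fun ξ => (χ ξ : ℂ)) D φ g)
    (hgt : ∀ᵐ s ∂volume.restrict (Ioo 0 T), g s ≠ ⊤)
    {W : ℤ → ℝ → RR n → CC n} (hWm : ∀ l, Measurable (Function.uncurry (W l)))
    (hW : ∀ l, ∀ t ∈ Ioo 0 T, BRep (dyadic φ l (u t)) (W l t)) {ρ : ℤ → ℝ → ℝ≥0∞}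
    (hρ : ∀ l, ∀ t ∈ Ioo 0 T, ∀ x, ‖W l t x‖ₑ ≤ ρ l t)
    (hs : ∀ l : ℤ, ∀ᵐ s ∂volume.restrict (Ioo 0 T), ∑' i : ℕ, ρ (l - 2 + i) s ≠ ⊤)
    (l : ℤ) {t : ℝ} (ht : t ∈ Ioo 0 T) (y : RR n) :
    ‖duh (dsym φ l) U U t y‖ₑ ≤ flop (1 + kerNorm fun ξ => (χ ξ : ℂ)) φ g
      (fun l s x => (Ioo 0 T).indicator (fun s => ‖W l s x‖ₑ) s) l t y := by
  set Cχ := 1 + kerNorm fun ξ => (χ ξ : ℂ)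
  have hset : MeasurableSet {p : ℝ × RR n | p.1 ∈ Ioo 0 T} := measurable_fst measurableSet_Ioo
  have hNm : Measurable (Function.uncurry fun s x => Cχ * g s * ∑' i : ℕ,
      (Ioo 0 T).indicator (fun s => ‖W (l - 2 + i) s x‖ₑ) s) := by
    have h1 : Measurable fun p : ℝ × RR n => ∑' i : ℕ,
        {p : ℝ × RR n | p.1 ∈ Ioo 0 T}.indicator (fun p => ‖W (l - 2 + i) p.1 p.2‖ₑ) p :=
      Measurable.tsum fun i => (hWm _).enorm.indicator hset
    exact ((hF.gmeas.comp measurable_fst).const_mul Cχ).mul h1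
  rw [flop, lintegral_dabs_mul (H.sym l) hNm]
  have hsub : Ioo 0 t ⊆ Ioo 0 T := Ioo_subset_Ioo_right ht.2.le
  refine (enorm_le_sum_enorm _).trans (Finset.sum_le_sum fun i _ => ?_)
  refine (enorm_sum_le _ _).trans (Finset.sum_le_sum fun j _ => ?_)
  refine (enorm_sum_le _ _).trans (Finset.sum_le_sum fun k _ => ?_)
  refine (enorm_integral_le_lintegral_enorm _).trans (lintegral_mono_ae ?_)
  filter_upwards [ae_restrict_of_ae hF.rep, ae_restrict_of_ae_restrict_of_subset hsub hgt,
    ae_restrict_of_ae_restrict_of_subset hsub (hs l), ae_restrict_mem measurableSet_Ioo]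
    with s hsr hsg hss hst
  have hsT : s ∈ Ioo 0 T := hsub hst
  have hU := hsr hsT
  refine h.enorm_integral_leray_le hU.meas hsg (hF.bound s) rfl ?_ i j k (sub_nonneg.2 hst.2.le) y
  -- `u = Ṡ_{l-2} u + ∑_{k ≥ l-2} Δ̇_k u`, so that the error of the low frequency part is bounded by
  -- the sum of the high blocks.
  have h1 := h.bRep_of_high (hU.mult (h.isSch_chi (l - 2))) (fun i => hW (l - 2 + i) s hsT)
    (fun i x => hρ _ s hsT x) hss
  filter_upwards [hU.isRep.ae_eq h1.isRep] with x hx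
  rw [hx]
  change ‖cv (ker (dsym χ (l - 2))) (U s) x + _ - cv (ker (dsym χ (l - 2))) (U s) x‖ₑ ≤ _
  rw [add_sub_cancel_left]
  have h2 : Summable fun i : ℕ => W (l - 2 + i) s x := by
    refine (ENNReal.summable_toReal hss).of_norm_bounded fun i => ?_
    rw [← toReal_enorm]
    exact ENNReal.toReal_mono (ENNReal.ne_top_of_tsum_ne_top hss i) (hρ _ s hsT x)
  refine (enorm_le_tsum_of_hasSum h2.hasSum).trans (le_of_eq ?_)
  exact tsum_congr fun i => by rw [indicator_of_mem hsT]

end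

section

/-! ### Persistence of Besov regularity -/

variable {χ φ : RR n → ℝ} {T : ℝ} {g : ℝ → ℝ≥0∞} {u : ℝ → TDist n} {U : ℝ → RR n → CC n}

/-- The restriction to `(0,T)` of the pointwise norm of a family of functions. -/
def cutNorm (T : ℝ) (W : ℤ → ℝ → RR n → CC n) (l : ℤ) (s : ℝ) (x : RR n) : ℝ≥0∞ :=
  (Ioo 0 T).indicator (fun s => ‖W l s x‖ₑ) s

theorem cutNorm_of_mem {W : ℤ → ℝ → RR n → CC n} {l : ℤ} {s : ℝ} (hs : s ∈ Ioo 0 T) (x : RR n) :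
    cutNorm T W l s x = ‖W l s x‖ₑ := indicator_of_mem hs _

theorem cutNorm_of_notMem {W : ℤ → ℝ → RR n → CC n} {l : ℤ} {s : ℝ} (hs : s ∉ Ioo 0 T)
    (x : RR n) : cutNorm T W l s x = 0 := indicator_of_notMem hs _

theorem measurable_cutNorm {W : ℤ → ℝ → RR n → CC n}
    (hW : ∀ l, Measurable (Function.uncurry (W l))) (l : ℤ) :
    Measurable (Function.uncurry (cutNorm T W l)) :=
  (hW l).enorm.indicator (s := {p : ℝ × RR n | p.1 ∈ Ioo 0 T}) (measurable_fst measurableSet_Ioo)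

theorem IsLittlewoodPaley.exists_flopData (h : IsLittlewoodPaley χ φ) : ∃ D : ℝ≥0∞, D ≠ ⊤ ∧
    ∀ g : ℝ → ℝ≥0∞, Measurable g → FlopData (1 + kerNorm fun ξ => (χ ξ : ℂ)) D φ g := by
  obtain ⟨D, hD, hb⟩ := h.exists_dnorm_phi_le
  exact ⟨D, hD, fun g hg => ⟨hg, fun l => (h.isSch_phi l).continuous.measurable, hb⟩⟩

/-- The blocks of a mild solution. -/
def flowBlock (φ : RR n → ℝ) (U : ℝ → RR n → CC n) (A : ℤ → ℝ → RR n → CC n) (l : ℤ) (t : ℝ)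
    (y : RR n) : CC n := A l t y + duh (dsym φ l) U U t y

/-- The blocks of a mild solution are controlled by the Neumann series of the free evolution. -/
theorem Flow.ae_cutNorm_le (h : IsLittlewoodPaley χ φ) (hF : Flow T g u U) {α : ℝ}
    (hg : TimeGood α T g) (hT : 0 < T) (h0 : 0 < α) (h1 : α ≤ 1) {f : TDist n}
    (hm : IsMildSolution (ENNReal.ofReal T) f u) {K D : ℝ≥0∞} (hK : K ≠ ⊤) (hD : D ≠ ⊤)
    {A : ℤ → ℝ → RR n → CC n} (hA : HeatBlocks K φ f A)
    (H : FlopData (1 + kerNorm fun ξ => (χ ξ : ℂ)) D φ g) {ε : ℝ} (hε : 0 < ε)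
    (hf : besovNorm φ (-1 + ε) ⊤ ⊤ f < ⊤) :
    (∀ l, ∀ t ∈ Ioo 0 T, ∀ y, ‖duh (dsym φ l) U U t y‖ₑ ≤
      flop (1 + kerNorm fun ξ => (χ ξ : ℂ)) φ g (cutNorm T (flowBlock φ U A)) l t y) ∧
    ∀ᵐ t : ℝ, ∀ l y, cutNorm T (flowBlock φ U A) l t y ≤
      ∑' m : ℕ, (flop (1 + kerNorm fun ξ => (χ ξ : ℂ)) φ g)^[m] (cutNorm T A) l t y := by
  set Cχ := 1 + kerNorm fun ξ => (χ ξ : ℂ) with hCχ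
  have hCt : Cχ ≠ ⊤ := by
    have := kerNorm_dsym χ (0 : ℤ) ▸ (h.isSch_chi 0).kerNorm_lt_top.ne
    finiteness
  have hG := hg.lintegral_sq_lt_top h0.le hT
  set ρ := blockBound K D g (fun l => distLpNorm ⊤ (dyadic φ l f)) with hρ
  have hρm : ∀ l, Measurable (ρ l) := measurable_blockBound hg.1 _
  obtain ⟨K', hK', hL2⟩ := hg.exists_blockBound_le hT h0.le h1 hK hD hf
  obtain ⟨A', hA', hgeo⟩ := exists_tsum_two_geometric_le hε h0 K'
  set β : ℤ → ℝ≥0∞ := fun l => K' * (ENNReal.ofReal ((2 : ℝ) ^ (-((l : ℝ) * ε))) +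
    ENNReal.ofReal ((2 : ℝ) ^ (-((l : ℝ) * α)))) with hβ
  have hβt : ∀ l, β l ≠ ⊤ := fun l => by simp only [hβ]; finiteness
  have hsum : ∀ l : ℤ, ∀ᵐ s ∂volume.restrict (Ioo 0 T), ∑' i : ℕ, ρ (l - 2 + i) s ≠ ⊤ := by
    intro l
    have e1 : eLpNorm (fun s => ∑' i : ℕ, ρ (l - 2 + i) s) 2 (volume.restrict (Ioo 0 T)) < ⊤ := by
      refine (eLpNorm_tsum_le one_le_two fun i : ℕ => hρm (l - 2 + i)).trans_lt ?_
      refine ((ENNReal.tsum_le_tsum fun i : ℕ => hL2 (l - 2 + i)).trans (hgeo l)).trans_lt ?_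
      exact ENNReal.mul_lt_top hA'.lt_top (hβt l).lt_top
    have e2 : ∫⁻ s in Ioo 0 T, (∑' i : ℕ, ρ (l - 2 + i) s) ^ 2 < ⊤ := by
      rw [← eLpNorm_two_sq]; finiteness
    filter_upwards [ae_lt_top ((Measurable.tsum fun i : ℕ => hρm (l - 2 + i)).pow_const 2) e2.ne]
      with s hs h2
    rw [h2] at hs
    simp at hs
  have hgt : ∀ᵐ s ∂volume.restrict (Ioo 0 T), g s ≠ ⊤ := by
    filter_upwards [ae_lt_top (hg.1.pow_const 2) hG.ne] with s hs h2
    rw [h2] at hs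
    simp at hs
  have hblock := fun (l : ℤ) (t : ℝ) (ht : t ∈ Ioo 0 T) => hF.bRep_block h hm hD hA H hG l ht
  have hWm : ∀ l, Measurable (Function.uncurry (flowBlock φ U A l)) := fun l =>
    (hA.meas l).add (measurable_duh (H.sym l) hF.meas hF.meas)
  have hduh : ∀ l, ∀ t ∈ Ioo 0 T, ∀ y, ‖duh (dsym φ l) U U t y‖ₑ ≤
      flop Cχ φ g (cutNorm T (flowBlock φ U A)) l t y := fun l t ht y =>
    hF.enorm_duh_le_flop h H hgt hWm (fun l t ht => (hblock l t ht).1)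
      (fun l t ht => (hblock l t ht).2) hsum l ht y
  refine ⟨hduh, ?_⟩
  have hle : ∀ l t y, cutNorm T (flowBlock φ U A) l t y ≤
      cutNorm T A l t y + flop Cχ φ g (cutNorm T (flowBlock φ U A)) l t y := by
    intro l t y
    by_cases ht : t ∈ Ioo 0 T
    · rw [cutNorm_of_mem ht, cutNorm_of_mem ht]
      exact (enorm_add_le _ _).trans (add_le_add le_rfl (hduh l t ht y))
    · rw [cutNorm_of_notMem ht]; exact zero_le
  have hleρ : ∀ l t y, cutNorm T (flowBlock φ U A) l t y ≤ ρ l t := by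
    intro l t y
    by_cases ht : t ∈ Ioo 0 T
    · rw [cutNorm_of_mem ht]; exact (hblock l t ht).2 y
    · rw [cutNorm_of_notMem ht]; exact zero_le
  obtain ⟨lam, hl, hlop⟩ := hg.exists_wN_lop_le h0 h1 (c := D * Cχ) (by finiteness) hA'
  have hit := iterate_lop_wN_le hg.1 hlop (D := β) hgeo hρm
    (fun l => (wN_le_eLpNorm hl.le _).trans (hL2 l))
  -- The iterates of the a priori bound `ρ`, which is uniform in `x`, halve at each step in the
  -- weighted norm.
  have hae : ∀ᵐ t : ℝ, t ∈ Ioo 0 T → ∀ l, Tendsto (fun M => (lop (D * Cχ) g)^[M] ρ l t) atTop (𝓝 0) := by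
    rw [← ae_restrict_iff' measurableSet_Ioo]
    exact ae_all_iff.2 fun l => ae_tendsto_zero_of_wN_le (hβt l) (fun M => (hit M).1 l)
      fun M => (hit M).2 l
  filter_upwards [hae] with t ht l y
  by_cases htT : t ∈ Ioo 0 T
  · have h3 : Tendsto (fun M => ∑' m : ℕ, (flop Cχ φ g)^[m] (cutNorm T A) l t y +
        (lop (D * Cχ) g)^[M] ρ l t) atTop
        (𝓝 (∑' m : ℕ, (flop Cχ φ g)^[m] (cutNorm T A) l t y + 0)) :=
      tendsto_const_nhds.add (ht htT l)
    rw [add_zero] at h3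
    -- The remainder of the Neumann expansion is dominated by the iterates of `ρ`; letting `M → ∞`
    -- removes it.
    refine ge_of_tendsto' h3 fun M => ?_
    refine (le_tsum_iterate_flop_add H (measurable_cutNorm hA.meas) hle M l t y).trans ?_
    gcongr
    exact iterate_flop_le_of_le H hleρ M l t y
  · rw [cutNorm_of_notMem htT]; exact zero_le

set_option maxHeartbeats 1000000 in
/-- The free evolution controls all Besov norms of a mild solution. -/
theorem Flow.distLpNorm_le (h : IsLittlewoodPaley χ φ) (hF : Flow T g u U) {α : ℝ}
    (hg : TimeGood α T g) (hT : 0 < T) (h0 : 0 < α) (h1 : α ≤ 1) {f : TDist n}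
    (hm : IsMildSolution (ENNReal.ofReal T) f u) {K D : ℝ≥0∞} (hK : K ≠ ⊤) (hD : D ≠ ⊤)
    {A : ℤ → ℝ → RR n → CC n} (hA : HeatBlocks K φ f A)
    (H : FlopData (1 + kerNorm fun ξ => (χ ξ : ℂ)) D φ g) {ε : ℝ} (hε : 0 < ε)
    (hf : besovNorm φ (-1 + ε) ⊤ ⊤ f < ⊤) {p : ℝ≥0∞} (hp : 1 ≤ p) (l : ℤ) {t : ℝ}
    (ht : t ∈ Ioo 0 T) :
    distLpNorm p (dyadic φ l (u t)) ≤ K * decay (4 ^ l * t) * distLpNorm p (dyadic φ l f) +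
      lop (D * (1 + kerNorm fun ξ => (χ ξ : ℂ))) g (fun l t => ∑' m : ℕ,
        (lop (D * (1 + kerNorm fun ξ => (χ ξ : ℂ))) g)^[m]
          (fun l t => K * decay (4 ^ l * t) * distLpNorm p (dyadic φ l f)) l t) l t := by
  set Cχ := 1 + kerNorm fun ξ => (χ ξ : ℂ) with hCχ
  obtain ⟨hduh, hae⟩ := hF.ae_cutNorm_le h hg hT h0 h1 hm hK hD hA H hε hf
  have hG := hg.lintegral_sq_lt_top h0.le hT
  have hd := measurable_decay
  rw [(hF.bRep_block h hm hD hA H hG l ht).1.distLpNorm_eq]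
  have hAm : Measurable (A l t) := (hA.meas l).comp measurable_prodMk_left
  have hDm : Measurable (duh (dsym φ l) U U t) :=
    (measurable_duh (H.sym l) hF.meas hF.meas).comp measurable_prodMk_left
  refine (eLpNorm_add_le hAm.aestronglyMeasurable hDm.aestronglyMeasurable hp).trans ?_
  have hAc := measurable_cutNorm (T := T) hA.meas
  have hit := measurable_iterate_flop H hAc
  have hβm : ∀ l : ℤ, Measurable fun t => K * decay (4 ^ l * t) * distLpNorm p (dyadic φ l f) :=
    fun l => by fun_prop
  have hitl := measurable_iterate_lop hg.1 (c := D * Cχ) hβm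
  have hb : ∀ l s, eLpNorm (cutNorm T A l s) p volume ≤
      K * decay (4 ^ l * s) * distLpNorm p (dyadic φ l f) := by
    intro l s
    by_cases hs : s ∈ Ioo 0 T
    · refine le_trans (le_of_eq ?_) (hA.le l s hs.1 p hp)
      refine (eLpNorm_congr_enorm_ae (Eventually.of_forall fun x => ?_))
      rw [cutNorm_of_mem hs, enorm_eq_self]
    · have : cutNorm T A l s = fun _ => 0 := funext fun x => cutNorm_of_notMem hs x
      rw [this]
      simp
  refine add_le_add (hA.le l t ht.1 p hp) ?_
  refine (eLpNorm_mono_enorm (g := flop Cχ φ g (fun l t y => ∑' m : ℕ,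
    (flop Cχ φ g)^[m] (cutNorm T A) l t y) l t) fun y => ?_).trans ?_
  · rw [enorm_eq_self]
    -- The Neumann bound holds for almost every time only. Under the time integral this suffices, so
    -- the estimate holds for every `t`, as required by the true supremum in the norm.
    exact (hduh l t ht y).trans (flop_mono_ae hae l t y)
  · have hPm : ∀ l, Measurable (Function.uncurry fun t y => ∑' m : ℕ,
        (flop Cχ φ g)^[m] (cutNorm T A) l t y) := fun l =>
      (Measurable.tsum fun m => hit m l : Measurable fun x : ℝ × RR n => ∑' m : ℕ,
        Function.uncurry ((flop Cχ φ g)^[m] (cutNorm T A) l) x)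
    refine eLpNorm_flop_le H hp hPm (fun l => Measurable.tsum fun m => hitl m l) (fun l s => ?_) l t
    refine (eLpNorm_tsum_le hp fun m => (hit m l).comp measurable_prodMk_left).trans ?_
    exact ENNReal.tsum_le_tsum fun m => eLpNorm_iterate_flop_le H hp hAc hβm hb m l s

/-- Persistence of regularity: a mild solution lies in every `Z^s_{p,q}` allowed by its data. -/
theorem Flow.persist (h : IsLittlewoodPaley χ φ) (hF : Flow T g u U) {α : ℝ}
    (hg : TimeGood α T g) (hT : 0 < T) (h0 : 0 < α) (h1 : α ≤ 1) {f : TDist n}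
    (hm : IsMildSolution (ENNReal.ofReal T) f u) {ε : ℝ} (hε : 0 < ε)
    (hf : besovNorm φ (-1 + ε) ⊤ ⊤ f < ⊤) {s : ℝ} (hs : -1 < s) {p q : ℝ≥0∞} (hp : 1 ≤ p)
    (hq : 1 ≤ q) (hfs : besovNorm φ s p q f < ⊤) :
    cheminLernerNorm φ T 1 (s + 2) p q u < ⊤ ∧ cheminLernerSupNorm φ T s p q u < ⊤ := by
  obtain ⟨K, hK, hb⟩ := h.exists_heatBlocks
  obtain ⟨A, hA⟩ := hb f fun l => (le_weightedSeqNorm_top _ (fun l => distLpNorm ⊤ (dyadic φ l f))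
    l).trans_lt (ENNReal.mul_lt_top (by finiteness) hf)
  obtain ⟨D, hD, hH⟩ := h.exists_flopData
  have H := hH g hg.1
  have hd := measurable_decay
  have hq0 : q ≠ 0 := (zero_lt_one.trans_le hq).ne'
  set Cχ := 1 + kerNorm fun ξ => (χ ξ : ℂ) with hCχ
  have hCt : Cχ ≠ ⊤ := by
    have := kerNorm_dsym χ (0 : ℤ) ▸ (h.isSch_chi 0).kerNorm_lt_top.ne
    finiteness
  set a : ℤ → ℝ≥0∞ := fun l => distLpNorm p (dyadic φ l f) with ha
  have hat : weightedSeqNorm s q a < ⊤ := hfs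
  have key := fun (l : ℤ) (t : ℝ) (ht : t ∈ Ioo 0 T) =>
    hF.distLpNorm_le h hg hT h0 h1 hm hK hD hA H hε hf hp l ht
  set c := D * Cχ with hc
  have hct : c ≠ ⊤ := by finiteness
  obtain ⟨B, hB, hBl⟩ := hg.exists_neumann_bound hT h0 h1 hct hK hs hq hat
  have hβm : ∀ l : ℤ, Measurable fun t => K * decay (4 ^ l * t) * a l := fun l => by fun_prop
  have hPm : ∀ l : ℤ, Measurable fun t => ∑' m : ℕ, (lop c g)^[m]
      (fun l t => K * decay (4 ^ l * t) * a l) l t := fun l =>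
    Measurable.tsum fun m => measurable_iterate_lop hg.1 hβm m l
  -- Both norms of `Z^s_{p,q}` have this form: `σ = 2` for the integral in time and `σ = 0` for the
  -- supremum. Here `B` is finite with the weight `s + 1`.
  have fin : ∀ (σ : ℝ) (k₁ k₂ : ℝ≥0∞), k₁ ≠ ⊤ → k₂ ≠ ⊤ → weightedSeqNorm (s + σ) q (fun j =>
      k₁ * (ENNReal.ofReal ((2 : ℝ) ^ ((j : ℝ) * (-σ))) * a j) +
        k₂ * (ENNReal.ofReal ((2 : ℝ) ^ ((j : ℝ) * (1 - σ))) * B j)) < ⊤ := by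
    intro σ k₁ k₂ h1 h2
    refine (weightedSeqNorm_add_le _ hq _ _).trans_lt ?_
    rw [weightedSeqNorm_const_mul _ hq0, weightedSeqNorm_const_mul _ hq0, weightedSeqNorm_shift,
      weightedSeqNorm_shift, add_neg_cancel_right, add_add_sub_cancel]
    have := hat.ne
    have := hB.ne
    finiteness
  constructor
  · refine (weightedSeqNorm_mono fun l => ?_).trans_lt (fin 2 (K * ENNReal.ofReal Real.pi)
      (c * ENNReal.ofReal Real.pi) (by finiteness) (by finiteness))
    rw [eLpNorm_one_eq_lintegral_enorm]
    simp only [enorm_eq_self]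
    refine (setLIntegral_mono' measurableSet_Ioo (key l)).trans ?_
    rw [lintegral_add_left (hβm l)]
    have e1 : ENNReal.ofReal ((2 : ℝ) ^ (-l)) ^ 2 = ENNReal.ofReal ((2 : ℝ) ^ ((l : ℝ) * (-2))) := by
      rw [← ENNReal.ofReal_pow (by positivity),
        two_zpow_eq_rpow (-l) (-(l : ℝ)) (by push_cast; ring), ← Real.rpow_natCast,
        ← Real.rpow_mul two_pos.le]
      congr 2; ring
    refine add_le_add ?_ ?_
    · calc ∫⁻ t in Ioo 0 T, K * decay (4 ^ l * t) * a l
          = K * (∫⁻ t in Ioo 0 T, decay (4 ^ l * t)) * a l := by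
            rw [lintegral_mul_const _ (by fun_prop), lintegral_const_mul _ (by fun_prop)]
        _ ≤ K * (ENNReal.ofReal Real.pi * ENNReal.ofReal ((2 : ℝ) ^ (-l)) ^ 2) * a l := by
            gcongr; exact lintegral_decay_le l T
        _ = _ := by rw [e1]; ring
    · refine (lintegral_lop_le hg.1 hPm l T).trans ?_
      calc _ ≤ c * ENNReal.ofReal Real.pi * ENNReal.ofReal ((2 : ℝ) ^ (-l)) * B l :=
            mul_le_mul' le_rfl (hBl l)
        _ = _ := by
          rw [two_zpow_eq_rpow (-l) ((l : ℝ) * (1 - 2)) (by push_cast; ring)]; ring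
  · have := fin 0 K c hK hct
    rw [add_zero] at this
    refine (weightedSeqNorm_mono fun l => ?_).trans_lt this
    refine iSup₂_le fun t ht => (key l t ht).trans (add_le_add ?_ ?_)
    · simp only [neg_zero, mul_zero, Real.rpow_zero, ENNReal.ofReal_one, one_mul]
      gcongr
      exact mul_le_of_le_one_right' (decay_le_one _)
    · refine (lop_le hg.1 hPm l ht.2.le).trans ?_
      calc _ ≤ c * ENNReal.ofReal (2 ^ l) * B l := mul_le_mul' le_rfl (hBl l)
        _ = _ := by
          rw [two_zpow_eq_rpow l ((l : ℝ) * (1 - 0)) (by ring)]; ring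

end

section

/-! ### Functions that represent the elements of the solution spaces -/

variable {χ φ : RR n → ℝ} {T : ℝ} {u : ℝ → TDist n}

theorem IsSch.comp_sub_left {m : RR n → ℂ} (h : IsSch m) (x : RR n) : IsSch fun y => m (x - y) := by
  obtain ⟨g, hg⟩ := h
  refine ⟨SchwartzMap.compSubConstCLM ℂ x (reflS g), fun y => ?_⟩
  rw [SchwartzMap.compSubConstCLM_apply, reflS_apply, neg_sub, hg]

theorem IsLittlewoodPaley.isSch_fatten (h : IsLittlewoodPaley χ φ) (l : ℤ) :
    IsSch (dsym (fatten χ) l) := isSch_dsym h.annular_fatten.smooth h.annular_fatten.compact l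

/-- A bounded dyadic block is continuous. -/
theorem IsLittlewoodPaley.exists_cv_fatten (h : IsLittlewoodPaley χ φ) {l : ℤ} {v : TDist n}
    (hd : distLpNorm ⊤ (dyadic φ l v) < ⊤) : ∃ w : RR n → CC n,
      BRep (dyadic φ l v) w ∧ BRep (dyadic φ l v) (cv (ker (dsym (fatten χ) l)) w) ∧
      (∀ x, ‖cv (ker (dsym (fatten χ) l)) w x‖ₑ ≤
        (kerNorm fun ξ => (fatten χ ξ : ℂ)) * distLpNorm ⊤ (dyadic φ l v)) ∧
      ∀ (ψ : 𝓢(RR n, ℂ)) x, (∀ y, ψ y = ker (dsym (fatten χ) l) (x - y)) →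
        dyadic φ l v ψ = cv (ker (dsym (fatten χ) l)) w x := by
  obtain ⟨w, hw, hwb⟩ := exists_bRep_of_distLpNorm_lt_top hd
  have hS := h.isSch_fatten l
  refine ⟨w, hw, ?_, fun x => ?_, fun ψ x hψ => ?_⟩
  · have h1 := hw.mult hS
    have h2 : mult (dsym (fatten χ) l) (dyadic φ l v) = dyadic φ l v := by
      rw [dyadic_eq, mult_mult (h.isSch_phi l).hasTemperateGrowth hS.hasTemperateGrowth]
      congr 1; ext ξ
      rw [mul_comm, h.dsym_fatten_mul]
    rwa [h2] at h1
  · rw [← kerNorm_dsym (fatten χ) l]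
    exact enorm_cv_le_of_bound hS.ker.continuous.measurable (Eventually.of_forall hwb) _
  · rw [hw.rep, cv]
    exact integral_congr_ae (Eventually.of_forall fun y => by simp only [hψ])

theorem measurable_indicator_of_subtype {X : Type*} [MeasurableSpace X] {E : Type*}
    [MeasurableSpace E] [Zero E] {s : Set X} (hs : MeasurableSet s) {f : X → E}
    (hf : Measurable fun t : s => f t) : Measurable (s.indicator f) := by
  refine measurable_of_restrict_of_restrict_compl hs ?_ ?_
  · have e : s.domRestrict (s.indicator f) = fun t : s => f t :=
      funext fun t => indicator_of_mem t.2 _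
    rw [e]; exact hf
  · have e : sᶜ.domRestrict (s.indicator f) = fun _ => 0 :=
      funext fun t => indicator_of_notMem t.2 _
    rw [e]; exact measurable_const

/-- By continuity in `x` the supremum is taken over a dense sequence and is thus measurable in `t`.
The norm of the distribution itself is not known to be a measurable function of time. -/
theorem exists_measurable_bound {W : ℝ → RR n → CC n} (hc : ∀ t, Continuous (W t))
    (hm : ∀ x, Measurable fun t => W t x) :
    Measurable (Function.uncurry W) ∧ ∃ ρ : ℝ → ℝ≥0∞, Measurable ρ ∧ (∀ t x, ‖W t x‖ₑ ≤ ρ t) ∧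
      ∀ t M, (∀ x, ‖W t x‖ₑ ≤ M) → ρ t ≤ M := by
  refine ⟨(measurable_uncurry_of_continuous_of_measurable (u := fun x t => W t x)
      hc hm).comp measurable_swap, fun t => ⨆ k : ℕ, ‖W t (TopologicalSpace.denseSeq (RR n) k)‖ₑ,
    .iSup fun k => (hm _).enorm, fun t x => ?_, fun t M hM => iSup_le fun k => hM _⟩
  have hcl : IsClosed {x | ‖W t x‖ₑ ≤ ⨆ k : ℕ, ‖W t (TopologicalSpace.denseSeq (RR n) k)‖ₑ} :=
    isClosed_le (hc t).enorm continuous_const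
  have h2 := hcl.closure_subset_iff.2 (range_subset_iff.2 fun k =>
    le_iSup (fun k : ℕ => ‖W t (TopologicalSpace.denseSeq (RR n) k)‖ₑ) k)
  refine h2 ?_
  rw [(TopologicalSpace.denseRange_denseSeq (RR n)).closure_range]
  trivial

/-- The value `W(t,x)` is the pairing of the block with the reflected and translated kernel of the
fattened cutoff, hence measurable in `t` by weak* measurability; as a convolution it is continuous
in `x`. Joint measurability follows from these two properties. -/
theorem IsLittlewoodPaley.exists_continuous_blocks (h : IsLittlewoodPaley χ φ)
    (hw : ∀ ψ : 𝓢(RR n, ℂ), Measurable fun t : Ioo (0 : ℝ) T => u t ψ)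
    (hd : ∀ l, ∀ t ∈ Ioo 0 T, distLpNorm ⊤ (dyadic φ l (u t)) < ⊤) (l : ℤ) :
    ∃ (W : ℝ → RR n → CC n) (ρ : ℝ → ℝ≥0∞), Measurable (Function.uncurry W) ∧
      Measurable ρ ∧ (∀ t x, ‖W t x‖ₑ ≤ ρ t) ∧ ∀ t ∈ Ioo 0 T, BRep (dyadic φ l (u t)) (W t) ∧
        ρ t ≤ (kerNorm fun ξ => (fatten χ ξ : ℂ)) * distLpNorm ⊤ (dyadic φ l (u t)) := by
  choose ψ hψ using fun x : RR n => (h.isSch_fatten l).ker.comp_sub_left x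
  obtain ⟨W, hW⟩ : ∃ W : ℝ → RR n → CC n, ∀ t x, W t x =
    (Ioo 0 T).indicator (fun t => dyadic φ l (u t) (ψ x)) t := ⟨_, fun _ _ => rfl⟩
  have key : ∀ t ∈ Ioo 0 T, ∃ w : RR n → CC n, BRep (dyadic φ l (u t)) w ∧
      BRep (dyadic φ l (u t)) (W t) ∧ (∀ x, ‖W t x‖ₑ ≤
        (kerNorm fun ξ => (fatten χ ξ : ℂ)) * distLpNorm ⊤ (dyadic φ l (u t))) ∧
      W t = cv (ker (dsym (fatten χ) l)) w := by
    intro t ht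
    obtain ⟨w, hw, hwc, hwb, hwψ⟩ := h.exists_cv_fatten (hd l t ht)
    have e : W t = cv (ker (dsym (fatten χ) l)) w := funext fun x => by
      rw [hW, indicator_of_mem ht, hwψ _ x (hψ x)]
    exact ⟨w, hw, e ▸ hwc, e ▸ hwb, e⟩
  have hcont : ∀ t, Continuous (W t) := by
    intro t
    by_cases ht : t ∈ Ioo 0 T
    · obtain ⟨w, hw, -, -, he⟩ := key t ht
      rw [he]
      exact continuous_cv (h.isSch_fatten l) hw.meas hw.bdd
    · have : W t = fun _ => 0 := funext fun x => by rw [hW, indicator_of_notMem ht]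
      rw [this]; exact continuous_const
  have hmeas : ∀ x, Measurable fun t => W t x := fun x => by
    simp_rw [hW]
    exact measurable_indicator_of_subtype measurableSet_Ioo (hw (multT (dsym φ l) (ψ x)))
  obtain ⟨hWm, ρ, hρm, hWρ, hρ⟩ := exists_measurable_bound hcont hmeas
  refine ⟨W, ρ, hWm, hρm, hWρ, fun t ht => ?_⟩
  obtain ⟨w, -, hr, hb, -⟩ := key t ht
  exact ⟨hr, hρ t _ hb⟩

/-! ### Time integrability of sums of dyadic blocks. -/

theorem lintegral_rpow_neg {a b : ℝ} (ha : a < 1) (hb : 0 ≤ b) :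
    ∫⁻ s in Ioo 0 b, ENNReal.ofReal (s ^ (-a)) = ENNReal.ofReal (b ^ (1 - a) / (1 - a)) := by
  have hi : IntegrableOn (fun s : ℝ => s ^ (-a)) (Ioo 0 b) volume :=
    ((intervalIntegrable_iff_integrableOn_Ioc_of_le hb).1
      (intervalIntegral.intervalIntegrable_rpow' (by linarith))).mono_set Ioo_subset_Ioc_self
  rw [← ofReal_integral_eq_lintegral_ofReal hi]
  · rw [← integral_Ioc_eq_integral_Ioo, ← intervalIntegral.integral_of_le hb,
      integral_rpow (Or.inl (by linarith)), Real.zero_rpow (by linarith)]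
    congr 1
    rw [show -a + 1 = 1 - a by ring]; ring
  · filter_upwards [ae_restrict_mem measurableSet_Ioo] with s hs
    exact Real.rpow_nonneg hs.1.le _

/-- Split at `t - s = δ`: near `t` the supremum of `ρ` is used, away from it the weight is at most
`δ^{-a}` and the `L²` norm suffices. -/
theorem lintegral_rpow_mul_sq_le {a δ t : ℝ} (ha0 : 0 ≤ a) (ha : a < 1) (hδ : 0 < δ)
    {ρ : ℝ → ℝ≥0∞} (hρ : Measurable ρ) {M : ℝ≥0∞} (hM : ∀ s ∈ Ioo 0 T, ρ s ≤ M) (ht : t ≤ T) :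
    ∫⁻ s in Ioo 0 t, ENNReal.ofReal ((t - s) ^ (-a)) * ρ s ^ 2 ≤
      ENNReal.ofReal (δ ^ (1 - a) / (1 - a)) * M ^ 2 +
        ENNReal.ofReal (δ ^ (-a)) * ∫⁻ s in Ioo 0 T, ρ s ^ 2 := by
  set F : ℝ → ℝ≥0∞ := (Ioo 0 δ).indicator fun τ => ENNReal.ofReal (τ ^ (-a)) with hF
  have hFm : Measurable F := Measurable.indicator (by fun_prop) measurableSet_Ioo
  calc _ ≤ ∫⁻ s in Ioo 0 t, (F (t - s) * M ^ 2 + ENNReal.ofReal (δ ^ (-a)) * ρ s ^ 2) := by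
        refine setLIntegral_mono' measurableSet_Ioo fun s hs => ?_
        rcases lt_or_ge (t - s) δ with h | h
        · rw [hF, indicator_of_mem (show t - s ∈ Ioo 0 δ from ⟨sub_pos.2 hs.2, h⟩)]
          refine le_add_right ?_
          gcongr
          exact hM s ⟨hs.1, hs.2.trans_le ht⟩
        · refine le_add_left ?_
          gcongr ENNReal.ofReal ?_ * _
          exact Real.rpow_le_rpow_of_nonpos hδ h (by linarith)
    _ = (∫⁻ s in Ioo 0 t, F (t - s)) * M ^ 2 +
        ENNReal.ofReal (δ ^ (-a)) * ∫⁻ s in Ioo 0 t, ρ s ^ 2 := by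
        rw [lintegral_add_right _ (by fun_prop), lintegral_const_mul _ (by fun_prop),
          lintegral_mul_const _ (by fun_prop)]
    _ ≤ _ := by
        refine add_le_add (mul_le_mul' ?_ le_rfl)
          (mul_le_mul' le_rfl (lintegral_mono_set (Ioo_subset_Ioo_right ht)))
        calc _ ≤ ∫⁻ s, F (t - s) := setLIntegral_le_lintegral _ _
          _ = ∫⁻ s, F s := lintegral_sub_left_eq_self F t
          _ = _ := by
            rw [hF, lintegral_indicator measurableSet_Ioo, lintegral_rpow_neg ha hδ.le]

/-- Sums of dyadic pieces with the bounds of `Z^{-1+ε}_{∞,∞}` are integrable in time. -/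
theorem timeGood_tsum {ε : ℝ} (hε : ε ∈ Ioo (0 : ℝ) 1) (hT : 0 < T) {ρ : ℤ → ℝ → ℝ≥0∞}
    (hρ : ∀ l, Measurable (ρ l)) {K₁ K₂ : ℝ≥0∞} (hK₁ : K₁ ≠ ⊤) (hK₂ : K₂ ≠ ⊤)
    (h₁ : ∀ l, ∀ t ∈ Ioo 0 T, ρ l t ≤ ENNReal.ofReal ((2 : ℝ) ^ ((l : ℝ) * (1 - ε))) * K₁)
    (h₂ : ∀ l, ∫⁻ t in Ioo 0 T, ρ l t ≤ ENNReal.ofReal ((2 : ℝ) ^ (-((l : ℝ) * (1 + ε)))) * K₂) :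
    TimeGood (ε / 2) T fun t => ∑' l, ρ l t := by
  obtain ⟨hε0, hε1⟩ := hε
  set α := ε / 2 with hα
  have hα0 : 0 ≤ α := by positivity
  have hα1 : α < 1 := by rw [hα]; linarith
  -- The rate of decay in `|l|` of the weighted `L²` norms: `ε/2` at high frequencies and `1 - ε` at
  -- low ones.
  set σ := min (ε / 2) (1 - ε) with hσ
  have hσ0 : 0 < σ := lt_min (by positivity) (by linarith)
  set w : ℤ → ℝ≥0∞ := fun l => ENNReal.ofReal ((2 : ℝ) ^ (-(|(l : ℝ)| * σ))) with hw
  set M : ℤ → ℝ≥0∞ := fun l => ENNReal.ofReal ((2 : ℝ) ^ ((l : ℝ) * (1 - ε))) * K₁ with hM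
  set Q := ENNReal.ofReal (1 / (1 - α)) * K₁ ^ 2 + K₁ * K₂ +
    ENNReal.ofReal (T ^ (1 - α) / (1 - α)) * K₁ ^ 2 +
      ENNReal.ofReal (T ^ (-α)) * (ENNReal.ofReal T * K₁ ^ 2) with hQ
  have hQt : Q ≠ ⊤ := by finiteness
  -- Interpolation of the supremum and the integral in time.
  have hsq : ∀ l : ℤ, ∫⁻ t in Ioo 0 T, ρ l t ^ 2 ≤
      ENNReal.ofReal ((2 : ℝ) ^ (-((l : ℝ) * (2 * ε)))) * (K₁ * K₂) := fun l => by
    calc _ ≤ ∫⁻ t in Ioo 0 T, M l * ρ l t := by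
          refine setLIntegral_mono' measurableSet_Ioo fun t ht => ?_
          rw [sq]; gcongr; exact h₁ l t ht
      _ = M l * ∫⁻ t in Ioo 0 T, ρ l t := lintegral_const_mul _ (hρ l)
      _ ≤ M l * (ENNReal.ofReal ((2 : ℝ) ^ (-((l : ℝ) * (1 + ε)))) * K₂) := by
          gcongr; exact h₂ l
      _ = ENNReal.ofReal ((2 : ℝ) ^ ((l : ℝ) * (1 - ε))) *
          ENNReal.ofReal ((2 : ℝ) ^ (-((l : ℝ) * (1 + ε)))) * (K₁ * K₂) := by rw [hM]; ring
      _ = _ := by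
          rw [← ENNReal.ofReal_mul (by positivity), ← Real.rpow_add two_pos]
          congr 3; ring
  have hN : ∀ (l : ℤ) (t : ℝ), t ≤ T →
      ∫⁻ s in Ioo 0 t, ENNReal.ofReal ((t - s) ^ (-α)) * ρ l s ^ 2 ≤ ((1 + Q) * w l) ^ 2 := by
    intro l t ht
    have hM2 : M l ^ 2 = ENNReal.ofReal ((2 : ℝ) ^ ((l : ℝ) * (2 - 2 * ε))) * K₁ ^ 2 := by
      rw [hM, mul_pow, ← ENNReal.ofReal_pow (by positivity), ← Real.rpow_natCast,
        ← Real.rpow_mul two_pos.le]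
      congr 3; push_cast; ring
    have hw2 : w l ^ 2 = ENNReal.ofReal ((2 : ℝ) ^ (-(|(l : ℝ)| * (2 * σ)))) := by
      rw [hw, ← ENNReal.ofReal_pow (by positivity), ← Real.rpow_natCast,
        ← Real.rpow_mul two_pos.le]
      congr 2; push_cast; ring
    have hQ1 : Q ≤ (1 + Q) ^ 2 := by
      calc Q ≤ 1 + Q := le_add_self
        _ = (1 + Q) * 1 := (mul_one _).symm
        _ ≤ _ := by rw [sq]; gcongr; exact le_self_add
    suffices hs : ∫⁻ s in Ioo 0 t, ENNReal.ofReal ((t - s) ^ (-α)) * ρ l s ^ 2 ≤ Q * w l ^ 2 by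
      rw [mul_pow]; exact hs.trans (mul_le_mul' hQ1 le_rfl)
    rcases le_or_gt 0 l with hl | hl
    · have hl' : (0 : ℝ) ≤ l := by exact_mod_cast hl
      have hwl : ENNReal.ofReal ((2 : ℝ) ^ (-((l : ℝ) * ε))) ≤ w l ^ 2 := by
        rw [hw2]
        refine ENNReal.ofReal_le_ofReal (Real.rpow_le_rpow_of_exponent_le one_le_two ?_)
        rw [abs_of_nonneg hl']
        have : 2 * σ ≤ ε := by linarith [min_le_left (ε / 2) (1 - ε)]
        nlinarith
      -- The parabolic choice `δ = 4^{-l}` balances the two parts: with `α = ε/2` both are of order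
      -- `2^{-lε}`. At low frequencies `δ = T`.
      refine (lintegral_rpow_mul_sq_le hα0 hα1 (δ := (2 : ℝ) ^ (-(2 * l : ℝ))) (by positivity) (hρ l)
        (h₁ l) ht).trans ?_
      calc _ ≤ ENNReal.ofReal (((2 : ℝ) ^ (-(2 * l : ℝ))) ^ (1 - α) / (1 - α)) * M l ^ 2 +
            ENNReal.ofReal (((2 : ℝ) ^ (-(2 * l : ℝ))) ^ (-α)) *
              (ENNReal.ofReal ((2 : ℝ) ^ (-((l : ℝ) * (2 * ε)))) * (K₁ * K₂)) := by
            gcongr; exact hsq l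
        _ = (ENNReal.ofReal (1 / (1 - α)) * K₁ ^ 2 + K₁ * K₂) *
            ENNReal.ofReal ((2 : ℝ) ^ (-((l : ℝ) * ε))) := by
            have e1 : ENNReal.ofReal (((2 : ℝ) ^ (-(2 * l : ℝ))) ^ (1 - α) / (1 - α)) *
                ENNReal.ofReal ((2 : ℝ) ^ ((l : ℝ) * (2 - 2 * ε))) =
                ENNReal.ofReal (1 / (1 - α)) * ENNReal.ofReal ((2 : ℝ) ^ (-((l : ℝ) * ε))) := by
              rw [← ENNReal.ofReal_mul (div_nonneg (by positivity) (by linarith)),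
                ← ENNReal.ofReal_mul (div_nonneg zero_le_one (by linarith)),
                ← Real.rpow_mul two_pos.le, div_mul_eq_mul_div, ← Real.rpow_add two_pos,
                one_div_mul_eq_div]
              congr 3; rw [hα]; ring
            have e2 : ENNReal.ofReal (((2 : ℝ) ^ (-(2 * l : ℝ))) ^ (-α)) *
                ENNReal.ofReal ((2 : ℝ) ^ (-((l : ℝ) * (2 * ε)))) =
                ENNReal.ofReal ((2 : ℝ) ^ (-((l : ℝ) * ε))) := by
              rw [← ENNReal.ofReal_mul (by positivity), ← Real.rpow_mul two_pos.le,
                ← Real.rpow_add two_pos]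
              congr 2; rw [hα]; ring
            rw [hM2, ← mul_assoc, e1, ← mul_assoc _ _ (K₁ * K₂), e2]; ring
        _ ≤ _ := by
            refine mul_le_mul' ?_ hwl
            rw [hQ, add_assoc _ _ (ENNReal.ofReal (T ^ (-α)) * _)]
            exact le_self_add
    · have hl' : (l : ℝ) < 0 := by exact_mod_cast hl
      have hM3 : M l ^ 2 ≤ w l ^ 2 * K₁ ^ 2 := by
        rw [hM2, hw2]
        gcongr
        · exact one_le_two
        rw [abs_of_neg hl']
        have : 2 * σ ≤ 2 - 2 * ε := by linarith [min_le_right (ε / 2) (1 - ε)]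
        nlinarith
      refine (lintegral_rpow_mul_sq_le hα0 hα1 hT (hρ l) (h₁ l) ht).trans ?_
      calc _ ≤ ENNReal.ofReal (T ^ (1 - α) / (1 - α)) * (w l ^ 2 * K₁ ^ 2) +
            ENNReal.ofReal (T ^ (-α)) * (ENNReal.ofReal T * (w l ^ 2 * K₁ ^ 2)) := by
            gcongr
            calc _ ≤ ∫⁻ s in Ioo 0 T, M l ^ 2 := setLIntegral_mono' measurableSet_Ioo fun s hs =>
                  pow_le_pow_left' (h₁ l s hs) 2
              _ = ENNReal.ofReal T * M l ^ 2 := by simp [mul_comm]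
              _ ≤ _ := by gcongr
        _ = (ENNReal.ofReal (T ^ (1 - α) / (1 - α)) * K₁ ^ 2 +
            ENNReal.ofReal (T ^ (-α)) * (ENNReal.ofReal T * K₁ ^ 2)) * w l ^ 2 := by ring
        _ ≤ _ := by
            refine mul_le_mul' ?_ le_rfl
            rw [hQ, add_assoc (_ + _)]
            exact le_add_self
  refine ⟨.tsum hρ, (∑' l, (1 + Q) * w l) ^ 2, ?_, fun t ht htT => ?_⟩
  · rw [ENNReal.tsum_mul_left]
    have := tsum_two_rpow_neg_abs_ne_top hσ0
    finiteness
  · set v : ℝ → ℝ≥0∞ := fun s => ENNReal.ofReal ((t - s) ^ (-(α / 2))) with hv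
    have hv2 : ∀ s ∈ Ioo 0 t, ∀ r : ℝ≥0∞, ENNReal.ofReal ((t - s) ^ (-α)) * r ^ 2 =
        (v s * r) ^ 2 := fun s hs r => by
      rw [mul_pow, hv, ← ENNReal.ofReal_pow (Real.rpow_nonneg (sub_nonneg.2 hs.2.le) _),
        ← Real.rpow_natCast, ← Real.rpow_mul (sub_nonneg.2 hs.2.le)]
      congr 3; push_cast; ring
    rw [setLIntegral_congr_fun measurableSet_Ioo (fun s hs => hv2 s hs _), ← eLpNorm_two_sq]
    simp_rw [← ENNReal.tsum_mul_left]
    refine pow_le_pow_left' ((eLpNorm_tsum_le one_le_two fun l =>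
      (show Measurable v by fun_prop).mul (hρ l)).trans (ENNReal.tsum_le_tsum fun l => ?_)) 2
    refine le_of_sq_le_sq ?_
    rw [eLpNorm_two_sq]
    change ∫⁻ s in Ioo 0 t, (v s * ρ l s) ^ 2 ≤ _
    rw [← setLIntegral_congr_fun measurableSet_Ioo (fun s hs => hv2 s hs (ρ l s))]
    exact hN l t htT

theorem measurable_tsum_int {X : Type*} [MeasurableSpace X] {F : ℤ → X → CC n}
    (hm : ∀ l, Measurable (F l)) (hs : ∀ p, Summable fun l => F l p) :
    Measurable fun p => ∑' l, F l p := by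
  obtain ⟨σ⟩ : Nonempty (ℕ ≃ ℤ) := ⟨Equiv.intEquivNat.symm⟩
  refine measurable_of_tendsto_metrizable (f := fun J p => ∑ i ∈ Finset.range J, F (σ i) p)
    (fun J => Finset.measurable_fun_sum _ fun i _ => hm _) (tendsto_pi_nhds.2 fun p => ?_)
  exact ((σ.hasSum_iff (f := fun l => F l p)).2 (hs p).hasSum).tendsto_sum_nat

/-- Elements of `Z^{-1+ε}_{∞,∞}(T)` are given by functions. -/
theorem MemZ.exists_flow (h : IsLittlewoodPaley χ φ) {ε : ℝ} (hε : ε ∈ Ioo (0 : ℝ) 1) (hT : 0 < T)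
    (hu : MemZ χ φ (-1 + ε) ⊤ ⊤ T u) : ∃ g U, Flow T g u U ∧ TimeGood (ε / 2) T g := by
  obtain ⟨hS, hw, hL1, hLs⟩ := hu
  set N₁ := cheminLernerSupNorm φ T (-1 + ε) ⊤ ⊤ u with hN₁
  set N₂ := cheminLernerNorm φ T 1 (-1 + ε + 2) ⊤ ⊤ u with hN₂
  have h₁ : ∀ (l : ℤ), ∀ t ∈ Ioo 0 T, distLpNorm ⊤ (dyadic φ l (u t)) ≤
      ENNReal.ofReal ((2 : ℝ) ^ ((l : ℝ) * (1 - ε))) * N₁ := fun l t ht => by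
    have h1 := le_weightedSeqNorm_top (-1 + ε)
      (fun j => ⨆ t ∈ Ioo 0 T, distLpNorm ⊤ (dyadic φ j (u t))) l
    rw [show (l : ℝ) * (1 - ε) = -(l * (-1 + ε)) by ring]
    exact (le_iSup₂ (f := fun t _ => distLpNorm ⊤ (dyadic φ l (u t))) t ht).trans h1
  have h₂ : ∀ l : ℤ, ∫⁻ t in Ioo 0 T, distLpNorm ⊤ (dyadic φ l (u t)) ≤
      ENNReal.ofReal ((2 : ℝ) ^ (-((l : ℝ) * (1 + ε)))) * N₂ := fun l => by
    have h1 := le_weightedSeqNorm_top (-1 + ε + 2) (fun j =>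
      eLpNorm (fun t => distLpNorm ⊤ (dyadic φ j (u t))) 1 (volume.restrict (Ioo 0 T))) l
    rw [eLpNorm_one_eq_lintegral_enorm] at h1
    simp only [enorm_eq_self] at h1
    rwa [show (1 : ℝ) + ε = -1 + ε + 2 by ring]
  choose W ρ hWm hρm hWρ hrep using h.exists_continuous_blocks hw
    fun l t ht => (h₁ l t ht).trans_lt (ENNReal.mul_lt_top ENNReal.ofReal_lt_top hLs)
  set Cf := kerNorm fun ξ => (fatten χ ξ : ℂ) with hCf
  have hCt : Cf ≠ ⊤ := by
    rw [hCf, ← kerNorm_dsym (fatten χ) 0]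
    exact (h.isSch_fatten 0).kerNorm_lt_top.ne
  set g : ℝ → ℝ≥0∞ := fun t => ∑' l, ρ l t with hg
  have hgood : TimeGood (ε / 2) T g := by
    refine timeGood_tsum hε hT hρm (K₁ := Cf * N₁) (K₂ := Cf * N₂) (ENNReal.mul_ne_top hCt hLs.ne)
      (ENNReal.mul_ne_top hCt hL1.ne) (fun l t ht => ?_) fun l => ?_
    · refine (hrep l t ht).2.trans ?_
      rw [mul_left_comm]
      gcongr
      exact h₁ l t ht
    · refine (setLIntegral_mono' measurableSet_Ioo fun t ht => (hrep l t ht).2).trans ?_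
      rw [lintegral_const_mul' _ _ hCt, mul_left_comm]
      gcongr
      exact h₂ l
  have hset : MeasurableSet {p : ℝ × RR n | g p.1 ≠ ⊤} :=
    (hgood.1 (measurableSet_singleton ⊤).compl).preimage measurable_fst
  have hsum : ∀ t, g t ≠ ⊤ → ∀ x, Summable fun l => W l t x := fun t ht x => by
    refine (ENNReal.summable_toReal ht).of_norm_bounded fun l => ?_
    rw [← toReal_enorm]
    exact ENNReal.toReal_mono (ENNReal.ne_top_of_tsum_ne_top ht l) (hWρ l t x)
  -- At the times where the bound is infinite, which form a null set in `(0,T)`, the field is set to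
  -- zero; elsewhere the series converges absolutely and uniformly in `x`.
  refine ⟨g, fun t x => ∑' l, {p : ℝ × RR n | g p.1 ≠ ⊤}.indicator (Function.uncurry (W l)) (t, x),
    ⟨?_, hgood.1, fun t x => ?_, ?_⟩, hgood⟩
  · refine measurable_tsum_int (F := fun l =>
      {p : ℝ × RR n | g p.1 ≠ ⊤}.indicator (Function.uncurry (W l)))
      (fun l => (hWm l).indicator hset) ?_
    rintro ⟨t, x⟩
    by_cases ht : g t ≠ ⊤
    · simpa [indicator, ht] using hsum t ht x
    · simp [indicator, ht]
  · by_cases ht : g t ≠ ⊤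
    · refine le_trans (le_of_eq ?_) ((enorm_le_tsum_of_hasSum (hsum t ht x).hasSum).trans
        (ENNReal.tsum_le_tsum fun l => hWρ l t x))
      simp [indicator, ht]
    · simp [indicator, ht]
  · have hG := hgood.lintegral_sq_lt_top (by linarith [hε.1]) hT
    have hfin : ∀ᵐ s ∂volume.restrict (Ioo 0 T), g s ≠ ⊤ := by
      filter_upwards [ae_lt_top (hgood.1.pow_const 2) hG.ne] with s hs h2
      rw [h2] at hs
      simp at hs
    filter_upwards [(ae_restrict_iff' measurableSet_Ioo).1 hfin] with t ht htT
    have := (hS t htT).2.bRep_tsum h (fun l => (hrep l t htT).1) (fun l x => hWρ l t x) (ht htT)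
    simpa [indicator, ht htT] using this

end

section

/-! ### Differences of Duhamel terms -/

variable {θ : RR n → ℂ} {U V : ℝ → RR n → CC n} {G δ : ℝ → ℝ≥0∞} {t : ℝ}

theorem integrable_duh_integrand (hθ : Measurable θ) (hU : Measurable (Function.uncurry U))
    (hb : ∀ s x, ‖U s x‖ₑ ≤ G s) (hG : ∫⁻ s in Ioo 0 t, dnorm θ (t - s) * G s ^ 2 < ⊤)
    (y : RR n) (i j k : Fin n) :
    Integrable (fun q : ℝ × RR n => U q.1 q.2 j * U q.1 q.2 k * dker θ i j k (t - q.1) (q.2 - y))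
      ((volume.restrict (Ioo 0 t)).prod volume) := by
  have hm : Measurable fun q : ℝ × RR n =>
      U q.1 q.2 j * U q.1 q.2 k * dker θ i j k (t - q.1) (q.2 - y) :=
    ((measurable_coord_comp hU j measurable_fst measurable_snd).mul
      (measurable_coord_comp hU k measurable_fst measurable_snd)).mul
      ((measurable_dker hθ i j k).comp (f := fun q : ℝ × RR n => (t - q.1, q.2 - y)) (by fun_prop))
  refine ⟨hm.aestronglyMeasurable, ?_⟩
  rw [hasFiniteIntegral_iff_enorm, lintegral_prod _ hm.enorm.aemeasurable]
  refine lt_of_le_of_lt (lintegral_mono fun s => ?_) hG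
  have hd : Measurable fun x => dabs θ (t - s) (x - y) :=
    (measurable_dabs hθ).comp (f := fun x => (t - s, x - y)) (by fun_prop)
  calc _ ≤ ∫⁻ x, dabs θ (t - s) (x - y) * G s ^ 2 := by
        refine lintegral_mono fun x => ?_
        simp only []
        rw [enorm_mul, enorm_mul, mul_comm, sq]
        exact mul_le_mul' (enorm_dker_le _ _ _ _ _ _) (mul_le_mul'
          ((enorm_apply_le _ _).trans (hb s x)) ((enorm_apply_le _ _).trans (hb s x)))
    _ = _ := by
        rw [lintegral_mul_const _ hd, lintegral_sub_right_eq_self (fun x => dabs θ (t - s) x) y]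
        rfl

theorem enorm_duh_sub_le (hθ : Measurable θ) (hU : Measurable (Function.uncurry U))
    (hV : Measurable (Function.uncurry V)) (hUb : ∀ s x, ‖U s x‖ₑ ≤ G s)
    (hVb : ∀ s x, ‖V s x‖ₑ ≤ G s) (hG : ∫⁻ s in Ioo 0 t, dnorm θ (t - s) * G s ^ 2 < ⊤)
    (hδ : ∀ᵐ s ∂volume.restrict (Ioo 0 t), ∀ᵐ x, ‖U s x - V s x‖ₑ ≤ δ s) (y : RR n) :
    ‖duh θ U U t y - duh θ V V t y‖ₑ ≤
      ∫⁻ s in Ioo 0 t, dnorm θ (t - s) * (2 * G s * δ s) := by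
  set N : ℝ → RR n → ℝ≥0∞ := fun s x =>
    ‖U s x‖ₑ * ‖U s x - V s x‖ₑ + ‖U s x - V s x‖ₑ * ‖V s x‖ₑ with hN
  have hNm : Measurable (Function.uncurry N) :=
    (hU.enorm.mul (hU.sub hV).enorm).add ((hU.sub hV).enorm.mul hV.enorm)
  have key : ‖duh θ U U t y - duh θ V V t y‖ₑ ≤
      ∫⁻ s in Ioo 0 t, ∫⁻ x, dabs θ (t - s) (x - y) * N s x := by
    rw [lintegral_dabs_mul hθ hNm]
    refine (enorm_le_sum_enorm _).trans (Finset.sum_le_sum fun i _ => ?_)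
    change ‖(∑ j, ∑ k, ∫ s in Ioo 0 t, ∫ x, U s x j * U s x k * dker θ i j k (t - s) (x - y)) -
      ∑ j, ∑ k, ∫ s in Ioo 0 t, ∫ x, V s x j * V s x k * dker θ i j k (t - s) (x - y)‖ₑ ≤ _
    simp_rw [← Finset.sum_sub_distrib]
    refine (enorm_sum_le _ _).trans (Finset.sum_le_sum fun j _ => ?_)
    refine (enorm_sum_le _ _).trans (Finset.sum_le_sum fun k _ => ?_)
    have h1 := integrable_duh_integrand hθ hU hUb hG y i j k
    have h2 := integrable_duh_integrand hθ hV hVb hG y i j k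
    rw [← integral_sub h1.integral_prod_left h2.integral_prod_left]
    refine (enorm_integral_le_lintegral_enorm _).trans (lintegral_mono_ae ?_)
    filter_upwards [h1.prod_right_ae, h2.prod_right_ae] with s hs1 hs2
    rw [← integral_sub hs1 hs2]
    refine (enorm_integral_le_lintegral_enorm _).trans (lintegral_mono fun x => ?_)
    simp only []
    rw [← sub_mul, enorm_mul, mul_comm]
    gcongr
    rw [show U s x j * U s x k - V s x j * V s x k =
      U s x j * (U s x - V s x) k + (U s x - V s x) j * V s x k by
        simp only [PiLp.sub_apply]; ring]
    refine (enorm_add_le _ _).trans ?_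
    rw [enorm_mul, enorm_mul]
    exact add_le_add (mul_le_mul' (enorm_apply_le _ _) (enorm_apply_le _ _))
      (mul_le_mul' (enorm_apply_le _ _) (enorm_apply_le _ _))
  refine key.trans (lintegral_mono_ae ?_)
  filter_upwards [hδ] with s hs
  have hm : Measurable fun x => dabs θ (t - s) (x - y) :=
    (measurable_dabs hθ).comp (f := fun x => (t - s, x - y)) (by fun_prop)
  calc _ ≤ ∫⁻ x, dabs θ (t - s) (x - y) * (2 * G s * δ s) := by
        refine lintegral_mono_ae ?_
        filter_upwards [hs] with x hx
        refine mul_le_mul' le_rfl ?_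
        calc N s x ≤ G s * δ s + δ s * G s :=
              add_le_add (mul_le_mul' (hUb s x) hx) (mul_le_mul' hx (hVb s x))
          _ = _ := by ring
    _ = _ := by
        rw [lintegral_mul_const _ hm, lintegral_sub_right_eq_self (fun x => dabs θ (t - s) x) y]
        rfl

/-! ### Uniqueness -/

/-- The operator that bounds the Duhamel term of a difference. -/
def kop (C : ℝ≥0∞) (G b : ℝ → ℝ≥0∞) (t : ℝ) : ℝ≥0∞ :=
  ∫⁻ s in Ioo 0 t, C * ENNReal.ofReal ((t - s) ^ (-(1 / 2 : ℝ))) * (2 * G s * b s)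

theorem measurable_kop {C : ℝ≥0∞} {b : ℝ → ℝ≥0∞} (hG : Measurable G) (hb : Measurable b) :
    Measurable (kop C G b) := by
  refine measurable_duhamel (Φ := fun t s =>
    C * ENNReal.ofReal ((t - s) ^ (-(1 / 2 : ℝ))) * (2 * G s * b s)) ?_
  simp only [Function.uncurry_def]
  fun_prop

theorem lintegral_rpow_mul_expw {α lam : ℝ} (hα : 0 < α) (hl : 0 < lam) :
    ∫⁻ τ in Ioi (0 : ℝ), ENNReal.ofReal (τ ^ (α - 1)) * expw lam τ =
      ENNReal.ofReal ((1 / lam) ^ α * Real.Gamma α) := by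
  have h := Real.integral_rpow_mul_exp_neg_mul_Ioi hα hl
  have hpos : 0 < (1 / lam) ^ α * Real.Gamma α := mul_pos (by positivity) (Real.Gamma_pos_of_pos hα)
  have hi : Integrable (fun τ : ℝ => τ ^ (α - 1) * Real.exp (-(lam * τ)))
      (volume.restrict (Ioi 0)) := not_imp_comm.1 integral_undef (h ▸ hpos.ne')
  rw [← h, ofReal_integral_eq_lintegral_ofReal hi]
  · refine setLIntegral_congr_fun measurableSet_Ioi fun τ hτ => ?_
    rw [expw, ← ENNReal.ofReal_mul (Real.rpow_nonneg (le_of_lt hτ) _), neg_mul]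
  · filter_upwards [ae_restrict_mem measurableSet_Ioi] with τ hτ
    exact mul_nonneg (Real.rpow_nonneg (le_of_lt hτ) _) (Real.exp_pos _).le

/-- The square of `τ^{-1/2}` is not integrable at zero. It is split as `τ^{-α/2} τ^{(α-1)/2}`: the
first factor is absorbed by the time integrability of `G`, and the square of the second one against
`e^{-λτ}` has integral `λ^{-α} Γ(α)`, which is small for large `λ`. -/
theorem TimeGood.exists_wN_kop_le {α T : ℝ} (hg : TimeGood α T G) (h0 : 0 < α) {C : ℝ≥0∞}
    (hC : C ≠ ⊤) : ∃ lam : ℝ, 0 < lam ∧ ∀ b : ℝ → ℝ≥0∞, Measurable b →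
      wN lam T (kop C G b) ≤ 2⁻¹ * wN lam T b := by
  obtain ⟨hgm, K, hK, h⟩ := hg
  set M := K * (4 * C ^ 2) with hM
  have hMt : M ≠ ⊤ := by finiteness
  have hlim : Tendsto (fun lam : ℝ => M * ENNReal.ofReal ((1 / lam) ^ α * Real.Gamma α)) atTop
      (𝓝 (M * ENNReal.ofReal (0 ^ α * Real.Gamma α))) := by
    refine ENNReal.Tendsto.const_mul (ENNReal.tendsto_ofReal (Tendsto.mul_const _ ?_)) (Or.inr hMt)
    have h1 : Tendsto (fun lam : ℝ => 1 / lam) atTop (𝓝 0) := by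
      simpa using tendsto_inv_atTop_zero (𝕜 := ℝ)
    exact h1.rpow_const (Or.inr h0.le)
  rw [Real.zero_rpow h0.ne', zero_mul, ENNReal.ofReal_zero, mul_zero] at hlim
  have hev := (hlim.eventually_le_const (show (0 : ℝ≥0∞) < 2⁻¹ ^ 2 from
    ENNReal.pow_pos (ENNReal.inv_pos.2 ENNReal.ofNat_ne_top) 2)).and
    (eventually_gt_atTop 0)
  obtain ⟨lam, hlam, hl⟩ := hev.exists
  refine ⟨lam, hl, fun b hb => le_of_sq_le_sq ?_⟩
  have he := measurable_expw lam
  rw [mul_pow, wN_sq, wN_sq]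
  have key := lintegral_duhamel_sq_le (T := T) (k₁ := fun τ => ENNReal.ofReal (τ ^ (-(α / 2))))
    (k₂ := fun τ => 2 * C * (ENNReal.ofReal (τ ^ ((α - 1) / 2)) * expw lam τ)) (by fun_prop)
    (by fun_prop) hgm (b := fun s => expw lam s * b s) (by fun_prop) (A := K) (fun t ht => by
      refine le_trans (le_of_eq ?_) (h t ht.1 ht.2.le)
      refine setLIntegral_congr_fun measurableSet_Ioo fun s hs => ?_
      have hts : 0 ≤ t - s := sub_nonneg.2 hs.2.le
      rw [mul_pow, ← ENNReal.ofReal_pow (Real.rpow_nonneg hts _), ← Real.rpow_natCast,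
        ← Real.rpow_mul hts]
      congr 3; push_cast; ring)
  refine le_trans (le_of_eq ?_) (key.trans ?_)
  · refine lintegral_congr fun t => ?_
    congr 1
    rw [kop, ← lintegral_const_mul' _ _ (expw_ne_top _ _)]
    refine setLIntegral_congr_fun measurableSet_Ioo fun s hs => ?_
    have hts : 0 < t - s := sub_pos.2 hs.2
    have e1 : expw lam t = expw lam (t - s) * expw lam s := by rw [← expw_add, sub_add_cancel]
    have e2 : ENNReal.ofReal ((t - s) ^ (-(1 / 2 : ℝ))) =
        ENNReal.ofReal ((t - s) ^ (-(α / 2))) * ENNReal.ofReal ((t - s) ^ ((α - 1) / 2)) := by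
      rw [← ENNReal.ofReal_mul (Real.rpow_nonneg hts.le _), ← Real.rpow_add hts]
      congr 2; ring
    rw [e1, e2]; ring
  · rw [← mul_assoc]
    refine mul_le_mul' (le_trans ?_ hlam) le_rfl
    rw [hM, mul_assoc]
    gcongr
    calc _ ≤ ∫⁻ τ in Ioi (0 : ℝ), 4 * C ^ 2 * (ENNReal.ofReal (τ ^ (α - 1)) * expw lam τ) := by
          refine setLIntegral_mono' measurableSet_Ioi fun τ hτ => ?_
          have hτ : 0 < τ := hτ
          have e1 : ENNReal.ofReal (τ ^ ((α - 1) / 2)) ^ 2 = ENNReal.ofReal (τ ^ (α - 1)) := by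
            rw [← ENNReal.ofReal_pow (Real.rpow_nonneg hτ.le _), ← Real.rpow_natCast,
              ← Real.rpow_mul hτ.le]
            congr 2; push_cast; ring
          calc _ = 4 * C ^ 2 * (ENNReal.ofReal (τ ^ (α - 1)) * expw lam τ ^ 2) := by
                rw [mul_pow, mul_pow, mul_pow, e1]; norm_num
            _ ≤ _ := by
                gcongr
                exact pow_le_of_le_one zero_le (expw_le_one hl.le hτ.le) two_ne_zero
      _ = _ := by rw [lintegral_const_mul _ (by fun_prop), lintegral_rpow_mul_expw h0 hl]

theorem wN_iterate_kop_le {T lam : ℝ} {C : ℝ≥0∞} (hG : Measurable G)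
    (h : ∀ b : ℝ → ℝ≥0∞, Measurable b → wN lam T (kop C G b) ≤ 2⁻¹ * wN lam T b) {b : ℝ → ℝ≥0∞}
    (hb : Measurable b) (M : ℕ) : Measurable ((kop C G)^[M] b) ∧
      wN lam T ((kop C G)^[M] b) ≤ 2⁻¹ ^ M * wN lam T b := by
  induction M with
  | zero => exact ⟨hb, by simp⟩
  | succ M ih =>
    rw [Function.iterate_succ_apply']
    refine ⟨measurable_kop hG ih.1, (h _ ih.1).trans ?_⟩
    rw [pow_succ', mul_assoc]
    gcongr
    exact ih.2

variable {χ φ : RR n → ℝ} {T : ℝ} {u v : ℝ → TDist n} {g g' : ℝ → ℝ≥0∞}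

theorem mult_one (v : TDist n) : mult (fun _ => 1) v = v := by
  rw [mult, TemperedDistribution.fourierMultiplierCLM_const]
  simp

theorem Flow.mono (hF : Flow T g u U) (hm : Measurable g') (h : ∀ s, g s ≤ g' s) :
    Flow T g' u U := ⟨hF.meas, hm, fun s x => (hF.bound s x).trans (h s), hF.rep⟩

/-- Duhamel's formula for the functions that represent a mild solution. -/
theorem Flow.bRep_duh (hF : Flow T g u U) {f : TDist n}
    (hm : IsMildSolution (ENNReal.ofReal T) f u) {t : ℝ} (ht : t ∈ Ioo 0 T)
    (hfin : ∫⁻ s in Ioo 0 t, dnorm (fun _ : RR n => 1) (t - s) * g s ^ 2 < ⊤) {A : RR n → CC n}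
    (hA : BRep (heat t f) A) : BRep (u t) fun y => A y + duh (fun _ => 1) U U t y := by
  have := hF.block hm (Function.HasTemperateGrowth.const 1) (fun _ => rfl)
    (fun τ hτ i j k => integrable_leray_heat (Function.HasTemperateGrowth.const 1) hτ i j k) ht hfin
    (A := A) (by rwa [mult_one])
  rwa [mult_one] at this

theorem BRep.ext {v w : TDist n} {h k : RR n → CC n} (hv : BRep v h) (hw : BRep w k)
    (hhk : h =ᵐ[volume] k) : v = w := by
  ext1 ψ
  rw [hv.rep, hw.rep]
  refine integral_congr_ae ?_
  filter_upwards [hhk] with x hx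
  rw [hx]

/-- The right-hand side of the mild formulation depends on the past only through a time integral, so
equality at almost all times gives equality at each time. -/
theorem IsMildSolution.eq_of_ae_eq {f : TDist n} {T' : ℝ≥0∞} (hu : IsMildSolution T' f u)
    (hv : IsMildSolution T' f v) {t : ℝ} (h0 : 0 < t) (ht : ENNReal.ofReal t < T')
    (h : ∀ᵐ s ∂volume.restrict (Ioo 0 t), u s = v s) : u t = v t := by
  ext ψ i
  rw [(hu.2 t h0 ht i ψ).2, (hv.2 t h0 ht i ψ).2]
  congr 1
  rw [bilin, bilin, intervalIntegral.integral_of_le h0.le, intervalIntegral.integral_of_le h0.le,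
    integral_Ioc_eq_integral_Ioo, integral_Ioc_eq_integral_Ioo]
  refine integral_congr_ae ?_
  filter_upwards [h] with s hs
  simp only [bilinIntegrand, hs]

/-- The difference of two solutions is bounded by `G = g + g'`, hence, inserting this into Duhamel's
formula, by every iterate of `kop` applied to `G`. The iterates tend to zero almost everywhere by
the weighted contraction. -/
theorem Flow.unique (h : IsLittlewoodPaley χ φ) (hF : Flow T g u U) (hF' : Flow T g' v V) {α : ℝ}
    (h0 : 0 < α) (hg : TimeGood α T g) (hg' : TimeGood α T g') {f : TDist n}
    (hS : InSh χ f) {ε : ℝ} (hε : ε ∈ Ioo (0 : ℝ) 1) (hf : besovNorm φ (-1 + ε) ⊤ ⊤ f < ⊤)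
    (hu : IsMildSolution (ENNReal.ofReal T) f u) (hv : IsMildSolution (ENNReal.ofReal T) f v)
    {t : ℝ} (ht : t ∈ Ioo 0 T) : u t = v t := by
  have hT : 0 < T := ht.1.trans ht.2
  obtain ⟨K, hK, hb⟩ := h.exists_heatBlocks
  obtain ⟨A, hA⟩ := hb f fun l => (le_weightedSeqNorm_top _ (fun l => distLpNorm ⊤ (dyadic φ l f))
    l).trans_lt (ENNReal.mul_lt_top (by finiteness) hf)
  have hH := (hA.bRep_heatSum h hK hS hε hf).2.1
  obtain ⟨C, hC, hCb⟩ := h.exists_dnorm_one_le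
  set G : ℝ → ℝ≥0∞ := fun s => g s + g' s with hG
  have hGood : TimeGood α T G := hg.add hg'
  have hFG : Flow T G u U := hF.mono hGood.1 fun s => le_self_add
  have hFG' : Flow T G v V := hF'.mono hGood.1 fun s => le_add_self
  obtain ⟨lam, hl, hlam⟩ := hGood.exists_wN_kop_le h0 hC
  have hGN : wN lam T G < ⊤ := (wN_le_eLpNorm hl.le _).trans_lt (hGood.eLpNorm_lt_top h0.le hT)
  have hdk : ∀ (b : ℝ → ℝ≥0∞) (t : ℝ),
      ∫⁻ s in Ioo 0 t, dnorm (fun _ : RR n => 1) (t - s) * (2 * G s * b s) ≤ kop C G b t :=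
    fun b t => setLIntegral_mono' measurableSet_Ioo fun s hs =>
      mul_le_mul' (hCb _ (sub_pos.2 hs.2)) le_rfl
  -- Without frequency localization the Duhamel integral is known to be finite for almost every `t`
  -- only; `IsMildSolution.eq_of_ae_eq` makes this sufficient.
  have hfin : ∀ᵐ t ∂volume.restrict (Ioo 0 T), kop C G G t < ⊤ := by
    have hm := measurable_kop (C := C) hGood.1 hGood.1
    have e : ∫⁻ t in Ioo 0 T, kop C G G t ^ 2 < ⊤ := by
      rw [← eLpNorm_two_sq]
      refine ENNReal.pow_lt_top ((eLpNorm_le_wN hl.le hm).trans_lt ?_)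
      refine ENNReal.mul_lt_top (expw_ne_top _ _).lt_top ((hlam G hGood.1).trans_lt ?_)
      finiteness
    filter_upwards [ae_lt_top (hm.pow_const 2) e.ne] with s hs
    by_contra h2
    rw [not_lt, top_le_iff] at h2
    rw [h2] at hs
    simp at hs
  have hfin2 : ∀ t, kop C G G t < ⊤ →
      ∫⁻ s in Ioo 0 t, dnorm (fun _ : RR n => 1) (t - s) * G s ^ 2 < ⊤ := fun t ht => by
    refine lt_of_le_of_lt (lintegral_mono fun s => ?_) ((hdk G t).trans_lt ht)
    refine mul_le_mul' le_rfl ?_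
    rw [sq, mul_assoc, two_mul]
    exact le_self_add
  have hdiff : ∀ M : ℕ, ∀ᵐ t ∂volume.restrict (Ioo 0 T), ∀ᵐ x,
      ‖U t x - V t x‖ₑ ≤ (kop C G)^[M] G t := by
    intro M
    induction M with
    | zero =>
      refine Eventually.of_forall fun t => Eventually.of_forall fun x => ?_
      exact (enorm_sub_le).trans (add_le_add (hF.bound t x) (hF'.bound t x))
    | succ M ih =>
      filter_upwards [hfin, ae_restrict_of_ae hF.rep, ae_restrict_of_ae hF'.rep,
        ae_restrict_mem measurableSet_Ioo] with t htf htu htv htT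
      have h1 := (htu htT).isRep.ae_eq
        (hFG.bRep_duh hu htT (hfin2 t htf) (hH t htT.1)).isRep
      have h2 := (htv htT).isRep.ae_eq
        (hFG'.bRep_duh hv htT (hfin2 t htf) (hH t htT.1)).isRep
      filter_upwards [h1, h2] with x hx1 hx2
      rw [hx1, hx2, add_sub_add_left_eq_sub, Function.iterate_succ_apply']
      exact (enorm_duh_sub_le measurable_const hF.meas hF'.meas hFG.bound hFG'.bound (hfin2 t htf)
        (ae_restrict_of_ae_restrict_of_subset (Ioo_subset_Ioo_right htT.2.le) ih) x).trans
        (hdk _ t)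
  have hit := wN_iterate_kop_le hGood.1 hlam hGood.1
  have hlim := ae_tendsto_zero_of_wN_le hGN.ne (fun M => (hit M).1) fun M => (hit M).2
  refine hu.eq_of_ae_eq hv ht.1 ((ENNReal.ofReal_lt_ofReal_iff hT).2 ht.2)
    (ae_restrict_of_ae_restrict_of_subset (Ioo_subset_Ioo_right ht.2.le) ?_)
  filter_upwards [hlim, ae_all_iff.2 hdiff, ae_restrict_of_ae hF.rep, ae_restrict_of_ae hF'.rep,
    ae_restrict_mem measurableSet_Ioo] with s hs hd hsu hsv hsT
  refine (hsu hsT).ext (hsv hsT) ?_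
  filter_upwards [ae_all_iff.2 hd] with x hx
  have := ge_of_tendsto' hs hx
  rwa [nonpos_iff_eq_zero, enorm_eq_zero, sub_eq_zero] at this

end

section

/-! ### The fixed point -/

variable {T : ℝ} {H U V : ℝ → RR n → CC n} {w : ℝ → ℝ≥0∞}

/-- The components of `U` are real-valued. -/
def RealField (U : ℝ → RR n → CC n) : Prop := ∀ t x i, starRingEnd ℂ (U t x i) = U t x i

theorem conj_dker_one (i j k : Fin n) (τ : ℝ) (x : RR n) :
    starRingEnd ℂ (dker (fun _ => 1) i j k τ x) = dker (fun _ => 1) i j k τ x := by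
  rw [dker, conj_ker]
  congr 1; ext ξ
  simp only [mul_one, map_mul, conj_lerayGradSymbol, heatSymbol, norm_neg, Complex.conj_ofReal,
    neg_neg]

theorem RealField.duh (hU : RealField U) : RealField (duh (fun _ => 1) U U) := by
  intro t y i
  change starRingEnd ℂ (∑ j, ∑ k, ∫ s in Ioo 0 t, ∫ x,
    U s x j * U s x k * dker (fun _ => 1) i j k (t - s) (x - y)) = ∑ j, ∑ k, ∫ s in Ioo 0 t, ∫ x,
    U s x j * U s x k * dker (fun _ => 1) i j k (t - s) (x - y)
  simp only [map_sum, ← integral_conj, map_mul, conj_dker_one, hU _ _ _]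

/-- The right-hand side of Duhamel's formula on `(0,T)`. -/
def duhamelMap (T : ℝ) (H U : ℝ → RR n → CC n) (t : ℝ) (x : RR n) : CC n :=
  (Ioo 0 T).indicator (fun t => H t x + duh (fun _ => 1) U U t x) t

theorem duhamelMap_of_mem {t : ℝ} (ht : t ∈ Ioo 0 T) (x : RR n) :
    duhamelMap T H U t x = H t x + duh (fun _ => 1) U U t x := indicator_of_mem ht _

theorem duhamelMap_of_notMem {t : ℝ} (ht : t ∉ Ioo 0 T) (x : RR n) :
    duhamelMap T H U t x = 0 := indicator_of_notMem ht _

theorem measurable_duhamelMap (hH : Measurable (Function.uncurry H))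
    (hU : Measurable (Function.uncurry U)) : Measurable (Function.uncurry (duhamelMap T H U)) :=
  (hH.add (measurable_duh measurable_const hU hU)).indicator
    (s := {p : ℝ × RR n | p.1 ∈ Ioo 0 T}) (measurable_fst measurableSet_Ioo)

theorem RealField.duhamelMap (hH : RealField H) (hU : RealField U) :
    RealField (duhamelMap T H U) := by
  intro t x i
  by_cases ht : t ∈ Ioo 0 T
  · rw [duhamelMap_of_mem ht, PiLp.add_apply, map_add, hH, hU.duh]
  · rw [duhamelMap_of_notMem ht]; simp

/-- Picard iteration from zero, for functions defined everywhere with bounds that hold everywhere.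
The ball has radius `2a` relative to `w`, on which the quadratic map has Lipschitz constant `4aΛ`.
The limit is a telescoping series, so that measurability and reality pass to it directly. -/
theorem exists_fixed_point (hH : Measurable (Function.uncurry H)) (hw : Measurable w)
    (hwt : ∀ t, w t ≠ ⊤) {Λ a : ℝ≥0∞} (ha : a ≠ ⊤)
    (hL : ∀ t ∈ Ioo 0 T, ∫⁻ s in Ioo 0 t, dnorm (fun _ : RR n => 1) (t - s) * w s ^ 2 ≤ Λ * w t)
    (hHb : ∀ t ∈ Ioo 0 T, ∀ x, ‖H t x‖ₑ ≤ a * w t) (hq : 4 * a * Λ < 1) :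
    ∃ U : ℝ → RR n → CC n, Measurable (Function.uncurry U) ∧ (∀ t x, ‖U t x‖ₑ ≤ 2 * a * w t) ∧
      (∀ t ∈ Ioo 0 T, ∀ x, U t x = H t x + duh (fun _ => 1) U U t x) ∧
      (∀ t ∉ Ioo 0 T, ∀ x, U t x = 0) ∧ (RealField H → RealField U) := by
  set q := 4 * a * Λ with hqd
  have hdm : Measurable (dnorm (fun _ : RR n => 1)) := measurable_dnorm measurable_const
  have hLc : ∀ (c : ℝ≥0∞), ∀ t ∈ Ioo 0 T,
      ∫⁻ s in Ioo 0 t, dnorm (fun _ : RR n => 1) (t - s) * (c * w s ^ 2) ≤ c * Λ * w t := by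
    intro c t ht
    simp_rw [mul_left_comm _ c]
    rw [lintegral_const_mul _ (by fun_prop), mul_assoc]
    gcongr
    exact hL t ht
  have hfin : ∀ t ∈ Ioo 0 T,
      ∫⁻ s in Ioo 0 t, dnorm (fun _ : RR n => 1) (t - s) * (2 * a * w s) ^ 2 < ⊤ := by
    intro t ht
    simp_rw [mul_pow _ (w _)]
    refine (hLc _ t ht).trans_lt ?_
    rw [show (2 * a) ^ 2 * Λ * w t = a * q * w t by rw [hqd]; ring]
    have := hq.ne_top
    have := hwt t
    finiteness
  have hstep : ∀ U : ℝ → RR n → CC n, Measurable (Function.uncurry U) →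
      (∀ t x, ‖U t x‖ₑ ≤ 2 * a * w t) → ∀ t x, ‖duhamelMap T H U t x‖ₑ ≤ 2 * a * w t := by
    intro U hU hUb t x
    by_cases ht : t ∈ Ioo 0 T
    · rw [duhamelMap_of_mem ht]
      refine (enorm_add_le _ _).trans ?_
      calc _ ≤ a * w t + (2 * a) ^ 2 * Λ * w t := by
            refine add_le_add (hHb t ht x) ((enorm_duh_le_of_bound measurable_const hU hU
              (G := fun s => (2 * a) ^ 2 * w s ^ 2) (Eventually.of_forall fun s =>
                Eventually.of_forall fun x => ?_) x).trans (hLc _ t ht))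
            rw [← mul_pow, sq]
            exact mul_le_mul' (hUb s x) (hUb s x)
        _ = a * w t + q * (a * w t) := by rw [hqd]; ring
        -- Invariance of the ball: the quadratic term is `4a²Λ w = q (a w)` with `q < 1`.
        _ ≤ a * w t + 1 * (a * w t) := by gcongr
        _ = _ := by ring
    · rw [duhamelMap_of_notMem ht]; simp
  have hsub : ∀ U V : ℝ → RR n → CC n, Measurable (Function.uncurry U) →
      Measurable (Function.uncurry V) → (∀ t x, ‖U t x‖ₑ ≤ 2 * a * w t) →
      (∀ t x, ‖V t x‖ₑ ≤ 2 * a * w t) → ∀ c : ℝ≥0∞, (∀ t x, ‖U t x - V t x‖ₑ ≤ c * w t) →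
      ∀ t x, ‖duhamelMap T H U t x - duhamelMap T H V t x‖ₑ ≤ c * q * w t := by
    intro U V hU hV hUb hVb c hc t x
    by_cases ht : t ∈ Ioo 0 T
    · rw [duhamelMap_of_mem ht, duhamelMap_of_mem ht, add_sub_add_left_eq_sub]
      refine (enorm_duh_sub_le measurable_const hU hV hUb hVb (hfin t ht) (δ := fun s => c * w s)
        (Eventually.of_forall fun s => Eventually.of_forall fun x => hc s x) x).trans ?_
      refine le_trans (le_of_eq (lintegral_congr fun s => ?_)) ((hLc (4 * a * c) t ht).trans
        (le_of_eq ?_))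
      · congr 1; ring
      · rw [hqd]; ring
    · rw [duhamelMap_of_notMem ht, duhamelMap_of_notMem ht]; simp
  set S : ℕ → ℝ → RR n → CC n := fun m => (duhamelMap T H)^[m] 0 with hS
  have hS0 : S 0 = 0 := rfl
  have hS1 : ∀ m, S (m + 1) = duhamelMap T H (S m) := fun m => Function.iterate_succ_apply' _ _ _
  have hSm : ∀ m, Measurable (Function.uncurry (S m)) ∧ ∀ t x, ‖S m t x‖ₑ ≤ 2 * a * w t := by
    intro m
    induction m with
    | zero =>
      refine ⟨?_, fun t x => by simp [hS0]⟩
      rw [hS0]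
      exact (measurable_const : Measurable fun _ : ℝ × RR n => (0 : CC n))
    | succ m ih => rw [hS1]; exact ⟨measurable_duhamelMap hH ih.1, hstep _ ih.1 ih.2⟩
  have hSd : ∀ m t x, ‖S (m + 1) t x - S m t x‖ₑ ≤ 2 * a * q ^ m * w t := by
    intro m
    induction m with
    | zero => intro t x; simpa [hS0] using (hSm 1).2 t x
    | succ m ih =>
      intro t x
      rw [hS1 (m + 1), hS1 m, pow_succ, ← mul_assoc]
      exact hsub _ _ (hS1 m ▸ (hSm (m + 1)).1) (hSm m).1 (hS1 m ▸ (hSm (m + 1)).2) (hSm m).2 _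
        (by rw [← hS1]; exact ih) t x
  set B := ∑' m : ℕ, q ^ m with hB
  have hBt : B ≠ ⊤ := by
    rw [hB, ENNReal.tsum_geometric, ENNReal.inv_ne_top]
    exact (tsub_pos_of_lt hq).ne'
  have hsumb : ∀ t, ∑' m : ℕ, 2 * a * q ^ m * w t = 2 * a * B * w t := fun t => by
    rw [ENNReal.tsum_mul_right, ENNReal.tsum_mul_left]
  have hsumm : ∀ t x, Summable fun m => S (m + 1) t x - S m t x := fun t x => by
    have hf : ∑' m : ℕ, 2 * a * q ^ m * w t ≠ ⊤ := by
      rw [hsumb]; have := hwt t; finiteness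
    refine (ENNReal.summable_toReal hf).of_norm_bounded fun l => ?_
    rw [← toReal_enorm]
    exact ENNReal.toReal_mono (ENNReal.ne_top_of_tsum_ne_top hf l) (hSd l t x)
  set U : ℝ → RR n → CC n := fun t x => ∑' m, (S (m + 1) t x - S m t x) with hU
  have hlim : ∀ t x, Tendsto (fun m => S m t x) atTop (𝓝 (U t x)) := fun t x => by
    have := (hsumm t x).hasSum.tendsto_sum_nat
    simp_rw [Finset.sum_range_sub (fun m => S m t x), hS0] at this
    simpa using this
  have hUm : Measurable (Function.uncurry U) :=
    measurable_of_tendsto_metrizable (fun m => (hSm m).1)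
      (tendsto_pi_nhds.2 fun p => hlim p.1 p.2)
  have hUb : ∀ t x, ‖U t x‖ₑ ≤ 2 * a * w t := fun t x =>
    le_of_tendsto' (hlim t x).enorm fun m => (hSm m).2 t x
  have hUS : ∀ m t x, ‖S m t x - U t x‖ₑ ≤ 2 * a * B * q ^ m * w t := by
    intro m t x
    have h1 : HasSum (fun k => S (k + m + 1) t x - S (k + m) t x) (U t x - S m t x) := by
      have := (hasSum_nat_add_iff' m).2 (hsumm t x).hasSum
      rw [Finset.sum_range_sub (fun m => S m t x), hS0] at this
      simpa using this
    rw [enorm_sub_rev]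
    refine (enorm_le_tsum_of_hasSum h1).trans ((ENNReal.tsum_le_tsum fun k => hSd (k + m) t x).trans
      (le_of_eq ?_))
    rw [ENNReal.tsum_mul_right, ENNReal.tsum_mul_left]
    simp_rw [pow_add]
    rw [ENNReal.tsum_mul_right]
    ring
  have hfix : ∀ t x, U t x = duhamelMap T H U t x := by
    intro t x
    refine tendsto_nhds_unique ((hlim t x).comp (tendsto_add_atTop_nat 1)) ?_
    rw [tendsto_iff_edist_tendsto_0]
    have h2 : Tendsto (fun m : ℕ => 2 * a * B * q ^ m * q * w t) atTop
        (𝓝 (2 * a * B * 0 * q * w t)) := by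
      have hqt := hq.ne_top
      have hw := hwt t
      exact ENNReal.Tendsto.mul_const (ENNReal.Tendsto.mul_const (ENNReal.Tendsto.const_mul
        (ENNReal.tendsto_pow_atTop_nhds_zero_of_lt_one hq) (Or.inr (by finiteness)))
        (Or.inr hqt)) (Or.inr hw)
    rw [mul_zero, zero_mul, zero_mul] at h2
    refine tendsto_of_tendsto_of_tendsto_of_le_of_le tendsto_const_nhds h2 (fun _ => zero_le)
      fun m => ?_
    simp only [Function.comp_apply, hS1, edist_eq_enorm_sub]
    exact hsub _ _ (hSm m).1 hUm (hSm m).2 hUb _ (hUS m) t x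
  refine ⟨U, hUm, hUb, fun t ht x => (hfix t x).trans (duhamelMap_of_mem ht x),
    fun t ht x => (hfix t x).trans (duhamelMap_of_notMem ht x), fun hr t x i => ?_⟩
  have hSr : ∀ m, RealField (S m) := fun m => by
    induction m with
    | zero => intro t x i; simp [hS0]
    | succ m ih => rw [hS1]; exact hr.duhamelMap ih
  have h1 : Tendsto (fun m => S m t x i) atTop (𝓝 (U t x i)) :=
    ((EuclideanSpace.proj (𝕜 := ℂ) i).continuous.tendsto _).comp (hlim t x)
  refine tendsto_nhds_unique ((Complex.continuous_conj.tendsto _).comp h1) ?_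
  simpa only [Function.comp_def, hSr _ _ _ _] using h1

/-- Split at `t/2`, where the nonsingular factor is at most twice its value at `t`. The constant is
explicit because its growth as an exponent approaches one enters the dependence on `ε`. -/
theorem lintegral_beta_le {a b t : ℝ} (ha0 : 0 ≤ a) (ha : a < 1) (hb0 : 0 ≤ b) (hb : b < 1)
    (ht : 0 < t) :
    ∫⁻ s in Ioo 0 t, ENNReal.ofReal ((t - s) ^ (-a)) * ENNReal.ofReal (s ^ (-b)) ≤
      ENNReal.ofReal (2 * (1 / (1 - a) + 1 / (1 - b)) * t ^ (1 - a - b)) := by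
  have h1 : ∀ c : ℝ, 0 ≤ c → c < 1 → (t / 2) ^ (-c) ≤ 2 * t ^ (-c) := fun c h0 h1 => by
    rw [Real.div_rpow ht.le two_pos.le, Real.rpow_neg two_pos.le, div_inv_eq_mul, mul_comm]
    gcongr
    calc (2 : ℝ) ^ c ≤ 2 ^ (1 : ℝ) := Real.rpow_le_rpow_of_exponent_le one_le_two h1.le
      _ = 2 := Real.rpow_one 2
  have hrefl : ∫⁻ s in Ioo 0 t, ENNReal.ofReal ((t - s) ^ (-a)) =
      ∫⁻ s in Ioo 0 t, ENNReal.ofReal (s ^ (-a)) := by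
    rw [← lintegral_indicator measurableSet_Ioo, ← lintegral_indicator measurableSet_Ioo,
      ← lintegral_sub_left_eq_self _ t]
    refine lintegral_congr fun s => ?_
    by_cases hs : s ∈ Ioo 0 t
    · rw [indicator_of_mem hs, indicator_of_mem (show t - s ∈ Ioo 0 t from
        ⟨sub_pos.2 hs.2, sub_lt_self t hs.1⟩), sub_sub_cancel]
    · rw [indicator_of_notMem hs, indicator_of_notMem fun h : t - s ∈ Ioo 0 t =>
        hs ⟨by linarith [h.2], by linarith [h.1]⟩]
  calc _ ≤ ∫⁻ s in Ioo 0 t, (ENNReal.ofReal ((t / 2) ^ (-a)) * ENNReal.ofReal (s ^ (-b)) +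
        ENNReal.ofReal ((t / 2) ^ (-b)) * ENNReal.ofReal ((t - s) ^ (-a))) := by
        refine setLIntegral_mono' measurableSet_Ioo fun s hs => ?_
        rcases le_total s (t / 2) with h | h
        · refine le_add_right ?_
          gcongr ENNReal.ofReal ?_ * _
          exact Real.rpow_le_rpow_of_nonpos (by positivity) (by linarith) (by linarith)
        · refine le_add_left ?_
          rw [mul_comm]
          gcongr ENNReal.ofReal ?_ * _
          exact Real.rpow_le_rpow_of_nonpos (by positivity) h (by linarith)
    _ = ENNReal.ofReal ((t / 2) ^ (-a)) * ENNReal.ofReal (t ^ (1 - b) / (1 - b)) +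
        ENNReal.ofReal ((t / 2) ^ (-b)) * ENNReal.ofReal (t ^ (1 - a) / (1 - a)) := by
        rw [lintegral_add_left (by fun_prop), lintegral_const_mul _ (by fun_prop),
          lintegral_const_mul _ (by fun_prop), hrefl, lintegral_rpow_neg ha ht.le,
          lintegral_rpow_neg hb ht.le]
    _ = ENNReal.ofReal ((t / 2) ^ (-a) * (t ^ (1 - b) / (1 - b)) +
          (t / 2) ^ (-b) * (t ^ (1 - a) / (1 - a))) := by
        have := sub_pos.2 ha
        have := sub_pos.2 hb
        rw [ENNReal.ofReal_add (by positivity) (by positivity), ENNReal.ofReal_mul (by positivity),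
          ENNReal.ofReal_mul (by positivity)]
    _ ≤ _ := by
        have h3 := sub_pos.2 ha
        have h4 := sub_pos.2 hb
        refine ENNReal.ofReal_le_ofReal ?_
        calc _ ≤ 2 * t ^ (-a) * (t ^ (1 - b) / (1 - b)) + 2 * t ^ (-b) * (t ^ (1 - a) / (1 - a)) := by
              gcongr
              · exact h1 a ha0 ha
              · exact h1 b hb0 hb
          _ = 2 * (t ^ (-b) * t ^ (1 - a) / (1 - a) + t ^ (-a) * t ^ (1 - b) / (1 - b)) := by ring
          _ = _ := by
              rw [← Real.rpow_add ht, ← Real.rpow_add ht, show -b + (1 - a) = 1 - a - b by ring,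
                show -a + (1 - b) = 1 - a - b by ring]
              ring

end

section

/-! ### Construction of mild solutions -/

variable {χ φ : RR n → ℝ} {T : ℝ} {H U : ℝ → RR n → CC n} {u : ℝ → TDist n} {f : TDist n}
  {g : ℝ → ℝ≥0∞}

theorem multT_one (ψ : 𝓢(RR n, ℂ)) : multT (fun _ => 1) ψ = ψ := by
  rw [multT_eq_multS (fun _ => rfl) (Function.HasTemperateGrowth.const 1), multS,
    SchwartzMap.fourierMultiplierCLM_const]
  simp

/-- Although `ℙ∇ψ` need not be Schwartz, it is the kernel of the Leray symbol times a Schwartz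
symbol. Bounded products may thus be paired with it. -/
theorem IsLittlewoodPaley.integrable_lerayGrad (h : IsLittlewoodPaley χ φ) (i j k : Fin n)
    (ψ : 𝓢(RR n, ℂ)) : Integrable (lerayGrad i j k ψ) volume := by
  have hm : IsSch fun ξ : RR n => 𝓕 (ψ : RR n → ℂ) ((2 * Real.pi)⁻¹ • ξ) :=
    IsSch.comp_smul (m := 𝓕 (ψ : RR n → ℂ)) ⟨𝓕 ψ, fun x => by rw [SchwartzMap.fourier_coe]⟩
      (inv_ne_zero two_pi_ne_zero)
  have e : lerayGrad i j k ψ =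
      ker fun ξ => lerayGradSymbol i j k ξ * 𝓕 (ψ : RR n → ℂ) ((2 * Real.pi)⁻¹ • ξ) := by
    rw [lerayGrad, ker]
    congr 1; ext η
    rw [smul_smul, inv_mul_cancel₀ two_pi_ne_zero, one_smul]
  rw [e]
  exact ⟨(continuous_ker (hm.integrable_lerayGradSymbol_mul i j k)).aestronglyMeasurable,
    h.kerNorm_lerayGradSymbol_mul_lt_top hm i j k⟩

theorem BRep.productAdmissible (h : IsLittlewoodPaley χ φ) {v : TDist n} {w : RR n → CC n}
    (hv : BRep v w) : ProductAdmissible v v := by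
  refine ⟨⟨w, hv.isRep⟩, ⟨w, hv.isRep⟩, fun i j k ψ => ?_⟩
  obtain ⟨M, hM⟩ := hv.bdd
  have h1 : Integrable (fun x => w x j * w x k * lerayGrad i j k ψ x) volume := by
    refine (h.integrable_lerayGrad i j k ψ).bdd_mul (c := M * M)
      (((measurable_coord j).comp hv.meas).mul
        ((measurable_coord k).comp hv.meas)).aestronglyMeasurable (Eventually.of_forall fun x => ?_)
    rw [norm_mul]
    have h0 := (norm_nonneg _).trans (hM x)
    exact mul_le_mul ((PiLp.norm_apply_le _ _).trans (hM x)) ((PiLp.norm_apply_le _ _).trans (hM x))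
      (norm_nonneg _) h0
  refine h1.congr ?_
  filter_upwards [hv.isRep.toFn_ae_eq] with x hx
  rw [hx]

theorem BRep.integrable {v : TDist n} {w : RR n → CC n} (hv : BRep v w) (ψ : 𝓢(RR n, ℂ)) :
    Integrable (fun x => ψ x • w x) volume := by
  obtain ⟨M, hM⟩ := hv.bdd
  exact ψ.integrable.smul_bdd M hv.meas.aestronglyMeasurable (Eventually.of_forall hM)

theorem BRep.apply {v : TDist n} {w : RR n → CC n} (hv : BRep v w) (ψ : 𝓢(RR n, ℂ)) (i : Fin n) :
    v ψ i = ∫ x, ψ x * w x i := by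
  rw [hv.rep]
  exact ((EuclideanSpace.proj (𝕜 := ℂ) i).integral_comp_comm (hv.integrable ψ)).symm

/-- Solutions of Duhamel's formula are mild solutions. -/
theorem Flow.isMildSolution (h : IsLittlewoodPaley χ φ) (hF : Flow T g u U)
    (hU : ∀ t ∈ Ioo 0 T, BRep (u t) (U t)) (hH : ∀ t ∈ Ioo 0 T, BRep (heat t f) (H t))
    (hfin : ∀ t ∈ Ioo 0 T, ∫⁻ s in Ioo 0 t, dnorm (fun _ : RR n => 1) (t - s) * g s ^ 2 < ⊤)
    (hd : ∀ t ∈ Ioo 0 T, ∀ x, U t x = H t x + duh (fun _ => 1) U U t x) :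
    IsMildSolution (ENNReal.ofReal T) f u := by
  have hlt : ∀ t : ℝ, 0 < t → ENNReal.ofReal t < ENNReal.ofReal T → t ∈ Ioo 0 T := fun t h0 h1 =>
    ⟨h0, (ENNReal.ofReal_lt_ofReal_iff').1 h1 |>.1⟩
  refine ⟨Eventually.of_forall fun s h0 h1 => (hU s (hlt s h0 h1)).productAdmissible h,
    fun t h0 h1 i ψ => ?_⟩
  have ht := hlt t h0 h1
  have h2 := hF.bilin_multT (Function.HasTemperateGrowth.const 1) (fun _ => rfl)
    (fun τ hτ i j k => integrable_leray_heat (Function.HasTemperateGrowth.const 1) hτ i j k) ht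
    (hfin t ht) ψ i
  rw [multT_one] at h2
  refine ⟨h2.1, ?_⟩
  have hdm : Measurable (duh (fun _ => 1) U U t) :=
    (measurable_duh measurable_const hF.meas hF.meas).comp (f := fun y => (t, y))
      measurable_prodMk_left
  obtain ⟨d, hd'⟩ := exists_bRep hdm (enorm_bdd_iff (hfin t ht).ne
    (enorm_duh_le_of_bound measurable_const hF.meas hF.meas (Eventually.of_forall fun s =>
      Eventually.of_forall fun x => by
        rw [sq]; exact mul_le_mul' (hF.bound s x) (hF.bound s x))))
  have e : u t = heat t f + d := (hU t ht).ext ((hH t ht).add hd')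
    (Eventually.of_forall (hd t ht))
  rw [e, sub_eq_add_neg, h2.2, ← hd'.apply]
  rfl

/-- Mild solutions stay in `𝓢'_h`. -/
theorem Flow.inSh (h : IsLittlewoodPaley χ φ) (hF : Flow T g u U)
    (hm : IsMildSolution (ENNReal.ofReal T) f u) (hS : InSh χ f)
    (hH : ∀ t ∈ Ioo 0 T, BRep (heat t f) (H t)) (hg : ∫⁻ s in Ioo 0 T, g s ^ 2 < ⊤) {t : ℝ}
    (ht : t ∈ Ioo 0 T) : InSh χ (u t) := by
  obtain ⟨C, hC, hb⟩ := h.exists_dnorm_chi_le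
  have hgm := hF.gmeas
  set Q := ∫⁻ s in Ioo 0 T, g s ^ 2
  have h1 : ∀ l : ℤ, ∫⁻ s in Ioo 0 t, dnorm (dsym χ l) (t - s) * g s ^ 2 ≤
      ENNReal.ofReal (2 ^ l) * (C * Q) := by
    intro l
    calc _ ≤ ∫⁻ s in Ioo 0 t, C * ENNReal.ofReal (2 ^ l) * g s ^ 2 := by
          refine setLIntegral_mono' measurableSet_Ioo fun s hs => ?_
          gcongr
          exact hb l _ (sub_pos.2 hs.2)
      _ = C * ENNReal.ofReal (2 ^ l) * ∫⁻ s in Ioo 0 t, g s ^ 2 :=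
          lintegral_const_mul _ (by fun_prop)
      _ ≤ C * ENNReal.ofReal (2 ^ l) * Q :=
          mul_le_mul' le_rfl (lintegral_mono_set (Ioo_subset_Ioo_right ht.2.le))
      _ = _ := by ring
  have hQ : C * Q ≠ ⊤ := ENNReal.mul_ne_top hC hg.ne
  have h2 : ∀ l : ℤ, distLpNorm ⊤ (dyadic χ l (u t)) ≤
      distLpNorm ⊤ (dyadic χ l (heat t f)) + ENNReal.ofReal (2 ^ l) * (C * Q) := by
    intro l
    have hA := (hH t ht).mult (h.isSch_chi l)
    have hr := hF.block hm (h.isSch_chi l).hasTemperateGrowth (dsym_neg h.radial_χ l)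
      (fun τ hτ i j k => integrable_leray_heat (h.isSch_chi l).hasTemperateGrowth hτ i j k) ht
      ((h1 l).trans_lt (by finiteness)) hA
    have hdm : Measurable (duh (dsym χ l) U U t) :=
      (measurable_duh (h.isSch_chi l).continuous.measurable hF.meas hF.meas).comp
        (f := fun y => (t, y)) measurable_prodMk_left
    rw [dyadic_eq, dyadic_eq, hr.distLpNorm_eq, hA.distLpNorm_eq]
    refine (eLpNorm_add_le hA.meas.aestronglyMeasurable hdm.aestronglyMeasurable le_top).trans ?_
    gcongr
    rw [eLpNorm_exponent_top]
    refine eLpNormEssSup_le_of_ae_enorm_bound (Eventually.of_forall fun y => ?_)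
    exact (enorm_duh_le_of_bound (h.isSch_chi l).continuous.measurable hF.meas hF.meas
      (Eventually.of_forall fun s => Eventually.of_forall fun x => by
        rw [sq]; exact mul_le_mul' (hF.bound s x) (hF.bound s x)) y).trans (h1 l)
  have h3 : Tendsto (fun l : ℤ => ENNReal.ofReal (2 ^ l) * (C * Q)) atBot (𝓝 0) := by
    have : Tendsto (fun l : ℤ => ENNReal.ofReal ((2 : ℝ) ^ l)) atBot (𝓝 0) := by
      have h4 : Tendsto (fun l : ℤ => (2 : ℝ) ^ l) atBot (𝓝 0) := by
        have := (tendsto_rpow_atBot_of_base_gt_one 2 one_lt_two).comp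
          (tendsto_intCast_atBot_iff.2 tendsto_id : Tendsto (fun l : ℤ => (l : ℝ)) atBot atBot)
        simpa [Function.comp_def] using this
      simpa using ENNReal.tendsto_ofReal h4
    simpa using ENNReal.Tendsto.mul_const this (Or.inr hQ)
  have h5 := (hS.mult h (isSch_heatSymbol ht.1)).add h3
  rw [add_zero] at h5
  exact tendsto_of_tendsto_of_tendsto_of_le_of_le tendsto_const_nhds h5 (fun _ => zero_le) h2

/-! ### Real-valued representatives. -/

/-- The field of the real parts of the components. -/
def rePart (w : RR n → CC n) (x : RR n) : CC n := WithLp.toLp 2 fun i => ((w x i).re : ℂ)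

theorem norm_rePart_le (w : RR n → CC n) (x : RR n) : ‖rePart w x‖ ≤ ‖w x‖ := by
  rw [EuclideanSpace.norm_eq, EuclideanSpace.norm_eq]
  refine Real.sqrt_le_sqrt (Finset.sum_le_sum fun i _ => ?_)
  gcongr
  change ‖((w x i).re : ℂ)‖ ≤ _
  rw [Complex.norm_real]
  exact Complex.abs_re_le_norm _

theorem measurable_rePart {X : Type*} [MeasurableSpace X] {F : X → RR n → CC n}
    (hF : Measurable (Function.uncurry F)) :
    Measurable (Function.uncurry fun t => rePart (F t)) := by
  refine (PiLp.continuous_toLp 2 _).measurable.comp (measurable_pi_lambda _ fun i => ?_)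
  exact Complex.continuous_ofReal.measurable.comp
    (Complex.measurable_re.comp ((measurable_coord i).comp hF))

/-- Real distributions are given by real functions. -/
theorem BRep.rePart {v : TDist n} (hr : IsReal v) {w : RR n → CC n} (hv : BRep v w) :
    BRep v (rePart w) := by
  have hm : Measurable (BesovNS.rePart w) :=
    (measurable_rePart (F := fun _ : Unit => w) (hv.meas.comp measurable_snd)).comp
      (measurable_prodMk_left (x := ()))
  obtain ⟨M, hM⟩ := hv.bdd
  have hb : ∃ M : ℝ, ∀ x, ‖BesovNS.rePart w x‖ ≤ M := ⟨M, fun x => (norm_rePart_le w x).trans (hM x)⟩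
  obtain ⟨v', hv'⟩ := exists_bRep hm hb
  have hae : w =ᵐ[volume] BesovNS.rePart w := by
    refine ae_eq_of_integral_contDiff_smul_eq (locallyIntegrable_of_bdd hv.meas hv.bdd)
      (locallyIntegrable_of_bdd hm hb) fun θ hθ hc => ?_
    have h1 : HasCompactSupport (Complex.ofRealCLM ∘ θ) := hc.comp_left rfl
    have h2 : ContDiff ℝ ∞ (Complex.ofRealCLM ∘ θ) := Complex.ofRealCLM.contDiff.comp hθ
    set ψ := h1.toSchwartzMap h2
    have e : ∀ (V : RR n → CC n), ∫ x, θ x • V x = ∫ x, ψ x • V x := fun V => by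
      refine integral_congr_ae (Eventually.of_forall fun x => ?_)
      change θ x • V x = (θ x : ℂ) • V x
      rw [Complex.coe_smul]
    rw [e, e, ← hv.rep, ← hv'.rep]
    ext i
    have h3 : (v ψ i).im = 0 := hr ψ (fun x => Complex.ofReal_im _) i
    have h4 : Integrable (fun x => ψ x * w x i) volume :=
      (EuclideanSpace.proj (𝕜 := ℂ) i).integrable_comp (hv.integrable ψ)
    have h5 : v' ψ i = ((v ψ i).re : ℂ) := by
      rw [hv'.apply, hv.apply, ← RCLike.re_eq_complex_re, ← integral_re h4]
      refine Eq.trans ?_ (integral_ofReal (𝕜 := ℂ))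
      refine integral_congr_ae (Eventually.of_forall fun x => ?_)
      change (θ x : ℂ) * ((w x i).re : ℂ) = (((θ x : ℂ) * w x i).re : ℂ)
      rw [Complex.re_ofReal_mul, Complex.ofReal_mul]
    rw [h5]
    exact Complex.ext rfl (by simp [h3])
  rwa [hv.ext hv' hae]

theorem isReal_heat {f : TDist n} (hf : IsReal f) {t : ℝ} (ht : 0 < t) : IsReal (heat t f) := by
  intro ψ hψ i
  refine hf _ (fun y => ?_) i
  change (multT (heatSymbol t) ψ y).im = 0
  rw [multT_apply (isSch_heatSymbol ht), ← Complex.conj_eq_iff_im, ← integral_conj]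
  refine integral_congr_ae (Eventually.of_forall fun z => ?_)
  simp only [map_mul]
  rw [conj_ker, Complex.conj_eq_iff_im.2 (hψ z)]
  congr 2; ext ξ
  simp only [heatSymbol, norm_neg, Complex.conj_ofReal]

/-- A beta integral with exponents `α` and `2κ`; the condition `α + 2κ ≤ 1` makes the resulting
power of `t` nonnegative and the bound uniform up to `T`. -/
theorem timeGood_rpow {α κ : ℝ} (hα0 : 0 ≤ α) (hα : α < 1) (hκ0 : 0 ≤ κ) (hκ : κ < 1 / 2)
    (hακ : α + 2 * κ ≤ 1) {c : ℝ≥0∞} (hc : c ≠ ⊤) :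
    TimeGood α T fun s => c * ENNReal.ofReal (s ^ (-κ)) := by
  refine ⟨by fun_prop, c ^ 2 * ENNReal.ofReal
    (2 * (1 / (1 - α) + 1 / (1 - 2 * κ)) * T ^ (1 - α - 2 * κ)), by finiteness, fun t h0 ht => ?_⟩
  calc _ = ∫⁻ s in Ioo 0 t, c ^ 2 *
        (ENNReal.ofReal ((t - s) ^ (-α)) * ENNReal.ofReal (s ^ (-(2 * κ)))) := by
        refine setLIntegral_congr_fun measurableSet_Ioo fun s hs => ?_
        simp only []
        rw [mul_pow, ← ENNReal.ofReal_pow (Real.rpow_nonneg hs.1.le _), ← Real.rpow_natCast,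
          ← Real.rpow_mul hs.1.le, mul_left_comm]
        congr 5; push_cast; ring
    _ = c ^ 2 * _ := lintegral_const_mul _ (by fun_prop)
    _ ≤ c ^ 2 * ENNReal.ofReal (2 * (1 / (1 - α) + 1 / (1 - 2 * κ)) * t ^ (1 - α - 2 * κ)) := by
        gcongr
        exact lintegral_beta_le hα0 hα (by linarith) (by linarith) h0
    _ ≤ _ := by
        have h1 : 0 < 1 - α := by linarith
        have h2 : 0 < 1 - 2 * κ := by linarith
        gcongr
        linarith

/-- Existence of mild solutions for data whose free evolution is small. -/
theorem IsLittlewoodPaley.exists_solution (h : IsLittlewoodPaley χ φ) {Cd : ℝ≥0∞} (hCd : Cd ≠ ⊤)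
    (hCb : ∀ τ : ℝ, 0 < τ → dnorm (fun _ : RR n => 1) τ ≤ Cd * ENNReal.ofReal (τ ^ (-(1 / 2) : ℝ)))
    (hr : IsReal f) (hS : InSh χ f) {κ : ℝ} (hκ0 : 0 ≤ κ) (hκ : κ < 1 / 2) (hT : 0 < T)
    (hH : Measurable (Function.uncurry H)) (hrep : ∀ t ∈ Ioo 0 T, BRep (heat t f) (H t))
    {a : ℝ≥0∞} (ha : a ≠ ⊤) (hHb : ∀ t ∈ Ioo 0 T, ∀ x, ‖H t x‖ₑ ≤ a * ENNReal.ofReal (t ^ (-κ)))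
    (hq : 4 * a * (Cd * ENNReal.ofReal (2 * (2 + 1 / (1 - 2 * κ)) * T ^ (1 / 2 - κ))) < 1) :
    ∃ u U, Flow T (fun s => 2 * a * ENNReal.ofReal (s ^ (-κ))) u U ∧
      IsMildSolution (ENNReal.ofReal T) f u ∧ (∀ t ∈ Ioo 0 T, IsReal (u t) ∧ InSh χ (u t)) ∧
        ∀ ψ : 𝓢(RR n, ℂ), Measurable fun t : Ioo (0 : ℝ) T => u t ψ := by
  -- The free evolution of real data is real, so the real part of `H` represents it as well.
  -- Starting from a field that is real everywhere, the fixed point is real everywhere.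
  have hrep' : ∀ t ∈ Ioo 0 T, BRep (heat t f) (rePart (H t)) := fun t ht =>
    (hrep t ht).rePart (isReal_heat hr ht.1)
  have hL : ∀ t ∈ Ioo 0 T, ∫⁻ s in Ioo 0 t, dnorm (fun _ : RR n => 1) (t - s) *
      ENNReal.ofReal (s ^ (-κ)) ^ 2 ≤ Cd * ENNReal.ofReal (2 * (2 + 1 / (1 - 2 * κ)) *
        T ^ (1 / 2 - κ)) * ENNReal.ofReal (t ^ (-κ)) := by
    intro t ht
    calc _ ≤ ∫⁻ s in Ioo 0 t, Cd * (ENNReal.ofReal ((t - s) ^ (-(1 / 2) : ℝ)) *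
          ENNReal.ofReal (s ^ (-(2 * κ)))) := by
          refine setLIntegral_mono' measurableSet_Ioo fun s hs => ?_
          rw [← ENNReal.ofReal_pow (Real.rpow_nonneg hs.1.le _), ← Real.rpow_natCast,
            ← Real.rpow_mul hs.1.le, ← mul_assoc, show -κ * ((2 : ℕ) : ℝ) = -(2 * κ) by
              push_cast; ring]
          gcongr
          exact hCb _ (sub_pos.2 hs.2)
      _ = Cd * _ := lintegral_const_mul _ (by fun_prop)
      _ ≤ Cd * ENNReal.ofReal (2 * (1 / (1 - 1 / 2) + 1 / (1 - 2 * κ)) *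
          t ^ (1 - 1 / 2 - 2 * κ)) := by
          gcongr
          exact lintegral_beta_le (by norm_num) (by norm_num) (by linarith) (by linarith) ht.1
      _ ≤ _ := by
          have h2 : 0 < 1 - 2 * κ := by linarith
          have h3 := ht.1
          rw [mul_assoc Cd, ← ENNReal.ofReal_mul (by positivity)]
          gcongr Cd * ?_
          refine ENNReal.ofReal_le_ofReal ?_
          -- One factor `t^{-κ}` restores the weight; the remaining power has a positive exponent
          -- and is bounded by its value at `T`.
          rw [show 1 - 1 / 2 - 2 * κ = (1 / 2 - κ) + -κ by ring, Real.rpow_add ht.1,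
            show (1 : ℝ) / (1 - 1 / 2) = 2 by norm_num, ← mul_assoc]
          have h4 : 0 ≤ 1 / 2 - κ := by linarith
          gcongr
          exact ht.2.le
  obtain ⟨U, hUm, hUb, hUd, -, hUr⟩ := exists_fixed_point (T := T)
    (H := fun t => rePart (H t)) (w := fun s => ENNReal.ofReal (s ^ (-κ))) (measurable_rePart hH)
    (by fun_prop) (fun _ => ENNReal.ofReal_ne_top) ha hL (fun t ht x => (enorm_le_iff_norm_le.2
      (norm_rePart_le _ _)).trans (hHb t ht x)) hq
  have hUr := hUr fun t x i => Complex.conj_ofReal _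
  have hrepU : ∀ t, ∃ v, BRep v (U t) := fun t =>
    exists_bRep (hUm.comp measurable_prodMk_left) (enorm_bdd_iff (by finiteness) (hUb t))
  choose u hu using hrepU
  have hF : Flow T (fun s => 2 * a * ENNReal.ofReal (s ^ (-κ))) u U :=
    ⟨hUm, by fun_prop, hUb, Eventually.of_forall fun s _ => hu s⟩
  have hdm : Measurable (dnorm (fun _ : RR n => 1)) := measurable_dnorm measurable_const
  have hfin : ∀ t ∈ Ioo 0 T, ∫⁻ s in Ioo 0 t, dnorm (fun _ : RR n => 1) (t - s) *
      (2 * a * ENNReal.ofReal (s ^ (-κ))) ^ 2 < ⊤ := by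
    intro t ht
    simp_rw [mul_pow _ (ENNReal.ofReal _), mul_left_comm _ ((2 * a) ^ 2)]
    rw [lintegral_const_mul _ (by fun_prop)]
    exact ENNReal.mul_lt_top (by finiteness) ((hL t ht).trans_lt (by finiteness))
  have hm := hF.isMildSolution h (fun t _ => hu t) hrep' hfin hUd
  have hg2 := (timeGood_rpow (T := T) le_rfl zero_lt_one hκ0 hκ (by linarith)
    (c := 2 * a) (by finiteness)).lintegral_sq_lt_top le_rfl hT
  refine ⟨u, U, hF, hm, fun t ht => ⟨fun ψ hψ i => ?_, hF.inSh h hm hS hrep' hg2 ht⟩, fun ψ => ?_⟩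
  · rw [(hu t).apply, ← Complex.conj_eq_iff_im, ← integral_conj]
    refine integral_congr_ae (Eventually.of_forall fun x => ?_)
    simp only [map_mul]
    rw [hUr, Complex.conj_eq_iff_im.2 (hψ x)]
  · simp_rw [fun t => (hu t).rep ψ]
    have h1 : StronglyMeasurable fun t => ∫ x, ψ x • U t x :=
      StronglyMeasurable.integral_prod_right' (f := fun q : ℝ × RR n => ψ q.2 • U q.1 q.2)
        (Measurable.stronglyMeasurable
          ((ψ.continuous.measurable.comp measurable_snd).smul hUm))
    exact h1.measurable.comp measurable_subtype_coe

end

section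

/-! ### Local existence -/

variable {χ φ : RR n → ℝ} {ε s : ℝ} {p q : ℝ≥0∞} {f : TDist n}

/-- Mild solutions given by functions with integrable bounds belong to the solution spaces. -/
theorem Flow.memZ (h : IsLittlewoodPaley χ φ) {T α : ℝ} {g : ℝ → ℝ≥0∞} {u : ℝ → TDist n}
    {U : ℝ → RR n → CC n} (hF : Flow T g u U) (hg : TimeGood α T g) (hT : 0 < T) (h0 : 0 < α)
    (h1 : α ≤ 1) (hm : IsMildSolution (ENNReal.ofReal T) f u) {ε₀ : ℝ}
    (hε₀ : 0 < ε₀) (hf₀ : besovNorm φ (-1 + ε₀) ⊤ ⊤ f < ⊤)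
    (hu : ∀ t ∈ Ioo 0 T, IsReal (u t) ∧ InSh χ (u t))
    (hw : ∀ ψ : 𝓢(RR n, ℂ), Measurable fun t : Ioo (0 : ℝ) T => u t ψ)
    (hP : AdmissibleParams ε s p q) (hf : MemBesov χ φ s p q f)
    (hf' : MemBesov χ φ (-1 + ε) ⊤ ⊤ f) :
    MemZ χ φ s p q T u ∧ MemZ χ φ (-1 + ε) ⊤ ⊤ T u := by
  obtain ⟨⟨hε0, hε1⟩, hs, hp, hq⟩ := hP
  exact ⟨⟨hu, hw, hF.persist h hg hT h0 h1 hm hε₀ hf₀ hs hp hq hf.2.2⟩,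
    ⟨hu, hw, hF.persist h hg hT h0 h1 hm hε₀ hf₀ (by linarith) le_top le_top hf'.2.2⟩⟩

/-- The square, used with `k = 1`, keeps the constant positive even if `C = 0`. -/
theorem toReal_mul_le {C : ℝ≥0∞} (hC : C ≠ ⊤) {k r : ℝ} :
    C * ENNReal.ofReal r ≤ ENNReal.ofReal ((C.toReal + k ^ 2) * r) := by
  rw [ENNReal.ofReal_mul (by positivity)]
  gcongr
  conv_lhs => rw [← ENNReal.ofReal_toReal hC]
  exact ENNReal.ofReal_le_ofReal (by nlinarith)

/-- Either term of the minimum may be the small one. The Besov term gives the fixed point with `κ =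
(1 - ε)/2`, the `L^∞` term with `κ = 0`. Both solutions have time integrability with exponent `ε/2`,
so persistence of regularity places them in the same spaces. -/
theorem IsLittlewoodPaley.exists_memZ (h : IsLittlewoodPaley χ φ) :
    ∃ C C' : ℝ, 0 < C ∧ 0 < C' ∧ ∀ (T ε s : ℝ) (p q : ℝ≥0∞) (f : TDist n), 0 < T →
      AdmissibleParams ε s p q → MemBesov χ φ s p q f → MemBesov χ φ (-1 + ε) ⊤ ⊤ f →
        rho φ C C' ε T f < 1 → ∃ u : ℝ → TDist n, MemZ χ φ s p q T u ∧
          MemZ χ φ (-1 + ε) ⊤ ⊤ T u ∧ IsMildSolution (ENNReal.ofReal T) f u := by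
  obtain ⟨K, hK, hb⟩ := h.exists_heatBlocks
  obtain ⟨Cd, hCd, hCb⟩ := h.exists_dnorm_one_le
  set K' := kerNorm (heatSymbol (n := n) 1) with hK'
  have hK't : K' ≠ ⊤ := (isSch_heatSymbol one_pos).kerNorm_lt_top.ne
  -- `504 = 4 · 21 · 6`: the contraction condition, the dyadic sum `21/(1-ε)`, and `2(2 + 1/ε) ≤
  -- 6/ε` from the beta integral. For `κ = 0` the last factor is exactly `6`, and `24 = 4 · 6`.
  refine ⟨(504 * K * Cd).toReal + 1 ^ 2, (24 * K' * Cd).toReal + 1 ^ 2, by positivity, by positivity,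
    fun T ε s p q f hT hP hf hf' hrho => ?_⟩
  obtain ⟨hr, hS, hf'n⟩ := hf'
  have hε := hP.1
  obtain ⟨hε0, hε1⟩ := hP.1
  have h1ε : 0 < 1 - ε := by linarith
  suffices hex : ∃ κ a, 0 ≤ κ ∧ κ < 1 / 2 ∧ ε / 2 + 2 * κ ≤ 1 ∧ a ≠ ⊤ ∧ ∃ u U,
      Flow T (fun s => 2 * a * ENNReal.ofReal (s ^ (-κ))) u U ∧
      IsMildSolution (ENNReal.ofReal T) f u ∧ (∀ t ∈ Ioo 0 T, IsReal (u t) ∧ InSh χ (u t)) ∧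
        ∀ ψ : 𝓢(RR n, ℂ), Measurable fun t : Ioo (0 : ℝ) T => u t ψ by
    obtain ⟨κ, a, hκ0, hκ, hκε, ha, u, U, hF, hm, hu, hw⟩ := hex
    have hg := timeGood_rpow (T := T) (α := ε / 2) (by linarith) (by linarith) hκ0 hκ hκε
      (c := 2 * a) (by finiteness)
    obtain ⟨h1, h2⟩ := hF.memZ h hg hT (by linarith) (by linarith) hm hε0 hf'n hu hw hP hf
      ⟨hr, hS, hf'n⟩
    exact ⟨u, h1, h2, hm⟩
  rw [rho, min_lt_iff] at hrho
  rcases hrho with hrho | hrho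
  · set N := besovNorm φ (-1 + ε) ⊤ ⊤ f with hN
    obtain ⟨A, hA⟩ := hb f fun l => (le_weightedSeqNorm_top _ (fun l => distLpNorm ⊤ (dyadic φ l f))
      l).trans_lt (ENNReal.mul_lt_top (by finiteness) hf'n)
    obtain ⟨hHm, hHr, hHb⟩ := hA.bRep_heatSum h hK hS hε hf'n
    have hat : K * ENNReal.ofReal (21 / (1 - ε)) * N ≠ ⊤ := by have := hf'n.ne; finiteness
    refine ⟨(1 - ε) / 2, K * ENNReal.ofReal (21 / (1 - ε)) * N, by linarith, by linarith,
      by linarith, hat, h.exists_solution hCd hCb hr hS (by linarith) (by linarith) hT hHm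
      (fun t ht => hHr t ht.1) hat (fun t ht x => (hHb t ht.1 x).trans (le_of_eq ?_)) ?_⟩
    · rw [ENNReal.ofReal_mul (by positivity)]; ring
    · refine lt_of_le_of_lt ?_ hrho
      calc _ = 4 * K * Cd * (ENNReal.ofReal (21 / (1 - ε)) *
            ENNReal.ofReal (2 * (2 + 1 / (1 - 2 * ((1 - ε) / 2))) * T ^ (1 / 2 - (1 - ε) / 2))) *
              N := by ring
        _ ≤ 4 * K * Cd * ENNReal.ofReal (126 * (1 / (ε * (1 - ε)) * T ^ (ε / 2))) * N := by
            rw [← ENNReal.ofReal_mul (by positivity)]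
            refine mul_le_mul' (mul_le_mul' le_rfl (ENNReal.ofReal_le_ofReal ?_)) le_rfl
            rw [show 1 - 2 * ((1 - ε) / 2) = ε by ring,
              show 1 / 2 - (1 - ε) / 2 = ε / 2 by ring]
            have e : 2 * (2 + 1 / ε) ≤ 6 / ε := by
              rw [le_div_iff₀ hε0]
              have : 1 / ε * ε = 1 := one_div_mul_cancel hε0.ne'
              nlinarith
            calc 21 / (1 - ε) * (2 * (2 + 1 / ε) * T ^ (ε / 2))
                ≤ 21 / (1 - ε) * (6 / ε * T ^ (ε / 2)) := by gcongr
              _ = _ := by field_simp; norm_num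
        _ = 504 * K * Cd * ENNReal.ofReal (1 / (ε * (1 - ε)) * T ^ (ε / 2)) * N := by
            rw [ENNReal.ofReal_mul (by norm_num), ENNReal.ofReal_ofNat]; ring
        _ ≤ _ := by
            gcongr
            refine (toReal_mul_le (k := 1) (by finiteness)).trans_eq ?_
            congr 1; ring
  · set N := distLpNorm ⊤ f with hN
    have hNt : N ≠ ⊤ := fun hN => by
      rw [hN, ENNReal.mul_top] at hrho
      · simp at hrho
      · have : 0 < (24 * K' * Cd).toReal + 1 ^ 2 := by positivity
        exact (ENNReal.ofReal_pos.2 (by positivity)).ne'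
    obtain ⟨f₀, hf₀, hfb⟩ := exists_bRep_of_distLpNorm_lt_top hNt.lt_top
    have hat : K' * N ≠ ⊤ := by finiteness
    refine ⟨0, K' * N, le_rfl, by norm_num, by linarith, hat, h.exists_solution hCd hCb hr hS le_rfl
      (by norm_num) hT (measurable_cv_family (m := heatSymbol) measurable_heatSymbol hf₀.meas)
      (fun t ht => hf₀.mult (isSch_heatSymbol ht.1)) hat (fun t ht x => ?_) ?_⟩
    · rw [neg_zero, Real.rpow_zero, ENNReal.ofReal_one, mul_one, hK', ← kerNorm_heatSymbol ht.1]
      exact enorm_cv_le_of_bound (isSch_heatSymbol ht.1).ker.continuous.measurable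
        (Eventually.of_forall hfb) x
    · refine lt_of_le_of_lt ?_ hrho
      calc _ = 4 * K' * Cd * ENNReal.ofReal (6 * T ^ (1 / 2 : ℝ)) * N := by
            norm_num; ring
        _ = 24 * K' * Cd * ENNReal.ofReal (T ^ (1 / 2 : ℝ)) * N := by
            rw [ENNReal.ofReal_mul (by norm_num), ENNReal.ofReal_ofNat]; ring
        _ ≤ _ := by
            gcongr
            exact toReal_mul_le (k := 1) (by finiteness)

/-! ### Restriction and gluing of solutions -/

variable {T T' : ℝ} {u v : ℝ → TDist n}

theorem MemZ.mono (hu : MemZ χ φ s p q T u) (h : T' ≤ T) : MemZ χ φ s p q T' u := by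
  obtain ⟨h1, h2, h3, h4⟩ := hu
  have hs : Ioo 0 T' ⊆ Ioo 0 T := Ioo_subset_Ioo_right h
  refine ⟨fun t ht => h1 t (hs ht), fun ψ => ?_, lt_of_le_of_lt (weightedSeqNorm_mono fun j => ?_) h3,
    lt_of_le_of_lt (weightedSeqNorm_mono fun j => ?_) h4⟩
  · exact (h2 ψ).comp (measurable_subtype_coe.subtype_mk (h := fun t : Ioo (0 : ℝ) T' => hs t.2))
  · exact eLpNorm_mono_measure _ (Measure.restrict_mono hs le_rfl)
  · exact biSup_mono fun t ht => hs ht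

theorem MemZ.congr (hu : MemZ χ φ s p q T u) (h : ∀ t ∈ Ioo 0 T, u t = v t) :
    MemZ χ φ s p q T v := by
  obtain ⟨h1, h2, h3, h4⟩ := hu
  refine ⟨fun t ht => h t ht ▸ h1 t ht, fun ψ => ?_, lt_of_le_of_lt (weightedSeqNorm_mono fun j =>
    le_of_eq ?_) h3, lt_of_le_of_lt (weightedSeqNorm_mono fun j => le_of_eq ?_) h4⟩
  · have : (fun t : Ioo (0 : ℝ) T => v t ψ) = fun t : Ioo (0 : ℝ) T => u t ψ :=
      funext fun t => by rw [h t t.2]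
    rw [this]; exact h2 ψ
  · refine eLpNorm_congr_ae ?_
    filter_upwards [ae_restrict_mem measurableSet_Ioo] with t ht
    rw [h t ht]
  · exact iSup_congr fun t => iSup_congr fun ht => by rw [h t ht]

theorem IsMildSolution.mono {T T' : ℝ≥0∞} (hu : IsMildSolution T f u) (h : T' ≤ T) :
    IsMildSolution T' f u :=
  ⟨hu.1.mono fun _ hs h0 h1 => hs h0 (h1.trans_le h), fun t h0 h1 => hu.2 t h0 (h1.trans_le h)⟩

theorem bilinIntegrand_congr {t t' : ℝ} (h : u t' = v t') (i : Fin n) (ψ : 𝓢(RR n, ℂ)) :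
    bilinIntegrand u u t i ψ t' = bilinIntegrand v v t i ψ t' := by
  rw [bilinIntegrand, bilinIntegrand, h]

theorem IsMildSolution.congr {T : ℝ≥0∞} (hu : IsMildSolution T f u)
    (h : ∀ t, 0 < t → ENNReal.ofReal t < T → u t = v t) : IsMildSolution T f v := by
  refine ⟨hu.1.mono fun s hs h0 h1 => h s h0 h1 ▸ hs h0 h1, fun t h0 h1 i ψ => ?_⟩
  have he : EqOn (bilinIntegrand u u t i ψ) (bilinIntegrand v v t i ψ) (uIoc 0 t) := fun s hs => by
    rw [uIoc_of_le h0.le] at hs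
    exact bilinIntegrand_congr (h s hs.1 ((ENNReal.ofReal_le_ofReal hs.2).trans_lt h1)) i ψ
  obtain ⟨h2, h3⟩ := hu.2 t h0 h1 i ψ
  refine ⟨h2.congr he, ?_⟩
  rw [← h t h0 h1, h3, bilin, bilin]
  congr 1
  exact intervalIntegral.integral_congr_ae (Eventually.of_forall he)

/-- The almost everywhere condition is assembled from countably many intervals, hence the rational
end points. -/
theorem IsMildSolution.of_forall_lt {T : ℝ≥0∞}
    (h : ∀ T' : ℝ, 0 < T' → ENNReal.ofReal T' < T → IsMildSolution (ENNReal.ofReal T') f u) :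
    IsMildSolution T f u := by
  have hex : ∀ t : ℝ, 0 < t → ENNReal.ofReal t < T → ∃ r : ℚ, t < r ∧ ENNReal.ofReal r < T := by
    intro t h0 ht
    obtain ⟨r, hr1, hr2⟩ := ENNReal.lt_iff_exists_nnreal_btwn.1 ht
    obtain ⟨x, hx1, hx2⟩ := exists_rat_btwn
      (show t < (r : ℝ) from (ENNReal.ofReal_lt_ofReal_iff'.1 (by rwa [ENNReal.ofReal_coe_nnreal])).1)
    exact ⟨x, hx1, lt_of_le_of_lt (by
      rw [← ENNReal.ofReal_coe_nnreal]; exact ENNReal.ofReal_le_ofReal hx2.le) hr2⟩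
  have hlt : ∀ {t : ℝ} {r : ℚ}, 0 < t → t < r → ENNReal.ofReal t < ENNReal.ofReal r :=
    fun h0 h1 => (ENNReal.ofReal_lt_ofReal_iff (h0.trans h1)).2 h1
  constructor
  · have h1 : ∀ r : ℚ, ∀ᵐ s ∂(volume : Measure ℝ), (0 : ℝ) < r → ENNReal.ofReal r < T → 0 < s →
        ENNReal.ofReal s < ENNReal.ofReal r → ProductAdmissible (u s) (u s) := by
      intro r
      by_cases hr : (0 : ℝ) < r ∧ ENNReal.ofReal r < T
      · exact (h r hr.1 hr.2).1.mono fun s hs _ _ => hs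
      · exact Eventually.of_forall fun s h0 h1 => absurd ⟨h0, h1⟩ hr
    filter_upwards [ae_all_iff.2 h1] with s hs h0 hsT
    obtain ⟨r, hr, hrT⟩ := hex s h0 hsT
    exact hs r (h0.trans hr) hrT h0 (hlt h0 hr)
  · intro t h0 ht
    obtain ⟨r, hr, hrT⟩ := hex t h0 ht
    exact (h r (h0.trans hr) hrT).2 t h0 (hlt h0 hr)

/-- Mild solutions on `(0,T)` in the solution spaces for the data `f`. -/
structure GoodSolution (χ φ : RR n → ℝ) (ε s : ℝ) (p q : ℝ≥0∞) (f : TDist n) (T : ℝ)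
    (u : ℝ → TDist n) : Prop where
  memZ : MemZ χ φ s p q T u
  memZ' : MemZ χ φ (-1 + ε) ⊤ ⊤ T u
  mild : IsMildSolution (ENNReal.ofReal T) f u

theorem GoodSolution.mono (hu : GoodSolution χ φ ε s p q f T u) (h : T' ≤ T) :
    GoodSolution χ φ ε s p q f T' u :=
  ⟨hu.1.mono h, hu.2.mono h, hu.3.mono (ENNReal.ofReal_le_ofReal h)⟩

theorem mem_Ioo_of_ofReal_lt {t T : ℝ} (h0 : 0 < t) (h : ENNReal.ofReal t < ENNReal.ofReal T) :
    t ∈ Ioo 0 T := ⟨h0, (ENNReal.ofReal_lt_ofReal_iff'.1 h).1⟩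

theorem GoodSolution.congr (hu : GoodSolution χ φ ε s p q f T u) (h : ∀ t ∈ Ioo 0 T, u t = v t) :
    GoodSolution χ φ ε s p q f T v :=
  ⟨hu.1.congr h, hu.2.congr h, hu.3.congr fun t h0 h1 => h t (mem_Ioo_of_ofReal_lt h0 h1)⟩

theorem isSolutionBefore_iff {T : ℝ≥0∞} : IsSolutionBefore χ φ ε s p q f T u ↔
    ∀ T' : ℝ, 0 < T' → ENNReal.ofReal T' < T → GoodSolution χ φ ε s p q f T' u :=
  ⟨fun h T' h0 h1 => ⟨(h.1 T' h0 h1).1, (h.1 T' h0 h1).2, h.2.mono h1.le⟩,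
    fun h => ⟨fun T' h0 h1 => ⟨(h T' h0 h1).1, (h T' h0 h1).2⟩,
      .of_forall_lt fun T' h0 h1 => (h T' h0 h1).3⟩⟩

theorem GoodSolution.isSolutionBefore (hu : GoodSolution χ φ ε s p q f T u) :
    IsSolutionBefore χ φ ε s p q f (ENNReal.ofReal T) u :=
  isSolutionBefore_iff.2 fun _ h0 h1 => hu.mono (mem_Ioo_of_ofReal_lt h0 h1).2.le

theorem GoodSolution.unique (h : IsLittlewoodPaley χ φ) (hε : ε ∈ Ioo (0 : ℝ) 1)
    (hf : MemBesov χ φ (-1 + ε) ⊤ ⊤ f) (hu : GoodSolution χ φ ε s p q f T u)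
    (hv : GoodSolution χ φ ε s p q f T' v) {t : ℝ} (ht : t ∈ Ioo 0 T) (ht' : t ∈ Ioo 0 T') :
    u t = v t := by
  have htm : t ∈ Ioo 0 (min T T') := ⟨ht.1, lt_min ht.2 ht'.2⟩
  have h0 := htm.1.trans htm.2
  have hu := hu.mono (min_le_left T T')
  have hv := hv.mono (min_le_right T T')
  obtain ⟨g, U, hF, hg⟩ := hu.2.exists_flow h hε h0
  obtain ⟨g', V, hF', hg'⟩ := hv.2.exists_flow h hε h0
  exact hF.unique h hF' (half_pos hε.1) hg hg' hf.2.1 hε hf.2.2 hu.3 hv.3 htm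

/-- The maximal time is attained. -/
theorem exists_isSolutionBefore_maximalTime (h : IsLittlewoodPaley χ φ) (hε : ε ∈ Ioo (0 : ℝ) 1)
    (hf : MemBesov χ φ (-1 + ε) ⊤ ⊤ f) :
    ∃ u, IsSolutionBefore χ φ ε s p q f (maximalTime χ φ ε s p q f) u := by
  classical
  -- At each time the value of an arbitrary solution that lives beyond this time; by uniqueness the
  -- choices agree with any given solution.
  refine ⟨fun t => if ht : ∃ (T : ℝ) (u : ℝ → TDist n), t < T ∧ GoodSolution χ φ ε s p q f T u then
    ht.choose_spec.choose t else 0, isSolutionBefore_iff.2 fun T h0 hT => ?_⟩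
  obtain ⟨T₁, ⟨u, hu⟩, hT₁⟩ := lt_sSup_iff.1 hT
  have hu := isSolutionBefore_iff.1 hu T h0 hT₁
  refine hu.congr fun t ht => ?_
  have hex : ∃ (T : ℝ) (u : ℝ → TDist n), t < T ∧ GoodSolution χ φ ε s p q f T u :=
    ⟨T, u, ht.2, hu⟩
  rw [dif_pos hex]
  obtain ⟨h1, h2⟩ := hex.choose_spec.choose_spec
  exact hu.unique h hε hf h2 ht ⟨ht.1, h1⟩

end

section

/-! ### Concatenation of solutions -/

variable {χ φ : RR n → ℝ} {ε s : ℝ} {p q : ℝ≥0∞} {f : TDist n} {u v : ℝ → TDist n}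

/-- Follow `u` up to the time `t₀` and `v` afterwards. -/
def concat (u v : ℝ → TDist n) (t₀ t : ℝ) : TDist n := if t ≤ t₀ then u t else v (t - t₀)

theorem concat_of_le {t₀ t : ℝ} (h : t ≤ t₀) : concat u v t₀ t = u t := if_pos h

theorem concat_of_lt {t₀ t : ℝ} (h : t₀ < t) : concat u v t₀ t = v (t - t₀) := if_neg h.not_ge

theorem heat_apply {τ : ℝ} (hτ : 0 ≤ τ) (w : TDist n) (ψ : 𝓢(RR n, ℂ)) :
    heat τ w ψ = w (multS (heatSymbol τ) ψ) := by
  rw [heat, mult_apply, multT_eq_multS (fun ξ => by simp only [heatSymbol, norm_neg])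
    (hasTemperateGrowth_heatSymbol hτ)]

theorem heat_heat {τ t : ℝ} (hτ : 0 ≤ τ) (ht : 0 ≤ t) (w : TDist n) :
    heat τ (heat t w) = heat (t + τ) w := by
  rw [heat, heat, heat, mult_mult (hasTemperateGrowth_heatSymbol ht)
    (hasTemperateGrowth_heatSymbol hτ)]
  congr 1 with ξ
  rw [heatSymbol_add]

/-- Semigroup property, with the additional heat flow moved to the test function. -/
theorem bilinIntegrand_add {t₀ τ σ : ℝ} (hτ : 0 ≤ τ) (hσ : σ ≤ t₀) (i : Fin n)
    (ψ : 𝓢(RR n, ℂ)) : bilinIntegrand u u (t₀ + τ) i ψ σ =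
      bilinIntegrand u u t₀ i (multS (heatSymbol τ) ψ) σ := by
  rw [bilinIntegrand, bilinIntegrand, multS_multS (hasTemperateGrowth_heatSymbol hτ)
    (hasTemperateGrowth_heatSymbol (by linarith))]
  congr 2 with ξ
  rw [← heatSymbol_add]
  congr 1; ring

/-- For `t = t₀ + τ` the Duhamel integral splits at `t₀`: the first part is `e^{τΔ}` applied to the
Duhamel term of `u` at `t₀` and combines with `e^{tΔ} f` to give `e^{τΔ} u(t₀)`; the second one is
that of `v` after a translation in time. -/
theorem IsMildSolution.concat {t₀ T₁ T₂ : ℝ}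
    (hu : IsMildSolution (ENNReal.ofReal T₂) f u) (h0 : 0 < t₀) (ht₀ : t₀ < T₂)
    (hv : IsMildSolution (ENNReal.ofReal T₁) (u t₀) v) :
    IsMildSolution (ENNReal.ofReal (t₀ + T₁)) f (concat u v t₀) := by
  have hT₂ : 0 < T₂ := h0.trans ht₀
  have hlt : ∀ {t : ℝ}, t ≤ t₀ → ENNReal.ofReal t < ENNReal.ofReal T₂ := fun h =>
    (ENNReal.ofReal_lt_ofReal_iff hT₂).2 (h.trans_lt ht₀)
  have hlt' : ∀ {t : ℝ}, t₀ < t → ENNReal.ofReal t < ENNReal.ofReal (t₀ + T₁) →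
      0 < t - t₀ ∧ ENNReal.ofReal (t - t₀) < ENNReal.ofReal T₁ := fun h1 h2 => by
    have := (ENNReal.ofReal_lt_ofReal_iff'.1 h2).1
    exact ⟨by linarith, (ENNReal.ofReal_lt_ofReal_iff (by linarith)).2 (by linarith)⟩
  refine ⟨?_, fun t ht htT i ψ => ?_⟩
  · filter_upwards [hu.1,
      (measurePreserving_sub_right volume t₀).quasiMeasurePreserving.ae hv.1] with t h1 h2 h3 h4
    rcases le_or_gt t t₀ with h | h
    · rw [concat_of_le h]; exact h1 h3 (hlt h)
    · rw [concat_of_lt h]; exact h2 (hlt' h h4).1 (hlt' h h4).2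
  rcases le_or_gt t t₀ with h | h
  · have he : EqOn (bilinIntegrand u u t i ψ)
        (bilinIntegrand (BesovNS.concat u v t₀) (BesovNS.concat u v t₀) t i ψ) (uIoc 0 t) :=
      fun σ hσ => by
        rw [uIoc_of_le ht.le] at hσ
        exact bilinIntegrand_congr (concat_of_le (hσ.2.trans h)).symm i ψ
    obtain ⟨h1, h2⟩ := hu.2 t ht (hlt h) i ψ
    refine ⟨h1.congr he, ?_⟩
    rw [concat_of_le h, h2, bilin, bilin]
    congr 1
    exact intervalIntegral.integral_congr_ae (Eventually.of_forall he)
  · obtain ⟨hτ, hτT⟩ := hlt' h htT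
    obtain ⟨τ, rfl⟩ : ∃ τ, t = t₀ + τ := ⟨t - t₀, by ring⟩
    rw [add_sub_cancel_left] at hτ hτT
    obtain ⟨hu1, hu2⟩ := hu.2 t₀ h0 (hlt le_rfl) i (multS (heatSymbol τ) ψ)
    obtain ⟨hv1, hv2⟩ := hv.2 τ hτ hτT i ψ
    have he : EqOn (bilinIntegrand u u t₀ i (multS (heatSymbol τ) ψ))
        (bilinIntegrand (BesovNS.concat u v t₀) (BesovNS.concat u v t₀) (t₀ + τ) i ψ)
        (uIoc 0 t₀) := fun σ hσ => by
      rw [uIoc_of_le h0.le] at hσ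
      rw [← bilinIntegrand_add hτ.le hσ.2]
      exact bilinIntegrand_congr (concat_of_le hσ.2).symm i ψ
    have he' : EqOn (fun σ => bilinIntegrand v v τ i ψ (σ - t₀))
        (bilinIntegrand (BesovNS.concat u v t₀) (BesovNS.concat u v t₀) (t₀ + τ) i ψ)
        (uIoc t₀ (t₀ + τ)) := fun σ hσ => by
      rw [uIoc_of_le h.le] at hσ
      simp only [bilinIntegrand, concat_of_lt hσ.1]
      congr 3; ring
    have hi := hu1.congr he
    have hi' : IntervalIntegrable (fun σ => bilinIntegrand v v τ i ψ (σ - t₀)) volume t₀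
        (t₀ + τ) := by
      have := hv1.comp_sub_right t₀
      rwa [zero_add, add_comm τ] at this
    have hi'' := hi'.congr he'
    refine ⟨hi.trans hi'', ?_⟩
    rw [bilin, ← intervalIntegral.integral_add_adjacent_intervals hi hi'',
      ← intervalIntegral.integral_congr_ae (Eventually.of_forall he),
      ← intervalIntegral.integral_congr_ae (Eventually.of_forall he'),
      intervalIntegral.integral_comp_sub_right (fun σ => bilinIntegrand v v τ i ψ σ),
      concat_of_lt h, sub_self, add_sub_cancel_left, hv2, heat_apply hτ.le, hu2, ← heat_apply hτ.le,
      heat_heat hτ.le h0.le, bilin, bilin]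
    ring

theorem iSup_concat_le {F : TDist n → ℝ≥0∞} {t₀ T₁ T₂ : ℝ} (ht₀ : t₀ < T₂) :
    ⨆ t ∈ Ioo 0 (t₀ + T₁), F (concat u v t₀ t) ≤
      (⨆ t ∈ Ioo 0 T₂, F (u t)) + ⨆ t ∈ Ioo 0 T₁, F (v t) := by
  refine iSup₂_le fun t ht => ?_
  rcases le_or_gt t t₀ with h | h
  · rw [concat_of_le h]
    exact (le_iSup₂ (f := fun t (_ : t ∈ Ioo 0 T₂) => F (u t)) t ⟨ht.1, h.trans_lt ht₀⟩).trans
      le_self_add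
  · rw [concat_of_lt h]
    exact (le_iSup₂ (f := fun t (_ : t ∈ Ioo 0 T₁) => F (v t)) (t - t₀)
      ⟨by linarith, by linarith [ht.2]⟩).trans le_add_self

theorem lintegral_concat_le {F : TDist n → ℝ≥0∞} {t₀ T₁ T₂ : ℝ} (ht₀ : t₀ < T₂) :
    ∫⁻ t in Ioo 0 (t₀ + T₁), F (concat u v t₀ t) ≤
      (∫⁻ t in Ioo 0 T₂, F (u t)) + ∫⁻ t in Ioo 0 T₁, F (v t) := by
  calc ∫⁻ t in Ioo 0 (t₀ + T₁), F (concat u v t₀ t)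
      ≤ ∫⁻ t in Ioc 0 t₀ ∪ Ioo t₀ (t₀ + T₁), F (concat u v t₀ t) :=
        lintegral_mono_set fun t ht => (le_or_gt t t₀).imp (fun h => ⟨ht.1, h⟩) fun h => ⟨h, ht.2⟩
    _ ≤ (∫⁻ t in Ioc 0 t₀, F (concat u v t₀ t)) + ∫⁻ t in Ioo t₀ (t₀ + T₁), F (concat u v t₀ t) :=
        lintegral_union_le _ _ _
    _ ≤ _ := by
        refine add_le_add ?_ (le_of_eq ?_)
        · rw [setLIntegral_congr_fun measurableSet_Ioc fun t ht => by rw [concat_of_le ht.2]]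
          exact lintegral_mono_set fun t ht => ⟨ht.1, ht.2.trans_lt ht₀⟩
        · rw [setLIntegral_congr_fun measurableSet_Ioo fun t ht => by rw [concat_of_lt ht.1],
            ← lintegral_indicator measurableSet_Ioo, ← lintegral_indicator measurableSet_Ioo,
            ← lintegral_sub_right_eq_self ((Ioo 0 T₁).indicator fun t => F (v t)) t₀]
          refine lintegral_congr fun t => ?_
          simp only [indicator, mem_Ioo, sub_pos, sub_lt_iff_lt_add']

/-- Each norm of the concatenation is at most the sum of the two norms. That `u` lives beyond `t₀`
covers the junction time itself, which belongs to the first piece. -/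
theorem MemZ.concat {t₀ T₁ T₂ : ℝ} (hq : 1 ≤ q) (hu : MemZ χ φ s p q T₂ u) (ht₀ : t₀ < T₂)
    (hv : MemZ χ φ s p q T₁ v) : MemZ χ φ s p q (t₀ + T₁) (concat u v t₀) := by
  obtain ⟨u1, u2, u3, u4⟩ := hu
  obtain ⟨v1, v2, v3, v4⟩ := hv
  refine ⟨fun t ht => ?_, fun ψ => ?_, ?_, ?_⟩
  · rcases le_or_gt t t₀ with h | h
    · rw [concat_of_le h]; exact u1 t ⟨ht.1, h.trans_lt ht₀⟩
    · rw [concat_of_lt h]; exact v1 (t - t₀) ⟨by linarith, by linarith [ht.2]⟩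
  · have hum := measurable_indicator_of_subtype (f := fun t => u t ψ) measurableSet_Ioo (u2 ψ)
    have hvm := (measurable_indicator_of_subtype (f := fun t => v t ψ) measurableSet_Ioo
      (v2 ψ)).comp (measurable_id.sub_const t₀)
    have hw : Measurable fun t => if t ≤ t₀ then (Ioo 0 T₂).indicator (fun t => u t ψ) t
        else (Ioo 0 T₁).indicator (fun t => v t ψ) (t - t₀) :=
      hum.ite measurableSet_Iic hvm
    suffices e : (fun t : Ioo (0 : ℝ) (t₀ + T₁) => BesovNS.concat u v t₀ t ψ) =
        fun t : Ioo (0 : ℝ) (t₀ + T₁) =>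
        if (t : ℝ) ≤ t₀ then (Ioo 0 T₂).indicator (fun t => u t ψ) (t : ℝ)
          else (Ioo 0 T₁).indicator (fun t => v t ψ) (t - t₀) by
      rw [e]; exact hw.comp measurable_subtype_coe
    ext1 t
    obtain ⟨t, ht⟩ := t
    rcases le_or_gt t t₀ with h | h
    · simp only [if_pos h, concat_of_le h]
      rw [indicator_of_mem (show t ∈ Ioo 0 T₂ from ⟨ht.1, h.trans_lt ht₀⟩)]
    · simp only [if_neg h.not_ge, concat_of_lt h]
      rw [indicator_of_mem (show t - t₀ ∈ Ioo 0 T₁ from ⟨by linarith, by linarith [ht.2]⟩)]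
  · refine lt_of_le_of_lt ((weightedSeqNorm_mono fun j => ?_).trans
      (weightedSeqNorm_add_le _ hq _ _)) (ENNReal.add_lt_top.2 ⟨u3, v3⟩)
    simp only [eLpNorm_one_eq_lintegral_enorm, enorm_eq_self]
    exact lintegral_concat_le (F := fun w => distLpNorm p (dyadic φ j w)) ht₀
  · refine lt_of_le_of_lt ((weightedSeqNorm_mono fun j => ?_).trans
      (weightedSeqNorm_add_le _ hq _ _)) (ENNReal.add_lt_top.2 ⟨u4, v4⟩)
    exact iSup_concat_le (F := fun w => distLpNorm p (dyadic φ j w)) ht₀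

theorem GoodSolution.concat {t₀ T₁ T₂ : ℝ} (hq : 1 ≤ q) (hu : GoodSolution χ φ ε s p q f T₂ u)
    (h0 : 0 < t₀) (ht₀ : t₀ < T₂) (hv : GoodSolution χ φ ε s p q (u t₀) T₁ v) :
    GoodSolution χ φ ε s p q f (t₀ + T₁) (concat u v t₀) :=
  ⟨hu.1.concat hq ht₀ hv.1, hu.2.concat le_top ht₀ hv.2, hu.3.concat h0 ht₀ hv.3⟩

/-! ### The maximal time -/

theorem MemZ.memBesov {T t : ℝ} (hu : MemZ χ φ s p q T u) (ht : t ∈ Ioo 0 T) :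
    MemBesov χ φ s p q (u t) :=
  ⟨(hu.1 t ht).1, (hu.1 t ht).2, lt_of_le_of_lt (weightedSeqNorm_mono fun j =>
    le_iSup₂ (f := fun t (_ : t ∈ Ioo 0 T) => distLpNorm p (dyadic φ j (u t))) t ht) hu.2.2.2⟩

theorem tendsto_ofReal_mul_rpow {c κ T : ℝ} (hκ : 0 ≤ κ) {N : ℝ≥0∞} (hN : N ≠ ⊤) :
    Tendsto (fun T => ENNReal.ofReal (c * T ^ κ) * N) (𝓝 T)
      (𝓝 (ENNReal.ofReal (c * T ^ κ) * N)) :=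
  ENNReal.Tendsto.mul_const (ENNReal.tendsto_ofReal
    ((Real.continuousAt_rpow_const T κ (Or.inr hκ)).tendsto.const_mul c)) (Or.inr hN)

theorem ne_top_of_ofReal_mul_lt_one {c : ℝ} (hc : 0 < c) {N : ℝ≥0∞}
    (h : ENNReal.ofReal c * N < 1) : N ≠ ⊤ := fun hN => by
  rw [hN, ENNReal.mul_top (ENNReal.ofReal_pos.2 hc).ne'] at h
  simp at h

/-- The smallness condition is open in the time of existence. -/
theorem exists_rho_lt_one {C C' T : ℝ} (hC : 0 < C) (hC' : 0 < C') (hε : ε ∈ Ioo (0 : ℝ) 1)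
    (hT : 0 < T) (h : rho φ C C' ε T f < 1) : ∃ T₁, T < T₁ ∧ rho φ C C' ε T₁ f < 1 := by
  obtain ⟨h0, h1⟩ := hε
  have h1' : 0 < 1 - ε := by linarith
  suffices ∀ᶠ T₁ in 𝓝 T, rho φ C C' ε T₁ f < 1 from
    ((eventually_mem_nhdsWithin (s := Ioi T)).and (this.filter_mono nhdsWithin_le_nhds)).exists
  simp only [rho, min_lt_iff] at h ⊢
  rcases h with h | h
  · exact ((tendsto_ofReal_mul_rpow (by linarith)
      (ne_top_of_ofReal_mul_lt_one (by positivity) h)).eventually_lt_const h).mono fun _ => Or.inl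
  · exact ((tendsto_ofReal_mul_rpow (by norm_num)
      (ne_top_of_ofReal_mul_lt_one (by positivity) h)).eventually_lt_const h).mono fun _ => Or.inr

theorem exists_pos_rho_lt_one (C C' : ℝ) (hε : 0 < ε) (hf : besovNorm φ (-1 + ε) ⊤ ⊤ f < ⊤) :
    ∃ T, 0 < T ∧ rho φ C C' ε T f < 1 := by
  have h := tendsto_ofReal_mul_rpow (c := C / (ε * (1 - ε))) (T := 0) (half_pos hε).le hf.ne
  rw [Real.zero_rpow (half_pos hε).ne', mul_zero, ENNReal.ofReal_zero, zero_mul] at h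
  obtain ⟨T, hT, hT'⟩ := ((eventually_mem_nhdsWithin (a := (0 : ℝ)) (s := Ioi 0)).and
    ((h.eventually_lt_const zero_lt_one).filter_mono nhdsWithin_le_nhds)).exists
  exact ⟨T, hT, (min_le_left _ _).trans_lt hT'⟩

/-- The local existence statement with the constants `C`, `C'`. -/
def LocalExistence (χ φ : RR n → ℝ) (C C' : ℝ) : Prop :=
  ∀ (T ε s : ℝ) (p q : ℝ≥0∞) (f : TDist n), 0 < T → AdmissibleParams ε s p q →
    MemBesov χ φ s p q f → MemBesov χ φ (-1 + ε) ⊤ ⊤ f → rho φ C C' ε T f < 1 →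
      ∃ u : ℝ → TDist n, MemZ χ φ s p q T u ∧ MemZ χ φ (-1 + ε) ⊤ ⊤ T u ∧
        IsMildSolution (ENNReal.ofReal T) f u

variable {C C' : ℝ}

theorem LocalExistence.goodSolution (h : LocalExistence χ φ C C') {T : ℝ} (hT : 0 < T)
    (hP : AdmissibleParams ε s p q) (hf : MemBesov χ φ s p q f)
    (hf' : MemBesov χ φ (-1 + ε) ⊤ ⊤ f) (hr : rho φ C C' ε T f < 1) :
    ∃ u, GoodSolution χ φ ε s p q f T u := by
  obtain ⟨u, h1, h2, h3⟩ := h T ε s p q f hT hP hf hf' hr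
  exact ⟨u, h1, h2, h3⟩

theorem GoodSolution.le_maximalTime {T : ℝ} (hu : GoodSolution χ φ ε s p q f T u) :
    ENNReal.ofReal T ≤ maximalTime χ φ ε s p q f :=
  le_sSup ⟨u, hu.isSolutionBefore⟩

theorem LocalExistence.maximalTime_pos (h : LocalExistence χ φ C C')
    (hP : AdmissibleParams ε s p q) (hf : MemBesov χ φ s p q f)
    (hf' : MemBesov χ φ (-1 + ε) ⊤ ⊤ f) : 0 < maximalTime χ φ ε s p q f := by
  obtain ⟨T, hT, hr⟩ := exists_pos_rho_lt_one (φ := φ) C C' hP.1.1 hf'.2.2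
  obtain ⟨u, hu⟩ := h.goodSolution hT hP hf hf' hr
  exact (ENNReal.ofReal_pos.2 hT).trans_le hu.le_maximalTime

/-- The smallness condition fails before the maximal time. -/
theorem LocalExistence.one_le_rho (h : LocalExistence χ φ C C') (hC : 0 < C) (hC' : 0 < C')
    (hP : AdmissibleParams ε s p q) (hT : maximalTime χ φ ε s p q f < ⊤)
    (hu : IsSolutionBefore χ φ ε s p q f (maximalTime χ φ ε s p q f) u) {t : ℝ}
    (ht : t ∈ Ioo 0 (maximalTime χ φ ε s p q f).toReal) :
    1 ≤ rho φ C C' ε ((maximalTime χ φ ε s p q f).toReal - t) (u t) := by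
  by_contra! hr
  -- The life span has to exceed `T* - t` strictly, since a solution up to `T*` would be no
  -- contradiction; continuity of `ρ` in the time variable provides the excess.
  obtain ⟨T₁, hT₁, hr₁⟩ := exists_rho_lt_one hC hC' hP.1 (sub_pos.2 ht.2) hr
  obtain ⟨T₂, ht₂, hT₂⟩ := exists_between ht.2
  have hg := isSolutionBefore_iff.1 hu T₂ (ht.1.trans ht₂)
    ((ENNReal.ofReal_lt_iff_lt_toReal (ht.1.trans ht₂).le hT.ne).2 hT₂)
  have h1 : 0 < T₁ := (sub_pos.2 ht.2).trans hT₁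
  obtain ⟨v, hv⟩ := h.goodSolution h1 hP (hg.1.memBesov ⟨ht.1, ht₂⟩)
    (hg.2.memBesov ⟨ht.1, ht₂⟩) hr₁
  have := ENNReal.toReal_mono hT.ne (hg.concat hP.2.2.2 ht.1 ht₂ hv).le_maximalTime
  rw [ENNReal.toReal_ofReal (by linarith [ht.1])] at this
  linarith

theorem ofReal_inv_le_of_one_le_mul {c d : ℝ} (hd : 0 < d) (hcd : c = d⁻¹) {N : ℝ≥0∞}
    (h : 1 ≤ ENNReal.ofReal d * N) : ENNReal.ofReal c ≤ N := by
  rw [hcd, ENNReal.ofReal_inv_of_pos hd]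
  exact (ENNReal.inv_le_iff_le_mul (fun _ => (ENNReal.ofReal_pos.2 hd).ne')
    fun h => absurd h ENNReal.ofReal_ne_top).2 h

theorem le_besovNorm_of_one_le_rho (hC : 0 < C) (hε : ε ∈ Ioo (0 : ℝ) 1) {T : ℝ} (hT : 0 < T)
    (h : 1 ≤ rho φ C C' ε T f) :
    ENNReal.ofReal (C⁻¹ * (ε * (1 - ε)) * T ^ (-(ε / 2))) ≤ besovNorm φ (-1 + ε) ⊤ ⊤ f := by
  obtain ⟨h0, h1⟩ := hε
  have h1' : 0 < 1 - ε := by linarith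
  refine ofReal_inv_le_of_one_le_mul (by positivity) ?_ (h.trans (min_le_left _ _))
  rw [Real.rpow_neg hT.le, mul_inv, inv_div, div_eq_inv_mul _ C]

theorem le_distLpNorm_of_one_le_rho (hC' : 0 < C') {T : ℝ} (hT : 0 < T)
    (h : 1 ≤ rho φ C C' ε T f) :
    ENNReal.ofReal (C'⁻¹ * T ^ (-(1 / 2 : ℝ))) ≤ distLpNorm ⊤ f := by
  refine ofReal_inv_le_of_one_le_mul (by positivity) ?_ (h.trans (min_le_right _ _))
  rw [Real.rpow_neg hT.le, mul_inv]

/-- The solution classes for different parameters coincide. -/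
theorem GoodSolution.change_params (h : IsLittlewoodPaley χ φ) {T ε' s' : ℝ} {p' q' : ℝ≥0∞}
    (hT : 0 < T) (hu : GoodSolution χ φ ε s p q f T u) (hε : ε ∈ Ioo (0 : ℝ) 1)
    (hf : MemBesov χ φ (-1 + ε) ⊤ ⊤ f) (hP : AdmissibleParams ε' s' p' q')
    (hf₁ : MemBesov χ φ s' p' q' f) (hf₂ : MemBesov χ φ (-1 + ε') ⊤ ⊤ f) :
    GoodSolution χ φ ε' s' p' q' f T u := by
  obtain ⟨g, U, hF, hg⟩ := hu.2.exists_flow h hε hT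
  obtain ⟨h1, h2⟩ := hF.memZ h hg hT (half_pos hε.1) (by linarith [hε.2]) hu.3 hε.1 hf.2.2 hu.2.1
    hu.2.2.1 hP hf₁ hf₂
  exact ⟨h1, h2, hu.3⟩

theorem maximalTime_le (h : IsLittlewoodPaley χ φ) {ε' s' : ℝ} {p' q' : ℝ≥0∞}
    (hε : ε ∈ Ioo (0 : ℝ) 1) (hf : MemBesov χ φ (-1 + ε) ⊤ ⊤ f)
    (hP : AdmissibleParams ε' s' p' q') (hf₁ : MemBesov χ φ s' p' q' f)
    (hf₂ : MemBesov χ φ (-1 + ε') ⊤ ⊤ f) :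
    maximalTime χ φ ε s p q f ≤ maximalTime χ φ ε' s' p' q' f := by
  refine sSup_le fun T ⟨u, hu⟩ => le_sSup ⟨u, isSolutionBefore_iff.2 fun T' h0 hT' => ?_⟩
  exact (isSolutionBefore_iff.1 hu T' h0 hT').change_params h h0 hε hf hP hf₁ hf₂

end

end BesovNS

end

/-! ### Local existence, blow-up rates and independence of the parameters. -/

theorem mainTheorem1 (n : ℕ) (hn : 1 ≤ n) (χ φ : BesovNS.RR n → ℝ)
    (hLP : BesovNS.IsLittlewoodPaley χ φ) :
    ∃ (C : ℝ) (C' : ℝ → ℝ), 0 < C ∧ (∀ ε ∈ Set.Ioo (0 : ℝ) 1, 0 < C' ε) ∧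
      -- (i) local existence
      (∀ (T ε s : ℝ) (p q : ENNReal) (f : BesovNS.TDist n),
        0 < T → BesovNS.AdmissibleParams ε s p q →
        BesovNS.MemBesov χ φ s p q f → BesovNS.MemBesov χ φ (-1 + ε) ⊤ ⊤ f →
        BesovNS.rho φ C (C' ε) ε T f < 1 →
        ∃ u : ℝ → BesovNS.TDist n,
          BesovNS.MemZ χ φ s p q T u ∧ BesovNS.MemZ χ φ (-1 + ε) ⊤ ⊤ T u ∧
          BesovNS.IsMildSolution (ENNReal.ofReal T) f u) ∧
      -- (ii) the maximal time is positive and attained, and the blow-up estimates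
      (∀ (ε s : ℝ) (p q : ENNReal) (f : BesovNS.TDist n),
        BesovNS.AdmissibleParams ε s p q →
        BesovNS.MemBesov χ φ s p q f → BesovNS.MemBesov χ φ (-1 + ε) ⊤ ⊤ f →
        0 < BesovNS.maximalTime χ φ ε s p q f ∧
        (∃ u : ℝ → BesovNS.TDist n,
          BesovNS.IsSolutionBefore χ φ ε s p q f (BesovNS.maximalTime χ φ ε s p q f) u) ∧
        (BesovNS.maximalTime χ φ ε s p q f < ⊤ →
          ∀ u : ℝ → BesovNS.TDist n,
            BesovNS.IsSolutionBefore χ φ ε s p q f (BesovNS.maximalTime χ φ ε s p q f) u →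
            ∀ t ∈ Set.Ioo (0 : ℝ) (BesovNS.maximalTime χ φ ε s p q f).toReal,
              1 ≤ BesovNS.rho φ C (C' ε) ε
                ((BesovNS.maximalTime χ φ ε s p q f).toReal - t) (u t) ∧
              ENNReal.ofReal (C⁻¹ * (ε * (1 - ε)) *
                  ((BesovNS.maximalTime χ φ ε s p q f).toReal - t) ^ (-(ε / 2))) ≤
                BesovNS.besovNorm φ (-1 + ε) ⊤ ⊤ (u t) ∧
              ENNReal.ofReal ((C' ε)⁻¹ *
                  ((BesovNS.maximalTime χ φ ε s p q f).toReal - t) ^ (-(1 / 2 : ℝ))) ≤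
                BesovNS.distLpNorm ⊤ (u t))) ∧
      -- the maximal time does not depend on `ε, s, p, q`
      (∀ (ε s : ℝ) (p q : ENNReal) (ε' s' : ℝ) (p' q' : ENNReal) (f : BesovNS.TDist n),
        BesovNS.AdmissibleParams ε s p q → BesovNS.AdmissibleParams ε' s' p' q' →
        BesovNS.MemBesov χ φ s p q f → BesovNS.MemBesov χ φ (-1 + ε) ⊤ ⊤ f →
        BesovNS.MemBesov χ φ s' p' q' f → BesovNS.MemBesov χ φ (-1 + ε') ⊤ ⊤ f →
        BesovNS.maximalTime χ φ ε s p q f = BesovNS.maximalTime χ φ ε' s' p' q' f) := by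
  obtain ⟨C, C', hC, hC', hex⟩ := hLP.exists_memZ
  have hex : BesovNS.LocalExistence χ φ C C' := hex
  -- The constant of the `L^∞` criterion can be taken independent of `ε`: with `κ = 0` nothing in
  -- the contraction depends on it.
  refine ⟨C, fun _ => C', hC, fun _ _ => hC', hex, fun ε s p q f hP hf hf' =>
    ⟨hex.maximalTime_pos hP hf hf', BesovNS.exists_isSolutionBefore_maximalTime hLP hP.1 hf',
      fun hT u hu t ht => ?_⟩, fun ε s p q ε' s' p' q' f hP hP' h1 h2 h1' h2' =>
    le_antisymm (BesovNS.maximalTime_le hLP hP.1 h2 hP' h1' h2')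
      (BesovNS.maximalTime_le hLP hP'.1 h2' hP h1 h2)⟩
  have h := hex.one_le_rho hC hC' hP hT hu ht
  exact ⟨h, BesovNS.le_besovNorm_of_one_le_rho hC hP.1 (sub_pos.2 ht.2) h,
    BesovNS.le_distLpNorm_of_one_le_rho hC' (sub_pos.2 ht.2) h⟩
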